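/- Let $\mathfrak g=\mathfrak g_1\oplus\mathfrak g_2$ be a finite-dimensional real Lie algebra with $[\mathfrak g_1,\mathfrak g_1]=\mathfrak g_2\neq 0$ and $[\mathfrak g,\mathfrak g_2]=0$, and let $G$ be the connected, simply connected Lie group with Lie algebra $\mathfrak g$, identified with $\mathfrak g$ by the exponential map. Let $\{X_j\}$ be a basis of $\mathfrak g_1$ and $\{U_k\}$ a basis of $\mathfrak g_2$; they identify $\mathfrak g_1$, $\mathfrak g_2$ and $\mathfrak g_2^*$ with Euclidean spaces (so $\langle\cdot,\cdot\rangle$ on $\mathfrak g_1$ is the inner product for which $\{X_j\}$ is orthonormal), and $dx$, $du$, $d\xi$, $d\eta$ are the corresponding Lebesgue measures; $dx\,du$ is a Haar measure of $G$. Let $L=-\sum_j X_j^2$ and $\mathbf U=(-iU_k)_k$, where the $X_j,U_k$ act as left-invariant vector fields; $H(L,\mathbf U)$ denotes the joint functional calculus on $L^2(G)$ of the closures of $L$ and the $-iU_k$ with initial domain $C_c^\infty(G)$. The convolution kernel $\mathcal K_T$ of an operator $T$ is determined by $Tf=f*\mathcal K_T$, where $(f*K)(g)=\int_G f(h)K(h^{-1}g)\,dh$,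 $f\in C_c^\infty(G)$. For $\eta\in\mathfrak g_2^*$ let $J_\eta$ be the endomorphism of $\mathfrak g_1$ with $\langle J_\eta x,x'\rangle=\eta([x,x'])$. There are a nonempty Zariski-open set $\ddot{\mathfrak g}_2^*\subseteq\mathfrak g_2^*$, integers $d\ge 0$, $r_0\geq 0$, $r_1,\dots,r_d\geq1$, and functions $\eta\mapsto b_j^\eta$ $(1\le j\le d)$ that are continuous, positive and pairwise distinct at each point of $\ddot{\mathfrak g}_2^*$, such that $$\det(\lambda+J_\eta^2)=\lambda^{r_0}\prod_{j=1}^{d}\bigl(\lambda-(b_j^\eta)^2\bigr)^{2r_j}\qquad(\eta\in\ddot{\mathfrak g}_2^*).$$ Fix any such choice. For $\eta\in\ddot{\mathfrak g}_2^*$ let $P_j^\eta$ be the orthogonal projection onto $\ker(-J_\eta^2-(b_j^\eta)^2)$ and $P_0^\eta=1-\sum_{j=1}^{d}P_j^\eta$. Let $L_n^{(k)}(t)=\frac{t^{-k}e^t}{n!}\left(\frac{d}{dt}\right)^n(t^{k+n}e^{-t})$ be the Laguerre polynomials and $\mathcal L_n^{(k)}(t)=(-1)^ne^{-t}L_n^{(k)}(2t)$.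 Let $H:\mathbb R\times\mathfrak g_2^*\to\mathbb C$ be a Schwartz function, and put $m_H(n,\mu,\eta)=H\bigl(\sum_{j=1}^{d}(2n_j+r_j)b_j^\eta+\mu,\eta\bigr)$. Then $H(L,\mathbf U)$ is a well-defined bounded operator on $L^2(G)$; for $\eta\in\ddot{\mathfrak g}_2^*$ and $\xi\in\mathfrak g_1$ the series $$V(\xi,\eta)=\sum_{n\in\mathbb N^{d}}m_H\bigl(n,|P_0^\eta\xi|^2,\eta\bigr)\prod_{j=1}^{d}\mathcal L_{n_j}^{(r_j-1)}\bigl(|P_j^\eta\xi|^2/b_j^\eta\bigr)$$ converges absolutely; and $\mathcal K_{H(L,\mathbf U)}$ is the continuous function given, for all $(x,u)\in G$, by $$\mathcal K_{H(L,\mathbf U)}(x,u)=\frac{2^{|r|}}{(2\pi)^{\dim G}}\int_{\ddot{\mathfrak g}_2^*}\int_{\mathfrak g_1}V(\xi,\eta)\,e^{i\langle\xi,x\rangle}e^{i\langle\eta,u\rangle}\,d\xi\,d\eta,\qquad |r|=r_1+\dots+r_d,$$ where the inner integral, for each $\eta\in\ddot{\mathfrak g}_2^*$, and then the outer integral converge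 absolutely. -/

import Mathlib

open MeasureTheory Filter Topology
open scoped ContDiff SchwartzMap

noncomputable section

namespace TwoStep

/-! ### Two-step stratified Lie algebras and their groups in exponential coordinates -/

/-- A stratification `𝔤 = 𝔤₁ ⊕ 𝔤₂` of step two of a real Lie algebra:
`[𝔤₁, 𝔤₁] = 𝔤₂ ≠ 0` and `[𝔤, 𝔤₂] = 0`. -/
structure Stratification (𝔤 : Type*) [LieRing 𝔤] [LieAlgebra ℝ 𝔤] where
  layer₁ : Submodule ℝ 𝔤
  layer₂ : Submodule ℝ 𝔤
  isCompl : IsCompl layer₁ layer₂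
  span_bracket : Submodule.span ℝ {z : 𝔤 | ∃ x ∈ layer₁, ∃ y ∈ layer₁, ⁅x, y⁆ = z} = layer₂
  layer₂_ne_bot : layer₂ ≠ ⊥
  bracket_layer₂ : ∀ x : 𝔤, ∀ y ∈ layer₂, ⁅x, y⁆ = 0

/-- Coordinate space `ℝⁿ` with its Euclidean structure. -/
abbrev Eu (n : ℕ) : Type := EuclideanSpace ℝ (Fin n)

section Bracket

variable {𝔤 : Type*} [LieRing 𝔤] [LieAlgebra ℝ 𝔤]

theorem Stratification.bracket_mem (S : Stratification 𝔤) {x y : 𝔤}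
    (hx : x ∈ S.layer₁) (hy : y ∈ S.layer₁) : ⁅x, y⁆ ∈ S.layer₂ := by
  rw [← S.span_bracket]
  exact Submodule.subset_span ⟨x, hx, y, hy, rfl⟩

/-- The linear isomorphism `ℝⁿ ≃ V` determined by a basis of `V`. -/
def ofCoords {n : ℕ} {V : Type*} [AddCommGroup V] [Module ℝ V]
    (B : Module.Basis (Fin n) ℝ V) : Eu n ≃ₗ[ℝ] V :=
  (WithLp.linearEquiv 2 ℝ (Fin n → ℝ)).trans B.equivFun.symm

/-- The Lie bracket `𝔤₁ × 𝔤₁ → 𝔤₂` in the coordinates given by a basis `X` of the first layer and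
a basis `U` of the second layer. -/
def bracket (S : Stratification 𝔤) {d₁ d₂ : ℕ} (X : Module.Basis (Fin d₁) ℝ S.layer₁)
    (U : Module.Basis (Fin d₂) ℝ S.layer₂) : Eu d₁ →ₗ[ℝ] Eu d₁ →ₗ[ℝ] Eu d₂ :=
  LinearMap.mk₂ ℝ
    (fun x y => (ofCoords U).symm
      ⟨⁅(ofCoords X x : 𝔤), (ofCoords X y : 𝔤)⁆,
        S.bracket_mem (ofCoords X x).2 (ofCoords X y).2⟩)
    (fun x x' y => by rw [← map_add]; congr 1; ext; simp)
    (fun c x y => by rw [← map_smul]; congr 1; ext; simp)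
    (fun x y y' => by rw [← map_add]; congr 1; ext; simp)
    (fun c x y => by rw [← map_smul]; congr 1; ext; simp)

end Bracket

section Group

/-! Below, `β` is the bracket `𝔤₁ × 𝔤₁ → 𝔤₂` in coordinates. The connected, simply connected group
is identified with its Lie algebra by the exponential map, hence with `ℝ^{d₁} × ℝ^{d₂}`. Its
Haar measure is Lebesgue measure `volume`. -/

variable {d₁ d₂ : ℕ} (β : Eu d₁ →ₗ[ℝ] Eu d₁ →ₗ[ℝ] Eu d₂)

/-- The group law (Baker-Campbell-Hausdorff formula in step two):
`exp Z · exp W = exp (Z + W + [Z, W] / 2)`. -/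
def mul (p q : Eu d₁ × Eu d₂) : Eu d₁ × Eu d₂ :=
  (p.1 + q.1, p.2 + q.2 + (1 / 2 : ℝ) • β p.1 q.1)

/-- The left-invariant vector field of `v ∈ 𝔤`: `(v f)(g) = d/dt f(g · exp (t v))` at `t = 0`. -/
def leftInvariantField (v : Eu d₁ × Eu d₂) (f : Eu d₁ × Eu d₂ → ℂ) : Eu d₁ × Eu d₂ → ℂ :=
  fun g => deriv (fun t : ℝ => f (mul β g (t • v))) 0

/-- The sublaplacian `L = - ∑ⱼ Xⱼ²`; in coordinates `Xⱼ` is the `j`-th unit vector. -/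
def sublaplacian (f : Eu d₁ × Eu d₂ → ℂ) : Eu d₁ × Eu d₂ → ℂ :=
  fun g => - ∑ j : Fin d₁,
    leftInvariantField β (EuclideanSpace.single j 1, 0)
      (leftInvariantField β (EuclideanSpace.single j 1, 0) f) g

/-- The central derivative `-i U_k`. -/
def centralDerivative (k : Fin d₂) (f : Eu d₁ × Eu d₂ → ℂ) : Eu d₁ × Eu d₂ → ℂ :=
  fun g => - Complex.I * leftInvariantField β (0, EuclideanSpace.single k 1) f g

/-- Smooth compactly supported functions on the group. -/
def IsTest (f : Eu d₁ × Eu d₂ → ℂ) : Prop := ContDiff ℝ ∞ f ∧ HasCompactSupport f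

variable (d₁ d₂) in
/-- The Hilbert space `L²(G)`. -/
abbrev L2G : Type := Lp ℂ 2 (volume : Measure (Eu d₁ × Eu d₂))

/-- The graph in `L²(G) × L²(G)` of the closure of the operator `A` with domain `C_c^∞(G)`. -/
def closureGraph (A : (Eu d₁ × Eu d₂ → ℂ) → (Eu d₁ × Eu d₂ → ℂ)) :
    Set (L2G d₁ d₂ × L2G d₁ d₂) :=
  closure {w | ∃ f : Eu d₁ × Eu d₂ → ℂ, IsTest f ∧ w.1 =ᵐ[volume] f ∧ w.2 =ᵐ[volume] A f}

/-- Group convolution `(f * K)(g) = ∫ f(h) K(h⁻¹ g) dh`; in exponential coordinates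
`h⁻¹ = -h`. -/
def conv (f K : Eu d₁ × Eu d₂ → ℂ) : Eu d₁ × Eu d₂ → ℂ :=
  fun g => ∫ h : Eu d₁ × Eu d₂, f h * K (mul β (-h) g)

/-- `K` is the convolution kernel of the operator `T` on `L²(G)`: `T f = f * K` for all
`f ∈ C_c^∞(G)`. -/
def IsConvolutionKernel (T : L2G d₁ d₂ →L[ℂ] L2G d₁ d₂) (K : Eu d₁ × Eu d₂ → ℂ) : Prop :=
  LocallyIntegrable K volume ∧
    ∀ (f : Eu d₁ × Eu d₂ → ℂ) (w : L2G d₁ d₂), IsTest f → w =ᵐ[volume] f →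
      T w =ᵐ[volume] conv β f K

end Group

/-! ### Projection-valued measures and the joint functional calculus -/

/-- A projection-valued measure (resolution of the identity) on a measurable space `Ω`. -/
structure ProjMeasure (Ω : Type*) [MeasurableSpace Ω] (𝓗 : Type*) [NormedAddCommGroup 𝓗]
    [InnerProductSpace ℂ 𝓗] [CompleteSpace 𝓗] where
  proj : Set Ω → 𝓗 →L[ℂ] 𝓗
  isStarProjection : ∀ s, MeasurableSet s → IsStarProjection (proj s)
  proj_univ : proj Set.univ = 1
  proj_inter : ∀ s t, MeasurableSet s → MeasurableSet t → proj (s ∩ t) = proj s * proj t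
  hasSum_iUnion : ∀ s : ℕ → Set Ω, (∀ n, MeasurableSet (s n)) → Pairwise (Function.onFun Disjoint s) →
    ∀ v : 𝓗, HasSum (fun n => proj (s n) v) (proj (⋃ n, s n) v)

namespace ProjMeasure

variable {Ω : Type*} [MeasurableSpace Ω] {𝓗 : Type*} [NormedAddCommGroup 𝓗]
    [InnerProductSpace ℂ 𝓗] [CompleteSpace 𝓗] (P : ProjMeasure Ω 𝓗)

theorem norm_sq_eq {s : Set Ω} (hs : MeasurableSet s) (v : 𝓗) :
    ‖P.proj s v‖ ^ 2 = (inner ℂ v (P.proj s v)).re := by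
  have h := P.isStarProjection s hs
  have h1 : ContinuousLinearMap.adjoint (P.proj s) = P.proj s := h.isSelfAdjoint
  have h2 : P.proj s (P.proj s v) = P.proj s v := by
    have := congrArg (fun T : 𝓗 →L[ℂ] 𝓗 => T v) h.isIdempotentElem
    simpa using this
  have h3 : inner ℂ v (P.proj s v) = inner ℂ (P.proj s v) (P.proj s v) := by
    conv_rhs => rw [← ContinuousLinearMap.adjoint_inner_right, h1, h2]
  rw [h3, inner_self_eq_norm_sq_to_K]
  norm_cast

theorem proj_empty : P.proj ∅ = 0 := by
  ext v
  have h := P.hasSum_iUnion (fun _ => ∅) (fun _ => MeasurableSet.empty)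
    (fun _ _ _ => by simp [Function.onFun]) v
  have h' := h.summable
  rw [summable_const_iff] at h'
  simpa using h'

theorem hasSum_norm_sq (s : ℕ → Set Ω) (hs : ∀ n, MeasurableSet (s n))
    (hd : Pairwise (Function.onFun Disjoint s)) (v : 𝓗) :
    HasSum (fun n => ‖P.proj (s n) v‖ ^ 2) (‖P.proj (⋃ n, s n) v‖ ^ 2) := by
  have h := P.hasSum_iUnion s hs hd v
  have h1 := (h.mapL (innerSL ℂ v)).mapL Complex.reCLM
  rw [P.norm_sq_eq (MeasurableSet.iUnion hs)]
  simp_rw [fun n => P.norm_sq_eq (hs n) v]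
  exact h1

/-- The spectral measure `s ↦ ⟨v, P(s) v⟩ = ‖P(s) v‖²` of a vector. -/
def measure (v : 𝓗) : Measure Ω :=
  Measure.ofMeasurable (fun s _ => ENNReal.ofReal (‖P.proj s v‖ ^ 2))
    (by simp [P.proj_empty])
    (fun s hs hd => by
      rw [← (P.hasSum_norm_sq s hs hd v).tsum_eq]
      exact ENNReal.ofReal_tsum_of_nonneg (fun n => by positivity)
        (P.hasSum_norm_sq s hs hd v).summable)

/-- `T = ∫ H dP`, for a bounded operator `T`. -/
def IsIntegral (H : Ω → ℂ) (T : 𝓗 →L[ℂ] 𝓗) : Prop :=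
  ∀ v, Integrable H (P.measure v) ∧ inner ℂ v (T v) = ∫ p, H p ∂(P.measure v)

/-- `Γ` is the graph of the self-adjoint operator `∫ φ dP`: the domain is
`{v | ∫ φ² d⟨v, P v⟩ < ∞}`, and the quadratic form is `∫ φ d⟨v, P v⟩`. (For the graph `Γ` of a
linear operator these two conditions determine `Γ`, by polarization.) -/
def IsIntegralGraph (φ : Ω → ℝ) (Γ : Set (𝓗 × 𝓗)) : Prop :=
  (∀ v, (∃ w, (v, w) ∈ Γ) ↔ Integrable (fun p => φ p ^ 2) (P.measure v)) ∧
    ∀ v w, (v, w) ∈ Γ → inner ℂ v w = ((∫ p, φ p ∂(P.measure v) : ℝ) : ℂ)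

end ProjMeasure

section JointCalculus

variable {d₁ d₂ : ℕ} (β : Eu d₁ →ₗ[ℝ] Eu d₁ →ₗ[ℝ] Eu d₂)

/-- `P` is the joint spectral resolution of the closures of `L, -iU₁, …, -iU_{d₂}`. -/
def IsJointResolution (P : ProjMeasure (ℝ × Eu d₂) (L2G d₁ d₂)) : Prop :=
  P.IsIntegralGraph (fun p => p.1) (closureGraph (sublaplacian β)) ∧
    ∀ k : Fin d₂, P.IsIntegralGraph (fun p => p.2 k) (closureGraph (centralDerivative β k))

/-- `T = H(L, -iU₁, …, -iU_{d₂})` in the joint functional calculus. -/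
def IsJointFunction (H : ℝ × Eu d₂ → ℂ) (T : L2G d₁ d₂ →L[ℂ] L2G d₁ d₂) : Prop :=
  ∃ P : ProjMeasure (ℝ × Eu d₂) (L2G d₁ d₂), IsJointResolution β P ∧ P.IsIntegral H T

end JointCalculus

/-! ### Spectral data of the maps `J_η` -/

section Spectral

variable {d₁ d₂ : ℕ} (β : Eu d₁ →ₗ[ℝ] Eu d₁ →ₗ[ℝ] Eu d₂)

/-- The endomorphism `J_η` of the first layer with `⟨J_η x, x'⟩ = η([x, x'])`, see `inner_J`. -/
def J (η : Eu d₂) : Eu d₁ →ₗ[ℝ] Eu d₁ where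
  toFun x := ∑ j, inner ℝ η (β x (EuclideanSpace.single j 1)) • EuclideanSpace.single j (1 : ℝ)
  map_add' x y := by simp [inner_add_right, add_smul, Finset.sum_add_distrib]
  map_smul' c x := by simp [inner_smul_right, mul_smul, Finset.smul_sum]

theorem inner_J (η : Eu d₂) (x x' : Eu d₁) : inner ℝ (J β η x) x' = inner ℝ η (β x x') := by
  have hx' : x' = ∑ j, x' j • EuclideanSpace.single j (1 : ℝ) := by
    simpa using ((EuclideanSpace.basisFun (Fin d₁) ℝ).sum_repr x').symm
  conv_rhs => rw [hx', map_sum, inner_sum]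
  simp only [J, LinearMap.coe_mk, AddHom.coe_mk, sum_inner, inner_smul_left, map_smul,
    inner_smul_right]
  refine Finset.sum_congr rfl fun j _ => ?_
  simp [EuclideanSpace.inner_single_left, mul_comm]

/-- `-J_η²`. -/
def negJSq (η : Eu d₂) : Eu d₁ →ₗ[ℝ] Eu d₁ := -(J β η * J β η)

/-- Zariski-open subsets of `ℝⁿ`. -/
def IsZariskiOpen {n : ℕ} (Ω : Set (Eu n)) : Prop :=
  ∃ S : Set (MvPolynomial (Fin n) ℝ),
    Ω = {η | ∃ q ∈ S, MvPolynomial.eval (fun k => η k) q ≠ 0}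

/-- A choice of a nonempty Zariski-open set `Ω` of parameters `η` and of numbers `r₀ ≥ 0`,
`r₁, …, r_d ≥ 1` and functions `b₁, …, b_d`, continuous, positive and pairwise distinct on `Ω`, with
`det (λ + J_η²) = λ^{r₀} ∏ⱼ (λ - (bⱼ^η)²)^{2 rⱼ}` for `η ∈ Ω`. -/
structure SpectralData where
  Ω : Set (Eu d₂)
  zariskiOpen : IsZariskiOpen Ω
  nonempty : Ω.Nonempty
  d : ℕ
  r₀ : ℕ
  r : Fin d → ℕ
  r_pos : ∀ j, 0 < r j
  b : Fin d → Eu d₂ → ℝ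
  b_cont : ∀ j, ContinuousOn (b j) Ω
  b_pos : ∀ j, ∀ η ∈ Ω, 0 < b j η
  b_ne : ∀ j j', j ≠ j' → ∀ η ∈ Ω, b j η ≠ b j' η
  charpoly_eq : ∀ η ∈ Ω, (negJSq β η).charpoly =
    Polynomial.X ^ r₀ * ∏ j, (Polynomial.X - Polynomial.C (b j η ^ 2)) ^ (2 * r j)

namespace SpectralData

variable {β} (D : SpectralData β)

/-- `Pⱼ^η`, the orthogonal projection onto the eigenspace of `-J_η²` for the eigenvalue
`(bⱼ^η)²`. -/
def P (j : Fin D.d) (η : Eu d₂) : Eu d₁ →L[ℝ] Eu d₁ :=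
  (Module.End.eigenspace (negJSq β η) (D.b j η ^ 2)).starProjection

/-- `P₀^η = 1 - (P₁^η + ⋯ + P_d^η)`. -/
def P₀ (η : Eu d₂) : Eu d₁ →L[ℝ] Eu d₁ := 1 - ∑ j, D.P j η

end SpectralData

/-- The Laguerre polynomial `L_n^{(k)}` evaluated at `t`; see `laguerre_rodrigues`. -/
def laguerre (n k : ℕ) (t : ℝ) : ℝ :=
  ∑ i ∈ Finset.range (n + 1), (-1) ^ i * ((n + k).choose (n - i) : ℝ) * t ^ i / (i.factorial : ℝ)

theorem laguerre_rodrigues (n k : ℕ) {t : ℝ} (ht : t ≠ 0) :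
    laguerre n k t = (t ^ k)⁻¹ * Real.exp t / (n.factorial : ℝ) *
      iteratedDeriv n (fun s : ℝ => s ^ (k + n) * Real.exp (-s)) t := by
  have hexp : ∀ i : ℕ, iteratedDeriv i (fun s : ℝ => Real.exp (-s)) t
      = (-1) ^ i * Real.exp (-t) := by
    intro i
    have h := iteratedDeriv_comp_neg i Real.exp t
    rw [h]
    simp [iteratedDeriv_eq_iterate, Real.iter_deriv_exp]
  have hmul := iteratedDeriv_fun_mul (n := n) (x := t) (f := fun s : ℝ => s ^ (k + n))
    (g := fun s : ℝ => Real.exp (-s)) (by fun_prop) (by fun_prop)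
  rw [hmul, laguerre, Finset.mul_sum, ← Finset.sum_range_reflect]
  refine Finset.sum_congr rfl fun i hi => ?_
  have hi' : i ≤ n := Nat.lt_succ_iff.mp (Finset.mem_range.mp hi)
  have e1 : n + 1 - 1 - i = n - i := by omega
  rw [e1, hexp, iteratedDeriv_eq_iterate, iter_deriv_pow]
  have e2 : n - (n - i) = i := by omega
  have e3 : k + n - i = k + (n - i) := by omega
  rw [e2, e3]
  have h1 : ((n + k).choose i : ℝ) * (i.factorial : ℝ) = ((k + n).descFactorial i : ℝ) := by
    rw [Nat.descFactorial_eq_factorial_mul_choose, add_comm n k]; push_cast; ring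
  have h2 : (n.choose i : ℝ) * (i.factorial : ℝ) * ((n - i).factorial : ℝ)
      = (n.factorial : ℝ) := by exact_mod_cast Nat.choose_mul_factorial_mul_factorial hi'
  have h3 : Real.exp t * Real.exp (-t) = 1 := by rw [← Real.exp_add]; simp
  have hf : (n.factorial : ℝ) ≠ 0 := by positivity
  have hg : ((n - i).factorial : ℝ) ≠ 0 := by positivity
  have hk : t ^ k ≠ 0 := pow_ne_zero _ ht
  have h4 : ∏ l ∈ Finset.range i, (((k + n : ℕ) : ℝ) - (l : ℝ))
      = ((k + n).descFactorial i : ℝ) := by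
    rw [← descPochhammer_eval_eq_prod_range, descPochhammer_eval_eq_descFactorial]
  rw [h4, ← h1, pow_add, Real.exp_neg]
  have he := Real.exp_ne_zero t
  field_simp
  rw [← h2]
  ring

/-- The Laguerre functions `𝓛_n^{(k)}(t) = (-1)^n e^{-t} L_n^{(k)}(2t)`. -/
def laguerreFun (n k : ℕ) (t : ℝ) : ℝ := (-1) ^ n * Real.exp (-t) * laguerre n k (2 * t)

namespace SpectralData

variable {β} (D : SpectralData β)

/-- `m_H(n, μ, η) = H(∑ⱼ (2 nⱼ + rⱼ) bⱼ^η + μ, η)`. -/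
def multiplier (H : ℝ × Eu d₂ → ℂ) (n : Fin D.d → ℝ) (μ : ℝ) (η : Eu d₂) : ℂ :=
  H ((∑ j, (2 * n j + D.r j) * D.b j η) + μ, η)

/-- The `n`-th term `m_H(n, |P₀^η ξ|², η) ∏ⱼ 𝓛_{nⱼ}^{(rⱼ-1)}(|Pⱼ^η ξ|² / bⱼ^η)`. -/
def term (H : ℝ × Eu d₂ → ℂ) (ξ : Eu d₁) (η : Eu d₂) (n : Fin D.d → ℕ) : ℂ :=
  D.multiplier H (fun j => n j) (‖D.P₀ η ξ‖ ^ 2) η *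
    ((∏ j, laguerreFun (n j) (D.r j - 1) (‖D.P j η ξ‖ ^ 2 / D.b j η) : ℝ) : ℂ)

/-- `V(ξ, η)`, the sum of the terms over `n ∈ ℕ^d`. -/
def V (H : ℝ × Eu d₂ → ℂ) (ξ : Eu d₁) (η : Eu d₂) : ℂ := ∑' n : Fin D.d → ℕ, D.term H ξ η n

end SpectralData

end Spectral

end TwoStep

end

noncomputable section

open MeasureTheory Filter Topology Finset
open Complex (I normSq norm_real norm_exp_ofReal_mul_I continuous_ofReal real_smul continuous_conj
  conj_conj conj_I I_sq ofReal_mul ofReal_zero normSq_eq_norm_sq conj_ofReal hasSum_ofReal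
  ofReal_injective)
open Real (exp sinh cosh norm_of_nonneg norm_eq_abs exp_pos sq_sqrt sinh_pos_iff exp_sum
  rpow_natCast continuous_sqrt)
open EuclideanSpace (single)
open Function (support comp_apply)
open Module (finrank)
open ContinuousLinearMap (adjoint adjoint_inner_left adjoint_inner_right star_eq_adjoint)
open Submodule (starProjection_eq_self_iff starProjection_apply_mem)
open Set (indicator indicator_of_mem indicator_of_notMem indicator_nonneg)
open scoped ContDiff SchwartzMap CompactlySupported ComplexConjugate Real

namespace TwoStep

section
variable {d₁ d₂ : ℕ}

set_option hygiene false in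
/-- The underlying space of the group. -/
notation "𝔾" => Eu d₁ × Eu d₂

set_option hygiene false in
/-- The brackets in coordinates. -/
notation "𝔅" => Eu d₁ →ₗ[ℝ] Eu d₁ →ₗ[ℝ] Eu d₂

set_option hygiene false in
/-- The joint spectrum lies in this space. -/
notation "𝕊" => ℝ × Eu d₂

set_option hygiene false in
notation "ℙ" => Eu d₂ × Eu d₁

/-- The bilinear map is alternating. -/
abbrev Alt (β : 𝔅) : Prop := ∀ x, β x x = 0

/-- The unitary characters. -/
notation "𝐞(" a "," b ")" => Complex.exp (Complex.I * (inner ℝ a b : ℝ))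

notation "cexp" => Complex.exp

notation "𝒳" => leftInvariantField

notation "𝓛" => sublaplacian

end

lemma integral_ext {X E : Type*} [MeasurableSpace X] {μ : Measure X} [NormedAddCommGroup E]
    [NormedSpace ℝ E] {f g : X → E} (h : ∀ x, f x = g x) : ∫ x, f x ∂μ = ∫ x, g x ∂μ :=
  integral_congr_ae (.of_forall h)

/-! ### Laguerre polynomials -/

/-- Charlier polynomials, normalised to have integer coefficients. -/
def charlier (x : ℝ) : ℕ → ℕ → ℝ
  | 0, _ => 1
  | n + 1, m => x * charlier x n m - m * charlier x n (m - 1)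

lemma charlier_succ_sub (x : ℝ) (n m : ℕ) :
    charlier x n (m + 1) - charlier x n m = -(n * charlier x (n - 1) m) := by
  induction n generalizing m with
  | zero => simp [charlier]
  | succ n ih =>
    have h1 := ih m
    simp only [charlier, Nat.add_sub_cancel]
    rcases m with _ | m
    · rcases n with _ | n
      · simp [charlier]
      · simp only [charlier, Nat.add_sub_cancel] at h1 ⊢
        push_cast at h1 ⊢
        linear_combination x * h1
    · have h2 := ih m
      rcases n with _ | n
      · simp [charlier]
      · simp only [charlier, Nat.add_sub_cancel] at h1 h2 ⊢
        push_cast at h1 h2 ⊢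
        linear_combination x * h1 - (m + 1) * h2

lemma charlier_eq_sum (x : ℝ) (n m : ℕ) : charlier x n m = ∑ i ∈ range (n + 1),
      (m.choose i : ℝ) * (-1) ^ i * n.descFactorial i * x ^ (n - i) := by
  induction m generalizing n with
  | zero =>
    rw [sum_range_succ']
    simp only [Nat.choose_zero_succ, Nat.cast_zero, zero_mul, sum_const_zero]
    induction n with
    | zero => simp [charlier]
    | succ n ih => simp [charlier, ih, pow_succ']
  | succ m ih =>
    have h := charlier_succ_sub x n m
    rw [sub_eq_iff_eq_add] at h
    rw [h, ih, ih]
    rcases n with _ | n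
    · simp
    · simp only [Nat.add_sub_cancel]
      conv_rhs => rw [sum_range_succ']
      conv_lhs => rw [sum_range_succ' _ (n + 1)]
      simp only [Nat.choose_succ_succ, Nat.succ_descFactorial_succ, Nat.succ_sub_succ]
      rw [mul_sum, ← sum_neg_distrib, ← add_assoc, ← sum_add_distrib]
      congr 1
      · refine sum_congr rfl fun i _ => ?_
        simp only [pow_succ]
        push_cast
        ring
      · simp

lemma charlier_diag (x : ℝ) (n : ℕ) : charlier x n n = (-1) ^ n * n.factorial * laguerre n 0 x := by
  rw [charlier_eq_sum, laguerre, mul_sum, ← sum_range_reflect]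
  refine sum_congr rfl fun i hi => ?_
  have hi' : i ≤ n := Nat.lt_succ_iff.mp (mem_range.mp hi)
  have e1 : n + 1 - 1 - i = n - i := by omega
  have e2 : n - (n - i) = i := by omega
  have h1 : ((n.descFactorial (n - i) : ℕ) : ℝ) * i.factorial = n.factorial := by
    have := Nat.factorial_mul_descFactorial (n := n) (k := n - i) (by omega)
    rw [e2] at this
    rw [mul_comm]; exact_mod_cast this
  have hf : (i.factorial : ℝ) ≠ 0 := by positivity
  have h2 : (-1 : ℝ) ^ (n - i) = (-1) ^ n * (-1) ^ i := by
    rw [← pow_add, show n + i = (n - i) + 2 * i by omega, pow_add, pow_mul]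
    simp
  rw [e1, e2, h2, add_zero, ← h1]
  field_simp

lemma abs_charlier_le {x : ℝ} (hx : 0 ≤ x) (n m : ℕ) :
    |charlier x n m| ≤ (x + 1) ^ n * (m + 1) ^ n := by
  induction n generalizing m with
  | zero => simp [charlier]
  | succ n ih =>
    have h1 := ih m
    have h2 := ih (m - 1)
    have h3 : (((m - 1 : ℕ) : ℝ) + 1) ^ n ≤ ((m : ℝ) + 1) ^ n := by
      gcongr; omega
    simp only [charlier]
    have hm : (0 : ℝ) ≤ m := by positivity
    calc |x * charlier x n m - m * charlier x n (m - 1)|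
        ≤ x * |charlier x n m| + m * |charlier x n (m - 1)| := by
          refine (abs_sub _ _).trans ?_
          rw [abs_mul, abs_mul, abs_of_nonneg hx, abs_of_nonneg hm]
      _ ≤ x * ((x + 1) ^ n * (m + 1) ^ n) + m * ((x + 1) ^ n * (m + 1) ^ n) := by
          gcongr
          exact h2.trans (by gcongr)
      _ ≤ _ := by
          have : 0 ≤ (x + 1) ^ n * ((m : ℝ) + 1) ^ n := by positivity
          rw [pow_succ, pow_succ]
          nlinarith [mul_nonneg hx hm]

lemma summable_pow_mul_pow_div_factorial (k : ℕ) (x : ℝ) :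
    Summable fun m : ℕ => ((m : ℝ) + 1) ^ k * (|x| ^ m / m.factorial) := by
  have hs := (Real.summable_pow_div_factorial (exp 1 * |x|)).mul_left (k.factorial * exp 1)
  refine Summable.of_nonneg_of_le (fun m => by positivity) (fun m => ?_) hs
  have h := Real.pow_div_factorial_le_exp (x := (m : ℝ) + 1) (by positivity) k
  rw [div_le_iff₀ (by positivity)] at h
  calc ((m : ℝ) + 1) ^ k * (|x| ^ m / m.factorial)
      ≤ (exp (m + 1) * k.factorial) * (|x| ^ m / m.factorial) := by gcongr
    _ = _ := by
        rw [Real.exp_add, mul_pow, ← Real.exp_nat_mul]; ring_nf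

lemma summable_charlier_mul {x : ℝ} (hx : 0 ≤ x) (n n' a : ℕ) :
    Summable fun m : ℕ => charlier x n m * charlier x n' (m + a) * (x ^ m / m.factorial) := by
  have hs := (summable_pow_mul_pow_div_factorial (n + n') x).mul_left
    ((x + 1) ^ n * ((x + 1) ^ n' * (a + 1) ^ n'))
  refine Summable.of_norm_bounded hs fun m => ?_
  rw [norm_eq_abs, abs_mul, abs_mul, abs_of_nonneg (a := x ^ m / _) (by positivity),
    abs_of_nonneg hx]
  have h1 := abs_charlier_le hx n m
  have h2 := abs_charlier_le hx n' (m + a)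
  have h3 : (((m + a : ℕ) : ℝ) + 1) ^ n' ≤ ((a + 1) * ((m : ℝ) + 1)) ^ n' := by
    gcongr; push_cast
    nlinarith [mul_nonneg (Nat.cast_nonneg (α := ℝ) a) (Nat.cast_nonneg (α := ℝ) m)]
  calc _ ≤ ((x + 1) ^ n * (m + 1) ^ n) * ((x + 1) ^ n' * (((a + 1) * ((m : ℝ) + 1)) ^ n'))
        * (x ^ m / m.factorial) := by
        gcongr
        exact h2.trans (by gcongr)
    _ = _ := by rw [mul_pow, pow_add]; ring

lemma tsum_charlier_sq {x : ℝ} (hx : 0 ≤ x) (n : ℕ) :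
    ∑' m : ℕ, charlier x n m ^ 2 * (x ^ m / m.factorial) = n.factorial * x ^ n * exp x := by
  induction n with
  | zero =>
    simp only [charlier, one_pow, one_mul, Nat.factorial_zero, Nat.cast_one, pow_zero, mul_one]
    rw [Real.exp_eq_exp_ℝ, NormedSpace.exp_eq_tsum_div]
  | succ n ih =>
    have s0 := summable_charlier_mul hx n n 0
    have s1 := summable_charlier_mul hx n (n + 1) 0
    have s2 := summable_charlier_mul hx n (n + 1) 1
    set g : ℕ → ℝ := fun m => m * charlier x n (m - 1) * charlier x (n + 1) m *
      (x ^ m / m.factorial) with hg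
    have hg1 : ∀ m, g (m + 1) =
        x * (charlier x n m * charlier x (n + 1) (m + 1) * (x ^ m / m.factorial)) := by
      intro m
      simp only [hg, Nat.add_sub_cancel, Nat.factorial_succ, pow_succ]
      push_cast
      field_simp
    have sg : Summable g := by
      rw [← summable_nat_add_iff 1]
      simp only [hg1]
      exact s2.mul_left x
    have tg : ∑' m, g m = x * ∑' m, charlier x n m * charlier x (n + 1) (m + 1) *
        (x ^ m / m.factorial) := by
      rw [sg.tsum_eq_zero_add, ← tsum_mul_left]
      simp only [hg1]
      simp [hg]
    have e1 : ∀ m : ℕ, charlier x (n + 1) m ^ 2 * (x ^ m / m.factorial) =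
        x * (charlier x n m * charlier x (n + 1) (m + 0) * (x ^ m / m.factorial)) - g m := by
      intro m
      rw [pow_two]
      nth_rw 1 [charlier]
      simp only [hg, add_zero]; ring
    simp_rw [e1]
    rw [Summable.tsum_sub (s1.mul_left x) sg, tg, tsum_mul_left, ← mul_sub,
      ← Summable.tsum_sub s1 s2]
    have e2 : ∀ m : ℕ, charlier x n m * charlier x (n + 1) (m + 0) * (x ^ m / m.factorial) -
        charlier x n m * charlier x (n + 1) (m + 1) * (x ^ m / m.factorial) =
        (n + 1) * (charlier x n m ^ 2 * (x ^ m / m.factorial)) := by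
      intro m
      have h := charlier_succ_sub x (n + 1) m
      simp only [Nat.add_sub_cancel, Nat.cast_add, Nat.cast_one] at h
      linear_combination (-charlier x n m * (x ^ m / m.factorial)) * h
    simp_rw [e2]
    rw [tsum_mul_left, ih, Nat.factorial_succ]
    push_cast; ring

lemma laguerre_zero_right (n k : ℕ) : laguerre n k 0 = (n + k).choose n := by
  rw [laguerre, sum_range_succ']
  simp

lemma laguerre_zero_left (k : ℕ) (x : ℝ) : laguerre 0 k x = 1 := by simp [laguerre]

lemma abs_laguerre_zero_le {x : ℝ} (hx : 0 ≤ x) (n : ℕ) :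
    |laguerre n 0 x| ≤ exp (x / 2) := by
  rcases hx.eq_or_lt with rfl | hx0
  · simp [laguerre_zero_right]
  have s0 := summable_charlier_mul hx n n 0
  have h := s0.le_tsum n fun j _ => by
    rw [add_zero]
    exact mul_nonneg (mul_self_nonneg _) (by positivity)
  simp only [add_zero] at h
  have e : ∀ m, charlier x n m * charlier x n m * (x ^ m / m.factorial) =
      charlier x n m ^ 2 * (x ^ m / m.factorial) := fun m => by ring
  simp_rw [e] at h
  rw [tsum_charlier_sq hx, charlier_diag] at h
  have h2 : ((-1 : ℝ) ^ n * n.factorial * laguerre n 0 x) ^ 2 * (x ^ n / n.factorial) =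
      n.factorial * x ^ n * laguerre n 0 x ^ 2 := by
    rw [mul_pow, mul_pow, ← pow_mul, mul_comm n 2, pow_mul]
    field_simp
    simp
  rw [h2] at h
  have h3 : laguerre n 0 x ^ 2 ≤ exp x := le_of_mul_le_mul_left h (by positivity)
  refine abs_le_of_sq_le_sq ?_ (by positivity)
  rwa [← Real.exp_nat_mul, show ((2 : ℕ) : ℝ) * (x / 2) = x by push_cast; ring]

lemma laguerre_succ_succ (n k : ℕ) (x : ℝ) :
    laguerre (n + 1) (k + 1) x = laguerre n (k + 1) x + laguerre (n + 1) k x := by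
  simp only [laguerre]
  rw [sum_range_succ _ (n + 1), sum_range_succ _ (n + 1)]
  have h1 : ∑ i ∈ range (n + 1), (-1) ^ i * ((n + 1 + (k + 1)).choose (n + 1 - i) : ℝ) *
      x ^ i / (i.factorial : ℝ) =
      ∑ i ∈ range (n + 1), (-1) ^ i * ((n + (k + 1)).choose (n - i) : ℝ) *
      x ^ i / (i.factorial : ℝ) +
      ∑ i ∈ range (n + 1), (-1) ^ i * ((n + 1 + k).choose (n + 1 - i) : ℝ) *
      x ^ i / (i.factorial : ℝ) := by
    rw [← sum_add_distrib]
    refine sum_congr rfl fun i hi => ?_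
    have hi' : i ≤ n := Nat.lt_succ_iff.mp (mem_range.mp hi)
    have h : (n + 1 + (k + 1)).choose (n + 1 - i) =
        (n + (k + 1)).choose (n - i) + (n + 1 + k).choose (n + 1 - i) := by
      rw [show n + 1 - i = (n - i) + 1 by omega, show n + 1 + (k + 1) = (n + k + 1) + 1 by ring,
        Nat.choose_succ_succ, show n + (k + 1) = n + k + 1 by ring,
        show n + 1 + k = n + k + 1 by ring]
    rw [h]; push_cast; ring
  rw [h1]
  simp only [Nat.sub_self, Nat.choose_zero_right]
  ring

lemma abs_laguerre_le {x : ℝ} (hx : 0 ≤ x) (n k : ℕ) :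
    |laguerre n k x| ≤ (n + k).choose n * exp (x / 2) := by
  induction k generalizing n with
  | zero => simpa using abs_laguerre_zero_le hx n
  | succ k ih =>
    induction n with
    | zero => simp [laguerre_zero_left]; linarith
    | succ n ihn =>
      rw [laguerre_succ_succ]
      refine (abs_add_le _ _).trans ((add_le_add ihn (ih (n + 1))).trans ?_)
      rw [← add_mul]
      gcongr
      rw [show n + 1 + (k + 1) = (n + (k + 1)) + 1 by ring, Nat.choose_succ_succ,
        show n + 1 + k = n + (k + 1) by ring]
      push_cast
      exact le_rfl

lemma mul_laguerre_succ (n k : ℕ) (x : ℝ) : x * laguerre n (k + 1) x =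
      (n + k + 1) * laguerre n k x - (n + 1) * laguerre (n + 1) k x := by
  simp only [laguerre]
  rw [sum_range_succ
      (fun i => (-1) ^ i * ((n + (k + 1)).choose (n - i) : ℝ) * x ^ i / (i.factorial : ℝ)) n,
    sum_range_succ'
      (fun i => (-1) ^ i * ((n + k).choose (n - i) : ℝ) * x ^ i / (i.factorial : ℝ)) n,
    sum_range_succ' (fun i => (-1) ^ i * ((n + 1 + k).choose (n + 1 - i) : ℝ) * x ^ i /
      (i.factorial : ℝ)) (n + 1),
    sum_range_succ (fun i => (-1) ^ (i + 1) *
      ((n + 1 + k).choose (n + 1 - (i + 1)) : ℝ) * x ^ (i + 1) / ((i + 1).factorial : ℝ)) n]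
  have h0 : ((n : ℝ) + 1) * ((-1) ^ 0 * (((n + 1 + k).choose (n + 1 - 0) : ℕ) : ℝ) * x ^ 0 /
      (Nat.factorial 0 : ℝ)) =
      (n + k + 1) * ((-1) ^ 0 * (((n + k).choose (n - 0) : ℕ) : ℝ) * x ^ 0 /
      (Nat.factorial 0 : ℝ)) := by
    have := Nat.add_one_mul_choose_eq (n + k) n
    simp only [Nat.sub_zero, pow_zero, one_mul, mul_one, Nat.factorial_zero, Nat.cast_one, div_one]
    rw [show n + 1 + k = n + k + 1 by ring]
    have h' : ((n : ℝ) + k + 1) * ((n + k).choose n : ℝ) =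
      ((n + k + 1).choose (n + 1) : ℝ) * (n + 1) := by exact_mod_cast this
    linarith
  have h1 : ∀ i ∈ range n, x * ((-1) ^ i * (((n + (k + 1)).choose (n - i) : ℕ) : ℝ) * x ^ i /
      (i.factorial : ℝ)) =
      (n + k + 1) * ((-1) ^ (i + 1) * (((n + k).choose (n - (i + 1)) : ℕ) : ℝ) * x ^ (i + 1) /
      ((i + 1).factorial : ℝ)) - (n + 1) * ((-1) ^ (i + 1) *
        (((n + 1 + k).choose (n + 1 - (i + 1)) : ℕ) : ℝ) * x ^ (i + 1) /
      ((i + 1).factorial : ℝ)) := by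
    intro i hi
    have hi' := mem_range.mp hi
    have := Nat.add_one_mul_choose_eq (n + k) (n - (i + 1))
    rw [show n - (i + 1) + 1 = n - i by omega] at this
    have h' : ((n : ℝ) + k + 1) * ((n + k).choose (n - (i + 1)) : ℝ) =
      ((n + k + 1).choose (n - i) : ℝ) * (n - i) := by
      rw [← Nat.cast_sub hi'.le]; exact_mod_cast this
    rw [show n + 1 - (i + 1) = n - i by omega, show n + 1 + k = n + k + 1 by ring,
      show n + (k + 1) = n + k + 1 by ring, Nat.factorial_succ]
    push_cast
    have hf : (i.factorial : ℝ) ≠ 0 := by positivity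
    field_simp
    linear_combination (-(-1 : ℝ) ^ (i + 1) * x * x ^ i) * h'
  have h3 := sum_congr rfl h1
  rw [sum_sub_distrib, ← mul_sum, ← mul_sum, ← mul_sum] at h3
  have h2 : x * ((-1) ^ n * (((n + (k + 1)).choose (n - n) : ℕ) : ℝ) * x ^ n /
      (n.factorial : ℝ)) = -((n + 1) * ((-1) ^ (n + 1) *
        (((n + 1 + k).choose (n + 1 - (n + 1)) : ℕ) : ℝ) * x ^ (n + 1) /
      ((n + 1).factorial : ℝ))) := by
    have hf : (n.factorial : ℝ) ≠ 0 := by positivity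
    simp only [Nat.sub_self, Nat.choose_zero_right, Nat.factorial_succ, Nat.cast_mul]
    push_cast
    field_simp
    ring
  linear_combination h3 + h2 + h0

lemma abs_laguerreFun_le {t : ℝ} (ht : 0 ≤ t) (n k : ℕ) :
    |laguerreFun n k t| ≤ (n + k).choose n := by
  rw [laguerreFun, abs_mul, abs_mul, abs_pow, abs_neg, abs_one, one_pow, one_mul, Real.abs_exp]
  have h := abs_laguerre_le (x := 2 * t) (by positivity) n k
  calc _ ≤ exp (-t) * ((n + k).choose n * exp (2 * t / 2)) := by gcongr
    _ = _ := by
      rw [show 2 * t / 2 = t by ring, Real.exp_neg]; field_simp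

lemma continuous_laguerreFun (n k : ℕ) : Continuous (laguerreFun n k) := by
  unfold laguerreFun laguerre; fun_prop

lemma mul_laguerreFun_succ (n k : ℕ) (t : ℝ) : 2 * t * laguerreFun (n + 1) k t =
      (n + k + 2) * laguerreFun (n + 1) k t + (n + 2) * laguerreFun (n + 2) k t +
      ((n + k + 1) * laguerreFun n k t + (n + 1) * laguerreFun (n + 1) k t) := by
  have h1 := mul_laguerre_succ (n + 1) k (2 * t)
  have h2 := mul_laguerre_succ n k (2 * t)
  have h3 := laguerre_succ_succ n k (2 * t)
  simp only [laguerreFun, pow_succ]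
  push_cast at h1 h2
  linear_combination ((-1 : ℝ) ^ n * -1 * exp (-t)) * (h1 - h2 - 2 * t * h3)

lemma mul_laguerreFun_zero (k : ℕ) (t : ℝ) :
    2 * t * laguerreFun 0 k t = (k + 1) * laguerreFun 0 k t + laguerreFun 1 k t := by
  have h1 := mul_laguerre_succ 0 k (2 * t)
  rw [laguerre_zero_left, laguerre_zero_left] at h1
  simp only [laguerreFun, laguerre_zero_left, pow_zero, pow_one]
  push_cast at h1
  simp only [zero_add] at h1
  linear_combination (exp (-t)) * h1

lemma choose_le_pow_succ (n k : ℕ) : ((n + k).choose n : ℝ) ≤ ((n : ℝ) + 1) ^ k := by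
  induction k with
  | zero => simp
  | succ k ih =>
    have h := Nat.add_one_mul_choose_eq (n + k) k
    rw [Nat.choose_symm_add] at ih ⊢
    rw [show n + (k + 1) = n + k + 1 by ring]
    have h' : ((n : ℝ) + k + 1) * ((n + k).choose k : ℝ) =
      ((n + k + 1).choose (k + 1) : ℝ) * (k + 1) := by exact_mod_cast h
    have hk : (0 : ℝ) < k + 1 := by positivity
    have : ((n + k + 1).choose (k + 1) : ℝ) = ((n : ℝ) + k + 1) / (k + 1) * ((n + k).choose k : ℝ) := by
      field_simp; linarith
    rw [this, pow_succ, mul_comm _ ((n : ℝ) + 1)]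
    gcongr
    rw [div_le_iff₀ hk]
    nlinarith [mul_nonneg (Nat.cast_nonneg (α := ℝ) n) (Nat.cast_nonneg (α := ℝ) k)]

lemma exists_pow_mul_laguerreFun_le (k M : ℕ) : ∃ C : ℝ, ∃ A : ℕ, 0 ≤ C ∧ ∀ n : ℕ, ∀ t : ℝ, 0 ≤ t →
      (1 + t) ^ M * |laguerreFun n k t| ≤ C * ((n : ℝ) + 1) ^ A := by
  induction M with
  | zero =>
    refine ⟨1, k, zero_le_one, fun n t ht => ?_⟩
    simpa using (abs_laguerreFun_le ht n k).trans (choose_le_pow_succ n k)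
  | succ M ih =>
    obtain ⟨C, A, hC, h⟩ := ih
    refine ⟨C * 2 ^ A * (6 * (k + 2)), A + 1, by positivity, fun n t ht => ?_⟩
    have key : (1 + t) * |laguerreFun n k t| ≤ 2 * (k + 2) * ((n : ℝ) + 1) *
        (|laguerreFun n k t| + |laguerreFun (n + 1) k t| + |laguerreFun (n - 1) k t|) := by
      have hk : (0 : ℝ) ≤ k := by positivity
      rcases n with _ | n
      · have h0 : |2 * t * laguerreFun 0 k t| ≤ (k + 1) * |laguerreFun 0 k t| +
            |laguerreFun 1 k t| := by
          rw [mul_laguerreFun_zero]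
          refine (abs_add_le _ _).trans ?_
          rw [abs_mul, abs_of_nonneg (a := (k : ℝ) + 1) (by positivity)]
        rw [abs_mul, abs_of_nonneg (by positivity)] at h0
        push_cast
        simp only [zero_add]
        have a0 := abs_nonneg (laguerreFun 0 k t)
        have a1 := abs_nonneg (laguerreFun 1 k t)
        nlinarith [mul_nonneg hk a0, mul_nonneg hk a1]
      · have hn : (0 : ℝ) ≤ n := by positivity
        have a0 := abs_nonneg (laguerreFun n k t)
        have a1 := abs_nonneg (laguerreFun (n + 1) k t)
        have a2 := abs_nonneg (laguerreFun (n + 2) k t)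
        have h0 : |2 * t * laguerreFun (n + 1) k t| ≤ (n + k + 2) * |laguerreFun (n + 1) k t| +
            (n + 2) * |laguerreFun (n + 2) k t| + ((n + k + 1) * |laguerreFun n k t| +
            (n + 1) * |laguerreFun (n + 1) k t|) := by
          rw [mul_laguerreFun_succ]
          refine (abs_add_le _ _).trans (add_le_add ((abs_add_le _ _).trans (le_of_eq ?_))
            ((abs_add_le _ _).trans (le_of_eq ?_)))
          · rw [abs_mul, abs_mul, abs_of_nonneg (a := (n : ℝ) + k + 2) (by positivity),
              abs_of_nonneg (a := (n : ℝ) + 2) (by positivity)]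
          · rw [abs_mul, abs_mul, abs_of_nonneg (a := (n : ℝ) + k + 1) (by positivity),
              abs_of_nonneg (a := (n : ℝ) + 1) (by positivity)]
        rw [abs_mul, abs_of_nonneg (by positivity)] at h0
        simp only [Nat.add_sub_cancel]
        push_cast
        have b0 := mul_nonneg hk a0
        have b1 := mul_nonneg hk a1
        have b2 := mul_nonneg hk a2
        have c0 := mul_nonneg hn a0
        have c1 := mul_nonneg hn a1
        have c2 := mul_nonneg hn a2
        have d0 := mul_nonneg hn b0
        have d1 := mul_nonneg hn b1
        have d2 := mul_nonneg hn b2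
        nlinarith
    have up : ∀ m : ℕ, m ≤ n + 1 → (1 + t) ^ M * |laguerreFun m k t| ≤
        C * (2 ^ A * ((n : ℝ) + 1) ^ A) := by
      intro m hm
      refine (h m t ht).trans ?_
      rw [← mul_pow]
      have : (m : ℝ) ≤ n + 1 := by exact_mod_cast hm
      gcongr
      have hn : (0 : ℝ) ≤ n := by positivity
      linarith
    have u0 := up n (by omega)
    have u1 := up (n + 1) le_rfl
    have u2 := up (n - 1) (by omega)
    calc (1 + t) ^ (M + 1) * |laguerreFun n k t|
        = (1 + t) ^ M * ((1 + t) * |laguerreFun n k t|) := by ring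
      _ ≤ (1 + t) ^ M * (2 * (k + 2) * ((n : ℝ) + 1) *
        (|laguerreFun n k t| + |laguerreFun (n + 1) k t| + |laguerreFun (n - 1) k t|)) := by gcongr
      _ = 2 * (k + 2) * ((n : ℝ) + 1) * ((1 + t) ^ M * |laguerreFun n k t| +
        (1 + t) ^ M * |laguerreFun (n + 1) k t| + (1 + t) ^ M * |laguerreFun (n - 1) k t|) := by ring
      _ ≤ 2 * (k + 2) * ((n : ℝ) + 1) * (C * (2 ^ A * ((n : ℝ) + 1) ^ A) +
        C * (2 ^ A * ((n : ℝ) + 1) ^ A) + C * (2 ^ A * ((n : ℝ) + 1) ^ A)) := by gcongr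
      _ = _ := by rw [pow_succ]; ring

lemma hasSum_laguerre {s : ℝ} (hs : |s| < 1) (k : ℕ) (y : ℝ) :
    HasSum (fun n => s ^ n * laguerre n k y)
      (((1 - s) ^ (k + 1))⁻¹ * exp (-(y * s) / (1 - s))) := by
  have aux : ∀ s y : ℝ, |s| < 1 → HasSum (fun i : ℕ => (-y * s) ^ i / i.factorial *
      ((1 - s)⁻¹) ^ (i + k + 1)) (((1 - s) ^ (k + 1))⁻¹ * exp (-(y * s) / (1 - s))) := by
    intro s y _
    have h := (NormedSpace.expSeries_div_hasSum_exp (-(y * s) / (1 - s))).mul_left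
      (((1 - s) ^ (k + 1))⁻¹)
    rw [← Real.exp_eq_exp_ℝ] at h
    have e : (fun i : ℕ => (-y * s) ^ i / i.factorial * ((1 - s)⁻¹) ^ (i + k + 1)) = fun i =>
        ((1 - s) ^ (k + 1))⁻¹ * ((-(y * s) / (1 - s)) ^ i / i.factorial) := by
      funext i
      rw [div_pow, neg_mul, add_assoc, pow_add, inv_pow, inv_pow]
      ring
    rw [e]
    exact h
  have inner : ∀ s y : ℝ, |s| < 1 → ∀ i : ℕ, HasSum (fun m : ℕ => (-y * s) ^ i / i.factorial *
      (((m + (i + k)).choose (i + k) : ℝ) * s ^ m))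
      ((-y * s) ^ i / i.factorial * ((1 - s)⁻¹) ^ (i + k + 1)) := by
    intro s y hs i
    have h := hasSum_choose_mul_geometric_of_norm_lt_one' (i + k) (r := s) (by simpa using hs)
    rw [Ring.inverse_eq_inv'] at h
    exact h.mul_left _
  set f : ℕ × ℕ → ℝ := fun p => (-y * s) ^ p.1 / p.1.factorial *
      (((p.2 + (p.1 + k)).choose (p.1 + k) : ℝ) * s ^ p.2) with hf
  have habs : |(|s|)| < 1 := by simpa using hs
  have hsum : Summable f := by
    refine Summable.of_norm_bounded (g := fun p => (-(-|y|) * |s|) ^ p.1 / p.1.factorial *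
      (((p.2 + (p.1 + k)).choose (p.1 + k) : ℝ) * |s| ^ p.2)) ?_ (fun p => ?_)
    · rw [summable_prod_of_nonneg (fun p => by simp only [neg_neg]; positivity)]
      refine ⟨fun i => (inner |s| (-|y|) habs i).summable, ?_⟩
      simp only [fun i => (inner |s| (-|y|) habs i).tsum_eq]
      exact (aux |s| (-|y|) habs).summable
    · simp only [hf, norm_eq_abs, abs_mul, abs_div, abs_pow, abs_neg, neg_neg, Nat.abs_cast]
      exact le_rfl
  have htot : HasSum f (((1 - s) ^ (k + 1))⁻¹ * exp (-(y * s) / (1 - s))) := by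
    have h1 := hsum.hasSum.prod_fiberwise (fun i => inner s y hs i)
    have e := h1.unique (aux s y hs)
    have h2 := hsum.hasSum
    rwa [e] at h2
  have h2 := (Equiv.hasSum_iff Finset.HasAntidiagonal.sigmaAntidiagonalEquivProd (f := f)).mpr htot
  have h3 := h2.sigma (fun n => hasSum_fintype _)
  suffices e : (fun n => s ^ n * laguerre n k y) = _ by rw [e]; exact h3
  funext n
  rw [laguerre, mul_sum]
  simp only [Function.comp_def, Finset.HasAntidiagonal.sigmaAntidiagonalEquivProd_apply]
  rw [univ_eq_attach, sum_attach (Finset.HasAntidiagonal.antidiagonal n) f,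
    Finset.Nat.sum_antidiagonal_eq_sum_range_succ_mk]
  refine sum_congr rfl fun i hi => ?_
  have hi' : i ≤ n := Nat.lt_succ_iff.mp (mem_range.mp hi)
  simp only [hf]
  have hc : (n - i + (i + k)).choose (i + k) = (n + k).choose (n - i) := by
    rw [Nat.choose_symm_add.symm]; congr 1; omega
  rw [hc, show (-y * s) ^ i = (-1) ^ i * y ^ i * s ^ i by rw [← mul_pow, ← mul_pow]; ring,
    show s ^ n = s ^ i * s ^ (n - i) by rw [← pow_add]; congr 1; omega]
  ring

lemma hasSum_laguerreFun {s : ℝ} (hs : |s| < 1) (k : ℕ) (t : ℝ) :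
    HasSum (fun n => s ^ n * laguerreFun n k t)
      (((1 + s) ^ (k + 1))⁻¹ * exp (-(t * ((1 - s) / (1 + s))))) := by
  have h := (hasSum_laguerre (s := -s) (by simpa using hs) k (2 * t)).mul_left (exp (-t))
  have h1 : 1 + s ≠ 0 := by
    have := (abs_lt.mp hs).1; linarith
  have e1 : (fun n => s ^ n * laguerreFun n k t) =
      fun n => exp (-t) * ((-s) ^ n * laguerre n k (2 * t)) := by
    funext n; simp only [laguerreFun]; rw [neg_pow]; ring
  have e2 : ((1 + s) ^ (k + 1))⁻¹ * exp (-(t * ((1 - s) / (1 + s)))) =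
      exp (-t) * (((1 - -s) ^ (k + 1))⁻¹ * exp (-(2 * t * -s) / (1 - -s))) := by
    rw [sub_neg_eq_add, mul_left_comm, ← Real.exp_add]
    congr 2
    field_simp
    ring
  rw [e1, e2]
  exact h

/-! ### Bounded Borel functional calculus of a projection-valued measure -/

section Hilbert

variable {𝓗 : Type*} [NormedAddCommGroup 𝓗] [InnerProductSpace ℂ 𝓗]

lemma clm_ext_inner {S T : 𝓗 →L[ℂ] 𝓗} (h : ∀ v, inner ℂ v (S v) = inner ℂ v (T v)) : S = T := by
  have h2 := (ext_inner_map (S : 𝓗 →ₗ[ℂ] 𝓗) T).mp fun v => by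
    have := congrArg (conj) (h v)
    simpa using this
  ext v
  exact congrArg (fun L : 𝓗 →ₗ[ℂ] 𝓗 => L v) h2

lemma isStarProjection_of_inner [CompleteSpace 𝓗] {A : 𝓗 →L[ℂ] 𝓗}
    (h : ∀ v, inner ℂ v (A v) = ((‖A v‖ ^ 2 : ℝ) : ℂ)) : IsStarProjection A := by
  have hs : star A = A := by
    refine clm_ext_inner fun v => ?_
    rw [star_eq_adjoint, adjoint_inner_right, ← inner_conj_symm, h, conj_ofReal]
  refine ⟨?_, hs⟩
  refine clm_ext_inner fun v => ?_
  rw [h, mul_apply_eq_comp]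
  nth_rw 1 [← hs]
  rw [star_eq_adjoint, adjoint_inner_right, inner_self_eq_norm_sq_to_K]
  norm_cast

end Hilbert

namespace ProjMeasure

variable {Ω : Type*} [MeasurableSpace Ω] {𝓗 : Type*} [NormedAddCommGroup 𝓗]
    [InnerProductSpace ℂ 𝓗] [CompleteSpace 𝓗] (P : ProjMeasure Ω 𝓗)

lemma measure_apply {s : Set Ω} (hs : MeasurableSet s) (v : 𝓗) :
    P.measure v s = ENNReal.ofReal (‖P.proj s v‖ ^ 2) :=
  Measure.ofMeasurable_apply s hs

instance isFiniteMeasure_measure (v : 𝓗) : IsFiniteMeasure (P.measure v) :=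
  ⟨by rw [P.measure_apply MeasurableSet.univ]; exact ENNReal.ofReal_lt_top⟩

lemma measureReal_apply {s : Set Ω} (hs : MeasurableSet s) (v : 𝓗) :
    (P.measure v).real s = ‖P.proj s v‖ ^ 2 := by
  rw [Measure.real, P.measure_apply hs, ENNReal.toReal_ofReal (by positivity)]

lemma measureReal_univ (v : 𝓗) : (P.measure v).real Set.univ = ‖v‖ ^ 2 := by
  rw [P.measureReal_apply MeasurableSet.univ, P.proj_univ]; rfl

lemma inner_proj {s : Set Ω} (hs : MeasurableSet s) (v : 𝓗) :
    inner ℂ v (P.proj s v) = ((‖P.proj s v‖ ^ 2 : ℝ) : ℂ) := by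
  have h := P.isStarProjection s hs
  have h1 : adjoint (P.proj s) = P.proj s := h.isSelfAdjoint
  have h2 : P.proj s (P.proj s v) = P.proj s v := by
    have := congrArg (fun T : 𝓗 →L[ℂ] 𝓗 => T v) h.isIdempotentElem
    simpa using this
  have h3 : inner ℂ v (P.proj s v) = inner ℂ (P.proj s v) (P.proj s v) := by
    conv_rhs => rw [← adjoint_inner_right, h1, h2]
  rw [h3, inner_self_eq_norm_sq_to_K]
  norm_cast

lemma inner_proj_proj_of_disjoint {s t : Set Ω} (hs : MeasurableSet s) (ht : MeasurableSet t)
    (hd : Disjoint s t) (v w : 𝓗) : inner ℂ (P.proj s v) (P.proj t w) = 0 := by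
  have h1 : adjoint (P.proj s) = P.proj s := (P.isStarProjection s hs).isSelfAdjoint
  rw [← h1, adjoint_inner_left, ← mul_apply_eq_comp,
    ← P.proj_inter s t hs ht, Set.disjoint_iff_inter_eq_empty.mp hd, P.proj_empty]
  simp

/-- `A = ∫ F dP`, together with the isometry property. -/
def IsFC (F : Ω → ℂ) (A : 𝓗 →L[ℂ] 𝓗) : Prop := ∀ v, inner ℂ v (A v) = ∫ p, F p ∂(P.measure v) ∧
    ‖A v‖ ^ 2 = ∫ p, ‖F p‖ ^ 2 ∂(P.measure v)

variable {P} in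
lemma integrable_of_bdd {F : Ω → ℂ} (hF : Measurable F) {C : ℝ} (hC : ∀ p, ‖F p‖ ≤ C) (v : 𝓗) :
    Integrable F (P.measure v) :=
  Integrable.of_bound hF.aestronglyMeasurable C (.of_forall hC)

lemma exists_isFC_simpleFunc (f : SimpleFunc Ω ℂ) :
    ∃ A, P.IsFC f A ∧ P.proj (support f) * A = A := by
  classical
  induction f using SimpleFunc.induction with
  | const c hs =>
    rename_i s
    have h0 : P.IsFC ⇑(SimpleFunc.piecewise s hs (SimpleFunc.const Ω c) (SimpleFunc.const Ω 0))
        (c • P.proj s) := by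
      intro v
      simp only [SimpleFunc.coe_piecewise, SimpleFunc.coe_const, Function.const_zero]
      rw [Set.piecewise_eq_indicator]
      constructor
      · rw [integral_indicator hs]
        simp only [Function.const_apply, integral_const]
        rw [_root_.smul_apply, inner_smul_right, P.inner_proj hs, measureReal_restrict_apply .univ, Set.univ_inter,
          P.measureReal_apply hs, real_smul, mul_comm]
      · have : ∀ p, ‖s.indicator (Function.const Ω c) p‖ ^ 2 =
            s.indicator (fun _ => ‖c‖ ^ 2) p := by
          intro p
          by_cases hp : p ∈ s <;> simp [hp]
        simp only [this]
        rw [integral_indicator hs]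
        simp only [integral_const]
        rw [_root_.smul_apply, norm_smul, mul_pow, measureReal_restrict_apply .univ, Set.univ_inter, P.measureReal_apply hs,
          smul_eq_mul, mul_comm]
    refine ⟨_, h0, ?_⟩
    by_cases hc : c = 0
    · simp [hc]
    · have : support ⇑(SimpleFunc.piecewise s hs (SimpleFunc.const Ω c)
          (SimpleFunc.const Ω 0)) = s := by
        ext p
        by_cases hp : p ∈ s <;> simp [hp, hc]
      rw [this, mul_smul_comm, (P.isStarProjection s hs).isIdempotentElem]
  | add hd hf hg =>
    rename_i f g
    obtain ⟨A, hA, hA'⟩ := hf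
    obtain ⟨B, hB, hB'⟩ := hg
    have mf : MeasurableSet (support f) := f.measurableSet_support
    have mg : MeasurableSet (support g) := g.measurableSet_support
    have hsupp : support ⇑(f + g) = support f ∪ support g := by
      ext p
      have : p ∈ support f → p ∉ support g := fun h => Set.disjoint_left.mp hd h
      simp only [SimpleFunc.coe_add, Function.mem_support, Pi.add_apply, Set.mem_union] at this ⊢
      by_cases h1 : f p = 0 <;> by_cases h2 : g p = 0 <;> simp_all
    refine ⟨A + B, fun v => ⟨?_, ?_⟩, ?_⟩
    · obtain ⟨C, hC⟩ := f.exists_forall_norm_le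
      obtain ⟨C', hC'⟩ := g.exists_forall_norm_le
      simp only [SimpleFunc.coe_add, Pi.add_apply]
      rw [integral_add (P.integrable_of_bdd f.measurable hC v)
        (P.integrable_of_bdd g.measurable hC' v), ← (hA v).1, ← (hB v).1, ← inner_add_right]
      rfl
    · have e1 : ∀ p, ‖(f + g) p‖ ^ 2 = ‖f p‖ ^ 2 + ‖g p‖ ^ 2 := by
        intro p
        have : p ∈ support f → p ∉ support g := fun h => Set.disjoint_left.mp hd h
        simp only [SimpleFunc.coe_add, Function.mem_support, Pi.add_apply] at this ⊢
        by_cases h1 : f p = 0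
        · simp [h1]
        · simp [not_not.mp (this h1)]
      simp only [e1]
      have i1 : ∀ h : SimpleFunc Ω ℂ, Integrable (fun p => ‖h p‖ ^ 2) (P.measure v) := by
        intro h
        obtain ⟨C, hC⟩ := h.exists_forall_norm_le
        refine Integrable.of_bound (by fun_prop) (C ^ 2) (.of_forall fun p => ?_)
        rw [norm_pow, norm_norm]
        exact pow_le_pow_left₀ (norm_nonneg _) (hC p) 2
      rw [integral_add (i1 f) (i1 g), ← (hA v).2, ← (hB v).2, _root_.add_apply]
      have e2 : inner ℂ (A v) (B v) = 0 := by
        rw [← hA', ← hB', mul_apply_eq_comp, mul_apply_eq_comp]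
        exact P.inner_proj_proj_of_disjoint mf mg hd _ _
      have := norm_add_sq_eq_norm_sq_add_norm_sq_of_inner_eq_zero (𝕜 := ℂ) _ _ e2
      simpa [pow_two] using this
    · have k : ∀ (h : Set Ω) (D : 𝓗 →L[ℂ] 𝓗), MeasurableSet h →
          h ⊆ support f ∪ support g → P.proj h * D = D →
          P.proj (support f ∪ support g) * D = D := by
        intro h D hm hsub hD
        rw [← hD, ← mul_assoc, ← P.proj_inter _ _ (mf.union mg) hm,
          Set.inter_eq_self_of_subset_right hsub]
      rw [hsupp, mul_add, k _ A mf Set.subset_union_left hA', k _ B mg Set.subset_union_right hB']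

lemma tendsto_integral_of_bdd {F : ℕ → Ω → ℂ} {G : Ω → ℂ} (hF : ∀ n, Measurable (F n)) {C : ℝ}
    (hC : ∀ n p, ‖F n p‖ ≤ C) (v : 𝓗) (h : ∀ᵐ p ∂(P.measure v), Tendsto (fun n => F n p) atTop (𝓝 (G p))) :
    Tendsto (fun n => ∫ p, F n p ∂(P.measure v)) atTop (𝓝 (∫ p, G p ∂(P.measure v))) :=
  tendsto_integral_of_dominated_convergence (fun _ => C)
    (fun n => (hF n).aestronglyMeasurable) (integrable_const _)
    (fun n => Eventually.of_forall (hC n)) h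

lemma tendsto_integral_sq_of_bdd {F : ℕ → Ω → ℂ} {G : Ω → ℂ} (hF : ∀ n, Measurable (F n)) {C : ℝ}
    (hC : ∀ n p, ‖F n p‖ ≤ C) (v : 𝓗) (h : ∀ᵐ p ∂(P.measure v), Tendsto (fun n => F n p) atTop (𝓝 (G p))) :
    Tendsto (fun n => ∫ p, ‖F n p‖ ^ 2 ∂(P.measure v)) atTop
      (𝓝 (∫ p, ‖G p‖ ^ 2 ∂(P.measure v))) := by
  refine tendsto_integral_of_dominated_convergence (fun _ => C ^ 2)
    (fun n => ((hF n).norm.pow_const 2).aestronglyMeasurable) (integrable_const _)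
    (fun n => Eventually.of_forall fun p => ?_) (h.mono fun p hp => (hp.norm.pow 2))
  rw [norm_pow, norm_norm]
  exact pow_le_pow_left₀ (norm_nonneg _) (hC n p) 2

lemma exists_isFC {F : Ω → ℂ} (hF : Measurable F) {C : ℝ} (hC : ∀ p, ‖F p‖ ≤ C) :
    ∃ A, P.IsFC F A := by
  rcases isEmpty_or_nonempty Ω with hΩ | ⟨⟨p₀⟩⟩
  · refine ⟨0, fun v => ?_⟩
    simp [Measure.eq_zero_of_isEmpty]
  have hC0 : 0 ≤ C := (norm_nonneg _).trans (hC p₀)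
  set f : ℕ → SimpleFunc Ω ℂ := hF.stronglyMeasurable.approxBounded C with hf
  have hfC : ∀ n p, ‖f n p‖ ≤ C := fun n p => hF.stronglyMeasurable.norm_approxBounded_le hC0 n p
  have hft : ∀ p, Tendsto (fun n => f n p) atTop (𝓝 (F p)) := fun p =>
    hF.stronglyMeasurable.tendsto_approxBounded_of_norm_le (hC p)
  choose A hA _ using fun n => P.exists_isFC_simpleFunc (f n)
  have hsub : ∀ n m, P.IsFC ⇑(f n - f m) (A n - A m) := by
    intro n m
    obtain ⟨B, hB, _⟩ := P.exists_isFC_simpleFunc (f n - f m)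
    have : A n - A m = B := by
      refine clm_ext_inner fun v => ?_
      rw [(hB v).1, _root_.sub_apply, inner_sub_right, (hA n v).1, (hA m v).1,
        ← integral_sub (P.integrable_of_bdd (f n).measurable (hfC n) v)
          (P.integrable_of_bdd (f m).measurable (hfC m) v)]
      rfl
    rwa [this]
  have hcau : ∀ v, CauchySeq fun n => A n v := by
    intro v
    rw [cauchySeq_iff_tendsto_dist_atTop_0]
    have h1 : Tendsto (fun q : ℕ × ℕ => ∫ p, ‖(f q.1 - f q.2) p‖ ^ 2 ∂(P.measure v)) atTop
        (𝓝 (∫ p, ‖F p - F p‖ ^ 2 ∂(P.measure v))) := by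
      refine tendsto_integral_filter_of_dominated_convergence (fun _ => (2 * C) ^ 2)
        (.of_forall fun q =>
          ((f q.1 - f q.2).measurable.norm.pow_const 2).aestronglyMeasurable)
        (.of_forall fun q => Eventually.of_forall fun p => ?_) (integrable_const _)
        (.of_forall fun p => ?_)
      · rw [norm_pow, norm_norm]
        refine pow_le_pow_left₀ (norm_nonneg _) ?_ 2
        rw [SimpleFunc.coe_sub, Pi.sub_apply, two_mul]
        exact (norm_sub_le _ _).trans (add_le_add (hfC _ p) (hfC _ p))
      · simp only [SimpleFunc.coe_sub, Pi.sub_apply]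
        rw [← prod_atTop_atTop_eq]
        exact ((((hft p).comp tendsto_fst).sub ((hft p).comp tendsto_snd)).norm).pow 2
    simp only [sub_self, norm_zero, ne_eq, OfNat.ofNat_ne_zero, not_false_eq_true, zero_pow,
      integral_zero] at h1
    have h2 := (Real.continuous_sqrt.tendsto 0).comp h1
    rw [Real.sqrt_zero] at h2
    refine h2.congr fun q => ?_
    simp only [comp_apply]
    rw [← (hsub q.1 q.2 v).2, Real.sqrt_sq (norm_nonneg _), dist_eq_norm]
    rfl
  choose l hl using fun v => cauchySeq_tendsto_of_complete (hcau v)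
  refine ⟨continuousLinearMapOfTendsto A (tendsto_pi_nhds.mpr hl), fun v => ⟨?_, ?_⟩⟩
  · refine tendsto_nhds_unique (f := fun n => inner ℂ v (A n v)) (l := atTop)
      ((continuous_const.inner continuous_id).tendsto _ |>.comp (hl v)) ?_
    simp only [fun n => (hA n v).1]
    exact P.tendsto_integral_of_bdd (fun n => (f n).measurable) hfC v (.of_forall hft)
  · refine tendsto_nhds_unique (f := fun n => ‖A n v‖ ^ 2) (l := atTop) ((hl v).norm.pow 2) ?_
    simp only [fun n => (hA n v).2]
    exact P.tendsto_integral_sq_of_bdd (fun n => (f n).measurable) hfC v (.of_forall hft)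

/-- Bounded measurable functions. -/
def IsBdd (F : Ω → ℂ) : Prop := Measurable F ∧ ∃ C : ℝ, ∀ p, ‖F p‖ ≤ C

open Classical in
/-- The operator `∫ F dP` for a bounded measurable function `F`. -/
def fc (F : Ω → ℂ) : 𝓗 →L[ℂ] 𝓗 := if h : ∃ A, P.IsFC F A then h.choose else 0

variable {F G : Ω → ℂ}

lemma isFC_fc (hF : IsBdd F) : P.IsFC F (P.fc F) := by
  obtain ⟨hm, C, hC⟩ := hF
  have h := P.exists_isFC hm hC
  rw [fc, dif_pos h]
  exact h.choose_spec

lemma inner_fc_self (hF : IsBdd F) (v : 𝓗) :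
    inner ℂ v (P.fc F v) = ∫ p, F p ∂(P.measure v) := (P.isFC_fc hF v).1

lemma norm_fc_sq (hF : IsBdd F) (v : 𝓗) :
    ‖P.fc F v‖ ^ 2 = ∫ p, ‖F p‖ ^ 2 ∂(P.measure v) := (P.isFC_fc hF v).2

lemma IsBdd.integrable (hF : IsBdd F) (v : 𝓗) : Integrable F (P.measure v) :=
  P.integrable_of_bdd hF.1 hF.2.choose_spec v

lemma IsBdd.add (hF : IsBdd F) (hG : IsBdd G) : IsBdd (fun p => F p + G p) := by
  obtain ⟨hF, C, hC⟩ := hF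
  obtain ⟨hG, D, hD⟩ := hG
  exact ⟨hF.add hG, C + D, fun p => (norm_add_le _ _).trans (add_le_add (hC p) (hD p))⟩

lemma IsBdd.mul (hF : IsBdd F) (hG : IsBdd G) : IsBdd (fun p => F p * G p) := by
  obtain ⟨hF, C, hC⟩ := hF
  obtain ⟨hG, D, hD⟩ := hG
  refine ⟨hF.mul hG, C * D, fun p => ?_⟩
  rw [norm_mul]
  exact mul_le_mul (hC p) (hD p) (norm_nonneg _) ((norm_nonneg _).trans (hC p))

lemma isBdd_const (c : ℂ) : IsBdd (fun _ : Ω => c) := ⟨measurable_const, ‖c‖, fun _ => le_rfl⟩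

lemma IsBdd.const_mul (hF : IsBdd F) (c : ℂ) : IsBdd (fun p => c * F p) := (isBdd_const c).mul hF

lemma IsBdd.sub (hF : IsBdd F) (hG : IsBdd G) : IsBdd (fun p => F p - G p) := by
  simpa [sub_eq_add_neg] using hF.add (hG.const_mul (-1))

lemma IsBdd.conj (hF : IsBdd F) : IsBdd (fun p => conj (F p)) :=
  ⟨Complex.continuous_conj.measurable.comp hF.1, hF.2.choose, fun p => by
    simpa using hF.2.choose_spec p⟩

lemma isBdd_indicator {s : Set Ω} (hs : MeasurableSet s) :
    IsBdd (s.indicator fun _ => (1 : ℂ)) := by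
  refine ⟨measurable_const.indicator hs, 1, fun p => ?_⟩
  by_cases hp : p ∈ s <;> simp [hp]

lemma fc_add (hF : IsBdd F) (hG : IsBdd G) : P.fc (fun p => F p + G p) = P.fc F + P.fc G := by
  refine clm_ext_inner fun v => ?_
  rw [P.inner_fc_self (hF.add hG), integral_add (P.integrable_of_bdd hF.1 hF.2.choose_spec v)
    (P.integrable_of_bdd hG.1 hG.2.choose_spec v), _root_.add_apply, inner_add_right,
    P.inner_fc_self hF, P.inner_fc_self hG]

lemma fc_const_mul (hF : IsBdd F) (c : ℂ) : P.fc (fun p => c * F p) = c • P.fc F := by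
  refine clm_ext_inner fun v => ?_
  rw [P.inner_fc_self (hF.const_mul c), integral_const_mul, _root_.smul_apply,
    inner_smul_right, P.inner_fc_self hF]

lemma fc_sub (hF : IsBdd F) (hG : IsBdd G) : P.fc (fun p => F p - G p) = P.fc F - P.fc G := by
  have h := P.fc_add hF (hG.const_mul (-1))
  rw [P.fc_const_mul hG] at h
  simpa [sub_eq_add_neg] using h

lemma inner_fc_left (hF : IsBdd F) (v w : 𝓗) :
    inner ℂ (P.fc F v) w = inner ℂ v (P.fc (fun p => conj (F p)) w) := by
  have h : adjoint (P.fc F) = P.fc (fun p => conj (F p)) := by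
    refine clm_ext_inner fun v => ?_
    rw [adjoint_inner_right, ← inner_conj_symm, P.inner_fc_self hF,
      P.inner_fc_self hF.conj, integral_conj]
  rw [← h, adjoint_inner_right]

lemma inner_fc_fc (hF : IsBdd F) (hG : IsBdd G) (v : 𝓗) :
    inner ℂ (P.fc F v) (P.fc G v) = ∫ p, conj (F p) * G p ∂(P.measure v) := by
  have i1 : ∀ {K : Ω → ℂ}, IsBdd K → Integrable (fun p => ((‖K p‖ : ℝ) : ℂ) ^ 2) (P.measure v) := by
    intro K hK
    obtain ⟨C, hC⟩ := hK.2
    have hm := hK.1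
    refine Integrable.of_bound (by fun_prop) (C ^ 2) (.of_forall fun p => ?_)
    rw [norm_pow, norm_real, norm_norm]
    exact pow_le_pow_left₀ (norm_nonneg _) (hC p) 2
  have i2 : ∀ {K : Ω → ℂ}, IsBdd K → ((‖P.fc K v‖ : ℝ) : ℂ) ^ 2 =
      ∫ p, ((‖K p‖ : ℝ) : ℂ) ^ 2 ∂(P.measure v) := by
    intro K hK
    rw [← Complex.ofReal_pow, P.norm_fc_sq hK, ← integral_complex_ofReal]
    simp
  have hI := hG.const_mul I
  have e : ∀ p, conj (F p) * G p = ((((‖F p + G p‖ : ℝ) : ℂ) ^ 2 - ((‖F p - G p‖ : ℝ) : ℂ) ^ 2) +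
              (((‖F p - I * G p‖ : ℝ) : ℂ) ^ 2 - ((‖F p + I * G p‖ : ℝ) : ℂ) ^ 2) * I) / 4 := by
    intro p
    have := inner_eq_sum_norm_sq_div_four (𝕜 := ℂ) (F p) (G p)
    rw [RCLike.inner_apply', ] at this
    exact this
  have hv := inner_eq_sum_norm_sq_div_four (𝕜 := ℂ) (P.fc F v) (P.fc G v)
  simp only [e]
  rw [integral_div, integral_add, integral_mul_const, integral_sub (i1 (hF.add hG)) (i1 (hF.sub hG)),
    integral_sub (i1 (hF.sub hI)) (i1 (hF.add hI)), ← i2 (hF.add hG), ← i2 (hF.sub hG),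
    ← i2 (hF.sub hI), ← i2 (hF.add hI), P.fc_add hF hG, P.fc_sub hF hG, P.fc_sub hF hI,
    P.fc_add hF hI, P.fc_const_mul hG]
  · exact hv
  · exact (i1 (hF.add hG)).sub (i1 (hF.sub hG))
  · exact ((i1 (hF.sub hI)).sub (i1 (hF.add hI))).mul_const _

lemma fc_mul (hF : IsBdd F) (hG : IsBdd G) : P.fc (fun p => F p * G p) = P.fc F * P.fc G := by
  refine clm_ext_inner fun v => ?_
  rw [P.inner_fc_self (hF.mul hG), mul_apply_eq_comp]
  have h := P.inner_fc_left hF.conj v (P.fc G v)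
  simp only [conj_conj] at h
  rw [← h, P.inner_fc_fc hF.conj hG]
  simp

lemma fc_indicator {s : Set Ω} (hs : MeasurableSet s) :
    P.fc (s.indicator fun _ => 1) = P.proj s := by
  refine clm_ext_inner fun v => ?_
  rw [P.inner_fc_self (isBdd_indicator hs), integral_indicator hs, P.inner_proj hs]
  simp [P.measureReal_apply hs]

lemma norm_fc_le (hF : IsBdd F) {C : ℝ} (hC0 : 0 ≤ C) (hC : ∀ p, ‖F p‖ ≤ C) (v : 𝓗) :
    ‖P.fc F v‖ ≤ C * ‖v‖ := by
  refine abs_le_of_sq_le_sq' ?_ (by positivity) |>.2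
  rw [P.norm_fc_sq hF, mul_pow, ← P.measureReal_univ v]
  calc ∫ p, ‖F p‖ ^ 2 ∂(P.measure v) ≤ ∫ _, C ^ 2 ∂(P.measure v) := by
        have hm := hF.1
        refine integral_mono_of_nonneg (.of_forall fun p => by positivity)
          (integrable_const _) (.of_forall fun p => ?_)
        exact pow_le_pow_left₀ (norm_nonneg _) (hC p) 2
    _ = _ := by simp [mul_comm]

lemma tendsto_fc {F : ℕ → Ω → ℂ} {G : Ω → ℂ} (hF : ∀ n, Measurable (F n)) (hG : Measurable G)
    {C : ℝ} (hC : ∀ n p, ‖F n p‖ ≤ C) (hGC : ∀ p, ‖G p‖ ≤ C)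
    (h : ∀ p, Tendsto (fun n => F n p) atTop (𝓝 (G p))) (v : 𝓗) :
    Tendsto (fun n => P.fc (F n) v) atTop (𝓝 (P.fc G v)) := by
  rw [tendsto_iff_norm_sub_tendsto_zero]
  have h1 := P.tendsto_integral_sq_of_bdd (F := fun n p => F n p - G p) (G := fun _ => 0)
    (fun n => (hF n).sub hG) (C := C + C)
    (fun n p => (norm_sub_le _ _).trans (add_le_add (hC n p) (hGC p))) v
    (.of_forall fun p => by simpa using (h p).sub_const (G p))
  simp only [norm_zero, ne_eq, OfNat.ofNat_ne_zero, not_false_eq_true, zero_pow,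
    integral_zero] at h1
  have h2 := (Real.continuous_sqrt.tendsto 0).comp h1
  rw [Real.sqrt_zero] at h2
  refine h2.congr fun n => ?_
  have b1 : IsBdd (F n) := ⟨hF n, C, hC n⟩
  have b2 : IsBdd G := ⟨hG, C, hGC⟩
  simp only [comp_apply]
  rw [← P.norm_fc_sq (b1.sub b2), Real.sqrt_sq (norm_nonneg _), P.fc_sub b1 b2]
  rfl

lemma measure_fc_apply (hF : IsBdd F) {s : Set Ω} (hs : MeasurableSet s) (v : 𝓗) :
    P.measure (P.fc F v) s = (P.measure v).withDensity (fun p => ENNReal.ofReal (‖F p‖ ^ 2)) s := by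
  obtain ⟨C, hC⟩ := hF.2
  have hm := hF.1
  rw [P.measure_apply hs, withDensity_apply _ hs, ← P.fc_indicator hs, ← mul_apply_eq_comp,
    ← P.fc_mul (isBdd_indicator hs) hF, P.norm_fc_sq ((isBdd_indicator hs).mul hF)]
  have : ∀ p, ‖s.indicator (fun _ => (1 : ℂ)) p * F p‖ ^ 2 = s.indicator (fun p => ‖F p‖ ^ 2) p := by
    intro p
    by_cases hp : p ∈ s <;> simp [hp]
  simp only [this]
  rw [integral_indicator hs, ofReal_integral_eq_lintegral_ofReal]
  · refine Integrable.of_bound (by fun_prop) (C ^ 2) (.of_forall fun p => ?_)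
    rw [norm_pow, norm_norm]
    exact pow_le_pow_left₀ (norm_nonneg _) (hC p) 2
  · exact Eventually.of_forall fun p => by positivity

lemma measure_fc (hF : IsBdd F) (v : 𝓗) :
    P.measure (P.fc F v) = (P.measure v).withDensity (fun p => ENNReal.ofReal (‖F p‖ ^ 2)) :=
  Measure.ext fun _ hs => P.measure_fc_apply hF hs v

end ProjMeasure

universe u

/-! ### The spectral theorem for commuting normal operators -/

section SpectralTheorem

variable {𝓗 : Type u} [NormedAddCommGroup 𝓗] [InnerProductSpace ℂ 𝓗] [CompleteSpace 𝓗]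

lemma exists_continuousMap_hom {ι A B : Type*} [CommCStarAlgebra A] [Semiring B] [StarRing B]
    [Algebra ℂ B] (ρ : A →⋆ₐ[ℂ] B) (c : ι → A) :
    ∃ (e : C(WeakDual.characterSpace ℂ A, ι → ℂ)) (Ψ : C(WeakDual.characterSpace ℂ A, ℂ) →⋆ₐ[ℂ] B),
      ∀ i, Ψ ⟨fun x => e x i, by fun_prop⟩ = ρ (c i) := by
  let g : A ≃⋆ₐ[ℂ] C(WeakDual.characterSpace ℂ A, ℂ) := gelfandStarTransform A
  refine ⟨⟨fun x i => g (c i) x, continuous_pi fun i => (g (c i)).continuous⟩,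
    ρ.comp (g.symm : C(WeakDual.characterSpace ℂ A, ℂ) →⋆ₐ[ℂ] A), fun i => ?_⟩
  exact congrArg ρ (g.symm_apply_apply (c i))

lemma exists_gelfand {ι : Type*} (C : ι → 𝓗 →L[ℂ] 𝓗)
    (h1 : ∀ i j, C i * C j = C j * C i) (h2 : ∀ i j, C i * star (C j) = star (C j) * C i) :
    ∃ (X : Type u) (_ : TopologicalSpace X) (_ : CompactSpace X) (_ : T2Space X)
      (e : C(X, ι → ℂ)) (Ψ : C(X, ℂ) →⋆ₐ[ℂ] (𝓗 →L[ℂ] 𝓗)),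
      ∀ i, Ψ (⟨fun x => e x i, by fun_prop⟩ : C(X, ℂ)) = C i := by
  have hc : IsMulCommutative (StarAlgebra.adjoin ℂ (Set.range C)) :=
    StarAlgebra.isMulCommutative_adjoin ℂ (by rintro _ ⟨i, rfl⟩ _ ⟨j, rfl⟩; exact h1 i j)
      (by rintro _ ⟨i, rfl⟩ _ ⟨j, rfl⟩; exact h2 i j)
  have hcomm : ∀ x y : (StarAlgebra.adjoin ℂ (Set.range C)).topologicalClosure, x * y = y * x :=
    (StarSubalgebra.commRingTopologicalClosure (StarAlgebra.adjoin ℂ (Set.range C))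
      (fun x y => hc.is_comm.comm x y)).mul_comm
  have hmem : ∀ i, C i ∈ (StarAlgebra.adjoin ℂ (Set.range C)).topologicalClosure :=
    fun i => StarSubalgebra.le_topologicalClosure _ (StarAlgebra.subset_adjoin ℂ _ ⟨i, rfl⟩)
  have hcl := StarSubalgebra.isClosed_topologicalClosure (StarAlgebra.adjoin ℂ (Set.range C))
  generalize (StarAlgebra.adjoin ℂ (Set.range C)).topologicalClosure = A at hcomm hmem hcl
  let i0 : CStarAlgebra A := StarSubalgebra.cstarAlgebra A
  let i1 : CommCStarAlgebra A := { i0 with mul_comm := hcomm }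
  obtain ⟨e, Ψ, h⟩ := exists_continuousMap_hom (StarSubalgebra.subtype A)
    (fun i => (⟨C i, hmem i⟩ : A))
  exact ⟨WeakDual.characterSpace ℂ A, inferInstance, inferInstance, inferInstance, e, Ψ, h⟩

/-- The composition of a continuous real function with the inclusion into `ℂ`. -/
def ofRealC {X : Type*} [TopologicalSpace X] (f : C(X, ℝ)) : C(X, ℂ) :=
  ⟨fun x => (f x : ℂ), by fun_prop⟩

lemma exists_riesz {X : Type*} [TopologicalSpace X] [CompactSpace X] [T2Space X]
    [MeasurableSpace X] [BorelSpace X] (Ψ : C(X, ℂ) →⋆ₐ[ℂ] (𝓗 →L[ℂ] 𝓗)) (v : 𝓗) :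
    ∃ μ : Measure X, IsFiniteMeasure μ ∧ ∀ f : C(X, ℂ), inner ℂ v (Ψ f v) = ∫ x, f x ∂μ := by
  let Λ₀ : C_c(X, ℝ) →ₗ[ℝ] ℝ :=
    { toFun := fun f => (inner ℂ v (Ψ (ofRealC f.toContinuousMap) v)).re
      map_add' := fun f g => by
        have : ofRealC (f + g).toContinuousMap =
            ofRealC f.toContinuousMap + ofRealC g.toContinuousMap := by
          ext x; simp [ofRealC]
        rw [this, map_add, _root_.add_apply, inner_add_right, Complex.add_re]
      map_smul' := fun c f => by
        have : ofRealC (c • f).toContinuousMap = (c : ℂ) • ofRealC f.toContinuousMap := by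
          ext x; simp [ofRealC]
        rw [this, map_smul, _root_.smul_apply, inner_smul_right, Complex.re_ofReal_mul]
        rfl }
  have hpos : ∀ f : C_c(X, ℝ), 0 ≤ f → 0 ≤ Λ₀ f := by
    intro f hf
    let s : C(X, ℂ) := ofRealC ⟨fun x => Real.sqrt (f x), by fun_prop⟩
    have hs : ofRealC f.toContinuousMap = star s * s := by
      ext x
      have hx : 0 ≤ f x := hf x
      simp only [ofRealC, s, ContinuousMap.coe_mk, ContinuousMap.mul_apply,
        ContinuousMap.star_apply, RCLike.star_def, conj_ofReal]
      rw [← ofReal_mul, Real.mul_self_sqrt hx]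
      rfl
    change 0 ≤ (inner ℂ v (Ψ (ofRealC f.toContinuousMap) v)).re
    rw [hs, map_mul, map_star, mul_apply_eq_comp, star_eq_adjoint, adjoint_inner_right]
    exact inner_self_nonneg (𝕜 := ℂ)
  let Λ : C_c(X, ℝ) →ₚ[ℝ] ℝ := PositiveLinearMap.mk₀ Λ₀ hpos
  have hΛ : ∀ f : C(X, ℝ), ∫ x, f x ∂(RealRMK.rieszMeasure Λ) =
      (inner ℂ v (Ψ (ofRealC f) v)).re := by
    intro f
    have := RealRMK.integral_rieszMeasure Λ ⟨f, HasCompactSupport.of_compactSpace _⟩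
    exact this
  have hreal : ∀ f : C(X, ℝ), inner ℂ v (Ψ (ofRealC f) v) =
      ((inner ℂ v (Ψ (ofRealC f) v)).re : ℂ) := by
    intro f
    have hst : star (ofRealC f) = ofRealC f := by ext x; simp [ofRealC]
    refine (Complex.conj_eq_iff_re.mp ?_).symm
    rw [inner_conj_symm]
    conv_rhs => rw [← hst, map_star, star_eq_adjoint, adjoint_inner_right]
  refine ⟨RealRMK.rieszMeasure Λ, inferInstance, fun f => ?_⟩
  let fr : C(X, ℝ) := ⟨fun x => (f x).re, by fun_prop⟩
  let fi : C(X, ℝ) := ⟨fun x => (f x).im, by fun_prop⟩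
  have hf : f = ofRealC fr + I • ofRealC fi := by
    ext x
    simp [ofRealC, fr, fi, mul_comm I, Complex.re_add_im]
  have hint : Integrable f (RealRMK.rieszMeasure Λ) :=
    f.continuous.integrable_of_hasCompactSupport (HasCompactSupport.of_compactSpace _)
  rw [← integral_re_add_im hint]
  have e1 := hΛ fr
  have e2 := hΛ fi
  simp only [fr, fi, ContinuousMap.coe_mk] at e1 e2
  conv_lhs => rw [hf]
  rw [map_add, map_smul, _root_.add_apply, _root_.smul_apply, inner_add_right,
    inner_smul_right, hreal fr, hreal fi]
  simp only [RCLike.re_eq_complex_re, RCLike.im_eq_complex_im, e1, e2]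
  simp [fr, fi, mul_comm]

variable {Y : Type*} [PseudoEMetricSpace Y] [MeasurableSpace Y] [BorelSpace Y]

/-- A family of measures represents a `*`-representation of the continuous functions. -/
def Represents (Φ : C(Y, ℂ) →⋆ₐ[ℂ] (𝓗 →L[ℂ] 𝓗)) (μ : 𝓗 → Measure Y) : Prop :=
  ∀ v, IsFiniteMeasure (μ v) ∧ ∀ f : C(Y, ℂ), Integrable f (μ v) ∧
    inner ℂ v (Φ f v) = ∫ y, f y ∂(μ v)

lemma exists_represents {X : Type*} [TopologicalSpace X] [CompactSpace X] [T2Space X]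
    (Ψ : C(X, ℂ) →⋆ₐ[ℂ] (𝓗 →L[ℂ] 𝓗)) (e : C(X, Y)) :
    ∃ μ : 𝓗 → Measure Y, Represents (Ψ.comp (ContinuousMap.compStarAlgHom' ℂ ℂ e)) μ := by
  let : MeasurableSpace X := borel X
  have : BorelSpace X := ⟨rfl⟩
  choose ν hν hν' using fun v => exists_riesz Ψ v
  have he : Measurable e := e.continuous.measurable
  refine ⟨fun v => (ν v).map e, fun v => ?_⟩
  have := hν v
  refine ⟨inferInstance, fun f => ?_⟩
  have hm : AEStronglyMeasurable f ((ν v).map e) := (f.continuous.measurable).aestronglyMeasurable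
  constructor
  · rw [integrable_map_measure hm he.aemeasurable]
    exact (f.comp e).continuous.integrable_of_hasCompactSupport (HasCompactSupport.of_compactSpace _)
  · rw [integral_map he.aemeasurable hm]
    exact hν' v (f.comp e)

namespace Represents

variable {Φ : C(Y, ℂ) →⋆ₐ[ℂ] (𝓗 →L[ℂ] 𝓗)} {μ : 𝓗 → Measure Y} (hμ : Represents Φ μ)
include hμ

lemma norm_sq (f : C(Y, ℂ)) (v : 𝓗) : ‖Φ f v‖ ^ 2 = ∫ y, ‖f y‖ ^ 2 ∂(μ v) := by
  have h := ((hμ v).2 (star f * f)).2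
  rw [map_mul, map_star, mul_apply_eq_comp, star_eq_adjoint,
    adjoint_inner_right, inner_self_eq_norm_sq_to_K] at h
  have e : ∀ y, (star f * f) y = ((‖f y‖ ^ 2 : ℝ) : ℂ) := by
    intro y
    simp [Complex.conj_mul']
  simp only [e] at h
  rw [integral_complex_ofReal] at h
  exact ofReal_injective (by simpa using h)

lemma measureReal_univ (v : 𝓗) : (μ v).real Set.univ = ‖v‖ ^ 2 := by
  have h := norm_sq hμ 1 v
  simp only [map_one, ContinuousMap.one_apply, norm_one, one_pow] at h
  have h' := integral_const (μ := μ v) (1 : ℝ)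
  rw [smul_eq_mul, mul_one] at h'
  rw [← h', ← h]; rfl

/-- `A` is the spectral projection of the set `s`. -/
def IsSpectralProj (μ : 𝓗 → Measure Y) (s : Set Y) (A : 𝓗 →L[ℂ] 𝓗) : Prop :=
  ∀ v, inner ℂ v (A v) = (((μ v).real s : ℝ) : ℂ) ∧ ‖A v‖ ^ 2 = (μ v).real s

omit [CompleteSpace 𝓗] hμ in
lemma IsSpectralProj.unique {s : Set Y} {A B : 𝓗 →L[ℂ] 𝓗} (hA : IsSpectralProj μ s A)
    (hB : IsSpectralProj μ s B) : A = B :=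
  clm_ext_inner fun v => (hA v).1.trans (hB v).1.symm

omit hμ in
lemma IsSpectralProj.isStarProjection {s : Set Y} {A : 𝓗 →L[ℂ] 𝓗}
    (hA : IsSpectralProj μ s A) : IsStarProjection A :=
  isStarProjection_of_inner fun v => by rw [(hA v).1, (hA v).2]

lemma IsSpectralProj.of_isStarProjection {s : Set Y} {A : 𝓗 →L[ℂ] 𝓗}
    (hA : IsStarProjection A) (h : ∀ v, inner ℂ v (A v) = (((μ v).real s : ℝ) : ℂ)) :
    IsSpectralProj μ s A := by
  refine fun v => ⟨h v, ?_⟩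
  have h1 : adjoint A = A := hA.isSelfAdjoint
  have h2 : inner ℂ (A v) (A v) = inner ℂ v (A v) := by
    nth_rw 1 [← h1]
    rw [adjoint_inner_left, ← mul_apply_eq_comp, hA.isIdempotentElem]
  rw [h v, inner_self_eq_norm_sq_to_K] at h2
  exact ofReal_injective (by simpa using h2)

lemma exists_isClosed {s : Set Y} (hs : IsClosed s) : ∃ A, IsSpectralProj μ s A := by
  have hδ : ∀ n : ℕ, (0 : ℝ) < 1 / (n + 1) := fun n => by positivity
  have hδ0 : Tendsto (fun n : ℕ => 1 / ((n : ℝ) + 1)) atTop (𝓝 0) :=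
    tendsto_one_div_add_atTop_nhds_zero_nat
  let f : ℕ → C(Y, ℂ) := fun n =>
    ⟨fun y => ((thickenedIndicator (hδ n) s y : ℝ) : ℂ), by fun_prop⟩
  have hf1 : ∀ n y, ‖f n y‖ ≤ 1 := by
    intro n y
    simp only [f, ContinuousMap.coe_mk, norm_real, NNReal.norm_eq]
    exact_mod_cast thickenedIndicator_le_one (hδ n) s y
  have hft : ∀ y, Tendsto (fun n => f n y) atTop (𝓝 (s.indicator (fun _ => (1 : ℂ)) y)) := by
    intro y
    have h := (tendsto_pi_nhds.mp (thickenedIndicator_tendsto_indicator_closure hδ hδ0 s)) y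
    rw [hs.closure_eq] at h
    have h2 := ((Complex.continuous_ofReal.comp NNReal.continuous_coe).tendsto _).comp h
    have e : (s.indicator (fun _ => (1 : ℂ)) y) =
      (Complex.ofReal ∘ NNReal.toReal) (s.indicator (fun _ => (1 : NNReal)) y) := by
      by_cases hy : y ∈ s <;> simp [hy]
    rw [e]
    exact h2
  have hcau : ∀ v, CauchySeq fun n => Φ (f n) v := by
    intro v
    have := (hμ v).1
    rw [cauchySeq_iff_tendsto_dist_atTop_0]
    have h1 : Tendsto (fun q : ℕ × ℕ => ∫ p, ‖(f q.1 - f q.2) p‖ ^ 2 ∂(μ v)) atTop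
        (𝓝 (∫ p, ‖s.indicator (fun _ => (1 : ℂ)) p - s.indicator (fun _ => (1 : ℂ)) p‖ ^ 2 ∂(μ v))) := by
      refine tendsto_integral_filter_of_dominated_convergence (fun _ => (1 + 1) ^ 2)
        (.of_forall fun q =>
          (((f q.1 - f q.2).continuous.norm.pow 2).measurable).aestronglyMeasurable)
        (.of_forall fun q => Eventually.of_forall fun p => ?_) (integrable_const _)
        (.of_forall fun p => ?_)
      · rw [norm_pow, norm_norm]
        refine pow_le_pow_left₀ (norm_nonneg _) ?_ 2
        exact (norm_sub_le _ _).trans (add_le_add (hf1 _ p) (hf1 _ p))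
      · simp only [ContinuousMap.sub_apply]
        rw [← prod_atTop_atTop_eq]
        exact ((((hft p).comp tendsto_fst).sub ((hft p).comp tendsto_snd)).norm).pow 2
    simp only [sub_self, norm_zero, ne_eq, OfNat.ofNat_ne_zero, not_false_eq_true, zero_pow,
      integral_zero] at h1
    have h2 := (Real.continuous_sqrt.tendsto 0).comp h1
    rw [Real.sqrt_zero] at h2
    refine h2.congr fun q => ?_
    simp only [comp_apply]
    rw [← norm_sq hμ, Real.sqrt_sq (norm_nonneg _), dist_eq_norm, map_sub]
    rfl
  choose l hl using fun v => cauchySeq_tendsto_of_complete (hcau v)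
  refine ⟨continuousLinearMapOfTendsto (fun n => Φ (f n)) (tendsto_pi_nhds.mpr hl), fun v => ⟨?_, ?_⟩⟩
  · have := (hμ v).1
    refine tendsto_nhds_unique (f := fun n => inner ℂ v (Φ (f n) v)) (l := atTop)
      ((continuous_const.inner continuous_id).tendsto _ |>.comp (hl v)) ?_
    simp only [fun n => ((hμ v).2 (f n)).2]
    have : (((μ v).real s : ℝ) : ℂ) = ∫ y, s.indicator (fun _ => (1 : ℂ)) y ∂(μ v) := by
      rw [integral_indicator hs.measurableSet]; simp
    rw [this]
    exact tendsto_integral_of_dominated_convergence (fun _ => 1)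
      (fun n => (f n).continuous.measurable.aestronglyMeasurable) (integrable_const _)
      (fun n => Eventually.of_forall (hf1 n)) (.of_forall hft)
  · have := (hμ v).1
    refine tendsto_nhds_unique (f := fun n => ‖Φ (f n) v‖ ^ 2) (l := atTop) ((hl v).norm.pow 2) ?_
    simp only [fun n => norm_sq hμ (f n) v]
    have : (μ v).real s = ∫ y, ‖s.indicator (fun _ => (1 : ℂ)) y‖ ^ 2 ∂(μ v) := by
      have e : ∀ y, ‖s.indicator (fun _ => (1 : ℂ)) y‖ ^ 2 = s.indicator (fun _ => (1 : ℝ)) y := by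
        intro y
        by_cases hy : y ∈ s <;> simp [hy]
      simp only [e]
      rw [integral_indicator hs.measurableSet]; simp
    rw [this]
    refine tendsto_integral_of_dominated_convergence (fun _ => 1 ^ 2)
      (fun n => ((f n).continuous.norm.pow 2).measurable.aestronglyMeasurable)
      (integrable_const _) (fun n => Eventually.of_forall fun y => ?_)
      (.of_forall fun y => (hft y).norm.pow 2)
    rw [norm_pow, norm_norm]
    exact pow_le_pow_left₀ (norm_nonneg _) (hf1 n y) 2

lemma mul_eq_zero_of_disjoint {s t : Set Y} (ht : MeasurableSet t)
    (hd : Disjoint s t) {A B : 𝓗 →L[ℂ] 𝓗} (hA : IsSpectralProj μ s A)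
    (hB : IsSpectralProj μ t B) : A * B = 0 := by
  ext v
  rw [mul_apply_eq_comp]
  have := (hμ (B v)).1
  have h1 : B (B v) = B v := by
    have := congrArg (fun T : 𝓗 →L[ℂ] 𝓗 => T v) hB.isStarProjection.isIdempotentElem
    simpa using this
  have h2 := (hB (B v)).2
  rw [h1] at h2
  have h3 := (hA (B v)).2
  have h4 := measureReal_univ hμ (B v)
  have h5 : (μ (B v)).real s + (μ (B v)).real t ≤ (μ (B v)).real Set.univ := by
    rw [← measureReal_union hd ht]
    exact measureReal_mono (Set.subset_univ _)
  have h6 : ‖A (B v)‖ ^ 2 ≤ 0 := by linarith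
  simpa using h6

lemma exists_iUnion {s : ℕ → Set Y} (hs : ∀ n, MeasurableSet (s n))
    (hd : Pairwise (Function.onFun Disjoint s)) {A : ℕ → 𝓗 →L[ℂ] 𝓗}
    (hA : ∀ n, IsSpectralProj μ (s n) (A n)) :
    ∃ B, IsSpectralProj μ (⋃ n, s n) B ∧ ∀ v, HasSum (fun n => A n v) (B v) := by
  have hm : ∀ v, HasSum (fun n => (μ v).real (s n)) ((μ v).real (⋃ n, s n)) := by
    intro v
    have := (hμ v).1
    have h := measure_iUnion (μ := μ v) hd hs
    rw [Measure.real, h, ENNReal.tsum_toReal_eq (fun n => measure_ne_top _ _)]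
    exact (ENNReal.hasSum_toReal (by rw [← h]; exact measure_ne_top _ _))
  let V : ℕ → Submodule ℂ 𝓗 := fun n => LinearMap.range (A n : 𝓗 →ₗ[ℂ] 𝓗)
  have hV : OrthogonalFamily ℂ (fun n => V n) fun n => (V n).subtypeₗᵢ := by
    rintro n m hnm ⟨_, v, rfl⟩ ⟨_, w, rfl⟩
    simp only [Submodule.coe_subtypeₗᵢ, Submodule.subtype_apply, ContinuousLinearMap.coe_coe]
    have h1 : adjoint (A n) = A n := (hA n).isStarProjection.isSelfAdjoint
    rw [← h1, adjoint_inner_left, ← mul_apply_eq_comp,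
      mul_eq_zero_of_disjoint hμ (hs m) (hd hnm) (hA n) (hA m)]
    simp
  have hsum : ∀ v, Summable fun n => A n v := by
    intro v
    have := (hV.summable_iff_norm_sq_summable (fun n => ⟨A n v, v, rfl⟩)).mpr (by
      simp only [Submodule.coe_norm, fun n => (hA n v).2]
      exact (hm v).summable)
    exact this
  have hT : Tendsto (fun n x => (∑ i ∈ range n, A i) x) atTop (𝓝 fun v => ∑' n, A n v) := by
    rw [tendsto_pi_nhds]
    intro v
    have := (hsum v).hasSum.tendsto_sum_nat
    simpa [_root_.sum_apply] using this
  refine ⟨continuousLinearMapOfTendsto _ hT, ?_, fun v => (hsum v).hasSum⟩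
  have hB : ∀ v, continuousLinearMapOfTendsto _ hT v = ∑' n, A n v := fun v => rfl
  intro v
  constructor
  · rw [hB]
    refine (((hsum v).hasSum.mapL (innerSL ℂ v)).unique ?_)
    simp only [innerSL_apply_apply, fun n => (hA n v).1]
    exact Complex.hasSum_ofReal.mpr (hm v)
  · rw [hB]
    refine tendsto_nhds_unique (f := fun n => ‖∑ i ∈ range n, A i v‖ ^ 2) (l := atTop)
      ((hsum v).hasSum.tendsto_sum_nat.norm.pow 2) ?_
    have e : ∀ n, ‖∑ i ∈ range n, A i v‖ ^ 2 = ∑ i ∈ range n, (μ v).real (s i) := by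
      intro n
      have := hV.norm_sum (fun n => ⟨A n v, v, rfl⟩) (range n)
      simp only [Submodule.coe_subtypeₗᵢ, Submodule.subtype_apply, Submodule.coe_norm] at this
      rw [this]
      exact sum_congr rfl fun i _ => (hA i v).2
    simp only [e]
    exact (hm v).tendsto_sum_nat

lemma exists_isSpectralProj {s : Set Y} (hs : MeasurableSet s) : ∃ A, IsSpectralProj μ s A := by
  induction s, hs using MeasurableSpace.induction_on_inter
    ((BorelSpace.measurable_eq (α := Y)).trans borel_eq_generateFrom_isClosed) isPiSystem_isClosed with
  | empty => exact ⟨0, fun v => by simp⟩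
  | basic t ht => exact exists_isClosed hμ ht
  | compl t ht ih =>
    obtain ⟨A, hA⟩ := ih
    have hp := hA.isStarProjection
    refine ⟨1 - A, IsSpectralProj.of_isStarProjection hμ hp.one_sub fun v => ?_⟩
    have := (hμ v).1
    rw [_root_.sub_apply, inner_sub_right, (hA v).1, measureReal_compl ht,
      measureReal_univ hμ, one_apply_eq_self, inner_self_eq_norm_sq_to_K]
    push_cast
    rfl
  | iUnion f hd hfm ih =>
    choose A hA using ih
    obtain ⟨B, hB, _⟩ := exists_iUnion hμ hfm hd hA
    exact ⟨B, hB⟩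

lemma exists_projMeasure : ∃ Q : ProjMeasure Y 𝓗, ∀ v, Q.measure v = μ v := by
  classical
  choose A hA using fun (s : Set Y) (hs : MeasurableSet s) => exists_isSpectralProj hμ hs
  let p : Set Y → 𝓗 →L[ℂ] 𝓗 := fun s => if hs : MeasurableSet s then A s hs else 0
  have hp : ∀ s, MeasurableSet s → IsSpectralProj μ s (p s) := by grind
  have hadd : ∀ s t, MeasurableSet s → MeasurableSet t → Disjoint s t → p (s ∪ t) = p s + p t := by
    intro s t hs ht hd
    refine clm_ext_inner fun v => ?_
    have := (hμ v).1
    rw [_root_.add_apply, inner_add_right, (hp _ (hs.union ht) v).1, (hp s hs v).1, (hp t ht v).1,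
      measureReal_union hd ht]
    push_cast; rfl
  have hort : ∀ s t, MeasurableSet s → MeasurableSet t → Disjoint s t → p s * p t = 0 :=
    fun s t hs ht hd => mul_eq_zero_of_disjoint hμ ht hd (hp s hs) (hp t ht)
  refine ⟨⟨p, fun s hs => (hp s hs).isStarProjection, ?_, ?_, ?_⟩, fun v => ?_⟩
  · refine clm_ext_inner fun v => ?_
    rw [(hp _ MeasurableSet.univ v).1, measureReal_univ hμ, one_apply_eq_self,
      inner_self_eq_norm_sq_to_K]
    push_cast; rfl
  · intro s t hs ht
    have h1 := hadd (s ∩ t) (s \ t) (hs.inter ht) (hs.diff ht)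
      (Set.disjoint_sdiff_right.mono_left Set.inter_subset_right)
    have h2 := hadd (s ∩ t) (t \ s) (hs.inter ht) (ht.diff hs)
      (Set.disjoint_sdiff_right.mono_left Set.inter_subset_left)
    rw [Set.inter_union_sdiff] at h1
    rw [Set.inter_comm s t, Set.inter_union_sdiff, Set.inter_comm t s] at h2
    rw [h1, h2, mul_add, add_mul, add_mul, (hp _ (hs.inter ht)).isStarProjection.isIdempotentElem,
      hort _ _ (hs.diff ht) (hs.inter ht) (Set.disjoint_sdiff_left.mono_right Set.inter_subset_right),
      hort _ _ (hs.inter ht) (ht.diff hs) (Set.disjoint_sdiff_right.mono_left Set.inter_subset_left),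
      hort _ _ (hs.diff ht) (ht.diff hs) (Set.disjoint_sdiff_left.mono_right Set.sdiff_subset)]
    simp
  · intro s hs hd v
    obtain ⟨B, hB, hB'⟩ := exists_iUnion hμ hs hd (fun n => hp (s n) (hs n))
    rw [(hp _ (MeasurableSet.iUnion hs)).unique hB]
    exact hB' v
  · have := (hμ v).1
    refine Measure.ext fun s hs => ?_
    rw [ProjMeasure.measure_apply _ hs]
    change ENNReal.ofReal (‖p s v‖ ^ 2) = _
    rw [(hp s hs v).2, ofReal_measureReal]

end Represents

lemma exists_projMeasure_of_commute {ι : Type*} [Fintype ι] (C : ι → 𝓗 →L[ℂ] 𝓗)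
    (h1 : ∀ i j, C i * C j = C j * C i) (h2 : ∀ i j, C i * star (C j) = star (C j) * C i) :
    ∃ (Φ : C(ι → ℂ, ℂ) →⋆ₐ[ℂ] (𝓗 →L[ℂ] 𝓗)) (Q : ProjMeasure (ι → ℂ) 𝓗),
      (∀ i, Φ ⟨fun y => y i, by fun_prop⟩ = C i) ∧ Represents Φ Q.measure := by
  obtain ⟨X, _, _, _, e, Ψ, he⟩ := exists_gelfand C h1 h2
  obtain ⟨μ, hμ⟩ := exists_represents Ψ e
  obtain ⟨Q, hQ⟩ := hμ.exists_projMeasure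
  exact ⟨Ψ.comp (ContinuousMap.compStarAlgHom' ℂ ℂ e), Q, he, by rwa [funext hQ]⟩

end SpectralTheorem

/-! ### Joint resolutions of commuting self-adjoint operators -/

namespace ProjMeasure

variable {Ω Ω' : Type*} [MeasurableSpace Ω] [MeasurableSpace Ω'] {𝓗 : Type*}
  [NormedAddCommGroup 𝓗] [InnerProductSpace ℂ 𝓗] [CompleteSpace 𝓗] (P : ProjMeasure Ω 𝓗)

/-- The push-forward of a projection-valued measure. -/
def map {f : Ω → Ω'} (hf : Measurable f) : ProjMeasure Ω' 𝓗 where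
  proj s := P.proj (f ⁻¹' s)
  isStarProjection s hs := P.isStarProjection _ (hf hs)
  proj_univ := P.proj_univ
  proj_inter s t hs ht := P.proj_inter _ _ (hf hs) (hf ht)
  hasSum_iUnion s hs hd v := by
    rw [Set.preimage_iUnion]
    exact P.hasSum_iUnion _ (fun n => hf (hs n)) (fun i j hij => (hd hij).preimage f) v

lemma measure_map {f : Ω → Ω'} (hf : Measurable f) (v : 𝓗) :
    (P.map hf).measure v = (P.measure v).map f := by
  refine Measure.ext fun s hs => ?_
  rw [Measure.map_apply hf hs, measure_apply _ hs, measure_apply _ (hf hs)]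
  rfl

lemma IsIntegralGraph.map {f : Ω → Ω'} (hf : Measurable f) {φ : Ω' → ℝ} (hφ : Measurable φ)
    {Γ : Set (𝓗 × 𝓗)} (h : P.IsIntegralGraph (fun p => φ (f p)) Γ) :
    (P.map hf).IsIntegralGraph φ Γ := by
  constructor
  · intro v
    rw [h.1, P.measure_map hf,
      integrable_map_measure (hφ.pow_const 2).aestronglyMeasurable hf.aemeasurable]
    rfl
  · intro v w hvw
    rw [h.2 v w hvw, P.measure_map hf, integral_map hf.aemeasurable hφ.aestronglyMeasurable]

lemma integral_measure_fc {F : Ω → ℂ} (hF : IsBdd F) (g : Ω → ℝ) (v : 𝓗) :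
    ∫ p, g p ∂(P.measure (P.fc F v)) = ∫ p, ‖F p‖ ^ 2 * g p ∂(P.measure v) := by
  rw [P.measure_fc hF, integral_withDensity_eq_integral_toReal_smul
    (hF.1.norm.pow_const 2).ennreal_ofReal (.of_forall fun _ => ENNReal.ofReal_lt_top)]
  refine integral_ext fun p => ?_
  simp only [smul_eq_mul]
  rw [ENNReal.toReal_ofReal (by positivity)]

lemma integrable_measure_fc {F : Ω → ℂ} (hF : IsBdd F) (g : Ω → ℝ) (v : 𝓗) :
    Integrable g (P.measure (P.fc F v)) ↔ Integrable (fun p => ‖F p‖ ^ 2 * g p) (P.measure v) := by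
  rw [P.measure_fc hF, integrable_withDensity_iff_integrable_smul'
    (hF.1.norm.pow_const 2).ennreal_ofReal (.of_forall fun _ => ENNReal.ofReal_lt_top)]
  refine integrable_congr (.of_forall fun p => ?_)
  simp only [smul_eq_mul]
  rw [ENNReal.toReal_ofReal (by positivity)]

lemma norm_sq_inv_of_im {c : ℂ} (h0 : c ≠ 0) (h : c.im = -normSq c) :
    ‖c⁻¹‖ ^ 2 = (c⁻¹).re ^ 2 + 1 := by
  have hn : normSq c ≠ 0 := by simpa using h0
  have : (c⁻¹).im = 1 := by rw [Complex.inv_im, h]; field_simp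
  rw [← normSq_eq_norm_sq, Complex.normSq_apply, this]
  ring

lemma norm_le_one_of_im {c : ℂ} (h : c.im = -normSq c) : ‖c‖ ≤ 1 := by
  have h1 := Complex.abs_im_le_norm c
  rw [h, abs_neg, normSq_eq_norm_sq, abs_of_nonneg (by positivity)] at h1
  nlinarith [norm_nonneg c]

section Resolvent

variable {F : Ω → ℂ} (hm : Measurable F) (h0 : ∀ p, F p ≠ 0) (him : ∀ p, (F p).im = -normSq (F p))
include hm h0 him

lemma exists_fc_eq {v : 𝓗} (h : Integrable (fun p => ((F p)⁻¹).re ^ 2) (P.measure v)) :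
    ∃ w, P.fc F w = v := by
  have hF1 : ∀ p, ‖F p‖ ≤ 1 := fun p => norm_le_one_of_im (him p)
  have hF : IsBdd F := ⟨hm, 1, hF1⟩
  let q : ℕ → Ω → ℂ := fun n p => conj (F p) * ((‖F p‖ ^ 2 + 1 / ((n : ℝ) + 1) : ℝ) : ℂ)⁻¹
  have hpos : ∀ (n : ℕ) p, 0 < ‖F p‖ ^ 2 + 1 / ((n : ℝ) + 1) := fun n p => by positivity
  have hqm : ∀ n, Measurable (q n) := fun n =>
    (Complex.continuous_conj.measurable.comp hm).mul
      (Complex.measurable_ofReal.comp ((hm.norm.pow_const 2).add_const _)).inv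
  have hFq : ∀ n p, F p * q n p = ((‖F p‖ ^ 2 / (‖F p‖ ^ 2 + 1 / ((n : ℝ) + 1)) : ℝ) : ℂ) := by
    intro n p
    simp only [q]
    rw [← mul_assoc, Complex.mul_conj, normSq_eq_norm_sq]
    push_cast
    rfl
  have hFq1 : ∀ n p, ‖F p * q n p‖ ≤ 1 := by
    intro n p
    rw [hFq, norm_real, norm_eq_abs, abs_of_nonneg (by positivity), div_le_one (hpos n p)]
    have : 0 ≤ 1 / ((n : ℝ) + 1) := by positivity
    linarith
  have hqle : ∀ n p, ‖q n p‖ ≤ ‖(F p)⁻¹‖ := by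
    intro n p
    have h1 := hFq1 n p
    rw [norm_mul] at h1
    rw [norm_inv, ← one_div, le_div_iff₀' (norm_pos_iff.mpr (h0 p))]
    exact h1
  have hqb : ∀ n, IsBdd (q n) := by
    refine fun n => ⟨hqm n, 1 * (1 / ((n : ℝ) + 1))⁻¹, fun p => ?_⟩
    simp only [q]
    rw [norm_mul, RCLike.norm_conj, norm_inv, norm_real, norm_eq_abs, abs_of_pos (hpos n p)]
    refine mul_le_mul (hF1 p) ?_ (by positivity) zero_le_one
    exact inv_anti₀ (by positivity) (by have := sq_nonneg ‖F p‖; linarith)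
  have hFqt : ∀ p, Tendsto (fun n => F p * q n p) atTop (𝓝 1) := by
    intro p
    simp only [hFq]
    have hp : ‖F p‖ ^ 2 ≠ 0 := by simpa using h0 p
    have h1 : Tendsto (fun n : ℕ => ‖F p‖ ^ 2 / (‖F p‖ ^ 2 + 1 / ((n : ℝ) + 1))) atTop
        (𝓝 (‖F p‖ ^ 2 / (‖F p‖ ^ 2 + 0))) :=
      tendsto_const_nhds.div (tendsto_const_nhds.add tendsto_one_div_add_atTop_nhds_zero_nat)
        (by simpa using h0 p)
    rw [add_zero, div_self hp] at h1
    exact_mod_cast (Complex.continuous_ofReal.tendsto _).comp h1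
  have hqt : ∀ p, Tendsto (fun n => q n p) atTop (𝓝 (F p)⁻¹) := by
    intro p
    have := (hFqt p).const_mul (F p)⁻¹
    simpa [← mul_assoc, inv_mul_cancel₀ (h0 p)] using this
  have hbound : Integrable (fun p => 4 * ‖(F p)⁻¹‖ ^ 2) (P.measure v) := by
    have := (h.add (integrable_const (1 : ℝ))).const_mul 4
    refine this.congr (.of_forall fun p => ?_)
    simp only [Pi.add_apply]
    rw [norm_sq_inv_of_im (h0 p) (him p)]
  have hcau : CauchySeq fun n => P.fc (q n) v := by
    rw [cauchySeq_iff_tendsto_dist_atTop_0]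
    have h1 : Tendsto (fun k : ℕ × ℕ => ∫ p, ‖q k.1 p - q k.2 p‖ ^ 2 ∂(P.measure v)) atTop
        (𝓝 (∫ p, ‖(F p)⁻¹ - (F p)⁻¹‖ ^ 2 ∂(P.measure v))) := by
      refine tendsto_integral_filter_of_dominated_convergence _ (.of_forall fun k =>
          (((hqm k.1).sub (hqm k.2)).norm.pow_const 2).aestronglyMeasurable)
        (.of_forall fun k => Eventually.of_forall fun p => ?_) hbound
        (.of_forall fun p => ?_)
      · rw [norm_pow, norm_norm]
        have := (norm_sub_le (q k.1 p) (q k.2 p)).trans (add_le_add (hqle _ p) (hqle _ p))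
        calc _ ≤ (‖(F p)⁻¹‖ + ‖(F p)⁻¹‖) ^ 2 := pow_le_pow_left₀ (norm_nonneg _) this 2
          _ = _ := by ring
      · rw [← prod_atTop_atTop_eq]
        exact ((((hqt p).comp tendsto_fst).sub ((hqt p).comp tendsto_snd)).norm).pow 2
    simp only [sub_self, norm_zero, ne_eq, OfNat.ofNat_ne_zero, not_false_eq_true, zero_pow,
      integral_zero] at h1
    have h2 := (Real.continuous_sqrt.tendsto 0).comp h1
    rw [Real.sqrt_zero] at h2
    refine h2.congr fun k => ?_
    simp only [comp_apply]
    rw [← P.norm_fc_sq ((hqb k.1).sub (hqb k.2)), Real.sqrt_sq (norm_nonneg _), dist_eq_norm,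
      P.fc_sub (hqb _) (hqb _)]
    rfl
  obtain ⟨w, hw⟩ := cauchySeq_tendsto_of_complete hcau
  refine ⟨w, tendsto_nhds_unique (((P.fc F).continuous.tendsto w).comp hw) ?_⟩
  have h3 := P.tendsto_fc (F := fun n p => F p * q n p) (G := fun _ => 1) (C := 1)
    (fun n => hm.mul (hqm n)) measurable_const hFq1 (by simp) hFqt v
  have h4 : P.fc (fun _ => (1 : ℂ)) = 1 := by
    have := P.fc_indicator MeasurableSet.univ
    rwa [Set.indicator_univ, P.proj_univ] at this
  rw [h4] at h3
  refine h3.congr fun n => ?_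
  rw [P.fc_mul hF (hqb n)]
  rfl

lemma isIntegralGraph_of_resolvent {Γ : Set (𝓗 × 𝓗)}
    (hΓ : ∀ v w, (v, w) ∈ Γ ↔ v = P.fc F (w + I • v)) :
    P.IsIntegralGraph (fun p => ((F p)⁻¹).re) Γ := by
  have hF1 : ∀ p, ‖F p‖ ≤ 1 := fun p => norm_le_one_of_im (him p)
  have hF : IsBdd F := ⟨hm, 1, hF1⟩
  have hre : ∀ p, ‖F p‖ ^ 2 * ((F p)⁻¹).re = (F p).re := by
    intro p
    have hn : normSq (F p) ≠ 0 := by simpa using h0 p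
    rw [Complex.inv_re, ← normSq_eq_norm_sq]
    field_simp
  constructor
  · intro v
    constructor
    · rintro ⟨w, hw⟩
      rw [(hΓ v w).mp hw, P.integrable_measure_fc hF]
      refine Integrable.of_bound (C := 1) ((hm.norm.pow_const 2).mul
        ((Complex.measurable_re.comp hm.inv).pow_const 2)).aestronglyMeasurable
        (.of_forall fun p => ?_)
      have h1 := norm_sq_inv_of_im (h0 p) (him p)
      have h2 : ‖F p‖ ^ 2 * ‖(F p)⁻¹‖ ^ 2 = 1 := by
        rw [← mul_pow, ← norm_mul, mul_inv_cancel₀ (h0 p)]; simp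
      rw [h1] at h2
      rw [norm_eq_abs, abs_of_nonneg (by positivity)]
      nlinarith [sq_nonneg ‖F p‖]
    · intro h
      obtain ⟨w, hw⟩ := P.exists_fc_eq hm h0 him h
      exact ⟨w - I • v, (hΓ _ _).mpr (by simp [hw])⟩
  · intro v w hvw
    have hv := (hΓ v w).mp hvw
    set u := w + I • v with hu
    have hw : w = u - I • v := by simp [hu]
    rw [hw, hv, P.integral_measure_fc hF]
    have h1 : inner ℂ (P.fc F u) (u - I • P.fc F u) =
        inner ℂ (P.fc F u) (P.fc (fun p => 1 - I * F p) u) := by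
      have h4 : P.fc (fun _ => (1 : ℂ)) = 1 := by
        have := P.fc_indicator MeasurableSet.univ
        rwa [Set.indicator_univ, P.proj_univ] at this
      rw [P.fc_sub (isBdd_const 1) (hF.const_mul _), P.fc_const_mul hF, h4]
      rfl
    rw [h1, P.inner_fc_fc hF ((isBdd_const 1).sub (hF.const_mul _)), ← integral_complex_ofReal]
    refine integral_ext fun p => ?_
    simp only [hre]
    have : conj (F p) * (1 - I * F p) = conj (F p) - I * (conj (F p) * F p) := by ring
    rw [this, ← Complex.normSq_eq_conj_mul_self]
    apply Complex.ext
    · simp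
    · simp [him p]

end Resolvent

end ProjMeasure

section Joint

variable {𝓗 : Type*} [NormedAddCommGroup 𝓗] [InnerProductSpace ℂ 𝓗] [CompleteSpace 𝓗]

open Classical in
/-- A retraction of `ℂ` onto the set of values of `t ↦ (t + i)⁻¹`. -/
def resolventValue (c : ℂ) : ℂ := if c ≠ 0 ∧ c.im = -normSq c then c else -I

lemma resolventValue_spec (c : ℂ) :
    resolventValue c ≠ 0 ∧ (resolventValue c).im = -normSq (resolventValue c) := by
  unfold resolventValue
  split_ifs with h
  · exact h
  · simp

lemma measurable_resolventValue : Measurable resolventValue := by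
  refine Measurable.ite ?_ measurable_id measurable_const
  exact (measurableSet_singleton 0).compl.inter
    (measurableSet_eq_fun Complex.measurable_im Complex.continuous_normSq.measurable.neg)

lemma exists_isIntegralGraph {ι : Type*} [Fintype ι] (Γ : ι → Set (𝓗 × 𝓗))
    (C : ι → 𝓗 →L[ℂ] 𝓗) (hΓ : ∀ i v w, (v, w) ∈ Γ i ↔ v = C i (w + I • v))
    (hinj : ∀ i v, C i v = 0 → v = 0)
    (hadj : ∀ i, star (C i) - C i = (2 * I) • (star (C i) * C i))
    (h1 : ∀ i j, C i * C j = C j * C i) (h2 : ∀ i j, C i * star (C j) = star (C j) * C i) :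
    ∃ P : ProjMeasure (ι → ℝ) 𝓗, ∀ i, P.IsIntegralGraph (fun p => p i) (Γ i) := by
  obtain ⟨Φ, Q, hΦ, hQ⟩ := exists_projMeasure_of_commute C h1 h2
  let co : ι → C(ι → ℂ, ℂ) := fun i => ⟨fun y => y i, by fun_prop⟩
  have hco : ∀ i, Φ (co i) = C i := hΦ
  have him : ∀ i v, ∀ᵐ y ∂(Q.measure v), (y i).im = -normSq (y i) := by
    intro i v
    have e : Φ (star (co i) - co i - (2 * I) • (star (co i) * co i)) = 0 := by
      rw [map_sub, map_sub, map_smul, map_mul, map_star, hco, hadj, sub_self]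
    have h3 := hQ.norm_sq (star (co i) - co i - (2 * I) • (star (co i) * co i)) v
    rw [e, _root_.zero_apply, norm_zero, zero_pow two_ne_zero, eq_comm,
      integral_eq_zero_iff_of_nonneg (fun y => by positivity)] at h3
    · filter_upwards [h3] with y hy
      have hy' : conj (y i) - y i - 2 * I * (conj (y i) * y i) = 0 := by
        simpa [co] using hy
      rw [← Complex.normSq_eq_conj_mul_self] at hy'
      have := congrArg Complex.im hy'
      simp at this
      linarith
    · have h4 := ((hQ v).2 (star (star (co i) - co i - (2 * I) • (star (co i) * co i)) *
        (star (co i) - co i - (2 * I) • (star (co i) * co i)))).1.norm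
      refine h4.congr (.of_forall fun y => ?_)
      simp only [ContinuousMap.mul_apply, ContinuousMap.star_apply, norm_mul, norm_star, sq]
  have hC : ∀ i v, ‖C i v‖ ^ 2 = ∫ y, ‖y i‖ ^ 2 ∂(Q.measure v) := by
    intro i v
    rw [← hco]
    exact hQ.norm_sq (co i) v
  have hne : ∀ i v, ∀ᵐ y ∂(Q.measure v), y i ≠ 0 := by
    intro i v
    have hms : MeasurableSet {y : ι → ℂ | y i = 0} :=
      measurableSet_eq_fun (measurable_pi_apply i) measurable_const
    have hp : Q.proj {y : ι → ℂ | y i = 0} v = 0 := by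
      refine hinj i _ ?_
      have h3 := hC i (Q.proj {y : ι → ℂ | y i = 0} v)
      rw [← Q.fc_indicator hms, Q.integral_measure_fc (ProjMeasure.isBdd_indicator hms)] at h3
      rw [← Q.fc_indicator hms]
      have h4 : ∀ y : ι → ℂ, ‖({y : ι → ℂ | y i = 0}.indicator (fun _ => (1 : ℂ))) y‖ ^ 2 *
          ‖y i‖ ^ 2 = 0 := by simp; grind
      simp only [h4, integral_zero] at h3
      simpa using h3
    rw [ae_iff]
    have e : {y : ι → ℂ | ¬ y i ≠ 0} = {y | y i = 0} := by ext; simp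
    rw [e, Q.measure_apply hms, hp]
    simp
  let F : ι → (ι → ℂ) → ℂ := fun i y => resolventValue (y i)
  have hFm : ∀ i, Measurable (F i) := fun i => measurable_resolventValue.comp (measurable_pi_apply i)
  have hFae : ∀ i v, ∀ᵐ y ∂(Q.measure v), y i = F i y := by
    intro i v
    filter_upwards [him i v, hne i v] with y hy hy'
    simp only [F, resolventValue]
    rw [if_pos ⟨hy', hy⟩]
  have hF1 : ∀ i y, ‖F i y‖ ≤ 1 := fun i y =>
    ProjMeasure.norm_le_one_of_im (resolventValue_spec (y i)).2
  have hCF : ∀ i, C i = Q.fc (F i) := by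
    intro i
    refine clm_ext_inner fun v => ?_
    rw [Q.inner_fc_self ⟨hFm i, 1, hF1 i⟩, ← hco, ((hQ v).2 (co i)).2]
    exact integral_congr_ae (hFae i v)
  have hTm : Measurable fun (y : ι → ℂ) (i : ι) => ((F i y)⁻¹).re :=
    measurable_pi_lambda _ fun i => Complex.measurable_re.comp (hFm i).inv
  refine ⟨Q.map hTm, fun i => ?_⟩
  refine ProjMeasure.IsIntegralGraph.map Q hTm (measurable_pi_apply i) ?_
  exact Q.isIntegralGraph_of_resolvent (hFm i) (fun y => (resolventValue_spec (y i)).1)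
    (fun y => (resolventValue_spec (y i)).2) (fun v w => by rw [hΓ i v w, hCF])

end Joint

/-! ### The group, its Haar measure and its left-invariant fields -/

section GroupLaw

variable {d₁ d₂ : ℕ} (β : 𝔅)

lemma contDiff_bilin : ContDiff ℝ ∞ fun p : Eu d₁ × Eu d₁ => β p.1 p.2 :=
  (β.toContinuousBilinearMap.isBoundedBilinearMap).contDiff

lemma ContDiff.bilin {E : Type*} [NormedAddCommGroup E] [NormedSpace ℝ E] {f g : E → Eu d₁}
    {n : ℕ∞} (hf : ContDiff ℝ n f) (hg : ContDiff ℝ n g) : ContDiff ℝ n fun x => β (f x) (g x) :=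
  ((contDiff_bilin β).of_le (by exact_mod_cast le_top)).comp (hf.prodMk hg)

lemma Continuous.bilin {E : Type*} [TopologicalSpace E] {f g : E → Eu d₁}
    (hf : Continuous f) (hg : Continuous g) : Continuous fun x => β (f x) (g x) :=
  (contDiff_bilin β).continuous.comp (hf.prodMk hg)

lemma ContDiff.mul {E : Type*} [NormedAddCommGroup E] [NormedSpace ℝ E] {f g : E → 𝔾}
    {n : ℕ∞} (hf : ContDiff ℝ n f) (hg : ContDiff ℝ n g) :
    ContDiff ℝ n fun x => mul β (f x) (g x) := by
  unfold TwoStep.mul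
  exact (hf.fst.add hg.fst).prodMk ((hf.snd.add hg.snd).add
    ((ContDiff.bilin β hf.fst hg.fst).const_smul _))

lemma Continuous.mul {E : Type*} [TopologicalSpace E] {f g : E → 𝔾}
    (hf : Continuous f) (hg : Continuous g) :
    Continuous fun x => mul β (f x) (g x) := by
  unfold TwoStep.mul
  have h := (Continuous.bilin β hf.fst hg.fst).const_smul (1 / 2 : ℝ)
  exact (hf.fst.add hg.fst).prodMk ((hf.snd.add hg.snd).add h)

lemma mul_assoc' (p q s : 𝔾) : mul β (mul β p q) s = mul β p (mul β q s) := by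
  simp only [mul, map_add, LinearMap.add_apply, smul_add]
  ext1 <;> simp only <;> abel

lemma zero_mul' (p : 𝔾) : mul β 0 p = p := by simp [mul]

lemma mul_zero' (p : 𝔾) : mul β p 0 = p := by simp [mul]

lemma mul_smul_eq (g v : 𝔾) (t : ℝ) :
    mul β g (t • v) = g + t • (v.1, v.2 + (1 / 2 : ℝ) • β g.1 v.1) := by
  ext1
  · simp [mul]
  · simp [mul, smul_comm t (2⁻¹ : ℝ), add_assoc]

lemma mul_central (g : 𝔾) (a : Eu d₂) : mul β g (0, a) = g + (0, a) := by
  ext1 <;> simp [mul]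

variable (halt : Alt β)
include halt

lemma bilin_antisymm (x y : Eu d₁) : β x y = -β y x := by
  have h := halt (x + y)
  simp only [map_add, LinearMap.add_apply, halt, zero_add, add_zero] at h
  exact eq_neg_of_add_eq_zero_right h

lemma mul_neg_self (p : 𝔾) : mul β p (-p) = 0 := by
  ext1 <;> simp [mul, halt]

lemma neg_mul_self (p : 𝔾) : mul β (-p) p = 0 := by
  ext1 <;> simp [mul, halt]

lemma neg_mul_cancel_left (p q : 𝔾) : mul β (-p) (mul β p q) = q := by
  rw [← mul_assoc', neg_mul_self β halt, zero_mul']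

lemma mul_neg_cancel_left (p q : 𝔾) : mul β p (mul β (-p) q) = q := by
  rw [← mul_assoc', mul_neg_self β halt, zero_mul']

lemma mul_neg_cancel_right (p q : 𝔾) : mul β (mul β p q) (-q) = p := by
  rw [mul_assoc', mul_neg_self β halt, mul_zero']

lemma neg_mul_cancel_right (p q : 𝔾) : mul β (mul β p (-q)) q = p := by
  rw [mul_assoc', neg_mul_self β halt, mul_zero']

lemma neg_mul_rev (p q : 𝔾) : -(mul β p q) = mul β (-q) (-p) := by
  ext1
  · simp [mul, add_comm]
  · simp only [mul, Prod.snd_neg, Prod.fst_neg, map_neg, LinearMap.neg_apply, neg_neg,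
      bilin_antisymm β halt q.1 p.1]
    rw [smul_neg]
    abel

lemma mul_add_smul (g v : 𝔾) (s t : ℝ) :
    mul β g ((s + t) • v) = mul β (mul β g (s • v)) (t • v) := by
  rw [mul_assoc']
  congr 1
  ext1 <;> simp [mul, add_smul, halt]

/-- Left translation. -/
def leftMul (a : 𝔾) : 𝔾 ≃ₜ 𝔾 where
  toFun g := mul β a g
  invFun g := mul β (-a) g
  left_inv g := neg_mul_cancel_left β halt a g
  right_inv g := mul_neg_cancel_left β halt a g
  continuous_toFun := Continuous.mul β continuous_const continuous_id
  continuous_invFun := Continuous.mul β continuous_const continuous_id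

/-- Right translation. -/
def rightMul (a : 𝔾) : 𝔾 ≃ₜ 𝔾 where
  toFun g := mul β g a
  invFun g := mul β g (-a)
  left_inv g := mul_neg_cancel_right β halt g a
  right_inv g := neg_mul_cancel_right β halt g a
  continuous_toFun := Continuous.mul β continuous_id continuous_const
  continuous_invFun := Continuous.mul β continuous_id continuous_const

/-- The shear `(g, h) ↦ (g h, h)`. -/
def shear : 𝔾 × 𝔾 ≃ₜ 𝔾 × 𝔾 where
  toFun p := (mul β p.1 p.2, p.2)
  invFun p := (mul β p.1 (-p.2), p.2)
  left_inv p := by simp [mul_neg_cancel_right β halt]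
  right_inv p := by simp [neg_mul_cancel_right β halt]
  continuous_toFun := (Continuous.mul β continuous_fst continuous_snd).prodMk continuous_snd
  continuous_invFun := (Continuous.mul β continuous_fst continuous_snd.neg).prodMk continuous_snd

omit halt in
lemma measurePreserving_left (a : 𝔾) :
    MeasurePreserving (fun g => mul β a g) (volume.prod volume) (volume.prod volume) := by
  have hc : Continuous fun x : Eu d₁ => a.2 + (1 / 2 : ℝ) • β a.1 x := by fun_prop
  have h := MeasurePreserving.skew_product (measurePreserving_add_left volume a.1)
    (g := fun x u => (a.2 + (1 / 2 : ℝ) • β a.1 x) + u)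
    ((hc.comp continuous_fst).add continuous_snd).measurable
    (.of_forall fun x => (measurePreserving_add_left volume _).map_eq)
  have e : (fun g => mul β a g) = fun p => (a.1 + p.1, (a.2 + (1 / 2 : ℝ) • β a.1 p.1) + p.2) := by
    funext g
    simp only [mul, add_right_comm]
  rw [e]
  exact h

omit halt in
lemma measurePreserving_right (a : 𝔾) :
    MeasurePreserving (fun g => mul β g a) (volume.prod volume) (volume.prod volume) := by
  have hc : Continuous fun x : Eu d₁ => a.2 + (1 / 2 : ℝ) • β x a.1 := by
    have := Continuous.bilin β (continuous_id (X := Eu d₁)) (continuous_const (y := a.1))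
    simp only [id] at this
    fun_prop
  have h := MeasurePreserving.skew_product (measurePreserving_add_left volume a.1)
    (g := fun x u => (a.2 + (1 / 2 : ℝ) • β x a.1) + u)
    ((hc.comp continuous_fst).add continuous_snd).measurable
    (.of_forall fun x => (measurePreserving_add_left volume _).map_eq)
  have e : (fun g => mul β g a) = fun p => (a.1 + p.1, (a.2 + (1 / 2 : ℝ) • β p.1 a.1) + p.2) := by
    funext g
    simp only [mul]
    ext1
    · simp [add_comm]
    · simp only; abel
  rw [e]
  exact h

lemma measurePreserving_shear :
    MeasurePreserving (shear β halt) (volume.prod volume) (volume.prod volume) := by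
  have h := MeasurePreserving.skew_product (MeasurePreserving.id (volume : Measure 𝔾))
    (g := fun h g => mul β g h)
    (Continuous.mul β continuous_snd continuous_fst).measurable
    (.of_forall fun x => (measurePreserving_right β x).map_eq)
  exact (Measure.measurePreserving_swap.comp h).comp Measure.measurePreserving_swap

instance : (volume : Measure 𝔾).IsAddHaarMeasure := Measure.prod.instIsAddHaarMeasure volume volume

lemma integral_mul_left {E : Type*} [NormedAddCommGroup E] [NormedSpace ℝ E]
    (f : 𝔾 → E) (a : 𝔾) : ∫ g, f (mul β a g) = ∫ g, f g :=
  (measurePreserving_left β a).integral_comp (leftMul β halt a).measurableEmbedding f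

lemma integral_mul_right {E : Type*} [NormedAddCommGroup E] [NormedSpace ℝ E]
    (f : 𝔾 → E) (a : 𝔾) : ∫ g, f (mul β g a) = ∫ g, f g :=
  (measurePreserving_right β a).integral_comp (rightMul β halt a).measurableEmbedding f

end GroupLaw

section Fields

variable {d₁ d₂ : ℕ} (β : 𝔅)

lemma leftInvariantField_eq_fderiv {f : 𝔾 → ℂ} {g : 𝔾} (hf : DifferentiableAt ℝ f g) (v : 𝔾) :
    𝒳 β v f g = fderiv ℝ f g (v.1, v.2 + (1 / 2 : ℝ) • β g.1 v.1) := by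
  rw [← hf.lineDeriv_eq_fderiv, leftInvariantField, lineDeriv]
  simp only [mul_smul_eq]

lemma hasDerivAt_mul_zero {f : 𝔾 → ℂ} {g : 𝔾} (hf : DifferentiableAt ℝ f g) (v : 𝔾) :
    HasDerivAt (fun t : ℝ => f (mul β g (t • v))) (𝒳 β v f g) 0 := by
  rw [leftInvariantField_eq_fderiv β hf]
  have := (hf.hasFDerivAt.hasLineDerivAt (v.1, v.2 + (1 / 2 : ℝ) • β g.1 v.1))
  simpa only [HasLineDerivAt, mul_smul_eq] using this

lemma contDiff_leftInvariantField {f : 𝔾 → ℂ} (hf : ContDiff ℝ ∞ f)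
    (v : 𝔾) : ContDiff ℝ ∞ (𝒳 β v f) := by
  have e : 𝒳 β v f = fun g => fderiv ℝ f g (v.1, v.2 + (1 / 2 : ℝ) • β g.1 v.1) := by
    funext g
    exact leftInvariantField_eq_fderiv β (hf.differentiable (by simp) g) v
  rw [e]
  refine (hf.fderiv_right (m := ∞) (by simp)).clm_apply ?_
  exact contDiff_const.prodMk (contDiff_const.add
    ((ContDiff.bilin β contDiff_fst contDiff_const).const_smul _))

lemma leftInvariantField_eq_zero {f : 𝔾 → ℂ} {g : 𝔾}
    (hg : g ∉ tsupport f) (v : 𝔾) : 𝒳 β v f g = 0 := by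
  have h : f =ᶠ[𝓝 g] 0 := notMem_tsupport_iff_eventuallyEq.mp hg
  have hd : DifferentiableAt ℝ f g := (differentiableAt_const (0 : ℂ)).congr_of_eventuallyEq h
  rw [leftInvariantField_eq_fderiv β hd, h.fderiv_eq]
  simp

lemma hasCompactSupport_leftInvariantField {f : 𝔾 → ℂ} (hf : HasCompactSupport f)
    (v : 𝔾) : HasCompactSupport (𝒳 β v f) :=
  HasCompactSupport.intro hf fun _ hg => leftInvariantField_eq_zero β hg v

lemma IsTest.field {f : 𝔾 → ℂ} (hf : IsTest f) (v : 𝔾) : IsTest (𝒳 β v f) :=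
  ⟨contDiff_leftInvariantField β hf.1 v, hasCompactSupport_leftInvariantField β hf.2 v⟩

lemma field_mul {f h : 𝔾 → ℂ} {g : 𝔾} (hf : DifferentiableAt ℝ f g)
    (hh : DifferentiableAt ℝ h g) (v : 𝔾) :
    𝒳 β v (fun g => f g * h g) g = 𝒳 β v f g * h g + f g * 𝒳 β v h g := by
  have h1 := ((hasDerivAt_mul_zero β hf v).mul (hasDerivAt_mul_zero β hh v)).deriv
  simp only [zero_smul, mul_zero'] at h1
  exact h1

lemma field_conj (f : 𝔾 → ℂ) (g v : 𝔾) : 𝒳 β v (fun g => conj (f g)) g = conj (𝒳 β v f g) := by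
  unfold leftInvariantField
  exact deriv.star

lemma field_leftMul (f : 𝔾 → ℂ) (a g v : 𝔾) :
    𝒳 β v (fun g => f (mul β a g)) g = 𝒳 β v f (mul β a g) := by
  simp only [leftInvariantField, mul_assoc']

variable (halt : Alt β)
include halt

lemma hasDerivAt_mul {f : 𝔾 → ℂ} (hf : ContDiff ℝ ∞ f) (g v : 𝔾)
    (s : ℝ) : HasDerivAt (fun t : ℝ => f (mul β g (t • v))) (𝒳 β v f (mul β g (s • v))) s := by
  have h := hasDerivAt_mul_zero β (hf.differentiable (by simp) (mul β g (s • v))) v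
  have h2 := HasDerivAt.scomp_of_eq (h := fun t => t - s) s h ((hasDerivAt_id s).sub_const s)
    (by simp)
  rw [one_smul] at h2
  refine h2.congr_of_eventuallyEq (.of_forall fun t => ?_)
  simp only [comp_apply]
  rw [← mul_add_smul β halt]
  simp

omit halt in
lemma integrable_mul_test {h f : 𝔾 → ℂ} (hh : LocallyIntegrable h)
    (hf : Continuous f) (hc : HasCompactSupport f) : Integrable fun g => h g * f g :=
  hh.integrable_smul_right_of_hasCompactSupport hf hc

lemma hasDerivAt_integral_mul {h f : 𝔾 → ℂ} (hh : LocallyIntegrable h)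
    (hf : IsTest f) (v : 𝔾) (s : ℝ) :
    HasDerivAt (fun t : ℝ => ∫ g, h g * f (mul β g (t • v)))
      (∫ g, h g * 𝒳 β v f (mul β g (s • v))) s := by
  let K : Set 𝔾 :=
    (fun p : 𝔾 × ℝ => mul β p.1 (-(p.2 • v))) '' (tsupport f ×ˢ Metric.closedBall s 1)
  have hK : IsCompact K := (hf.2.isCompact.prod (isCompact_closedBall s 1)).image
    (Continuous.mul β continuous_fst (continuous_snd.smul continuous_const).neg)
  have hX := hf.field β v
  obtain ⟨C, hC⟩ := hX.2.exists_bound_of_continuous hX.1.continuous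
  have hcm : ∀ t : ℝ, Continuous fun g => mul β g (t • v) := fun t =>
    Continuous.mul β continuous_id continuous_const
  refine (hasDerivAt_integral_of_dominated_loc_of_deriv_le (𝕜 := ℝ)
    (F' := fun t g => h g * 𝒳 β v f (mul β g (t • v)))
    (bound := K.indicator fun g => ‖h g‖ * C)
    (Metric.ball_mem_nhds s one_pos)
    (.of_forall fun t => hh.aestronglyMeasurable.mul
      (hf.1.continuous.comp (hcm t)).aestronglyMeasurable) ?_
    (hh.aestronglyMeasurable.mul (hX.1.continuous.comp (hcm s)).aestronglyMeasurable)
    (.of_forall fun g t ht => ?_) ?_ ?_).2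
  · exact integrable_mul_test hh (hf.1.continuous.comp (hcm s))
      (hf.2.comp_homeomorph (rightMul β halt (s • v)))
  · by_cases hg : mul β g (t • v) ∈ tsupport f
    · have : g ∈ K := ⟨(mul β g (t • v), t), ⟨hg, Metric.ball_subset_closedBall ht⟩,
        mul_neg_cancel_right β halt g _⟩
      rw [indicator_of_mem this, norm_mul]
      exact mul_le_mul_of_nonneg_left (hC _) (norm_nonneg _)
    · rw [leftInvariantField_eq_zero β hg, mul_zero, norm_zero]
      refine indicator_nonneg (fun g _ => ?_) g
      exact mul_nonneg (norm_nonneg _) ((norm_nonneg _).trans (hC 0))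
  · rw [integrable_indicator_iff hK.measurableSet]
    exact ((hh.integrableOn_isCompact hK).norm.mul_const C)
  · exact Eventually.of_forall fun g t _ => (hasDerivAt_mul β halt hf.1 g v t).const_mul (h g)

lemma integral_field_eq_zero {f : 𝔾 → ℂ} (hf : IsTest f) (v : 𝔾) : ∫ g, 𝒳 β v f g = 0 := by
  have h := hasDerivAt_integral_mul β halt (h := fun _ => 1) (locallyIntegrable_const 1) hf v 0
  simp only [one_mul, integral_mul_right β halt, zero_smul, mul_zero'] at h
  exact h.unique (hasDerivAt_const _ _)

lemma integral_field_mul {f h : 𝔾 → ℂ} (hf : ContDiff ℝ ∞ f) (hh : ContDiff ℝ ∞ h)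
    (hc : HasCompactSupport f ∨ HasCompactSupport h) (v : 𝔾) :
    ∫ g, 𝒳 β v f g * h g = -∫ g, f g * 𝒳 β v h g := by
  have h0 : IsTest fun g => f g * h g := ⟨hf.mul hh, by
    rcases hc with hc | hc
    exacts [hc.mul_right, hc.mul_left]⟩
  have h1 := integral_field_eq_zero β halt h0 v
  have hf' := contDiff_leftInvariantField β hf v
  have hh' := contDiff_leftInvariantField β hh v
  have e : ∀ g, 𝒳 β v (fun g => f g * h g) g = 𝒳 β v f g * h g + f g * 𝒳 β v h g := fun g =>
    field_mul β (hf.differentiable (by simp) g) (hh.differentiable (by simp) g) v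
  simp only [e] at h1
  rw [integral_add] at h1
  · exact eq_neg_of_add_eq_zero_left h1
  · refine (hf'.continuous.mul hh.continuous).integrable_of_hasCompactSupport ?_
    rcases hc with hc | hc
    exacts [(hasCompactSupport_leftInvariantField β hc v).mul_right, hc.mul_left]
  · refine (hf.continuous.mul hh'.continuous).integrable_of_hasCompactSupport ?_
    rcases hc with hc | hc
    exacts [hc.mul_right, (hasCompactSupport_leftInvariantField β hc v).mul_left]

end Fields

/-! ### Essentially self-adjoint operators -/

section EssentiallySelfAdjoint

variable {𝓗 : Type*} [NormedAddCommGroup 𝓗] [InnerProductSpace ℂ 𝓗]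

/-- A graph is symmetric and essentially self-adjoint. -/
structure IsEssSelfAdjoint (Γ : Submodule ℂ (𝓗 × 𝓗)) : Prop where
  symm : ∀ p ∈ Γ, ∀ q ∈ Γ, inner ℂ p.1 q.2 = inner ℂ p.2 q.1
  dense : ∀ h, (∀ p ∈ Γ, inner ℂ h p.1 = 0) → h = 0
  dense_add : ∀ h, (∀ p ∈ Γ, inner ℂ h (p.2 + I • p.1) = 0) → h = 0
  dense_sub : ∀ h, (∀ p ∈ Γ, inner ℂ h (p.2 - I • p.1) = 0) → h = 0

lemma symm_closure {Γ : Submodule ℂ (𝓗 × 𝓗)}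
    (hs : ∀ p ∈ Γ, ∀ q ∈ Γ, inner ℂ p.1 q.2 = inner ℂ p.2 q.1) {p q : 𝓗 × 𝓗}
    (hp : p ∈ closure (Γ : Set (𝓗 × 𝓗))) (hq : q ∈ closure (Γ : Set (𝓗 × 𝓗))) :
    inner ℂ p.1 q.2 = inner ℂ p.2 q.1 := by
  have h1 : ∀ q ∈ Γ, ∀ p ∈ closure (Γ : Set (𝓗 × 𝓗)), inner ℂ p.1 q.2 = inner ℂ p.2 q.1 := by
    intro q hq p hp
    refine closure_minimal (t := {p : 𝓗 × 𝓗 | inner ℂ p.1 q.2 = inner ℂ p.2 q.1})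
      (fun p hp => hs p hp q hq) (isClosed_eq ?_ ?_) hp
    · exact continuous_fst.inner continuous_const
    · exact continuous_snd.inner continuous_const
  refine closure_minimal (t := {q : 𝓗 × 𝓗 | inner ℂ p.1 q.2 = inner ℂ p.2 q.1})
    (fun q hq => h1 q hq p hp) (isClosed_eq ?_ ?_) hq
  · exact continuous_const.inner continuous_snd
  · exact continuous_const.inner continuous_fst

lemma norm_sq_add_I {v w : 𝓗} (h : inner ℂ v w = inner ℂ w v) :
    ‖w + I • v‖ ^ 2 = ‖v‖ ^ 2 + ‖w‖ ^ 2 := by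
  have h1 := @norm_add_sq ℂ 𝓗 _ _ _ w (I • v)
  have him : (inner ℂ w v).im = 0 := by
    have h2 := congrArg Complex.im (inner_conj_symm (𝕜 := ℂ) w v)
    rw [h, Complex.conj_im] at h2
    linarith
  rw [inner_smul_right, norm_smul] at h1
  simp only [RCLike.re_eq_complex_re, Complex.mul_re, Complex.I_re, Complex.I_im, him,
    Complex.norm_I, one_mul, zero_mul, sub_zero, mul_zero] at h1
  linarith

variable [CompleteSpace 𝓗]

lemma exists_resolvent {Γ : Submodule ℂ (𝓗 × 𝓗)}
    (hs : ∀ p ∈ Γ, ∀ q ∈ Γ, inner ℂ p.1 q.2 = inner ℂ p.2 q.1)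
    (hd : ∀ h, (∀ p ∈ Γ, inner ℂ h (p.2 + I • p.1) = 0) → h = 0) :
    ∃ C : 𝓗 →L[ℂ] 𝓗, ∀ v w, (v, w) ∈ closure (Γ : Set (𝓗 × 𝓗)) ↔ v = C (w + I • v) := by
  let Δ := Γ.topologicalClosure
  let T : Δ →L[ℂ] 𝓗 := ((ContinuousLinearMap.snd ℂ 𝓗 𝓗) +
    I • (ContinuousLinearMap.fst ℂ 𝓗 𝓗)).comp Δ.subtypeL
  have hT : ∀ p : Δ, T p = (p : 𝓗 × 𝓗).2 + I • (p : 𝓗 × 𝓗).1 := fun p => rfl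
  have hn : ∀ p : Δ, ‖T p‖ ^ 2 = ‖(p : 𝓗 × 𝓗).1‖ ^ 2 + ‖(p : 𝓗 × 𝓗).2‖ ^ 2 := fun p =>
    norm_sq_add_I (symm_closure hs p.2 p.2)
  have h1 : ∀ p : Δ, ‖(p : 𝓗 × 𝓗).1‖ ≤ ‖T p‖ := fun p =>
    abs_le_of_sq_le_sq' (by rw [hn]; linarith [sq_nonneg ‖(p : 𝓗 × 𝓗).2‖]) (norm_nonneg _) |>.2
  have h2 : ∀ p : Δ, ‖(p : 𝓗 × 𝓗).2‖ ≤ ‖T p‖ := fun p =>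
    abs_le_of_sq_le_sq' (by rw [hn]; linarith [sq_nonneg ‖(p : 𝓗 × 𝓗).1‖]) (norm_nonneg _) |>.2
  have hal : AntilipschitzWith 1 T := AddMonoidHomClass.antilipschitz_of_bound T fun p => by
      rw [NNReal.coe_one, one_mul]
      exact max_le (h1 p) (h2 p)
  have : CompleteSpace Δ := Γ.isClosed_topologicalClosure.completeSpace_coe
  have hcl : IsClosed (Set.range T) := hal.isClosed_range T.uniformContinuous
  have hsurj : Function.Surjective T := by
    have hr : (LinearMap.range (T : Δ →ₗ[ℂ] 𝓗)) = ⊤ := by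
      have hcl' : IsClosed ((LinearMap.range (T : Δ →ₗ[ℂ] 𝓗) : Submodule ℂ 𝓗) : Set 𝓗) := by
        rw [LinearMap.coe_range]
        exact hcl
      have : CompleteSpace (LinearMap.range (T : Δ →ₗ[ℂ] 𝓗)) := hcl'.completeSpace_coe
      rw [← Submodule.orthogonal_eq_bot_iff, Submodule.eq_bot_iff]
      intro h hh
      refine hd h fun p hp => ?_
      rw [← inner_conj_symm]
      have := (Submodule.mem_orthogonal _ h).mp hh (T ⟨p, Γ.le_topologicalClosure hp⟩) ⟨_, rfl⟩
      rw [hT] at this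
      simp [this]
    exact LinearMap.range_eq_top.mp hr
  let e : Δ ≃ₗ[ℂ] 𝓗 := LinearEquiv.ofBijective (T : Δ →ₗ[ℂ] 𝓗) ⟨hal.injective, hsurj⟩
  have he : ∀ p, e p = T p := fun p => rfl
  let C : 𝓗 →L[ℂ] 𝓗 := ((LinearMap.fst ℂ 𝓗 𝓗).comp (Δ.subtype.comp e.symm.toLinearMap)).mkContinuous 1
    (fun h => by
      rw [one_mul]
      have := h1 (e.symm h)
      rw [← he, e.apply_symm_apply] at this
      exact this)
  have hC : ∀ h, C h = (e.symm h : 𝓗 × 𝓗).1 := fun h => rfl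
  refine ⟨C, fun v w => ⟨fun hvw => ?_, fun hv => ?_⟩⟩
  · have : w + I • v = e ⟨(v, w), hvw⟩ := rfl
    rw [hC, this, e.symm_apply_apply]
  · have h3 := hT (e.symm (w + I • v))
    rw [← he, e.apply_symm_apply, ← hC, ← hv] at h3
    have h4 : (e.symm (w + I • v) : 𝓗 × 𝓗) = (v, w) := by grind
    rw [← h4]
    exact (e.symm (w + I • v)).2

lemma IsEssSelfAdjoint.mem_closure_iff {Γ : Submodule ℂ (𝓗 × 𝓗)} (hΓ : IsEssSelfAdjoint Γ) (v w : 𝓗) :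
    (v, w) ∈ closure (Γ : Set (𝓗 × 𝓗)) ↔ ∀ p ∈ Γ, inner ℂ v p.2 = inner ℂ w p.1 := by
  refine ⟨fun h p hp => symm_closure hΓ.symm h (subset_closure hp), fun h => ?_⟩
  obtain ⟨C, hC⟩ := exists_resolvent hΓ.symm hΓ.dense_add
  set z := w + I • v with hz
  have h1 : (C z, z - I • C z) ∈ closure (Γ : Set (𝓗 × 𝓗)) := (hC _ _).mpr (by simp)
  have h2 : v - C z = 0 := by
    refine hΓ.dense_sub _ fun p hp => ?_
    have h3 := h p hp
    have h4 := symm_closure hΓ.symm h1 (subset_closure hp)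
    have h5 : w = z - I • v := by simp [hz]
    rw [h5] at h3
    simp only [inner_sub_left, inner_smul_left, conj_I] at h3 h4
    simp only [inner_sub_left, inner_sub_right, inner_smul_right, h3, h4]
    ring
  rw [sub_eq_zero] at h2
  rw [hC]
  exact h2

lemma IsEssSelfAdjoint.exists_resolvent {Γ : Submodule ℂ (𝓗 × 𝓗)} (hΓ : IsEssSelfAdjoint Γ) :
    ∃ C : 𝓗 →L[ℂ] 𝓗, (∀ v w, (v, w) ∈ closure (Γ : Set (𝓗 × 𝓗)) ↔ v = C (w + I • v)) ∧
      (∀ v, C v = 0 → v = 0) ∧ star C - C = (2 * I) • (star C * C) ∧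
      C * star C = star C * C := by
  obtain ⟨C, hC⟩ := TwoStep.exists_resolvent hΓ.symm hΓ.dense_add
  have hmem : ∀ z, (C z, z - I • C z) ∈ closure (Γ : Set (𝓗 × 𝓗)) := fun z => (hC _ _).mpr (by simp)
  -- the graph of the negative operator gives the other resolvent
  let Γ' : Submodule ℂ (𝓗 × 𝓗) := Γ.map ((LinearMap.fst ℂ 𝓗 𝓗).prod (-(LinearMap.snd ℂ 𝓗 𝓗)))
  have hΓ' : ∀ p, p ∈ Γ' ↔ (p.1, -p.2) ∈ Γ := by
    intro p
    constructor
    · rintro ⟨q, hq, rfl⟩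
      simpa using hq
    · intro hp
      exact ⟨_, hp, by simp⟩
  obtain ⟨D, hD⟩ := TwoStep.exists_resolvent (Γ := Γ') (fun p hp q hq => by
      have := hΓ.symm _ ((hΓ' p).mp hp) _ ((hΓ' q).mp hq)
      simpa using this)
    (fun h hh => hΓ.dense_sub h fun p hp => by
      have := hh (p.1, -p.2) ((hΓ' _).mpr (by simpa using hp))
      simp only [inner_add_right, inner_neg_right, inner_sub_right] at this ⊢
      linear_combination -this)
  have hcl : ∀ v w, (v, w) ∈ closure (Γ' : Set (𝓗 × 𝓗)) ↔ (v, -w) ∈ closure (Γ : Set (𝓗 × 𝓗)) := by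
    intro v w
    let e : 𝓗 × 𝓗 ≃ₜ 𝓗 × 𝓗 := (Homeomorph.refl 𝓗).prodCongr (Homeomorph.neg 𝓗)
    have : (Γ' : Set (𝓗 × 𝓗)) = e ⁻¹' Γ := by
      ext p
      exact hΓ' p
    rw [this, ← e.preimage_closure]
    rfl
  have hres : ∀ v w, (v, w) ∈ closure (Γ : Set (𝓗 × 𝓗)) ↔ v = -D (w - I • v) := by grind
  have hmem' : ∀ z, (-D z, z - I • D z) ∈ closure (Γ : Set (𝓗 × 𝓗)) :=
    fun z => (hres _ _).mpr (by simp)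
  have hadj : star C = -D := by
    rw [star_eq_adjoint]
    symm
    rw [ContinuousLinearMap.eq_adjoint_iff]
    intro x y
    have := symm_closure hΓ.symm (hmem' x) (hmem y)
    simp only [inner_sub_right, inner_sub_left, inner_smul_right, inner_smul_left,
      inner_neg_left, conj_I] at this
    rw [_root_.neg_apply, inner_neg_left]
    linear_combination this
  refine ⟨C, hC, fun v hv => ?_, ?_, ?_⟩
  · refine hΓ.dense v fun p hp => ?_
    have h1 := hmem v
    rw [hv, smul_zero, sub_zero] at h1
    have := symm_closure hΓ.symm h1 (subset_closure hp)
    simpa using this.symm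
  · ext z
    have h1 := (hres _ _).mp (hmem z)
    rw [hadj]
    simp only [_root_.sub_apply, _root_.smul_apply, _root_.neg_apply, mul_apply_eq_comp]
    simp only [map_sub, map_smul] at h1
    have h2 : C z = -D z + (2 * I) • D (C z) := by
      conv_lhs => rw [h1]
      module
    conv_lhs => rw [h2]
    module
  · ext z
    have h1 := (hres _ _).mp (hmem z)
    have h2 := (hC _ _).mp (hmem' z)
    rw [hadj]
    simp only [_root_.neg_apply, mul_apply_eq_comp]
    simp only [map_sub, map_smul, map_neg, map_add, smul_neg] at h1 h2 ⊢
    have h3 : (2 * I) • D (C z) = (2 * I) • C (D z) := by simp; grind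
    rw [smul_right_injective 𝓗 (by simp : (2 * I) ≠ 0) h3]

lemma commute_resolvent {Γ : Set (𝓗 × 𝓗)} {B C : 𝓗 →L[ℂ] 𝓗}
    (hC : ∀ v w, (v, w) ∈ closure Γ ↔ v = C (w + I • v))
    (hB : ∀ p ∈ Γ, (B p.1, B p.2) ∈ closure Γ) : B * C = C * B := by
  have hB' : ∀ p ∈ closure Γ, (B p.1, B p.2) ∈ closure Γ := by
    intro p hp
    exact closure_minimal (t := {p : 𝓗 × 𝓗 | (B p.1, B p.2) ∈ closure Γ}) (fun p hp => hB p hp)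
      (isClosed_closure.preimage (by fun_prop)) hp
  ext z
  have h1 := (hC _ _).mp (hB' (C z, z - I • C z) ((hC _ _).mpr (by simp)))
  simpa using h1

end EssentiallySelfAdjoint

/-! ### Operators on test functions -/

section TestFunctions

variable {d₁ d₂ : ℕ}

open Classical in
/-- The class in `L²(G)` of a square integrable function. -/
def toL2 (f : 𝔾 → ℂ) : L2G d₁ d₂ := if h : MemLp f 2 volume then h.toLp f else 0

lemma coeFn_toL2 {f : 𝔾 → ℂ} (hf : MemLp f 2 volume) : toL2 f =ᵐ[volume] f := by
  rw [toL2, dif_pos hf]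
  exact hf.coeFn_toLp

lemma eq_toL2 {f : 𝔾 → ℂ} (hf : MemLp f 2 volume) {w : L2G d₁ d₂}
    (h : w =ᵐ[volume] f) : w = toL2 f :=
  Lp.ext (h.trans (coeFn_toL2 hf).symm)

lemma inner_eq_integral (h w : L2G d₁ d₂) : inner ℂ h w = ∫ g, conj (h g) * w g := by
  rw [L2.inner_def]
  refine integral_ext fun g => ?_
  simp [RCLike.inner_apply, mul_comm]

lemma inner_toL2 (h : L2G d₁ d₂) {f : 𝔾 → ℂ} (hf : MemLp f 2 volume) :
    inner ℂ h (toL2 f) = ∫ g, conj (h g) * f g := by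
  rw [inner_eq_integral]
  refine integral_congr_ae ?_
  filter_upwards [coeFn_toL2 hf] with g hg
  rw [hg]

lemma inner_toL2_toL2 {f h : 𝔾 → ℂ} (hf : MemLp f 2 volume) (hh : MemLp h 2 volume) :
    inner ℂ (toL2 f) (toL2 h) = ∫ g, conj (f g) * h g := by
  rw [inner_toL2 _ hh]
  refine integral_congr_ae ?_
  filter_upwards [coeFn_toL2 hf] with g hg
  rw [hg]

lemma toL2_add {f h : 𝔾 → ℂ} (hf : MemLp f 2 volume) (hh : MemLp h 2 volume) :
    toL2 (fun g => f g + h g) = toL2 f + toL2 h := by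
  refine (eq_toL2 (hf.add hh) ?_).symm
  filter_upwards [Lp.coeFn_add (toL2 f) (toL2 h), coeFn_toL2 hf, coeFn_toL2 hh] with g h1 h2 h3
  rw [h1, Pi.add_apply, h2, h3, Pi.add_apply]

lemma toL2_smul {f : 𝔾 → ℂ} (hf : MemLp f 2 volume) (c : ℂ) :
    toL2 (fun g => c * f g) = c • toL2 f := by
  refine (eq_toL2 (hf.const_mul c) ?_).symm
  filter_upwards [Lp.coeFn_smul c (toL2 f), coeFn_toL2 hf] with g h1 h2
  rw [h1, Pi.smul_apply, h2, smul_eq_mul]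

lemma locallyIntegrable_conj (h : L2G d₁ d₂) : LocallyIntegrable (fun g => conj (h g)) := by
  have h1 : MemLp (fun g => conj (h g)) 2 (volume : Measure 𝔾) := (Lp.memLp h).star
  exact h1.locallyIntegrable (by norm_num)

namespace IsTest

variable {f h : 𝔾 → ℂ}

lemma memLp (hf : IsTest f) : MemLp f 2 volume := hf.1.continuous.memLp_of_hasCompactSupport hf.2

lemma integrable (hf : IsTest f) : Integrable f :=
  hf.1.continuous.integrable_of_hasCompactSupport hf.2

lemma differentiableAt (hf : IsTest f) (g : 𝔾) : DifferentiableAt ℝ f g :=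
  hf.1.differentiable (by simp) g

lemma add (hf : IsTest f) (hh : IsTest h) : IsTest fun g => f g + h g :=
  ⟨hf.1.add hh.1, hf.2.add hh.2⟩

lemma const_mul (hf : IsTest f) (c : ℂ) : IsTest fun g => c * f g :=
  ⟨contDiff_const.mul hf.1, hf.2.mul_left⟩

lemma neg (hf : IsTest f) : IsTest fun g => -f g := ⟨hf.1.neg, hf.2.neg⟩

lemma _root_.TwoStep.IsTest.conj (hf : IsTest f) : IsTest fun g => conj (f g) :=
  ⟨Complex.conjCLE.contDiff.comp hf.1, hf.2.comp_left (g := conj) (map_zero _)⟩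

lemma sum {ι : Type*} (s : Finset ι) {F : ι → 𝔾 → ℂ} (hF : ∀ i, IsTest (F i)) :
    IsTest fun g => ∑ i ∈ s, F i g := by
  classical
  induction s using Finset.induction_on with
  | empty =>
    simp only [sum_empty]
    exact ⟨contDiff_const, HasCompactSupport.zero⟩
  | insert i s hi ih => simp only [sum_insert hi]; exact (hF i).add ih

lemma comp_mul_left (hf : IsTest f) (β : 𝔅) (halt : Alt β)
    (a : 𝔾) : IsTest fun g => f (mul β a g) :=
  ⟨hf.1.comp (ContDiff.mul β contDiff_const contDiff_id), hf.2.comp_homeomorph (leftMul β halt a)⟩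

lemma comp_mul_right (hf : IsTest f) (β : 𝔅) (halt : Alt β)
    (a : 𝔾) : IsTest fun g => f (mul β g a) :=
  ⟨hf.1.comp (ContDiff.mul β contDiff_id contDiff_const), hf.2.comp_homeomorph (rightMul β halt a)⟩

lemma comp_add (hf : IsTest f) (a : 𝔾) : IsTest fun g => f (g + a) :=
  ⟨hf.1.comp (contDiff_id.add contDiff_const), hf.2.comp_homeomorph (Homeomorph.addRight a)⟩

end IsTest

lemma dense_toL2 : Dense {w : L2G d₁ d₂ | ∃ f, IsTest f ∧ w = toL2 f} := by
  refine (Lp.dense_hasCompactSupport_contDiff (E := 𝔾) (F := ℂ) (μ := volume) (p := 2)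
    (by norm_num)).mono ?_
  rintro w ⟨f, hw, hc, hf⟩
  exact ⟨f, ⟨hf, hc⟩, eq_toL2 (IsTest.memLp ⟨hf, hc⟩) hw⟩

lemma eq_zero_of_forall_inner {h : L2G d₁ d₂} (H : ∀ f, IsTest f → inner ℂ h (toL2 f) = 0) :
    h = 0 := by
  refine dense_toL2.eq_zero_of_inner_left (𝕜 := ℂ) fun w hw => ?_
  obtain ⟨f, hf, rfl⟩ := hw
  exact H f hf

/-- A symmetric operator on the space of test functions. -/
structure IsSymmOp (A : (𝔾 → ℂ) → (𝔾 → ℂ)) : Prop where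
  isTest : ∀ f, IsTest f → IsTest (A f)
  add : ∀ f h, IsTest f → IsTest h → A (fun g => f g + h g) = fun g => A f g + A h g
  smul : ∀ (c : ℂ) f, IsTest f → A (fun g => c * f g) = fun g => c * A f g
  symm : ∀ f h, IsTest f → IsTest h → ∫ g, conj (f g) * A h g = ∫ g, conj (A f g) * h g

variable {A : (𝔾 → ℂ) → (𝔾 → ℂ)} (hA : IsSymmOp A)

/-- The graph of an operator on test functions. -/
def IsSymmOp.graph : Submodule ℂ (L2G d₁ d₂ × L2G d₁ d₂) where
  carrier := {p | ∃ f, IsTest f ∧ p = (toL2 f, toL2 (A f))}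
  zero_mem' := ⟨fun _ => 0 * 0, IsTest.const_mul ⟨contDiff_const, HasCompactSupport.zero⟩ 0, by
    have h0 : IsTest (fun _ : 𝔾 => (0 : ℂ)) := ⟨contDiff_const, HasCompactSupport.zero⟩
    rw [hA.smul 0 _ h0, toL2_smul h0.memLp, toL2_smul (hA.isTest _ h0).memLp]
    simp only [zero_smul]
    rfl⟩
  add_mem' := by
    rintro _ _ ⟨f, hf, rfl⟩ ⟨h, hh, rfl⟩
    refine ⟨_, hf.add hh, ?_⟩
    rw [hA.add f h hf hh, toL2_add hf.memLp hh.memLp,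
      toL2_add (hA.isTest f hf).memLp (hA.isTest h hh).memLp]
    rfl
  smul_mem' := by
    rintro c _ ⟨f, hf, rfl⟩
    refine ⟨_, hf.const_mul c, ?_⟩
    rw [hA.smul c f hf, toL2_smul hf.memLp, toL2_smul (hA.isTest f hf).memLp]
    rfl

lemma IsSymmOp.closureGraph_eq : closureGraph A = closure (hA.graph : Set (L2G d₁ d₂ × L2G d₁ d₂)) := by
  unfold closureGraph
  congr 1
  ext p
  constructor
  · rintro ⟨f, hf, h1, h2⟩
    exact ⟨f, hf, Prod.ext (eq_toL2 hf.memLp h1) (eq_toL2 (hA.isTest f hf).memLp h2)⟩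
  · rintro ⟨f, hf, rfl⟩
    exact ⟨f, hf, coeFn_toL2 hf.memLp, coeFn_toL2 (hA.isTest f hf).memLp⟩

lemma IsSymmOp.isEssSelfAdjoint
    (h1 : ∀ h : L2G d₁ d₂, (∀ f, IsTest f → inner ℂ h (toL2 (A f)) = -I * inner ℂ h (toL2 f)) → h = 0)
    (h2 : ∀ h : L2G d₁ d₂, (∀ f, IsTest f → inner ℂ h (toL2 (A f)) = I * inner ℂ h (toL2 f)) → h = 0) :
    IsEssSelfAdjoint hA.graph where
  symm := by
    rintro _ ⟨f, hf, rfl⟩ _ ⟨h, hh, rfl⟩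
    simp only
    rw [inner_toL2_toL2 hf.memLp (hA.isTest h hh).memLp,
      inner_toL2_toL2 (hA.isTest f hf).memLp hh.memLp, hA.symm f h hf hh]
  dense h hh := eq_zero_of_forall_inner fun f hf => hh _ ⟨f, hf, rfl⟩
  dense_add h hh := h1 h fun f hf => by
    have := hh _ ⟨f, hf, rfl⟩
    simp only [inner_add_right, inner_smul_right] at this
    linear_combination this
  dense_sub h hh := h2 h fun f hf => by
    have := hh _ ⟨f, hf, rfl⟩
    simp only [inner_sub_right, inner_smul_right] at this
    linear_combination this

end TestFunctions

section Translations

variable {d₁ d₂ : ℕ}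

/-- Translation `(τ_a f)(g) = f(g + a)` on `L²(G)`. -/
def translation (a : 𝔾) : L2G d₁ d₂ →L[ℂ] L2G d₁ d₂ :=
  (Lp.compMeasurePreservingₗᵢ ℂ (fun g => g + a)
    (measurePreserving_add_right volume a)).toContinuousLinearMap

lemma coeFn_translation (a : 𝔾) (h : L2G d₁ d₂) : translation a h =ᵐ[volume] fun g => h (g + a) :=
  Lp.coeFn_compMeasurePreserving h (measurePreserving_add_right volume a)

lemma norm_translation (a : 𝔾) (h : L2G d₁ d₂) : ‖translation a h‖ = ‖h‖ :=
  (Lp.compMeasurePreservingₗᵢ ℂ (fun g => g + a) (measurePreserving_add_right volume a)).norm_map h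

lemma translation_toL2 (a : 𝔾) {f : 𝔾 → ℂ} (hf : IsTest f) :
    translation a (toL2 f) = toL2 fun g => f (g + a) := by
  refine eq_toL2 (hf.comp_add a).memLp ((coeFn_translation a _).trans ?_)
  exact (measurePreserving_add_right volume a).quasiMeasurePreserving.ae_eq_comp
    (coeFn_toL2 hf.memLp)

lemma inner_translation (a : 𝔾) (h w : L2G d₁ d₂) :
    inner ℂ (translation a h) w = inner ℂ h (translation (-a) w) := by
  have h1 : translation a (translation (-a) w) = w := by
    refine Lp.ext ((coeFn_translation a _).trans ?_)
    refine ((measurePreserving_add_right volume a).quasiMeasurePreserving.ae_eq_comp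
      (coeFn_translation (-a) w)).trans (.of_forall fun g => ?_)
    simp
  conv_lhs => rw [← h1]
  rw [inner_eq_integral, inner_eq_integral,
    ← integral_add_right_eq_self (fun g => conj (h g) * (translation (-a) w) g) a]
  refine integral_congr_ae ?_
  filter_upwards [coeFn_translation a h, coeFn_translation a (translation (-a) w)] with g h2 h3
  rw [h2, h3]

variable (β : 𝔅)

/-- The vector of the Lie algebra with central coordinate `a`. -/
abbrev cen (a : Eu d₂) : 𝔾 := (0, a)

lemma field_comp_central (f : 𝔾 → ℂ) (a : Eu d₂) (v g : 𝔾) :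
    𝒳 β v (fun g => f (g + cen a)) g = 𝒳 β v f (g + cen a) := by
  simp only [leftInvariantField, ← mul_central β]
  congr 1
  funext t
  congr 1
  rw [mul_assoc', mul_assoc']
  congr 1
  ext1 <;> simp [mul, add_comm]

variable (halt : Alt β)
include halt

lemma hasDerivAt_inner_translation (h : L2G d₁ d₂) {f : 𝔾 → ℂ} (hf : IsTest f) (a : Eu d₂) (s : ℝ) :
    HasDerivAt (fun t : ℝ => inner ℂ h (translation (cen (t • a)) (toL2 f)))
      (inner ℂ h (translation (cen (s • a)) (toL2 (𝒳 β (cen a) f)))) s := by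
  have hX := hf.field β (cen a)
  have key := hasDerivAt_integral_mul β halt (locallyIntegrable_conj h) hf (cen a) s
  have e : ∀ t : ℝ, t • cen (d₁ := d₁) a = cen (t • a) := fun t => by simp [cen]
  simp only [e, mul_central] at key
  simp only [translation_toL2 _ hf, translation_toL2 _ hX, inner_toL2 _ (hf.comp_add _).memLp,
    inner_toL2 _ (hX.comp_add _).memLp]
  exact key

omit halt in
lemma inner_toL2_translation_zero (h : L2G d₁ d₂) {f : 𝔾 → ℂ} (hf : IsTest f) :
    inner ℂ h (translation (cen 0) (toL2 f)) = inner ℂ h (toL2 f) := by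
  rw [translation_toL2 _ hf]
  have : cen (d₁ := d₁) (0 : Eu d₂) = 0 := rfl
  simp [this]

lemma isSymmOp_centralDerivative (k : Fin d₂) : IsSymmOp (centralDerivative β k) where
  isTest f hf := (hf.field β _).const_mul _
  add f h hf hh := by
    funext g
    have : 𝒳 β (0, single k 1) (fun g => f g + h g) g = 𝒳 β (0, single k 1) f g +
        𝒳 β (0, single k 1) h g := by
      have h1 := ((hasDerivAt_mul_zero β (hf.differentiableAt g) (0, single k 1)).add
        (hasDerivAt_mul_zero β (hh.differentiableAt g) (0, single k 1))).deriv
      exact h1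
    simp only [centralDerivative, this]
    ring
  smul c f hf := by
    funext g
    have : 𝒳 β (0, single k 1) (fun g => c * f g) g = c * 𝒳 β (0, single k 1) f g :=
      ((hasDerivAt_mul_zero β (hf.differentiableAt g) (0, single k 1)).const_mul c).deriv
    simp only [centralDerivative, this]
    ring
  symm f h hf hh := by
    have h1 := integral_field_mul β halt hf.conj.1 hh.1 (Or.inl hf.conj.2) (0, single k 1)
    simp only [field_conj] at h1
    simp only [centralDerivative]
    have e1 : ∀ g, conj (f g) * (-I * 𝒳 β (0, single k 1) h g) =
        -I * (conj (f g) * 𝒳 β (0, single k 1) h g) := by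
      intro g; ring
    have e2 : ∀ g, conj (-I * 𝒳 β (0, single k 1) f g) * h g =
        I * (conj (𝒳 β (0, single k 1) f g) * h g) := by
      intro g; rw [map_mul, map_neg, conj_I]; ring
    simp only [e1, e2, integral_const_mul, h1]
    ring

lemma eq_zero_of_inner_field {h : L2G d₁ d₂} (a : Eu d₂) {ε : ℝ} (hε : ε ^ 2 = 1)
    (H : ∀ f, IsTest f → inner ℂ h (toL2 (𝒳 β (cen a) f)) = ε * inner ℂ h (toL2 f)) :
    h = 0 := by
  refine eq_zero_of_forall_inner fun f hf => ?_
  let y : ℝ → ℂ := fun t => inner ℂ h (translation (cen (t • a)) (toL2 f))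
  have hy : ∀ s, HasDerivAt y (ε * y s) s := by
    intro s
    have h1 := hasDerivAt_inner_translation β halt h hf a s
    have h2 : inner ℂ h (translation (cen (s • a)) (toL2 (𝒳 β (cen a) f))) = ε * y s := by
      simp only [y]
      rw [translation_toL2 _ hf, translation_toL2 _ (hf.field β _), ← H _ (hf.comp_add _)]
      congr 2
      funext g
      exact (field_comp_central β f _ _ g).symm
    rw [h2] at h1
    exact h1
  have hz : ∀ s, HasDerivAt (fun t : ℝ => cexp (-(ε * t : ℝ)) * y t) 0 s := by
    intro s
    have h1 : HasDerivAt (fun t : ℝ => cexp (-(ε * t : ℝ)))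
        (cexp (-(ε * s : ℝ)) * (-(ε : ℂ))) s := by
      have h2 : HasDerivAt (fun t : ℝ => (-(ε * t : ℝ) : ℂ)) (-(ε : ℂ)) s := by
        exact (((hasDerivAt_id s).const_mul ε).ofReal_comp).neg.congr_deriv (by simp)
      exact h2.cexp
    have h3 := h1.mul (hy s)
    refine h3.congr_deriv ?_
    ring
  have hconst : ∀ t, cexp (-(ε * t : ℝ)) * y t = y 0 := by
    intro t
    have := is_const_of_deriv_eq_zero (fun s => (hz s).differentiableAt) (fun s => (hz s).deriv) t 0
    simpa using this
  have hb : ∀ t, ‖y t‖ ≤ ‖h‖ * ‖toL2 f‖ := fun t =>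
    (norm_inner_le_norm _ _).trans (by rw [norm_translation])
  have hle : ∀ n : ℕ, ‖y 0‖ ≤ exp (-n) * (‖h‖ * ‖toL2 f‖) := by
    intro n
    have h1 := hconst (ε * n)
    rw [← h1, norm_mul, ← Complex.ofReal_neg, Complex.norm_exp, Complex.ofReal_re]
    have : ε * (ε * n) = n := by rw [← mul_assoc, ← sq, hε, one_mul]
    rw [this]
    exact mul_le_mul_of_nonneg_left (hb _) (exp_pos _).le
  have hlim : Tendsto (fun n : ℕ => exp (-n) * (‖h‖ * ‖toL2 f‖)) atTop (𝓝 (0 * (‖h‖ * ‖toL2 f‖))) :=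
    (Real.tendsto_exp_neg_atTop_nhds_zero.comp tendsto_natCast_atTop_atTop).mul_const _
  rw [zero_mul] at hlim
  have h0 : ‖y 0‖ ≤ 0 := ge_of_tendsto' hlim hle
  have h1 : y 0 = 0 := by simpa using h0
  simpa [y, inner_toL2_translation_zero h hf] using h1

lemma isEssSelfAdjoint_centralDerivative (k : Fin d₂) :
    IsEssSelfAdjoint (isSymmOp_centralDerivative β halt k).graph := by
  have key : ∀ (h : L2G d₁ d₂) f, IsTest f → inner ℂ h (toL2 (centralDerivative β k f)) =
      -I * inner ℂ h (toL2 (𝒳 β (cen (single k 1)) f)) := by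
    intro h f hf
    rw [← inner_smul_right, ← toL2_smul (hf.field β _).memLp]
    rfl
  refine (isSymmOp_centralDerivative β halt k).isEssSelfAdjoint ?_ ?_
  · intro h hh
    refine eq_zero_of_inner_field β halt (single k 1) (ε := 1) (by norm_num) ?_
    intro f hf
    have := hh f hf
    rw [key h f hf] at this
    have := mul_left_cancel₀ (by simp) this
    rw [this]; simp
  · intro h hh
    refine eq_zero_of_inner_field β halt (single k 1) (ε := -1) (by norm_num) ?_
    intro f hf
    have := hh f hf
    rw [key h f hf] at this
    refine mul_left_cancel₀ (by simp : -I ≠ 0) ?_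
    rw [this]; push_cast; ring

/-- Operators that commute with central translations preserve the graphs of the central
derivatives. -/
lemma mem_closure_graph_of_commute (k : Fin d₂) {B : L2G d₁ d₂ →L[ℂ] L2G d₁ d₂}
    (hB : ∀ a, B * translation (cen a) = translation (cen a) * B) :
    ∀ p ∈ (isSymmOp_centralDerivative β halt k).graph,
      (B p.1, B p.2) ∈ closure ((isSymmOp_centralDerivative β halt k).graph : Set (L2G d₁ d₂ × L2G d₁ d₂)) := by
  rintro _ ⟨f, hf, rfl⟩
  rw [(isEssSelfAdjoint_centralDerivative β halt k).mem_closure_iff]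
  rintro _ ⟨h, hh, rfl⟩
  simp only
  set e : Eu d₂ := single k 1 with he
  have hXf := hf.field β (cen e)
  have hXh := hh.field β (cen e)
  have e1 : toL2 (centralDerivative β k f) = -I • toL2 (𝒳 β (cen e) f) := by
    rw [← toL2_smul hXf.memLp]; rfl
  have e2 : toL2 (centralDerivative β k h) = -I • toL2 (𝒳 β (cen e) h) := by
    rw [← toL2_smul hXh.memLp]; rfl
  have d1 := hasDerivAt_inner_translation β halt (adjoint B (toL2 h)) hf e 0
  have d2 := hasDerivAt_inner_translation β halt (B (toL2 f)) hh e 0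
  have d3 := HasDerivAt.scomp_of_eq (h := fun t : ℝ => -t) 0 d2 (hasDerivAt_neg 0) (by simp)
  have d4 := d1.star
  have hfun : (fun t : ℝ => star (inner ℂ (adjoint B (toL2 h))
      (translation (cen (t • e)) (toL2 f)))) =
      ((fun t : ℝ => inner ℂ (B (toL2 f)) (translation (cen (t • e)) (toL2 h))) ∘ fun t : ℝ => -t) := by
    funext t
    simp only [comp_apply, RCLike.star_def]
    rw [inner_conj_symm, adjoint_inner_right, ← mul_apply_eq_comp, hB,
      mul_apply_eq_comp, inner_translation]
    congr 3
    simp [cen]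
  rw [hfun] at d4
  have h5 := d4.unique d3
  rw [zero_smul, inner_toL2_translation_zero _ hXf, inner_toL2_translation_zero _ hXh,
    RCLike.star_def, inner_conj_symm, adjoint_inner_right] at h5
  rw [e1, e2, map_smul, inner_smul_left, inner_smul_right, h5]
  simp

omit halt in
lemma translation_graph {A : (𝔾 → ℂ) → (𝔾 → ℂ)} (hA : IsSymmOp A)
    (hτ : ∀ a f, IsTest f → A (fun g => f (g + cen a)) = fun g => A f (g + cen a)) (a : Eu d₂) :
    ∀ p ∈ hA.graph, (translation (cen a) p.1, translation (cen a) p.2) ∈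
      closure (hA.graph : Set (L2G d₁ d₂ × L2G d₁ d₂)) := by
  rintro _ ⟨f, hf, rfl⟩
  refine subset_closure ⟨_, hf.comp_add (cen a), ?_⟩
  rw [hτ a f hf, translation_toL2 _ hf, translation_toL2 _ (hA.isTest f hf)]

end Translations

/-! ### Essential self-adjointness of the sublaplacian -/

section Sublaplacian

variable {d₁ d₂ : ℕ} (β : 𝔅)

/-- The first-layer field `X_j`. -/
abbrev hfield (j : Fin d₁) (f : 𝔾 → ℂ) : 𝔾 → ℂ := 𝒳 β (single j 1, 0) f

lemma IsTest.field_add {f h : 𝔾 → ℂ} (hf : IsTest f) (hh : IsTest h)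
    (v : 𝔾) : 𝒳 β v (fun g => f g + h g) = fun g => 𝒳 β v f g + 𝒳 β v h g := by
  funext g
  exact ((hasDerivAt_mul_zero β (hf.differentiableAt g) v).add
    (hasDerivAt_mul_zero β (hh.differentiableAt g) v)).deriv

lemma IsTest.field_const_mul {f : 𝔾 → ℂ} (hf : IsTest f) (c : ℂ)
    (v : 𝔾) : 𝒳 β v (fun g => c * f g) = fun g => c * 𝒳 β v f g := by
  funext g
  exact ((hasDerivAt_mul_zero β (hf.differentiableAt g) v).const_mul c).deriv

lemma IsTest.sublaplacian {f : 𝔾 → ℂ} (hf : IsTest f) : IsTest (𝓛 β f) :=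
  (IsTest.sum _ fun j => (hf.field β _).field β _).neg

lemma sublaplacian_comp_mul_left (f : 𝔾 → ℂ) (a g : 𝔾) :
    𝓛 β (fun g => f (mul β a g)) g = 𝓛 β f (mul β a g) := by
  simp only [sublaplacian]
  congr 1
  refine sum_congr rfl fun j _ => ?_
  rw [← field_leftMul]
  congr 1
  funext g
  exact field_leftMul β f a g _

variable (halt : Alt β)
include halt

lemma integral_mul_sublaplacian {f W : 𝔾 → ℂ} (hf : IsTest f) (hW : ContDiff ℝ ∞ W) :
    ∫ g, W g * 𝓛 β f g = ∑ j, ∫ g, hfield β j W g * hfield β j f g := by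
  have hint : ∀ j, Integrable fun g => W g * hfield β j (hfield β j f) g := fun j =>
    (hW.continuous.mul ((hf.field β _).field β _).1.continuous).integrable_of_hasCompactSupport
      ((hf.field β _).field β _).2.mul_left
  have hint' : ∀ j, Integrable fun g => -(W g * hfield β j (hfield β j f) g) := fun j =>
    (hint j).neg
  have e : ∀ g, W g * 𝓛 β f g = ∑ j, -(W g * hfield β j (hfield β j f) g) := by
    intro g
    rw [sublaplacian, mul_neg, mul_sum, sum_neg_distrib]
  simp only [e]
  rw [integral_finsetSum _ fun j _ => hint' j]
  refine sum_congr rfl fun j _ => ?_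
  rw [integral_neg, integral_field_mul β halt hW (hf.field β _).1 (Or.inr (hf.field β _).2)]

lemma isSymmOp_sublaplacian : IsSymmOp (𝓛 β) where
  isTest f hf := hf.sublaplacian β
  add f h hf hh := by
    funext g
    simp only [sublaplacian, hf.field_add β hh, (hf.field β _).field_add β (hh.field β _),
      sum_add_distrib]
    ring
  smul c f hf := by
    funext g
    simp only [sublaplacian, hf.field_const_mul β, (hf.field β _).field_const_mul β, mul_sum,
      mul_neg]
  symm f h hf hh := by
    rw [integral_mul_sublaplacian β halt hh hf.conj.1]
    have h1 := congrArg (conj) (integral_mul_sublaplacian β halt hf hh.conj.1)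
    rw [map_sum, ← integral_conj] at h1
    simp only [← integral_conj, map_mul, hfield, field_conj, conj_conj] at h1 ⊢
    simp only [mul_comm (h _)] at h1
    rw [h1]
    simp only [mul_comm]

/-- A quantitative Caccioppoli inequality. -/
lemma caccioppoli {W χ : 𝔾 → ℂ} (hW : ContDiff ℝ ∞ W) {z : ℂ} (hz : z.re = 0)
    (hz1 : ‖z‖ = 1) (heq : ∀ f, IsTest f → ∫ g, W g * 𝓛 β f g = z * ∫ g, W g * f g)
    (hχ : IsTest χ) (hχr : ∀ g, conj (χ g) = χ g) :
    ∫ g, ‖χ g * W g‖ ^ 2 ≤ 4 * ∑ j, ∫ g, ‖hfield β j χ g * W g‖ ^ 2 := by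
  have hWc : ContDiff ℝ ∞ fun g => conj (W g) := Complex.conjCLE.contDiff.comp hW
  have hχX := fun j : Fin d₁ => hχ.field β (single j 1, 0)
  have hWX := fun j : Fin d₁ => contDiff_leftInvariantField β hW (single j 1, 0)
  have hφ : IsTest fun g => (χ g * χ g) * conj (W g) :=
    ⟨(hχ.1.mul hχ.1).mul hWc, (hχ.2.mul_left).mul_right⟩
  have hXφ : ∀ j g, hfield β j (fun g => (χ g * χ g) * conj (W g)) g =
      2 * χ g * hfield β j χ g * conj (W g) + χ g * χ g * conj (hfield β j W g) := by
    intro j g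
    have hd := hχ.differentiableAt g
    rw [hfield, field_mul β (f := fun g => χ g * χ g) (hd.mul hd) (hWc.differentiable (by simp) g), field_conj,
      field_mul β hd hd]
    ring
  have h1 := heq _ hφ
  rw [integral_mul_sublaplacian β halt hφ hW] at h1
  have hi1 : ∀ j, Integrable fun g => ‖χ g * hfield β j W g‖ ^ 2 := fun j =>
    ((hχ.1.continuous.mul (hWX j).continuous).norm.pow 2).integrable_of_hasCompactSupport
      (hχ.2.mono' (fun g hg => subset_tsupport _ (by
        simp only [Function.mem_support] at hg ⊢
        intro h0; simp [h0] at hg)))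
  have hi1' : ∀ j, Integrable fun g => ((‖χ g * hfield β j W g‖ ^ 2 : ℝ) : ℂ) := fun j =>
    (hi1 j).ofReal
  have hi2 : ∀ j, Integrable fun g => ‖hfield β j χ g * W g‖ ^ 2 := fun j =>
    (((hχX j).1.continuous.mul hW.continuous).norm.pow 2).integrable_of_hasCompactSupport
      ((hχX j).2.mono' (fun g hg => subset_tsupport _ (by
        simp only [Function.mem_support] at hg ⊢
        intro h0; simp [hfield, h0] at hg)))
  have hi3 : ∀ j, Integrable fun g =>
      2 * χ g * hfield β j χ g * conj (W g) * hfield β j W g := fun j =>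
    ((((continuous_const.mul hχ.1.continuous).mul (hχX j).1.continuous).mul
      hWc.continuous).mul (hWX j).continuous).integrable_of_hasCompactSupport
      ((hχ.2.mul_left.mul_right.mul_right).mul_right)
  have h2 : ∀ j, ∫ g, hfield β j W g * hfield β j (fun g => (χ g * χ g) * conj (W g)) g =
      (∫ g, 2 * χ g * hfield β j χ g * conj (W g) * hfield β j W g) +
        ((∫ g, ‖χ g * hfield β j W g‖ ^ 2 : ℝ) : ℂ) := by
    intro j
    rw [← integral_complex_ofReal, ← integral_add (hi3 j) (hi1' j)]
    refine integral_ext fun g => ?_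
    simp only [hXφ]
    rw [Complex.ofReal_pow, ← Complex.conj_mul', map_mul, hχr]
    ring
  have h3 : ∫ g, W g * ((χ g * χ g) * conj (W g)) = ((∫ g, ‖χ g * W g‖ ^ 2 : ℝ) : ℂ) := by
    rw [← integral_complex_ofReal]
    refine integral_ext fun g => ?_
    rw [Complex.ofReal_pow, ← Complex.conj_mul', map_mul, hχr]
    ring
  simp only [h2, h3, sum_add_distrib] at h1
  rw [← Complex.ofReal_sum] at h1
  set K := ∑ j, ∫ g, 2 * χ g * hfield β j χ g * conj (W g) * hfield β j W g with hK
  set A := ∑ j, ∫ g, ‖χ g * hfield β j W g‖ ^ 2 with hA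
  set E := ∫ g, ‖χ g * W g‖ ^ 2 with hE
  set S := ∑ j, ∫ g, ‖hfield β j χ g * W g‖ ^ 2 with hS
  have hKle : ‖K‖ ≤ 1 / 2 * A + 2 * S := by
    rw [hK, hA, hS, mul_sum, mul_sum, ← sum_add_distrib]
    refine (norm_sum_le _ _).trans (sum_le_sum fun j _ => ?_)
    rw [← integral_const_mul, ← integral_const_mul,
      ← integral_add ((hi1 j).const_mul _) ((hi2 j).const_mul _)]
    refine norm_integral_le_of_norm_le (((hi1 j).const_mul _).add ((hi2 j).const_mul _))
      (.of_forall fun g => ?_)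
    simp only [norm_mul, RCLike.norm_conj, Complex.norm_ofNat]
    nlinarith [sq_nonneg (‖χ g‖ * ‖hfield β j W g‖ - 2 * (‖hfield β j χ g‖ * ‖W g‖))]
  have hE0 : 0 ≤ E := integral_nonneg fun g => by positivity
  have hre := congrArg Complex.re h1
  have him := congrArg Complex.im h1
  have hzim : z.im ^ 2 = 1 := by
    have := Complex.sq_norm z
    rw [hz1, Complex.normSq_apply, hz] at this
    linarith
  simp only [Complex.add_re, Complex.add_im, Complex.ofReal_re, Complex.ofReal_im, Complex.mul_re,
    Complex.mul_im, hz] at hre him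
  have hre2 := Complex.abs_re_le_norm K
  have him2 := Complex.abs_im_le_norm K
  have h5 : A ≤ ‖K‖ := by
    have := neg_abs_le K.re
    linarith
  have h6 : E ≤ ‖K‖ := by
    refine le_trans (le_of_eq ?_) him2
    have : K.im = z.im * E := by linarith
    have hz2 : |z.im| = 1 := by grind
    rw [this, abs_mul, hz2, one_mul, abs_of_nonneg hE0]
  linarith

/-- Anisotropic dilations. -/
def dil (r : ℝ) (g : 𝔾) : 𝔾 := (r • g.1, r ^ 2 • g.2)

omit halt in
lemma hfield_dil (χ : 𝔾 → ℂ) (r : ℝ) (j : Fin d₁) (g : 𝔾) :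
    hfield β j (fun g => χ (dil r g)) g = r * hfield β j χ (dil r g) := by
  simp only [hfield, leftInvariantField]
  have e : ∀ t : ℝ, dil r (mul β g (t • (single j (1 : ℝ), (0 : Eu d₂)))) =
      mul β (dil r g) ((r * t) • (single j (1 : ℝ), (0 : Eu d₂))) := by
    intro t
    ext1
    · simp [dil, mul, mul_smul]
    · simp only [dil, mul, Prod.smul_mk, smul_zero, add_zero, map_smul, LinearMap.smul_apply,
        smul_add, smul_smul]
      congr 2
      ring
  simp only [e]
  rw [deriv_comp_mul_left r (fun t : ℝ => χ (mul β (dil r g) (t • (single j (1 : ℝ), (0 : Eu d₂))))) 0]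
  simp

omit halt β in
lemma IsTest.comp_dil {χ : 𝔾 → ℂ} (hχ : IsTest χ) {r : ℝ} (hr : r ≠ 0) :
    IsTest fun g => χ (dil r g) := by
  refine ⟨hχ.1.comp ((contDiff_fst.const_smul r).prodMk (contDiff_snd.const_smul (r ^ 2))), ?_⟩
  exact hχ.2.comp_homeomorph ((Homeomorph.smulOfNeZero r hr).prodCongr
    (Homeomorph.smulOfNeZero (r ^ 2) (pow_ne_zero 2 hr)))

omit halt β in
lemma exists_cutoff : ∃ χ : 𝔾 → ℂ, IsTest χ ∧ (∀ g, conj (χ g) = χ g) ∧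
    (∀ g, ‖χ g‖ ≤ 1) ∧ χ 0 = 1 := by
  obtain ⟨f, _, hc, hf, hr, h0⟩ := exists_contDiff_tsupport_subset (n := ⊤)
    (s := (Set.univ : Set 𝔾)) (x := 0) univ_mem
  refine ⟨fun g => (f g : ℂ), ⟨Complex.ofRealCLM.contDiff.comp hf,
    hc.comp_left (g := Complex.ofReal) rfl⟩, fun g => conj_ofReal _, fun g => ?_, by simp [h0]⟩
  have := hr ⟨g, rfl⟩
  rw [norm_real, norm_eq_abs, abs_of_nonneg this.1]
  exact this.2

lemma eq_zero_of_weak_eigen {W : 𝔾 → ℂ} (hW : ContDiff ℝ ∞ W) {z : ℂ} (hz : z.re = 0)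
    (hz1 : ‖z‖ = 1) (heq : ∀ f, IsTest f → ∫ g, W g * 𝓛 β f g = z * ∫ g, W g * f g)
    (hW2 : Integrable fun g => ‖W g‖ ^ 2) : W = 0 := by
  obtain ⟨χ, hχ, hχr, hχ1, hχ0⟩ := exists_cutoff (d₁ := d₁) (d₂ := d₂)
  choose C hC using fun j : Fin d₁ => (hχ.field β (single j 1, 0)).2.exists_bound_of_continuous
    (hχ.field β (single j 1, 0)).1.continuous
  set M := ∫ g, ‖W g‖ ^ 2 with hM
  let r : ℕ → ℝ := fun n => 1 / ((n : ℝ) + 1)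
  have hr : ∀ n, r n ≠ 0 := fun n => by positivity
  have hr0 : Tendsto r atTop (𝓝 0) := tendsto_one_div_add_atTop_nhds_zero_nat
  have hle : ∀ n, ∫ g, ‖χ (dil (r n) g) * W g‖ ^ 2 ≤ 4 * ∑ j, (r n * C j) ^ 2 * M := by
    intro n
    refine (caccioppoli β halt hW hz hz1 heq (hχ.comp_dil (hr n)) fun g => hχr _).trans ?_
    refine mul_le_mul_of_nonneg_left (sum_le_sum fun j _ => ?_) (by norm_num)
    rw [hM, ← integral_const_mul]
    refine integral_mono_of_nonneg (.of_forall fun g => by positivity)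
      (hW2.const_mul _) (.of_forall fun g => ?_)
    simp only [hfield_dil, norm_mul, mul_pow, norm_real, norm_eq_abs, sq_abs]
    gcongr
    exact hC j _
  have hlim1 : Tendsto (fun n => 4 * ∑ j, (r n * C j) ^ 2 * M) atTop
      (𝓝 (4 * ∑ j, (0 * C j) ^ 2 * M)) :=
    (tendsto_finsetSum _ fun j _ => ((hr0.mul_const (C j)).pow 2).mul_const M).const_mul 4
  have hlim2 : Tendsto (fun n => ∫ g, ‖χ (dil (r n) g) * W g‖ ^ 2) atTop (𝓝 M) := by
    refine tendsto_integral_of_dominated_convergence (fun g => ‖W g‖ ^ 2)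
      (fun n => (((hχ.comp_dil (hr n)).1.continuous.mul
        hW.continuous).norm.pow 2).aestronglyMeasurable) hW2
      (fun n => Eventually.of_forall fun g => ?_) (.of_forall fun g => ?_)
    · rw [norm_pow, norm_norm, norm_mul]
      refine pow_le_pow_left₀ (by positivity) ?_ 2
      exact mul_le_of_le_one_left (norm_nonneg _) (hχ1 _)
    · have h1 : Tendsto (fun n => dil (r n) g) atTop (𝓝 0) := by
        have := (hr0.smul_const g.1).prodMk_nhds ((hr0.pow 2).smul_const g.2)
        have e : (0 : 𝔾) = (0, 0) := rfl
        simpa [dil, e] using this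
      have h2 := (((hχ.1.continuous.tendsto 0).comp h1).mul_const (W g)).norm.pow 2
      simpa [hχ0] using h2
  have hM0 : M ≤ 0 := by
    have := le_of_tendsto_of_tendsto' hlim2 hlim1 hle
    simpa using this
  have hM1 : M = 0 := le_antisymm hM0 (integral_nonneg fun g => by positivity)
  rw [hM, integral_eq_zero_iff_of_nonneg (fun g => by positivity) hW2] at hM1
  refine (hW.continuous.ae_eq_iff_eq volume (continuous_const (y := (0 : ℂ)))).mp ?_
  filter_upwards [hM1] with g hg
  simpa using hg

end Sublaplacian

instance {d₁ d₂ : ℕ} : (volume : Measure 𝔾).IsNegInvariant :=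
  Measure.IsAddHaarMeasure.isNegInvariant_of_regular volume

section Regularization

variable {d₁ d₂ : ℕ} (β : 𝔅) (halt : Alt β)

/-- The left regularization `∫ w(y) k(g y⁻¹) dy`. -/
def leftReg (k w : 𝔾 → ℂ) (g : 𝔾) : ℂ := ∫ y : 𝔾, w y * k (mul β g (-y))

include halt

lemma contDiff_leftReg {k w : 𝔾 → ℂ} (hk : IsTest k) (hw : LocallyIntegrable w) :
    ContDiff ℝ ∞ (leftReg β k w) := by
  rw [contDiff_iff_contDiffAt]
  intro p₀
  let K : Set 𝔾 := (fun q : 𝔾 × 𝔾 => mul β (-q.1) q.2) '' (Metric.closedBall p₀ 1 ×ˢ tsupport k)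
  have hK : IsCompact K := ((isCompact_closedBall p₀ 1).prod hk.2.isCompact).image
    (Continuous.mul β continuous_fst.neg continuous_snd)
  have h := contDiffOn_convolution_right_with_param (𝕜 := ℝ) (n := ⊤) (μ := volume)
    (ContinuousLinearMap.mul ℝ ℂ) (g := fun p x => k (mul β p x)) (s := Metric.ball p₀ 1) (k := K)
    Metric.isOpen_ball hK (fun p x hp hx => by
      by_contra h0
      exact hx ⟨(p, mul β p x), ⟨Metric.ball_subset_closedBall hp, subset_tsupport _ h0⟩,
        neg_mul_cancel_left β halt p x⟩) hw
    ((hk.1.comp (ContDiff.mul β contDiff_fst contDiff_snd)).contDiffOn)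
  have h2 := (h.contDiffAt (x := (p₀, 0)) (by
    rw [nhds_prod_eq]
    exact prod_mem_prod (Metric.ball_mem_nhds p₀ one_pos) univ_mem)).comp p₀
      (contDiff_id.prodMk contDiff_const).contDiffAt
  refine h2.congr_of_eventuallyEq (.of_forall fun p => ?_)
  simp only [leftReg, comp_apply, MeasureTheory.convolution, ContinuousLinearMap.mul_apply', zero_sub]
  rfl

lemma integrable_leftReg {k w f : 𝔾 → ℂ} (hk : IsTest k) (hw : LocallyIntegrable w)
    (hf : IsTest f) : Integrable (fun p : 𝔾 × 𝔾 =>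
      w p.2 * k (mul β p.1 (-p.2)) * f p.1) (volume.prod volume) := by
  let K : Set 𝔾 := (fun q : 𝔾 × 𝔾 => mul β (-q.2) q.1) '' (tsupport f ×ˢ tsupport k)
  have hK : IsCompact K := (hf.2.isCompact.prod hk.2.isCompact).image
    (Continuous.mul β continuous_snd.neg continuous_fst)
  obtain ⟨C, hC⟩ := hk.2.exists_bound_of_continuous hk.1.continuous
  have hwK : Integrable (K.indicator fun y => C * ‖w y‖) := by
    rw [integrable_indicator_iff hK.measurableSet]
    exact (hw.integrableOn_isCompact hK).norm.const_mul C
  refine Integrable.mono' ((hf.integrable.norm).mul_prod hwK) ?_ (.of_forall fun p => ?_)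
  · refine ((hw.aestronglyMeasurable.comp_snd).mul ?_).mul ?_
    · exact (hk.1.continuous.comp (Continuous.mul β continuous_fst continuous_snd.neg)).aestronglyMeasurable
    · exact (hf.1.continuous.comp continuous_fst).aestronglyMeasurable
  · have hC0 : 0 ≤ C := (norm_nonneg _).trans (hC 0)
    by_cases h1 : p.1 ∈ tsupport f
    · by_cases h2 : mul β p.1 (-p.2) ∈ tsupport k
      · have : p.2 ∈ K := ⟨(p.1, mul β p.1 (-p.2)), ⟨h1, h2⟩, by
          simp only
          rw [neg_mul_rev β halt, neg_neg, neg_mul_cancel_right β halt]⟩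
        rw [indicator_of_mem this, norm_mul, norm_mul]
        have := hC (mul β p.1 (-p.2))
        calc _ ≤ ‖w p.2‖ * C * ‖f p.1‖ := by gcongr
          _ = _ := by ring
      · rw [image_eq_zero_of_notMem_tsupport h2, mul_zero, zero_mul, norm_zero]
        exact mul_nonneg (norm_nonneg _) (indicator_nonneg (fun y _ => by positivity) _)
    · rw [image_eq_zero_of_notMem_tsupport h1, mul_zero, norm_zero, zero_mul]

lemma integral_leftReg_mul {k w f : 𝔾 → ℂ} (hk : IsTest k) (hw : LocallyIntegrable w)
    (hf : IsTest f) :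
    ∫ g, leftReg β k w g * f g = ∫ g, k g * ∫ y, w y * f (mul β g y) := by
  have hi := integrable_leftReg β halt hk hw hf
  have h1 : ∫ g, leftReg β k w g * f g = ∫ p : 𝔾 × 𝔾, w p.2 * k (mul β p.1 (-p.2)) * f p.1
        ∂(volume.prod volume) := by
    rw [integral_prod _ hi]
    refine integral_ext fun g => ?_
    simp only [leftReg]
    rw [integral_mul_const]
  have hmp := measurePreserving_shear β halt (d₁ := d₁) (d₂ := d₂)
  have hi2 := (hmp.integrable_comp_emb (shear β halt).measurableEmbedding).mpr hi
  have e : ∀ p : 𝔾 × 𝔾,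
      w (shear β halt p).2 * k (mul β (shear β halt p).1 (-(shear β halt p).2)) * f (shear β halt p).1 =
      k p.1 * (w p.2 * f (mul β p.1 p.2)) := by
    intro p
    have h2 : (shear β halt p).2 = p.2 := rfl
    have h3 : (shear β halt p).1 = mul β p.1 p.2 := rfl
    rw [h2, h3, mul_neg_cancel_right β halt]
    ring
  rw [h1, ← hmp.integral_comp (shear β halt).measurableEmbedding]
  simp only [Function.comp_def, e] at hi2 ⊢
  rw [integral_prod _ hi2]
  refine integral_ext fun g => ?_
  exact integral_const_mul (k g) _

lemma integrable_norm_sq_leftReg {k w : 𝔾 → ℂ} (hk : IsTest k)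
    (hw : MemLp w 2 volume) : Integrable fun g => ‖leftReg β k w g‖ ^ 2 := by
  have hwl : LocallyIntegrable w := hw.locallyIntegrable (by norm_num)
  have hw2 : Integrable fun y => ‖w y‖ ^ 2 := hw.integrable_norm_pow (by norm_num)
  obtain ⟨C, hC⟩ := hk.2.exists_bound_of_continuous hk.1.continuous
  have hmp := measurePreserving_shear β halt (d₁ := d₁) (d₂ := d₂)
  have hprod : Integrable (fun p : 𝔾 × 𝔾 =>
      ‖k (mul β p.1 (-p.2))‖ * ‖w p.2‖ ^ 2) (volume.prod volume) := by
    rw [← hmp.integrable_comp_emb (shear β halt).measurableEmbedding]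
    refine (hk.integrable.norm.mul_prod hw2).congr (.of_forall fun p => ?_)
    have h2 : (shear β halt p).2 = p.2 := rfl
    have h3 : (shear β halt p).1 = mul β p.1 p.2 := rfl
    simp only [comp_apply]
    rw [h2, h3, mul_neg_cancel_right β halt]
  have hD := hprod.integral_prod_left
  have hkc : ∀ g, Continuous fun y => k (mul β g (-y)) := fun g =>
    hk.1.continuous.comp (Continuous.mul β continuous_const continuous_neg)
  have hks : ∀ g, HasCompactSupport fun y => k (mul β g (-y)) := fun g =>
    hk.2.comp_homeomorph ((Homeomorph.neg _).trans (leftMul β halt g))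
  have hB : ∀ g, ∫ y, ‖k (mul β g (-y))‖ = ∫ y, ‖k y‖ := by
    intro g
    rw [integral_neg_eq_self (fun y => ‖k (mul β g y)‖) volume,
      integral_mul_left β halt (fun y => ‖k y‖)]
  refine Integrable.mono' (hD.const_mul (∫ y, ‖k y‖))
    ((contDiff_leftReg β halt hk hwl).continuous.norm.pow 2).aestronglyMeasurable
    (.of_forall fun g => ?_)
  have i1 : Integrable fun y => ‖k (mul β g (-y))‖ * ‖w y‖ ^ 2 :=
    hw2.bdd_mul (c := C) (hkc g).norm.aestronglyMeasurable (.of_forall fun y => by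
      rw [norm_norm]; exact hC _)
  have i2 : Integrable fun y => ‖w y‖ * ‖k (mul β g (-y))‖ := by
    have := (integrable_mul_test hwl (hkc g) (hks g)).norm
    simpa only [norm_mul] using this
  have i3 : Integrable fun y => ‖k (mul β g (-y))‖ :=
    ((hkc g).integrable_of_hasCompactSupport (hks g)).norm
  have hquad : ∀ t : ℝ, 0 ≤ (∫ y, ‖k y‖) * (t * t) + (-2 * ∫ y, ‖w y‖ * ‖k (mul β g (-y))‖) * t +
      ∫ y, ‖k (mul β g (-y))‖ * ‖w y‖ ^ 2 := by
    intro t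
    have h1 : 0 ≤ ∫ y, ‖k (mul β g (-y))‖ * (‖w y‖ - t) ^ 2 :=
      integral_nonneg fun y => by positivity
    have h2 : ∀ y, ‖k (mul β g (-y))‖ * (‖w y‖ - t) ^ 2 =
        ‖k (mul β g (-y))‖ * (t * t) + (-2 * (‖w y‖ * ‖k (mul β g (-y))‖)) * t +
          ‖k (mul β g (-y))‖ * ‖w y‖ ^ 2 := fun y => by ring
    simp only [h2] at h1
    have i4 : Integrable fun y => ‖k (mul β g (-y))‖ * (t * t) +
        (-2 * (‖w y‖ * ‖k (mul β g (-y))‖)) * t := (i3.mul_const _).add ((i2.const_mul _).mul_const _)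
    rw [integral_add i4 i1,
      integral_add (i3.mul_const _) ((i2.const_mul _).mul_const _), integral_mul_const,
      integral_mul_const, integral_const_mul, hB] at h1
    exact h1
  have hdisc := discrim_le_zero hquad
  rw [discrim] at hdisc
  have hle : ‖leftReg β k w g‖ ≤ ∫ y, ‖w y‖ * ‖k (mul β g (-y))‖ := by
    refine (norm_integral_le_integral_norm _).trans (le_of_eq ?_)
    simp only [norm_mul]
  rw [norm_pow, norm_norm]
  have h7 := pow_le_pow_left₀ (norm_nonneg _) hle 2
  simp only
  nlinarith

lemma eq_zero_of_inner_sublaplacian {h : L2G d₁ d₂} {z : ℂ} (hz : z.re = 0) (hz1 : ‖z‖ = 1)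
    (H : ∀ f, IsTest f → inner ℂ h (toL2 (𝓛 β f)) = z * inner ℂ h (toL2 f)) : h = 0 := by
  let w : 𝔾 → ℂ := fun g => conj (h g)
  have hw : MemLp w 2 volume := (Lp.memLp h).star
  have hwl : LocallyIntegrable w := hw.locallyIntegrable (by norm_num)
  have Hw : ∀ f, IsTest f → ∫ g, w g * 𝓛 β f g = z * ∫ g, w g * f g := by
    intro f hf
    have := H f hf
    rwa [inner_toL2 _ hf.memLp, inner_toL2 _ (hf.sublaplacian β).memLp] at this
  refine eq_zero_of_forall_inner fun f hf => ?_
  have hk : IsTest fun g => f (-g) := ⟨hf.1.comp contDiff_neg, hf.2.comp_homeomorph (Homeomorph.neg _)⟩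
  have h0 := eq_zero_of_weak_eigen β halt (contDiff_leftReg β halt hk hwl) hz hz1 (fun φ hφ => by
      rw [integral_leftReg_mul β halt hk hwl (hφ.sublaplacian β),
        integral_leftReg_mul β halt hk hwl hφ, ← integral_const_mul]
      refine integral_ext fun g => ?_
      simp only [← sublaplacian_comp_mul_left]
      rw [Hw _ (hφ.comp_mul_left β halt g)]
      ring)
    (integrable_norm_sq_leftReg β halt hk hw)
  have h1 := congrFun h0 0
  simp only [leftReg, zero_mul', neg_neg, Pi.zero_apply] at h1
  rw [inner_toL2 _ hf.memLp]
  exact h1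

lemma isEssSelfAdjoint_sublaplacian : IsEssSelfAdjoint (isSymmOp_sublaplacian β halt).graph := by
  refine (isSymmOp_sublaplacian β halt).isEssSelfAdjoint (fun h hh => ?_) fun h hh => ?_
  · exact eq_zero_of_inner_sublaplacian β halt (z := -I) (by simp) (by simp) hh
  · exact eq_zero_of_inner_sublaplacian β halt (z := I) (by simp) (by simp) hh

end Regularization

/-! ### Existence of the joint resolution -/

section JointExistence

variable {d₁ d₂ : ℕ} (β : 𝔅)

lemma sublaplacian_comp_central (f : 𝔾 → ℂ) (a : Eu d₂) :
    𝓛 β (fun g => f (g + cen a)) = fun g => 𝓛 β f (g + cen a) := by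
  funext g
  simp only [sublaplacian]
  congr 1
  refine sum_congr rfl fun j _ => ?_
  rw [← field_comp_central]
  congr 1
  funext g
  exact field_comp_central β f a _ g

lemma centralDerivative_comp_central (k : Fin d₂) (f : 𝔾 → ℂ) (a : Eu d₂) :
    centralDerivative β k (fun g => f (g + cen a)) = fun g => centralDerivative β k f (g + cen a) := by
  funext g
  simp only [centralDerivative, field_comp_central]

variable (halt : Alt β)

/-- The operators `L, -iU₁, …, -iU_{d₂}`. -/
def jointOp : Option (Fin d₂) → (𝔾 → ℂ) → (𝔾 → ℂ)
  | none => 𝓛 β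
  | some k => centralDerivative β k

include halt

lemma isSymmOp_jointOp (i : Option (Fin d₂)) : IsSymmOp (jointOp β i) := by
  cases i
  exacts [isSymmOp_sublaplacian β halt, isSymmOp_centralDerivative β halt _]

lemma isEssSelfAdjoint_jointOp (i : Option (Fin d₂)) :
    IsEssSelfAdjoint (isSymmOp_jointOp β halt i).graph := by
  cases i
  exacts [isEssSelfAdjoint_sublaplacian β halt, isEssSelfAdjoint_centralDerivative β halt _]

lemma exists_jointResolution : ∃ P : ProjMeasure 𝕊 (L2G d₁ d₂), IsJointResolution β P := by
  choose C hC hinj hadj hnorm using fun i => (isEssSelfAdjoint_jointOp β halt i).exists_resolvent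
  have hτ : ∀ i a, translation (cen a) * C i = C i * translation (cen a) := fun i a =>
    commute_resolvent (hC i) (translation_graph (isSymmOp_jointOp β halt i) (fun a f _ => by
      cases i
      exacts [sublaplacian_comp_central β f a, centralDerivative_comp_central β _ f a]) a)
  have hcomm : ∀ i k, C i * C (some k) = C (some k) * C i := fun i k =>
    commute_resolvent (hC (some k)) (mem_closure_graph_of_commute β halt k fun a => (hτ i a).symm)
  have h1 : ∀ i j, C i * C j = C j * C i := by
    intro i j
    rcases j with _ | k
    · rcases i with _ | l
      · rfl
      · exact (hcomm none l).symm
    · exact hcomm i k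
  have h2 : ∀ i j, C i * star (C j) = star (C j) * C i := by
    intro i j
    have hn : IsStarNormal (C j) := ⟨(hnorm j).symm⟩
    exact hn.commute_star_right (show Commute (C i) (C j) from h1 i j)
  obtain ⟨P, hP⟩ := exists_isIntegralGraph
    (fun i => closure ((isSymmOp_jointOp β halt i).graph : Set (L2G d₁ d₂ × L2G d₁ d₂))) C hC hinj
    hadj h1 h2
  have hm : Measurable fun p : Option (Fin d₂) → ℝ =>
      ((p none, WithLp.toLp 2 fun k => p (some k)) : 𝕊) := by fun_prop
  refine ⟨P.map hm, ?_, fun k => ?_⟩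
  · rw [(isSymmOp_sublaplacian β halt).closureGraph_eq]
    exact ProjMeasure.IsIntegralGraph.map P hm measurable_fst (hP none)
  · rw [(isSymmOp_centralDerivative β halt k).closureGraph_eq]
    refine ProjMeasure.IsIntegralGraph.map P hm (φ := fun p : 𝕊 => p.2 k) ?_ (hP (some k))
    exact (((EuclideanSpace.proj k : Eu d₂ →L[ℝ] ℝ).continuous).comp continuous_snd).measurable

end JointExistence

/-! ### Integration along orthogonal decompositions -/

section Orthogonal

variable {ι : Type*} [Fintype ι] [DecidableEq ι] {E : Type*} [NormedAddCommGroup E]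
  [InnerProductSpace ℝ E] [FiniteDimensional ℝ E] [MeasurableSpace E] [BorelSpace E]
  {V : ι → Submodule ℝ E} (hV : OrthogonalFamily ℝ (fun i => V i) fun i => (V i).subtypeₗᵢ)
  (hI : DirectSum.IsInternal V)
include hV hI

lemma starProjection_sum (v : ∀ i, V i) (i : ι) : (V i).starProjection (∑ k, (v k : E)) = v i := by
  rw [map_sum, sum_eq_single i]
  · exact Submodule.starProjection_eq_self_iff.mpr (v i).2
  · intro k _ hk
    rw [Submodule.starProjection_apply_eq_zero_iff, Submodule.mem_orthogonal]
    intro u hu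
    exact hV (Ne.symm hk) ⟨u, hu⟩ (v k)
  · simp

/-- The decomposition isomorphism of an orthogonal direct sum. -/
lemma exists_sumEquiv : ∃ e : (∀ i, V i) ≃L[ℝ] E, (∀ v, e v = ∑ i, (v i : E)) ∧
    MeasurePreserving e := by
  let e₁ : (∀ i, V i) ≃ₗ[ℝ] E := (WithLp.linearEquiv 2 ℝ (∀ i, V i)).symm.trans
    (hI.isometryL2OfOrthogonalFamily hV).symm.toLinearEquiv
  have he₁ : ∀ v, e₁ v = ∑ i, (v i : E) := fun v =>
    hI.isometryL2OfOrthogonalFamily_symm_apply hV _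
  let e : (∀ i, V i) ≃L[ℝ] E := e₁.toContinuousLinearEquiv
  refine ⟨e, he₁, e.continuous.measurable, ?_⟩
  have hH : (Measure.map e volume).IsAddHaarMeasure := e.isAddHaarMeasure_map _
  have hc := Measure.isAddLeftInvariant_eq_smul (Measure.map e volume) (volume : Measure E)
  set c := Measure.addHaarScalarFactor (Measure.map e volume) (volume : Measure E)
  have hnorm : ∀ v : ∀ i, V i, ‖e v‖ ^ 2 = ∑ i, ‖v i‖ ^ 2 := by
    intro v
    change ‖e₁ v‖ ^ 2 = _
    rw [he₁]
    have := hV.norm_sum v univ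
    simpa using this
  have h1 : ∫ x, exp (-1 * ‖x‖ ^ 2) ∂(Measure.map e volume) = ∫ x : E, exp (-1 * ‖x‖ ^ 2) := by
    rw [integral_map e.continuous.measurable.aemeasurable (by fun_prop),
      GaussianFourier.integral_rexp_neg_mul_sq_norm one_pos]
    simp only [hnorm, mul_sum, exp_sum]
    rw [integral_fintype_prod_volume_eq_prod (fun i (v : V i) => exp (-1 * ‖v‖ ^ 2))]
    simp only [GaussianFourier.integral_rexp_neg_mul_sq_norm one_pos]
    rw [← Real.rpow_sum_of_pos (by positivity)]
    congr 1
    rw [← sum_div]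
    congr 1
    have := e.toLinearEquiv.finrank_eq
    rw [Module.finrank_pi_fintype] at this
    exact_mod_cast this
  rw [hc, integral_smul_nnreal_measure, GaussianFourier.integral_rexp_neg_mul_sq_norm one_pos] at h1
  have hpos : 0 < (π / 1) ^ ((finrank ℝ E : ℝ) / 2) := by positivity
  have h3 : c = 1 := by
    rw [NNReal.smul_def, smul_eq_mul] at h1
    exact_mod_cast mul_right_cancel₀ hpos.ne' (h1.trans (one_mul _).symm)
  rw [hc, h3, one_smul]

lemma integral_prod_starProjection (f : ι → E → ℂ) :
    ∫ x, ∏ i, f i ((V i).starProjection x) = ∏ i, ∫ v : V i, f i v := by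
  obtain ⟨e, he, hm⟩ := exists_sumEquiv hV hI
  rw [← hm.integral_comp e.toHomeomorph.measurableEmbedding]
  simp only [he, starProjection_sum hV hI]
  exact integral_fintype_prod_volume_eq_prod (fun i (v : V i) => f i v)

lemma integrable_prod_starProjection {f : ι → E → ℂ} (hf : ∀ i, Integrable fun v : V i => f i v) :
    Integrable fun x => ∏ i, f i ((V i).starProjection x) := by
  obtain ⟨e, he, hm⟩ := exists_sumEquiv hV hI
  rw [← hm.integrable_comp_emb e.toHomeomorph.measurableEmbedding]
  simp only [Function.comp_def, he, starProjection_sum hV hI]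
  exact Integrable.fintype_prod_dep (f := fun i (v : V i) => f i v) hf

lemma sum_starProjection (x : E) : ∑ i, (V i).starProjection x = x := by
  obtain ⟨e, he, hm⟩ := exists_sumEquiv hV hI
  obtain ⟨v, rfl⟩ := e.surjective x
  simp only [he, starProjection_sum hV hI]

lemma inner_eq_sum_starProjection (x y : E) :
    inner ℝ x y = ∑ i, inner ℝ ((V i).starProjection x) y := by
  rw [← sum_inner, sum_starProjection hV hI]

omit [Fintype ι] [DecidableEq ι] [MeasurableSpace E] [BorelSpace E] hV hI in
lemma inner_starProjection_self (K : Submodule ℝ E) (x : E) :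
    inner ℝ (K.starProjection x) x = ‖K.starProjection x‖ ^ 2 := by
  rw [← real_inner_self_eq_norm_sq]
  have h := Submodule.inner_starProjection_left_eq_right K x (K.starProjection x)
  rw [Submodule.starProjection_eq_self_iff.mpr (starProjection_apply_mem K x)] at h
  rw [h, real_inner_comm]

lemma norm_sq_eq_sum_starProjection (x : E) : ‖x‖ ^ 2 = ∑ i, ‖(V i).starProjection x‖ ^ 2 := by
  rw [← real_inner_self_eq_norm_sq, inner_eq_sum_starProjection hV hI]
  exact sum_congr rfl fun i _ => inner_starProjection_self _ _

end Orthogonal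

/-! ### The eigenspaces of `-J_η²` -/

section Eigenspaces

open Polynomial

variable {d₁ d₂ : ℕ} {β : 𝔅}

lemma inner_J_antisymm (halt : Alt β) (η : Eu d₂) (x y : Eu d₁) :
    inner ℝ (J β η x) y = -inner ℝ x (J β η y) := by
  rw [real_inner_comm (J β η y) x, inner_J, inner_J, bilin_antisymm β halt x y, inner_neg_right]

lemma inner_negJSq (halt : Alt β) (η : Eu d₂) (x y : Eu d₁) :
    inner ℝ (negJSq β η x) y = inner ℝ (J β η x) (J β η y) := by
  simp only [negJSq, LinearMap.neg_apply, Module.End.mul_apply, inner_neg_left]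
  rw [inner_J_antisymm halt, neg_neg]

lemma isSymmetric_negJSq (halt : Alt β) (η : Eu d₂) : (negJSq β η).IsSymmetric := by
  intro x y
  rw [inner_negJSq halt, ← real_inner_comm x, inner_negJSq halt, real_inner_comm]

lemma rootMultiplicity_prod_pow {ι : Type*} [Fintype ι] [DecidableEq ι] {a : ι → ℝ}
    (ha : Function.Injective a) (m : ι → ℕ) (i : ι) :
    (∏ k, (X - C (a k)) ^ m k).rootMultiplicity (a i) = m i := by
  have hne : ∀ k, (X - C (a k)) ^ m k ≠ 0 := fun k => pow_ne_zero _ (X_sub_C_ne_zero _)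
  rw [← count_roots, roots_prod _ _ (prod_ne_zero_iff.mpr fun k _ => hne k), Multiset.count_bind]
  simp only [roots_pow, roots_X_sub_C, Multiset.count_nsmul, Multiset.count_singleton, ha.eq_iff]
  change ∑ k, _ = _
  simp

lemma finrank_eigenspace (halt : Alt β) (η : Eu d₂) (a : ℝ) :
    finrank ℝ (Module.End.eigenspace (negJSq β η) a) =
      (negJSq β η).charpoly.rootMultiplicity a := by
  rw [← LinearMap.finrank_maxGenEigenspace_eq,
    (isSymmetric_negJSq halt η).isFinitelySemisimple.maxGenEigenspace_eq_eigenspace]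

namespace SpectralData

variable (D : SpectralData β)

/-- The numbers `0, b₁, …, b_d`. -/
def ev (η : Eu d₂) : Option (Fin D.d) → ℝ
  | none => 0
  | some j => D.b j η

/-- The multiplicities `r₀, 2 r₁, …, 2 r_d`. -/
def mult : Option (Fin D.d) → ℕ
  | none => D.r₀
  | some j => 2 * D.r j

/-- The eigenspaces of `-J_η²`. -/
def W (η : Eu d₂) (i : Option (Fin D.d)) : Submodule ℝ (Eu d₁) :=
  Module.End.eigenspace (negJSq β η) (D.ev η i ^ 2)

/-- The orthogonal projections onto the eigenspaces of `-J_η²`. -/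
abbrev Pr (η : Eu d₂) (i : Option (Fin D.d)) : Eu d₁ →L[ℝ] Eu d₁ := (D.W η i).starProjection

variable {D} {η : Eu d₂} (hη : η ∈ D.Ω)
include hη

lemma ev_sq_injective : Function.Injective fun i => D.ev η i ^ 2 := by
  intro i k h
  have hpos : ∀ i, 0 ≤ D.ev η i := by
    rintro (_ | j)
    exacts [le_rfl, (D.b_pos j η hη).le]
  have h' : D.ev η i = D.ev η k := (pow_left_inj₀ (hpos i) (hpos k) two_ne_zero).mp h
  rcases i with _ | i <;> rcases k with _ | k
  · rfl
  · exact absurd h'.symm (D.b_pos k η hη).ne'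
  · exact absurd h' (D.b_pos i η hη).ne'
  · by_contra hne
    exact D.b_ne i k (fun h => hne (by rw [h])) η hη h'

lemma charpoly_eq_prod : (negJSq β η).charpoly = ∏ i, (X - C (D.ev η i ^ 2)) ^ D.mult i := by
  rw [D.charpoly_eq η hη, Fintype.prod_option]
  simp [ev, mult]

lemma finrank_W (halt : Alt β) (i : Option (Fin D.d)) : finrank ℝ (D.W η i) = D.mult i := by
  rw [W, finrank_eigenspace halt, charpoly_eq_prod hη]
  exact rootMultiplicity_prod_pow (ev_sq_injective hη) D.mult i

lemma orthogonalFamily_W (halt : Alt β) :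
    OrthogonalFamily ℝ (fun i => D.W η i) fun i => (D.W η i).subtypeₗᵢ :=
  (isSymmetric_negJSq halt η).orthogonalFamily_eigenspaces.comp (ev_sq_injective hη)

lemma isInternal_W (halt : Alt β) : DirectSum.IsInternal (D.W η) := by
  rw [(orthogonalFamily_W hη halt).isInternal_iff, ← le_bot_iff,
    ← (isSymmetric_negJSq halt η).orthogonalComplement_iSup_eigenspaces_eq_bot]
  refine Submodule.orthogonal_le (iSup_le fun μ => ?_)
  by_cases h : ∃ i, D.ev η i ^ 2 = μ
  · obtain ⟨i, rfl⟩ := h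
    exact le_iSup (D.W η) i
  · have : Module.End.eigenspace (negJSq β η) μ = ⊥ := by
      by_contra hne
      have h1 := (Module.End.hasEigenvalue_iff_isRoot_charpoly _ _).mp (Module.End.hasEigenvalue_iff.mpr hne)
      rw [Polynomial.IsRoot.def, charpoly_eq_prod hη, Polynomial.eval_prod, prod_eq_zero_iff] at h1
      obtain ⟨i, _, hi⟩ := h1
      rw [Polynomial.eval_pow, Polynomial.eval_sub, Polynomial.eval_X, Polynomial.eval_C] at hi
      exact h ⟨i, (sub_eq_zero.mp (eq_zero_of_pow_eq_zero hi)).symm⟩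
    rw [this]
    exact bot_le

omit hη in
lemma P_eq (j : Fin D.d) : D.P j η = D.Pr η (some j) := rfl

lemma P₀_eq (halt : Alt β) : D.P₀ η = D.Pr η none := by
  ext1 x
  have h := sum_starProjection (orthogonalFamily_W hη halt) (isInternal_W hη halt) x
  rw [Fintype.sum_option] at h
  simp only [P₀, P_eq, _root_.sub_apply, _root_.sum_apply, one_apply_eq_self]
  exact sub_eq_of_eq_add h.symm

lemma sum_mult : D.r₀ + 2 * ∑ j, D.r j = d₁ := by
  have h := congrArg Polynomial.natDegree (charpoly_eq_prod hη)
  rw [LinearMap.charpoly_natDegree, finrank_euclideanSpace_fin, Polynomial.natDegree_prod _ _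
    (fun k _ => pow_ne_zero _ (Polynomial.X_sub_C_ne_zero _))] at h
  simp only [Polynomial.natDegree_pow, Polynomial.natDegree_X_sub_C, mul_one] at h
  rw [Fintype.sum_option] at h
  rw [mul_sum]
  exact h.symm

lemma norm_J_sq (halt : Alt β) (x : Eu d₁) :
    ‖J β η x‖ ^ 2 = ∑ i, D.ev η i ^ 2 * ‖D.Pr η i x‖ ^ 2 := by
  rw [← real_inner_self_eq_norm_sq, ← inner_negJSq halt]
  nth_rw 1 [← sum_starProjection (orthogonalFamily_W hη halt) (isInternal_W hη halt) x]
  rw [map_sum, sum_inner]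
  refine sum_congr rfl fun i _ => ?_
  have h1 : negJSq β η (D.Pr η i x) = D.ev η i ^ 2 • D.Pr η i x :=
    Module.End.mem_eigenspace_iff.mp (starProjection_apply_mem (D.W η i) x)
  rw [h1, real_inner_smul_left, inner_starProjection_self]

omit hη in
/-- `J_η` commutes with the projections in the weak sense needed below. -/
lemma inner_J_Pr (halt : Alt β) (i : Option (Fin D.d)) (x : Eu d₁) :
    inner ℝ (J β η x) (D.Pr η i x) = 0 := by
  have hmem : ∀ y ∈ D.W η i, J β η y ∈ D.W η i := by
    intro y hy
    have h1 : negJSq β η y = D.ev η i ^ 2 • y := Module.End.mem_eigenspace_iff.mp hy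
    refine Module.End.mem_eigenspace_iff.mpr ?_
    rw [← map_smul, ← h1]
    simp [negJSq]
  have hp := starProjection_apply_mem (D.W η i) x
  have h2 : inner ℝ x (J β η (D.Pr η i x)) = inner ℝ (D.Pr η i x) (J β η (D.Pr η i x)) := by
    rw [Submodule.inner_starProjection_left_eq_right,
      Submodule.starProjection_eq_self_iff.mpr (hmem _ hp)]
  rw [inner_J_antisymm halt, h2, real_inner_comm, inner_J, halt, inner_zero_right, neg_zero]

end SpectralData

end Eigenspaces

/-! ### Sums and power series -/

lemma summable_norm_prod_pi {d : ℕ} (f : Fin d → ℕ → ℂ) (hf : ∀ j, Summable fun n => ‖f j n‖) :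
    (Summable fun n : Fin d → ℕ => ‖∏ j, f j (n j)‖) ∧
      ∑' n : Fin d → ℕ, ∏ j, f j (n j) = ∏ j, ∑' n, f j n := by
  induction d with
  | zero => exact ⟨(hasSum_unique _).summable, by simp [tsum_fintype]⟩
  | succ d ih =>
    obtain ⟨h1, h2⟩ := ih (fun j => f j.succ) fun j => hf _
    let e := Fin.consEquiv (fun _ : Fin (d + 1) => ℕ)
    have he : ∀ p : ℕ × (Fin d → ℕ), ∏ j, f j (e p j) = f 0 p.1 * ∏ j : Fin d, f j.succ (p.2 j) := by
      intro p
      rw [Fin.prod_univ_succ]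
      rfl
    constructor
    · rw [← e.summable_iff]
      simp only [Function.comp_def, he, norm_mul]
      exact (hf 0).mul_of_nonneg h1 (fun _ => norm_nonneg _) fun _ => norm_nonneg _
    · rw [← e.tsum_eq]
      simp only [he]
      rw [Fin.prod_univ_succ, ← h2]
      exact (tsum_mul_tsum_of_summable_norm (hf 0) h1).symm

lemma eq_of_hasSum_pow {c c' : ℕ → ℂ} {G : ℝ → ℂ}
    (h : ∀ s : ℝ, |s| < 1 → HasSum (fun n => (s : ℂ) ^ n * c n) (G s))
    (h' : ∀ s : ℝ, |s| < 1 → HasSum (fun n => (s : ℂ) ^ n * c' n) (G s)) : c = c' := by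
  have key : ∀ {c : ℕ → ℂ}, (∀ s : ℝ, |s| < 1 → HasSum (fun n => (s : ℂ) ^ n * c n) (G s)) →
      HasFPowerSeriesAt G ((fun n => ContinuousMultilinearMap.mkPiRing ℝ (Fin n) (c n) :
        FormalMultilinearSeries ℝ ℝ ℂ)) 0 := by
    intro c h
    refine hasFPowerSeriesAt_iff.mpr ?_
    filter_upwards [Metric.ball_mem_nhds (0 : ℝ) one_pos] with s hs
    have hs' : |s| < 1 := by simpa using hs
    simpa [FormalMultilinearSeries.coeff] using h s hs'
  have heq := (key h).eq_formalMultilinearSeries (key h')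
  funext n
  have := congrArg (fun p => FormalMultilinearSeries.coeff p n) heq
  simpa [FormalMultilinearSeries.coeff] using this

/-! ### The Fourier transform of Laguerre functions -/

section FourierLaguerre

variable {V : Type*} [NormedAddCommGroup V] [InnerProductSpace ℝ V] [FiniteDimensional ℝ V]
  [MeasurableSpace V] [BorelSpace V]

lemma integrable_inv_one_add_norm_sq_div_pow {b : ℝ} (hb : 0 < b) {M : ℕ}
    (hM : finrank ℝ V < M) : Integrable fun v : V => ((1 + ‖v‖ ^ 2 / b) ^ M)⁻¹ := by
  have h := integrable_rpow_neg_one_add_norm_sq (E := V) (μ := volume)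
    (r := 2 * (M : ℝ)) (by have : (finrank ℝ V : ℝ) < M := by exact_mod_cast hM
                           linarith [(Nat.cast_nonneg M : (0 : ℝ) ≤ M)])
  have hs : (√b)⁻¹ ≠ 0 := by positivity
  refine ((integrable_comp_smul_iff volume _ hs).mpr h).congr (.of_forall fun v => ?_)
  have e1 : ‖(√b)⁻¹ • v‖ ^ 2 = ‖v‖ ^ 2 / b := by
    rw [norm_smul, mul_pow, norm_inv, norm_of_nonneg (Real.sqrt_nonneg b), inv_pow, sq_sqrt hb.le]
    ring
  have e2 : -(2 * (M : ℝ)) / 2 = -(M : ℝ) := by ring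
  simp only [e1, e2]
  rw [Real.rpow_neg (by positivity), rpow_natCast]

lemma abs_laguerreFun_le_inv_pow {k M : ℕ} {C : ℝ} {A : ℕ}
    (h : ∀ n t, 0 ≤ t → (1 + t) ^ M * |laguerreFun n k t| ≤ C * (n + 1) ^ A) (n : ℕ) {t : ℝ}
    (ht : 0 ≤ t) : |laguerreFun n k t| ≤ C * (n + 1) ^ A * ((1 + t) ^ M)⁻¹ := by
  rw [← div_eq_mul_inv, le_div_iff₀ (by positivity), mul_comm]
  exact h n t ht

lemma integral_gaussian_mul_cexp {a : ℝ} (ha : 0 < a) (w : V) :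
    ∫ v : V, (exp (-(a * ‖v‖ ^ 2)) : ℂ) * 𝐞(v,w) =
      ((π / a) ^ ((finrank ℝ V : ℝ) / 2) * exp (-(‖w‖ ^ 2 / (4 * a))) : ℝ) := by
  have h := GaussianFourier.integral_cexp_neg_mul_sq_norm_add (b := (a : ℂ)) (by simpa using ha) I w
  rw [I_sq] at h
  have e : ∀ v : V, (exp (-(a * ‖v‖ ^ 2)) : ℂ) * 𝐞(v,w) =
      cexp (-(a : ℂ) * ‖v‖ ^ 2 + I * (inner ℝ w v : ℝ)) := by
    intro v
    rw [real_inner_comm, Complex.exp_add]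
    push_cast
    ring_nf
  simp only [e]
  rw [h]
  push_cast
  rw [Complex.ofReal_cpow (by positivity)]
  push_cast
  congr 2
  ring

lemma continuous_laguerreFun_mul_cexp (n k : ℕ) (b : ℝ) (w : V) :
    Continuous fun v : V => (laguerreFun n k (‖v‖ ^ 2 / b) : ℂ) * 𝐞(v,w) := by
  have h2 : Continuous fun v : V => (laguerreFun n k (‖v‖ ^ 2 / b) : ℂ) :=
    Complex.continuous_ofReal.comp ((continuous_laguerreFun n k).comp
      (show Continuous fun v : V => ‖v‖ ^ 2 / b by fun_prop))
  exact h2.mul (by fun_prop)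

lemma exists_integral_norm_laguerreFun_le (k : ℕ) {b : ℝ} (hb : 0 < b) (w : V) :
    ∃ (C : ℝ) (A : ℕ), ∀ n, Integrable (fun v : V => (laguerreFun n k (‖v‖ ^ 2 / b) : ℂ) * 𝐞(v,w)) ∧
      ∫ v : V, ‖(laguerreFun n k (‖v‖ ^ 2 / b) : ℂ) * 𝐞(v,w)‖ ≤ C * (n + 1) ^ A := by
  obtain ⟨C, A, hC, hA⟩ := exists_pow_mul_laguerreFun_le k (finrank ℝ V + 1)
  have hint := integrable_inv_one_add_norm_sq_div_pow (V := V) hb (Nat.lt_succ_self _)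
  have hbound : ∀ n (v : V), ‖(laguerreFun n k (‖v‖ ^ 2 / b) : ℂ) * 𝐞(v,w)‖ ≤
      C * (n + 1) ^ A * ((1 + ‖v‖ ^ 2 / b) ^ (finrank ℝ V + 1))⁻¹ := by
    intro n v
    rw [norm_mul, mul_comm I, norm_exp_ofReal_mul_I, mul_one, norm_real]
    exact abs_laguerreFun_le_inv_pow hA n (by positivity)
  have hI := fun n : ℕ => (hint.const_mul (C * ((n : ℝ) + 1) ^ A)).mono'
    (continuous_laguerreFun_mul_cexp n k b w).aestronglyMeasurable
    (.of_forall (hbound n))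
  refine ⟨C * ∫ v : V, ((1 + ‖v‖ ^ 2 / b) ^ (finrank ℝ V + 1))⁻¹, A, fun n => ⟨hI n, ?_⟩⟩
  refine (integral_mono (hI n).norm (hint.const_mul _) (hbound n)).trans_eq ?_
  rw [integral_const_mul]
  ring

lemma hasSum_integral_laguerreFun {r : ℕ} (hr : 0 < r) (hV : finrank ℝ V = 2 * r)
    {b : ℝ} (hb : 0 < b) (w : V) {s : ℝ} (hs : |s| < 1) :
    HasSum (fun n : ℕ => (s : ℂ) ^ n * ∫ v : V, (laguerreFun n (r - 1) (‖v‖ ^ 2 / b) : ℂ) * 𝐞(v,w))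
      (((π * b) ^ r * ((1 - s) ^ r)⁻¹ *
        exp (-(b * ‖w‖ ^ 2 / 4 * ((1 + s) / (1 - s)))) : ℝ) : ℂ) := by
  obtain ⟨C, A, hA⟩ := exists_integral_norm_laguerreFun_le (V := V) (r - 1) hb w
  have hs1 : 0 < 1 + s := by linarith [(abs_lt.mp hs).1]
  have hs2 : 0 < 1 - s := by linarith [(abs_lt.mp hs).2]
  have hsum : Summable fun n : ℕ => ∫ v : V, ‖(s : ℂ) ^ n *
      ((laguerreFun n (r - 1) (‖v‖ ^ 2 / b) : ℂ) *
      𝐞(v,w))‖ := by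
    simp only [norm_mul ((s : ℂ) ^ _), norm_pow, norm_real, norm_eq_abs, integral_const_mul]
    have hs' : ‖|s|‖ < 1 := by simpa using hs
    have h0 : Summable fun n : ℕ => ((n + 1 : ℕ) : ℝ) ^ A * |s| ^ (n + 1) :=
      (summable_nat_add_iff (f := fun n : ℕ => (n : ℝ) ^ A * |s| ^ n) 1).mpr
        (summable_pow_mul_geometric_of_norm_lt_one A hs')
    by_cases hs0 : s = 0
    · refine summable_of_ne_finset_zero (s := {0}) fun n hn => ?_
      have : n ≠ 0 := by simpa using hn
      simp [hs0, this]
    have habs : 0 < |s| := abs_pos.mpr hs0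
    refine Summable.of_nonneg_of_le (fun n => mul_nonneg (by positivity)
      (integral_nonneg fun v => norm_nonneg _)) (fun n => ?_) (h0.mul_left (C / |s|))
    refine (mul_le_mul_of_nonneg_left (hA n).2 (by positivity)).trans_eq ?_
    push_cast
    rw [pow_succ |s|]
    field_simp
  have h1 := hasSum_integral_of_summable_integral_norm
    (fun n => (hA n).1.const_mul ((s : ℂ) ^ n)) hsum
  simp only [integral_const_mul] at h1
  have h2 : ∀ v : V, ∑' n : ℕ, (s : ℂ) ^ n * ((laguerreFun n (r - 1) (‖v‖ ^ 2 / b) : ℂ) * 𝐞(v,w)) =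
      (((1 + s) ^ r)⁻¹ : ℝ) * ((exp (-((1 - s) / ((1 + s) * b) * ‖v‖ ^ 2)) : ℂ) * 𝐞(v,w)) := by
    intro v
    have h3 := hasSum_laguerreFun hs (r - 1) (‖v‖ ^ 2 / b)
    rw [Nat.sub_add_cancel hr] at h3
    have h4 := (Complex.hasSum_ofReal.mpr h3).mul_right (𝐞(v,w))
    have e : ‖v‖ ^ 2 / b * ((1 - s) / (1 + s)) = (1 - s) / ((1 + s) * b) * ‖v‖ ^ 2 := by
      field_simp
    rw [e] at h4
    rw [← mul_assoc, ← ofReal_mul, ← h4.tsum_eq]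
    refine tsum_congr fun n => ?_
    push_cast
    ring
  simp only [h2] at h1
  have ha : 0 < (1 - s) / ((1 + s) * b) := by positivity
  rw [integral_const_mul, integral_gaussian_mul_cexp ha, hV, ← ofReal_mul] at h1
  refine (congrArg (HasSum _) (congrArg Complex.ofReal ?_)).mp h1
  have e1 : ((2 * r : ℕ) : ℝ) / 2 = r := by push_cast; ring
  have e2 : ‖w‖ ^ 2 / (4 * ((1 - s) / ((1 + s) * b))) =
      b * ‖w‖ ^ 2 / 4 * ((1 + s) / (1 - s)) := by field_simp
  have e3 : π / ((1 - s) / ((1 + s) * b)) = π * b * ((1 + s) * (1 - s)⁻¹) := by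
    field_simp
  have e4 : (1 + s) ^ r ≠ 0 := by positivity
  rw [e1, rpow_natCast, e2, e3, mul_pow, mul_pow (1 + s), inv_pow]
  calc _ = (((1 + s) ^ r)⁻¹ * (1 + s) ^ r) * ((π * b) ^ r * ((1 - s) ^ r)⁻¹ *
        exp (-(b * ‖w‖ ^ 2 / 4 * ((1 + s) / (1 - s))))) := by ring
    _ = _ := by rw [inv_mul_cancel₀ e4, one_mul]

lemma integral_laguerreFun_mul_cexp {r : ℕ} (hr : 0 < r) (hV : finrank ℝ V = 2 * r)
    {b : ℝ} (hb : 0 < b) (n : ℕ) (w : V) :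
    ∫ v : V, (laguerreFun n (r - 1) (‖v‖ ^ 2 / b) : ℂ) * 𝐞(v,w) =
      ((π * b) ^ r * (-1) ^ n * laguerreFun n (r - 1) (b * ‖w‖ ^ 2 / 4) : ℝ) := by
  refine congrFun (eq_of_hasSum_pow (fun s hs => hasSum_integral_laguerreFun hr hV hb w hs)
    (c' := fun n => ((π * b) ^ r * (-1) ^ n *
      laguerreFun n (r - 1) (b * ‖w‖ ^ 2 / 4) : ℝ)) fun s hs => ?_) n
  have hs' : |-s| < 1 := by rwa [abs_neg]
  have h3 := hasSum_laguerreFun hs' (r - 1) (b * ‖w‖ ^ 2 / 4)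
  rw [Nat.sub_add_cancel hr] at h3
  have h4 := Complex.hasSum_ofReal.mpr (h3.mul_left ((π * b) ^ r))
  have e1 : (π * b) ^ r * (((1 + -s) ^ r)⁻¹ * exp (-(b * ‖w‖ ^ 2 / 4 * ((1 - -s) / (1 + -s))))) =
      (π * b) ^ r * ((1 - s) ^ r)⁻¹ * exp (-(b * ‖w‖ ^ 2 / 4 * ((1 + s) / (1 - s)))) := by
    rw [sub_neg_eq_add, ← sub_eq_add_neg, mul_assoc]
  rw [e1] at h4
  refine h4.congr_fun fun n => ?_
  push_cast
  rw [neg_pow]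
  ring

end FourierLaguerre

/-! ### The series `V` -/

namespace SpectralData

variable {d₁ d₂ : ℕ} {β : 𝔅} (D : SpectralData β)

/-- The numbers `∑ⱼ (2 nⱼ + rⱼ) bⱼ`. -/
def lam (η : Eu d₂) (n : Fin D.d → ℕ) : ℝ := ∑ j, (2 * (n j : ℝ) + D.r j) * D.b j η

/-- The elementary matrix coefficients from which the convolution kernels are built. -/
def coeff (x : Eu d₁) (η : Eu d₂) (ξ : Eu d₁) (n : Fin D.d → ℕ) : ℂ := 𝐞((D.P₀ η ξ),x) *
    (exp (-‖ξ - D.P₀ η ξ‖ ^ 2) * ∏ j, D.b j η ^ D.r j * (-1) ^ n j *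
        laguerreFun (n j) (D.r j - 1) (D.b j η * ‖D.P j η x‖ ^ 2 / 4) : ℝ)

variable {D} {η : Eu d₂} (hη : η ∈ D.Ω)
include hη

lemma lam_nonneg (n : Fin D.d → ℕ) : 0 ≤ D.lam η n :=
  sum_nonneg fun j _ => mul_nonneg (by positivity) (D.b_pos j η hη).le

lemma le_lam (n : Fin D.d → ℕ) (j : Fin D.d) : (2 * (n j : ℝ) + D.r j) * D.b j η ≤ D.lam η n :=
  single_le_sum (f := fun j => (2 * (n j : ℝ) + D.r j) * D.b j η)
    (fun j _ => mul_nonneg (by positivity) (D.b_pos j η hη).le) (mem_univ j)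

lemma succ_mul_le_lam (n : Fin D.d → ℕ) (j : Fin D.d) : ((n j : ℝ) + 1) * D.b j η ≤ D.lam η n := by
  refine le_trans ?_ (le_lam hη n j)
  refine mul_le_mul_of_nonneg_right ?_ (D.b_pos j η hη).le
  have : (1 : ℝ) ≤ D.r j := by exact_mod_cast D.r_pos j
  linarith [(Nat.cast_nonneg (n j) : (0 : ℝ) ≤ n j)]

lemma summable_prod_pow_mul_inv_lam (A : Fin D.d → ℕ) : Summable fun n : Fin D.d → ℕ =>
      (∏ j, ((n j : ℝ) + 1) ^ A j) * ((1 + D.lam η n) ^ (∑ j, (A j + 2)))⁻¹ := by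
  have h := (summable_norm_prod_pi (fun j n => (((D.b j η)⁻¹ ^ (A j + 2) *
    (((n : ℝ) + 1) ^ 2)⁻¹ : ℝ) : ℂ)) fun j => ?_).1
  · refine Summable.of_nonneg_of_le (fun n => ?_) (fun n => ?_) h
    · have := lam_nonneg hη n
      positivity
    · rw [norm_prod]
      have hl := lam_nonneg hη n
      rw [← prod_pow_eq_pow_sum, ← prod_inv_distrib, ← prod_mul_distrib]
      refine prod_le_prod (fun j _ => by positivity) fun j _ => ?_
      have hb := D.b_pos j η hη
      rw [norm_real, norm_of_nonneg (by positivity)]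
      have h1 : (((n j : ℝ) + 1) * D.b j η) ^ (A j + 2) ≤ (1 + D.lam η n) ^ (A j + 2) :=
        pow_le_pow_left₀ (by positivity) (by linarith [succ_mul_le_lam hη n j]) _
      calc ((n j : ℝ) + 1) ^ A j * ((1 + D.lam η n) ^ (A j + 2))⁻¹
          ≤ ((n j : ℝ) + 1) ^ A j * ((((n j : ℝ) + 1) * D.b j η) ^ (A j + 2))⁻¹ := by gcongr
        _ = _ := by
            rw [mul_pow, inv_pow, pow_add ((n j : ℝ) + 1)]
            field_simp
  · have h1 := (summable_nat_add_iff 1).mpr (Real.summable_nat_pow_inv (p := 2).mpr one_lt_two)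
    refine (h1.mul_left ((D.b j η)⁻¹ ^ (A j + 2))).congr fun n => ?_
    have hb := D.b_pos j η hη
    rw [norm_real, norm_of_nonneg (by positivity)]
    push_cast
    rfl

/-- Bound for the terms of the series `V` at a fixed `η`. -/
lemma exists_norm_term_le (halt : Alt β) {H : 𝕊 → ℂ}
    (hH : ∀ M : ℕ, ∃ C, ∀ t, 0 ≤ t → ‖H (t, η)‖ ≤ C * ((1 + t) ^ M)⁻¹) :
    ∃ (a : (Fin D.d → ℕ) → ℝ) (G : Eu d₁ → ℝ), Summable a ∧ Integrable G ∧ (∀ n, 0 ≤ a n) ∧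
      (∀ ξ, 0 ≤ G ξ) ∧ (∀ ξ, G ξ ≤ 1) ∧ ∀ ξ n, ‖D.term H ξ η n‖ ≤ a n * G ξ := by
  choose C A hC hA using fun j : Fin D.d => exists_pow_mul_laguerreFun_le (D.r j - 1) (d₁ + 1)
  obtain ⟨CH, hCH⟩ := hH ((∑ j, (A j + 2)) + (d₁ + 1))
  have hCH0 : 0 ≤ CH := by
    have := (norm_nonneg _).trans (hCH 0 le_rfl)
    simpa using this
  let g : Option (Fin D.d) → Eu d₁ → ℂ := fun i v => match i with
    | none => ((((1 + ‖v‖ ^ 2 / 1) ^ (d₁ + 1))⁻¹ : ℝ) : ℂ)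
    | some j => ((((1 + ‖v‖ ^ 2 / D.b j η) ^ (d₁ + 1))⁻¹ : ℝ) : ℂ)
  have hfin : ∀ i, finrank ℝ (D.W η i) < d₁ + 1 := fun i =>
    Nat.lt_succ_of_le ((Submodule.finrank_le _).trans_eq finrank_euclideanSpace_fin)
  have hg : ∀ i, Integrable fun v : D.W η i => g i v := by
    rintro (_ | j)
    · exact (integrable_inv_one_add_norm_sq_div_pow (V := D.W η none) one_pos (hfin _)).ofReal
    · exact (integrable_inv_one_add_norm_sq_div_pow (V := D.W η (some j)) (D.b_pos j η hη)
        (hfin _)).ofReal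
  have hG := (integrable_prod_starProjection (orthogonalFamily_W hη halt) (isInternal_W hη halt)
    hg).norm
  have hG' : ∀ ξ, ‖∏ i, g i ((D.W η i).starProjection ξ)‖ = ((1 + ‖D.P₀ η ξ‖ ^ 2) ^ (d₁ + 1))⁻¹ *
      ∏ j, ((1 + ‖D.P j η ξ‖ ^ 2 / D.b j η) ^ (d₁ + 1))⁻¹ := by
    intro ξ
    rw [norm_prod, Fintype.prod_option, P₀_eq hη halt]
    congr 1
    · simp only [g, norm_real, div_one]
      exact norm_of_nonneg (by positivity)
    · refine prod_congr rfl fun j _ => ?_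
      have := (D.b_pos j η hη).le
      simp only [g, norm_real]
      exact norm_of_nonneg (by positivity)
  refine ⟨fun n => (CH * ∏ j, C j) * ((∏ j, ((n j : ℝ) + 1) ^ A j) *
    ((1 + D.lam η n) ^ (∑ j, (A j + 2)))⁻¹), _, (summable_prod_pow_mul_inv_lam hη A).mul_left _,
    hG, fun n => ?_, fun ξ => norm_nonneg _, fun ξ => ?_, fun ξ n => ?_⟩
  · have := lam_nonneg hη n
    have := prod_nonneg fun j (_ : j ∈ univ) => hC j
    positivity
  · rw [hG']
    refine mul_le_one₀ (inv_le_one_of_one_le₀ (one_le_pow₀ (by nlinarith [sq_nonneg ‖D.P₀ η ξ‖])))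
      (prod_nonneg fun j _ => ?_) (prod_le_one (fun j _ => ?_) fun j _ => ?_) <;>
      have := (D.b_pos j η hη).le
    · positivity
    · positivity
    · exact inv_le_one_of_one_le₀ (one_le_pow₀ (by
        have : 0 ≤ ‖D.P j η ξ‖ ^ 2 / D.b j η := by positivity
        linarith))
  · rw [hG', term, norm_mul, norm_real, norm_eq_abs, abs_prod]
    have hl := lam_nonneg hη n
    set μ := ‖D.P₀ η ξ‖ ^ 2 with hμ
    have hμ0 : 0 ≤ μ := by positivity
    have h1 : ‖D.multiplier H (fun j => n j) μ η‖ ≤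
        CH * (((1 + D.lam η n) ^ (∑ j, (A j + 2)))⁻¹ * ((1 + μ) ^ (d₁ + 1))⁻¹) := by
      refine (hCH (D.lam η n + μ) (by positivity)).trans ?_
      refine mul_le_mul_of_nonneg_left ?_ hCH0
      rw [pow_add, mul_inv]
      gcongr <;> linarith
    have h2 : ∏ j, |laguerreFun (n j) (D.r j - 1) (‖D.P j η ξ‖ ^ 2 / D.b j η)| ≤
        ∏ j, (C j * (n j + 1) ^ A j * ((1 + ‖D.P j η ξ‖ ^ 2 / D.b j η) ^ (d₁ + 1))⁻¹) :=
      prod_le_prod (fun j _ => abs_nonneg _) fun j _ =>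
        abs_laguerreFun_le_inv_pow (hA j) _ (div_nonneg (by positivity) (D.b_pos j η hη).le)
    refine (mul_le_mul h1 h2 (prod_nonneg fun j _ => abs_nonneg _) (by positivity)).trans_eq ?_
    rw [prod_mul_distrib, prod_mul_distrib]
    ring

omit hη in
lemma continuous_term {H : 𝕊 → ℂ} (hHc : Continuous H) (n : Fin D.d → ℕ) :
    Continuous fun ξ => D.term H ξ η n := by
  unfold term multiplier
  refine (hHc.comp (by fun_prop)).mul (Complex.continuous_ofReal.comp
    (continuous_finsetProd _ fun j _ => (continuous_laguerreFun _ _).comp (by fun_prop)))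

lemma integral_mul_coeff (halt : Alt β) (F : Eu d₁ → ℂ) (x : Eu d₁) (n : Fin D.d → ℕ) :
    ∫ ξ, F (D.P₀ η ξ) * D.coeff x η ξ n = (∫ v : D.W η none, F v * 𝐞((v : Eu d₁),x)) *
        ∏ j, (((π * D.b j η) ^ D.r j * (-1) ^ n j *
          laguerreFun (n j) (D.r j - 1) (D.b j η * ‖D.P j η x‖ ^ 2 / 4) : ℝ) : ℂ) := by
  have hF := orthogonalFamily_W hη halt
  have hI := isInternal_W hη halt
  let g : Option (Fin D.d) → Eu d₁ → ℂ := fun i v => match i with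
    | none => F v * 𝐞(v,x)
    | some j => (exp (-(1 * ‖v‖ ^ 2)) : ℂ) * 𝐞(v,(0 : Eu d₁))
  have hgj : ∀ j, ∫ v : D.W η (some j), g (some j) v = ((π ^ D.r j : ℝ) : ℂ) := by
    intro j
    have h := integral_gaussian_mul_cexp one_pos (0 : D.W η (some j))
    rw [finrank_W hη halt] at h
    have e : ((D.mult (some j) : ℕ) : ℝ) / 2 = D.r j := by simp [mult]
    rw [e] at h
    simp only [norm_zero, div_one, rpow_natCast] at h
    simp only [g, inner_zero_right]
    simp only [inner_zero_right] at h
    refine Eq.trans ?_ (h.trans ?_)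
    · rfl
    · simp
  have h2 : ∀ ξ, F (D.P₀ η ξ) * D.coeff x η ξ n =
      (∏ i, g i ((D.W η i).starProjection ξ)) * ((∏ j, D.b j η ^ D.r j * (-1) ^ n j *
        laguerreFun (n j) (D.r j - 1) (D.b j η * ‖D.P j η x‖ ^ 2 / 4) : ℝ) : ℂ) := by
    intro ξ
    have e : ‖ξ - D.P₀ η ξ‖ ^ 2 = ∑ j, ‖D.Pr η (some j) ξ‖ ^ 2 := by
      have h3 := norm_sq_eq_sum_starProjection hF hI (ξ - D.P₀ η ξ)
      rw [h3, Fintype.sum_option]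
      have h4 : ∀ i, (D.W η i).starProjection (ξ - D.P₀ η ξ) =
          if i = none then 0 else D.Pr η i ξ := by
        intro i
        rw [map_sub, P₀_eq hη halt]
        split_ifs with hi
        · subst hi
          rw [Submodule.starProjection_eq_self_iff.mpr (starProjection_apply_mem _ _), sub_self]
        · have := starProjection_sum hF hI (fun k => if k = none then
            (D.W η k).orthogonalProjectionOnto ξ else 0) i
          simp only [hi, if_false] at this
          rw [Fintype.sum_option] at this
          simp only [if_true, reduceCtorEq, if_false, Submodule.coe_zero, sum_const_zero,
            add_zero] at this
          have h5 : (D.W η i).starProjection (D.Pr η none ξ) = 0 := this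
          rw [h5, sub_zero]
      simp [h4]
    rw [Fintype.prod_option, coeff, e]
    simp only [g, inner_zero_right, ofReal_zero, mul_zero, Complex.exp_zero, mul_one,
      P₀_eq hη halt, one_mul]
    rw [← sum_neg_distrib, exp_sum]
    push_cast
    ring
  simp only [h2]
  rw [integral_mul_const, integral_prod_starProjection hF hI, Fintype.prod_option]
  simp only [hgj]
  rw [mul_assoc]
  congr 1
  push_cast
  rw [← prod_mul_distrib]
  refine prod_congr rfl fun j _ => ?_
  ring

lemma integral_term_mul_cexp (halt : Alt β) (H : 𝕊 → ℂ) (x : Eu d₁) (n : Fin D.d → ℕ) :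
    ∫ ξ, D.term H ξ η n * 𝐞(ξ,x) = ∫ ξ, H (D.lam η n + ‖D.P₀ η ξ‖ ^ 2, η) * D.coeff x η ξ n := by
  have hF := orthogonalFamily_W hη halt
  have hI := isInternal_W hη halt
  let E0 : Eu d₁ → ℂ := fun v => H (D.lam η n + ‖v‖ ^ 2, η) * 𝐞(v,x)
  let f : Option (Fin D.d) → Eu d₁ → ℂ := fun i v => match i with
    | none => E0 v
    | some j => (laguerreFun (n j) (D.r j - 1) (‖v‖ ^ 2 / D.b j η) : ℂ) * 𝐞(v,x)
  have hexp : ∀ ξ, 𝐞(ξ,x) = ∏ i, 𝐞((D.Pr η i ξ),x) := by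
    intro ξ
    rw [← Complex.exp_sum, ← mul_sum, inner_eq_sum_starProjection hF hI]
    push_cast
    rfl
  have h1 : ∀ ξ, D.term H ξ η n * 𝐞(ξ,x) = ∏ i, f i ((D.W η i).starProjection ξ) := by
    intro ξ
    rw [hexp, Fintype.prod_option, Fintype.prod_option, term, P₀_eq hη halt]
    simp only [f, E0, prod_mul_distrib, multiplier, lam, P_eq]
    push_cast
    ring
  have hinner : ∀ i (v : D.W η i), inner ℝ (v : Eu d₁) x =
      inner ℝ v ((D.W η i).orthogonalProjectionOnto x) := by simp
  have hfj : ∀ j, ∫ v : D.W η (some j), f (some j) v = (((π * D.b j η) ^ D.r j * (-1) ^ n j *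
        laguerreFun (n j) (D.r j - 1) (D.b j η * ‖D.P j η x‖ ^ 2 / 4) : ℝ) : ℂ) := by
    intro j
    have h := integral_laguerreFun_mul_cexp (D.r_pos j) (V := D.W η (some j))
      (finrank_W hη halt (some j)) (D.b_pos j η hη) (n j) ((D.W η (some j)).orthogonalProjectionOnto x)
    have e : ‖(D.W η (some j)).orthogonalProjectionOnto x‖ = ‖D.P j η x‖ := rfl
    rw [e] at h
    rw [← h]
    refine integral_ext fun v => ?_
    simp only [f, hinner]
    rfl
  rw [integral_mul_coeff hη halt (fun v => H (D.lam η n + ‖v‖ ^ 2, η))]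
  simp only [h1]
  rw [integral_prod_starProjection hF hI, Fintype.prod_option]
  simp only [hfj]
  rfl

lemma summable_term (halt : Alt β) {H : 𝕊 → ℂ}
    (hH : ∀ M : ℕ, ∃ C, ∀ t, 0 ≤ t → ‖H (t, η)‖ ≤ C * ((1 + t) ^ M)⁻¹) (ξ : Eu d₁) :
    Summable (D.term H ξ η) := by
  obtain ⟨a, G, ha, -, -, -, -, hb⟩ := exists_norm_term_le hη halt hH
  exact Summable.of_norm_bounded (ha.mul_right (G ξ)) fun n => hb ξ n

lemma integrable_V (halt : Alt β) {H : 𝕊 → ℂ} (hHc : Continuous H)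
    (hH : ∀ M : ℕ, ∃ C, ∀ t, 0 ≤ t → ‖H (t, η)‖ ≤ C * ((1 + t) ^ M)⁻¹) :
    Integrable fun ξ => D.V H ξ η := by
  obtain ⟨a, G, ha, hG, ha0, hG0, hG1, hb⟩ := exists_norm_term_le hη halt hH
  have hc : Continuous fun ξ => D.V H ξ η := by
    refine continuous_tsum (fun n => continuous_term hHc n) ha fun n ξ => (hb ξ n).trans ?_
    exact mul_le_of_le_one_right (ha0 n) (hG1 ξ)
  refine (hG.const_mul (∑' n, a n)).mono' hc.aestronglyMeasurable (.of_forall fun ξ => ?_)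
  rw [← tsum_mul_right]
  exact tsum_of_norm_bounded (ha.mul_right (G ξ)).hasSum fun n => hb ξ n

lemma hasSum_integral_coeff (halt : Alt β) {H : 𝕊 → ℂ} (hHc : Continuous H)
    (hH : ∀ M : ℕ, ∃ C, ∀ t, 0 ≤ t → ‖H (t, η)‖ ≤ C * ((1 + t) ^ M)⁻¹) (x : Eu d₁) :
    HasSum (fun n => ∫ ξ, H (D.lam η n + ‖D.P₀ η ξ‖ ^ 2, η) * D.coeff x η ξ n)
      (∫ ξ, D.V H ξ η * 𝐞(ξ,x)) := by
  obtain ⟨a, G, ha, hG, ha0, hG0, hG1, hb⟩ := exists_norm_term_le hη halt hH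
  have hnorm : ∀ n ξ, ‖D.term H ξ η n * 𝐞(ξ,x)‖ ≤ a n * G ξ := by simp; grind
  have hI : ∀ n, Integrable fun ξ => D.term H ξ η n * 𝐞(ξ,x) := fun n =>
    (hG.const_mul (a n)).mono' (((continuous_term hHc n).mul (by fun_prop)).aestronglyMeasurable)
      (.of_forall (hnorm n))
  have h := hasSum_integral_of_summable_integral_norm hI
    (Summable.of_nonneg_of_le (fun n => integral_nonneg fun ξ => norm_nonneg _) (fun n => by
      rw [← integral_const_mul (a n)]
      exact integral_mono (hI n).norm (hG.const_mul (a n)) (hnorm n))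
      (ha.mul_right (∫ ξ, G ξ)) |> fun h => by simpa only [integral_const_mul] using h)
  simp only [integral_term_mul_cexp hη halt] at h
  have e : ∀ ξ, D.V H ξ η * 𝐞(ξ,x) = ∑' n, D.term H ξ η n * 𝐞(ξ,x) := fun ξ =>
    tsum_mul_right.symm
  simp only [e]
  exact h

end SpectralData

lemma integral_count_prod {N E : Type*} [Countable N] [MeasurableSpace N]
    [MeasurableSingletonClass N] [MeasurableSpace E] {μ : Measure E} [SFinite μ] {f : N × E → ℂ}
    (hf : Integrable f (Measure.count.prod μ)) :
    ∫ p, f p ∂(Measure.count.prod μ) = ∑' n, ∫ x, f (n, x) ∂μ := by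
  rw [integral_prod _ hf, integral_countable hf.integral_prod_left]
  simp

lemma IsZariskiOpen.isOpen {n : ℕ} {Ω : Set (Eu n)} (h : IsZariskiOpen Ω) : IsOpen Ω := by
  obtain ⟨S, rfl⟩ := h
  have : {η : Eu n | ∃ q ∈ S, MvPolynomial.eval (fun k => η k) q ≠ 0} =
      ⋃ q ∈ S, {η : Eu n | MvPolynomial.eval (fun k => η k) q ≠ 0} := by
    ext; simp
  rw [this]
  refine isOpen_biUnion fun q _ => ?_
  exact isOpen_ne_fun ((MvPolynomial.continuous_eval q).comp (by fun_prop)) continuous_const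

lemma exp_neg_le_inv_pow (M : ℕ) {q : ℝ} (hq : 0 ≤ q) :
    exp (-q) ≤ M.factorial * exp 1 * ((1 + q) ^ M)⁻¹ := by
  have h := Real.pow_div_factorial_le_exp (1 + q) (by linarith) M
  have hf : (0 : ℝ) < M.factorial := by positivity
  rw [div_le_iff₀ hf] at h
  rw [← div_eq_mul_inv, le_div_iff₀ (by positivity)]
  calc exp (-q) * (1 + q) ^ M ≤ exp (-q) * (exp (1 + q) * M.factorial) := by gcongr
    _ = _ := by
        rw [Real.exp_add]
        have := Real.exp_neg q
        have h2 := Real.exp_ne_zero q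
        rw [this]
        field_simp

lemma continuous_J_apply {d₁ d₂ : ℕ} (β : 𝔅) : Continuous fun p : ℙ => J β p.1 p.2 := by
  simp only [J, LinearMap.coe_mk, AddHom.coe_mk]
  refine continuous_finsetSum _ fun j _ => ?_
  have h : Continuous fun p : ℙ => β p.2 (single j 1) :=
    Continuous.bilin β continuous_snd continuous_const
  have h' : Continuous fun p : ℙ =>
    inner ℝ p.1 (β p.2 (single j 1)) := continuous_fst.inner h
  exact h'.smul (continuous_const (y := single j (1 : ℝ)))

namespace SpectralData

variable {d₁ d₂ : ℕ} {β : 𝔅} (D : SpectralData β)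

lemma measurableSet_Ω : MeasurableSet D.Ω := D.zariskiOpen.isOpen.measurableSet

lemma continuousOn_ev (i : Option (Fin D.d)) : ContinuousOn (fun η => D.ev η i) D.Ω := by
  rcases i with _ | j
  exacts [continuousOn_const, D.b_cont j]

/-- The spectral projections depend continuously on `η ∈ Ω`. -/
lemma continuousOn_Pr (halt : Alt β) (i : Option (Fin D.d)) :
    ContinuousOn (fun p : ℙ => D.Pr p.1 i p.2) (D.Ω ×ˢ Set.univ) := by
  classical
  have hev : ∀ i, ContinuousOn (fun p : ℙ => D.ev p.1 i) (D.Ω ×ˢ Set.univ) := fun i =>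
    (D.continuousOn_ev i).comp continuousOn_fst fun p hp => hp.1
  obtain ⟨T, hT, hTc⟩ : ∃ T : ℙ → Eu d₁, (∀ p, T p = J β p.1 p.2) ∧ Continuous T :=
    ⟨_, fun p => rfl, continuous_J_apply β⟩
  have key : ∀ s : Finset (Option (Fin D.d)), ∃ F : ℙ → Eu d₁,
      ContinuousOn F (D.Ω ×ˢ Set.univ) ∧ ∀ p ∈ D.Ω ×ˢ (Set.univ : Set (Eu d₁)),
        F p = ∑ i, (∏ k ∈ s, (D.ev p.1 i ^ 2 - D.ev p.1 k ^ 2)) • D.Pr p.1 i p.2 := by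
    intro s
    induction s using Finset.induction_on with
    | empty =>
      refine ⟨fun p => p.2, continuousOn_snd, fun p hp => ?_⟩
      simp only [prod_empty, one_smul]
      exact (sum_starProjection (orthogonalFamily_W hp.1 halt) (isInternal_W hp.1 halt) p.2).symm
    | insert k s hk ih =>
      obtain ⟨F, hF, hF'⟩ := ih
      refine ⟨fun p => -T (p.1, T (p.1, F p)) - D.ev p.1 k ^ 2 • F p, ?_, fun p hp => ?_⟩
      · have h1 : ContinuousOn (fun p => T (p.1, F p)) (D.Ω ×ˢ (Set.univ : Set (Eu d₁))) :=
          hTc.comp_continuousOn (continuousOn_fst.prodMk hF)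
        have h2 : ContinuousOn (fun p => T (p.1, T (p.1, F p)))
            (D.Ω ×ˢ (Set.univ : Set (Eu d₁))) := hTc.comp_continuousOn (continuousOn_fst.prodMk h1)
        exact h2.neg.sub (((hev k).pow 2).smul hF)
      · have h1 : ∀ i, negJSq β p.1 (D.Pr p.1 i p.2) = D.ev p.1 i ^ 2 • D.Pr p.1 i p.2 := fun i =>
          Module.End.mem_eigenspace_iff.mp (starProjection_apply_mem (D.W p.1 i) p.2)
        have h2 : -T (p.1, T (p.1, F p)) = negJSq β p.1 (F p) := by
          rw [hT, hT]
          rfl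
        beta_reduce
        rw [h2, hF' p hp, map_sum, smul_sum, ← sum_sub_distrib]
        refine sum_congr rfl fun i _ => ?_
        rw [map_smul, h1, prod_insert hk]
        module
  obtain ⟨F, hF, hF'⟩ := key (univ.erase i)
  have hne : ∀ p ∈ D.Ω ×ˢ (Set.univ : Set (Eu d₁)),
      ∏ k ∈ univ.erase i, (D.ev p.1 i ^ 2 - D.ev p.1 k ^ 2) ≠ 0 := by
    intro p hp
    refine prod_ne_zero_iff.mpr fun k hk => sub_ne_zero.mpr fun h => ?_
    exact ne_of_mem_erase hk (ev_sq_injective hp.1 h).symm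
  have hc : ContinuousOn (fun p : ℙ =>
      (∏ k ∈ univ.erase i, (D.ev p.1 i ^ 2 - D.ev p.1 k ^ 2))⁻¹ • F p)
      (D.Ω ×ˢ Set.univ) :=
    ((continuousOn_finsetProd _ fun k _ => ((hev i).pow 2).sub ((hev k).pow 2)).inv₀ hne).smul hF
  refine hc.congr fun p hp => ?_
  beta_reduce
  rw [hF' p hp, sum_eq_single i, smul_smul, inv_mul_cancel₀ (hne p hp), one_smul]
  · intro k _ hk
    rw [prod_eq_zero (mem_erase.mpr ⟨hk, mem_univ k⟩) (sub_self _), zero_smul]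
  · simp

lemma continuousOn_P₀ (halt : Alt β) : ContinuousOn (fun p : ℙ => D.P₀ p.1 p.2) (D.Ω ×ˢ Set.univ) :=
  (D.continuousOn_Pr halt none).congr fun p hp => by rw [P₀_eq hp.1 halt]

/-- The exponent of decay of the weights below. -/
def deg : ℕ := (∑ j, (D.r j + 1)) + (d₁ + 1)

/-- The weights `∏ⱼ (1 / (1 + nⱼ bⱼ) - 1 / (1 + (nⱼ + 1) bⱼ))`. -/
def tau (η : Eu d₂) (n : Fin D.d → ℕ) : ℝ :=
  ∏ j, ((1 + n j * D.b j η)⁻¹ - (1 + ((n j : ℝ) + 1) * D.b j η)⁻¹)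

lemma tau_factor_eq {b : ℝ} (hb : 0 < b) (n : ℕ) :
    (1 + n * b)⁻¹ - (1 + ((n : ℝ) + 1) * b)⁻¹ = b / ((1 + n * b) * (1 + ((n : ℝ) + 1) * b)) := by
  have h1 : 1 + n * b ≠ 0 := by positivity
  have h2 : 1 + ((n : ℝ) + 1) * b ≠ 0 := by positivity
  field_simp
  ring

lemma hasSum_tau_factor {b : ℝ} (hb : 0 < b) :
    HasSum (fun n : ℕ => (1 + n * b)⁻¹ - (1 + ((n : ℝ) + 1) * b)⁻¹) 1 := by
  rw [hasSum_iff_tendsto_nat_of_nonneg]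
  · have h : ∀ N : ℕ, ∑ n ∈ range N, ((1 + n * b)⁻¹ - (1 + ((n : ℝ) + 1) * b)⁻¹) =
        1 - (1 + N * b)⁻¹ := by
      intro N
      have := sum_range_sub' (fun n : ℕ => (1 + n * b)⁻¹) N
      push_cast at this
      simpa using this
    simp only [h]
    have h1 : Tendsto (fun N : ℕ => 1 + N * b) atTop atTop :=
      tendsto_atTop_add_const_left _ _ (tendsto_natCast_atTop_atTop.atTop_mul_const hb)
    simpa using tendsto_const_nhds.sub h1.inv_tendsto_atTop
  · intro n
    rw [tau_factor_eq hb]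
    positivity

variable {D} in
lemma tau_nonneg {η : Eu d₂} (hη : η ∈ D.Ω) (n : Fin D.d → ℕ) : 0 ≤ D.tau η n := by
  refine prod_nonneg fun j _ => ?_
  have := D.b_pos j η hη
  rw [tau_factor_eq this]
  positivity

variable {D} in
lemma hasSum_tau {η : Eu d₂} (hη : η ∈ D.Ω) : HasSum (D.tau η) 1 := by
  have h1 := fun j => hasSum_tau_factor (D.b_pos j η hη)
  have h := summable_norm_prod_pi (fun j n => (((1 + n * D.b j η)⁻¹ -
    (1 + ((n : ℝ) + 1) * D.b j η)⁻¹ : ℝ) : ℂ)) fun j => by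
      simp only [norm_real]
      exact (h1 j).summable.norm
  have h2 := h.1.of_norm.hasSum
  rw [h.2] at h2
  have h3 : ∀ j, ∑' n : ℕ, (((1 + n * D.b j η)⁻¹ -
    (1 + ((n : ℝ) + 1) * D.b j η)⁻¹ : ℝ) : ℂ) = 1 := fun j => by
      rw [← Complex.ofReal_tsum, (h1 j).tsum_eq, Complex.ofReal_one]
  simp only [h3, prod_const_one] at h2
  rw [← hasSum_ofReal]
  simpa [tau] using h2

variable {D} in
lemma exists_norm_coeff_le : ∃ C, 0 ≤ C ∧ ∀ η ∈ D.Ω, ∀ (x ξ : Eu d₁) (n : Fin D.d → ℕ),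
    ‖D.coeff x η ξ n‖ ≤ C * (1 + (D.lam η n + ‖D.P₀ η ξ‖ ^ 2)) ^ D.deg *
      (D.tau η n * ((1 + ‖ξ‖ ^ 2 / 1) ^ (d₁ + 1))⁻¹) := by
  refine ⟨(d₁ + 1).factorial * exp 1 * 2 ^ (d₁ + 1), by positivity, fun η hη x ξ n => ?_⟩
  have hl := lam_nonneg hη n
  set p := ‖D.P₀ η ξ‖ with hp
  set q := ‖ξ - D.P₀ η ξ‖ with hq
  set F := 1 + (D.lam η n + p ^ 2) with hF
  have hp0 : 0 ≤ p := norm_nonneg _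
  have hq0 : 0 ≤ q := norm_nonneg _
  have hF1 : 1 ≤ F := by rw [hF]; nlinarith
  have h1 : ∏ j, |D.b j η ^ D.r j * (-1) ^ n j *
      laguerreFun (n j) (D.r j - 1) (D.b j η * ‖D.P j η x‖ ^ 2 / 4)| ≤
      ∏ j, (F ^ (D.r j + 1) * ((1 + n j * D.b j η)⁻¹ - (1 + ((n j : ℝ) + 1) * D.b j η)⁻¹)) := by
    refine prod_le_prod (fun j _ => abs_nonneg _) fun j _ => ?_
    have hb := D.b_pos j η hη
    rw [tau_factor_eq hb, abs_mul, abs_mul, abs_pow, abs_pow, abs_neg, abs_one, one_pow, mul_one,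
      abs_of_pos hb]
    have h2 : |laguerreFun (n j) (D.r j - 1) (D.b j η * ‖D.P j η x‖ ^ 2 / 4)| ≤
        ((n j : ℝ) + 1) ^ (D.r j - 1) :=
      (abs_laguerreFun_le (by positivity) _ _).trans (choose_le_pow_succ _ _)
    have h3 : ((n j : ℝ) + 1) * D.b j η ≤ F := by
      have := succ_mul_le_lam hη n j
      rw [hF]; nlinarith
    have h5 : 1 + ((n j : ℝ) + 1) * D.b j η ≤ F := by
      have := succ_mul_le_lam hη n j
      rw [hF]; nlinarith
    have h4 : 1 + (n j : ℝ) * D.b j η ≤ F := by nlinarith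
    have e1 : D.r j = (D.r j - 1) + 1 := (Nat.sub_add_cancel (D.r_pos j)).symm
    have e2 : D.r j + 1 = (D.r j - 1) + 2 := by have := D.r_pos j; omega
    rw [← mul_div_assoc, le_div_iff₀ (by positivity)]
    calc D.b j η ^ D.r j * |laguerreFun (n j) (D.r j - 1) (D.b j η * ‖D.P j η x‖ ^ 2 / 4)| *
          ((1 + n j * D.b j η) * (1 + ((n j : ℝ) + 1) * D.b j η))
        ≤ D.b j η ^ D.r j * ((n j : ℝ) + 1) ^ (D.r j - 1) * (F * F) := by gcongr
      _ = D.b j η * (((n j : ℝ) + 1) * D.b j η) ^ (D.r j - 1) * (F * F) := by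
          nth_rw 1 [e1]
          rw [pow_succ, mul_pow]
          ring
      _ ≤ D.b j η * F ^ (D.r j - 1) * (F * F) := by gcongr
      _ = _ := by rw [e2]; ring
  have h2 : exp (-q ^ 2) ≤ (d₁ + 1).factorial * exp 1 * 2 ^ (d₁ + 1) *
      (F ^ (d₁ + 1) * ((1 + ‖ξ‖ ^ 2 / 1) ^ (d₁ + 1))⁻¹) := by
    refine (exp_neg_le_inv_pow (d₁ + 1) (sq_nonneg q)).trans ?_
    rw [mul_assoc _ ((2 : ℝ) ^ (d₁ + 1))]
    refine mul_le_mul_of_nonneg_left ?_ (by positivity)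
    rw [← mul_assoc, ← div_eq_mul_inv, inv_eq_one_div, div_le_div_iff₀ (by positivity)
      (by positivity), one_mul, ← mul_pow, ← mul_pow]
    refine pow_le_pow_left₀ (by positivity) ?_ _
    have h3 : ‖ξ‖ ≤ p + q := by
      have := norm_add_le (D.P₀ η ξ) (ξ - D.P₀ η ξ)
      rwa [add_sub_cancel] at this
    have h4 : ‖ξ‖ ^ 2 ≤ 2 * p ^ 2 + 2 * q ^ 2 := by
      have := pow_le_pow_left₀ (norm_nonneg ξ) h3 2
      nlinarith [sq_nonneg (p - q)]
    have h5 : 1 + p ^ 2 ≤ F := by rw [hF]; linarith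
    nlinarith [sq_nonneg p, sq_nonneg q, mul_nonneg (sq_nonneg p) (sq_nonneg q),
      mul_le_mul_of_nonneg_right h5 (by positivity : 0 ≤ 1 + q ^ 2)]
  rw [coeff, norm_mul, mul_comm I, norm_exp_ofReal_mul_I, one_mul,
    norm_real, norm_eq_abs, abs_mul, abs_of_pos (exp_pos _), abs_prod]
  refine (mul_le_mul h2 h1 (prod_nonneg fun j _ => abs_nonneg _) (by positivity)).trans_eq ?_
  rw [prod_mul_distrib, prod_pow_eq_pow_sum, deg, tau, pow_add]
  ring

/-! ### Kernels as integrals over the spectral parameters -/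

/-- The space of the parameters `(η, (n, ξ))`. -/
abbrev Param : Type := Eu d₂ × ((Fin D.d → ℕ) × Eu d₁)

/-- Lebesgue measure times counting measure. -/
abbrev pvol : Measure D.Param := volume.prod (Measure.count.prod volume)

/-- The point of the joint spectrum belonging to a parameter. -/
def loc (z : D.Param) : 𝕊 := (D.Ω.indicator (fun η => D.lam η z.2.1 + ‖D.P₀ η z.2.2‖ ^ 2) z.1, z.1)

/-- The elementary functions on the group. -/
def elem (z : D.Param) (g : 𝔾) : ℂ := D.Ω.indicator (fun η => D.coeff g.1 η z.2.2 z.2.1 *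
    𝐞(η,g.2)) z.1

/-- The weight which dominates the elementary functions. -/
def weight (z : D.Param) : ℝ :=
  D.Ω.indicator (fun η => D.tau η z.2.1 * ((1 + ‖z.2.2‖ ^ 2 / 1) ^ (d₁ + 1))⁻¹) z.1

lemma loc_nonneg (z : D.Param) : 0 ≤ (D.loc z).1 := by
  unfold loc
  by_cases hz : z.1 ∈ D.Ω
  · rw [indicator_of_mem hz]
    exact add_nonneg (lam_nonneg hz _) (sq_nonneg _)
  · rw [indicator_of_notMem hz]

lemma weight_nonneg (z : D.Param) : 0 ≤ D.weight z := by
  unfold weight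
  by_cases hz : z.1 ∈ D.Ω
  · rw [indicator_of_mem hz]
    exact mul_nonneg (tau_nonneg hz _) (by positivity)
  · rw [indicator_of_notMem hz]

lemma exists_norm_elem_le : ∃ C, 0 ≤ C ∧ ∀ z g,
    ‖D.elem z g‖ ≤ C * (1 + (D.loc z).1) ^ D.deg * D.weight z := by
  obtain ⟨C, hC, h⟩ := D.exists_norm_coeff_le
  refine ⟨C, hC, fun z g => ?_⟩
  by_cases hz : z.1 ∈ D.Ω
  · simp only [elem, loc, weight, indicator_of_mem hz]
    rw [norm_mul, mul_comm I, norm_exp_ofReal_mul_I, mul_one]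
    exact h _ hz _ _ _
  · simp [elem, weight, indicator_of_notMem hz]

lemma measurable_indicator_of_continuousOn {X Y : Type*} [TopologicalSpace X] [MeasurableSpace X]
    [OpensMeasurableSpace X] [TopologicalSpace Y] [MeasurableSpace Y] [BorelSpace Y] [Zero Y]
    {s : Set X} (hs : MeasurableSet s) {f : X → Y} (hf : ContinuousOn f s) :
    Measurable (s.indicator f) := by
  classical
  have := hf.measurable_piecewise (g := 0) continuousOn_const hs
  rwa [Set.piecewise_eq_indicator] at this

lemma measurable_param {X Y : Type*} [MeasurableSpace X] [MeasurableSpace Y] {f : D.Param × X → Y}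
    (hf : ∀ n, Measurable fun p : ℙ × X => f ((p.1.1, (n, p.1.2)), p.2)) :
    Measurable f := by
  have h : Measurable fun q : (ℙ × X) × (Fin D.d → ℕ) =>
      f ((q.1.1.1, (q.2, q.1.1.2)), q.1.2) := measurable_from_prod_countable_left hf
  exact h.comp (f := fun p : D.Param × X => (((p.1.1, p.1.2.2), p.2), p.1.2.1)) (by fun_prop)

lemma continuousOn_lam (n : Fin D.d → ℕ) : ContinuousOn (fun η => D.lam η n) D.Ω :=
  continuousOn_finsetSum _ fun j _ => continuousOn_const.mul (D.b_cont j)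

lemma continuousOn_coeff (halt : Alt β) (n : Fin D.d → ℕ) :
    ContinuousOn (fun p : Eu d₂ × Eu d₁ × Eu d₁ => D.coeff p.2.1 p.1 p.2.2 n)
      (D.Ω ×ˢ Set.univ) := by
  have h0 : ContinuousOn (fun p : Eu d₂ × Eu d₁ × Eu d₁ => D.P₀ p.1 p.2.2)
      (D.Ω ×ˢ Set.univ) := (D.continuousOn_P₀ halt).comp (f := fun p : Eu d₂ × Eu d₁ × Eu d₁ =>
        (p.1, p.2.2)) (by fun_prop) fun p hp => ⟨hp.1, trivial⟩
  have hj : ∀ j, ContinuousOn (fun p : Eu d₂ × Eu d₁ × Eu d₁ => D.P j p.1 p.2.1)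
      (D.Ω ×ˢ Set.univ) := fun j => (D.continuousOn_Pr halt (some j)).comp
        (f := fun p : Eu d₂ × Eu d₁ × Eu d₁ => (p.1, p.2.1)) (by fun_prop)
        fun p hp => ⟨hp.1, trivial⟩
  have hb : ∀ j, ContinuousOn (fun p : Eu d₂ × Eu d₁ × Eu d₁ => D.b j p.1) (D.Ω ×ˢ Set.univ) :=
    fun j => (D.b_cont j).comp continuousOn_fst fun p hp => hp.1
  refine ContinuousOn.mul ?_ (Complex.continuous_ofReal.comp_continuousOn (ContinuousOn.mul ?_
    (continuousOn_finsetProd _ fun j _ => ContinuousOn.mul ?_ ?_)))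
  · exact Complex.continuous_exp.comp_continuousOn (continuousOn_const.mul
      (Complex.continuous_ofReal.comp_continuousOn (h0.inner (by fun_prop))))
  · exact Real.continuous_exp.comp_continuousOn ((((by fun_prop :
      ContinuousOn (fun p : Eu d₂ × Eu d₁ × Eu d₁ => p.2.2) _).sub h0).norm.pow 2).neg)
  · exact ((hb j).pow _).mul continuousOn_const
  · exact (continuous_laguerreFun _ _).comp_continuousOn
      (((hb j).mul ((hj j).norm.pow 2)).div_const 4)

lemma measurable_elem (halt : Alt β) : Measurable fun p : D.Param × 𝔾 => D.elem p.1 p.2 := by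
  refine D.measurable_param fun n => ?_
  have hs : MeasurableSet {p : ℙ × 𝔾 | p.1.1 ∈ D.Ω} := D.measurableSet_Ω.preimage (by fun_prop)
  refine measurable_indicator_of_continuousOn hs (f := fun p => D.coeff p.2.1 p.1.1 p.1.2 n *
    𝐞(p.1.1,p.2.2)) (ContinuousOn.mul ?_ ?_)
  · exact (D.continuousOn_coeff halt n).comp (f := fun p : ℙ × 𝔾 =>
      (p.1.1, p.2.1, p.1.2)) (by fun_prop) fun p hp => ⟨hp, trivial⟩
  · fun_prop

lemma measurable_loc (halt : Alt β) : Measurable D.loc := by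
  have h : Measurable fun p : D.Param × Unit => D.loc p.1 := by
    refine D.measurable_param fun n => Measurable.prodMk ?_ (by dsimp [loc]; fun_prop)
    have hs : MeasurableSet {p : ℙ × Unit | p.1.1 ∈ D.Ω} := D.measurableSet_Ω.preimage (by fun_prop)
    refine measurable_indicator_of_continuousOn hs
      (f := fun p => D.lam p.1.1 n + ‖D.P₀ p.1.1 p.1.2‖ ^ 2) (ContinuousOn.add ?_ ?_)
    · exact (D.continuousOn_lam n).comp (by fun_prop) fun p hp => hp
    · exact ((D.continuousOn_P₀ halt).comp (f := fun p : ℙ × Unit => p.1)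
        (by fun_prop) fun p hp => ⟨hp, trivial⟩).norm.pow 2
  exact h.comp (f := fun z : D.Param => (z, ())) (by fun_prop)

lemma measurable_weight : Measurable D.weight := by
  have h : Measurable fun p : D.Param × Unit => D.weight p.1 := by
    refine D.measurable_param fun n => ?_
    have hs : MeasurableSet {p : ℙ × Unit | p.1.1 ∈ D.Ω} := D.measurableSet_Ω.preimage (by fun_prop)
    refine measurable_indicator_of_continuousOn hs
      (f := fun p => D.tau p.1.1 n * ((1 + ‖p.1.2‖ ^ 2 / 1) ^ (d₁ + 1))⁻¹)
      (ContinuousOn.mul ?_ ?_)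
    · refine continuousOn_finsetProd _ fun j _ => ?_
      have hb : ContinuousOn (fun p : ℙ × Unit => D.b j p.1.1) {p | p.1.1 ∈ D.Ω} :=
        (D.b_cont j).comp (by fun_prop) fun p hp => hp
      refine ContinuousOn.sub (ContinuousOn.inv₀ (continuousOn_const.add
        (continuousOn_const.mul hb)) fun p hp => ?_) (ContinuousOn.inv₀ (continuousOn_const.add
        (continuousOn_const.mul hb)) fun p hp => ?_) <;>
      · have := D.b_pos j p.1.1 hp
        positivity
    · refine Continuous.continuousOn (Continuous.inv₀ (by fun_prop) fun p => by positivity)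
  exact h.comp (f := fun z : D.Param => (z, ())) (by fun_prop)

variable {D} in
lemma integrable_weight_slice {η : Eu d₂} (hη : η ∈ D.Ω) :
    Integrable (fun y => D.weight (η, y)) (Measure.count.prod volume) ∧
      ∫ y, D.weight (η, y) ∂(Measure.count.prod volume) =
        ∫ ξ : Eu d₁, ((1 + ‖ξ‖ ^ 2 / 1) ^ (d₁ + 1))⁻¹ := by
  have h1 : Integrable (D.tau η) Measure.count :=
    integrable_count_iff.mpr (hasSum_tau hη).summable.norm
  have h2 := integrable_inv_one_add_norm_sq_div_pow (V := Eu d₁) one_pos (M := d₁ + 1)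
    (by rw [finrank_euclideanSpace_fin]; omega)
  have e : (fun y => D.weight (η, y)) = fun y : (Fin D.d → ℕ) × Eu d₁ =>
      D.tau η y.1 * ((1 + ‖y.2‖ ^ 2 / 1) ^ (d₁ + 1))⁻¹ := by
    funext y
    simp only [weight, indicator_of_mem hη]
  rw [e]
  refine ⟨h1.mul_prod h2, ?_⟩
  refine (integral_prod_mul (D.tau η) fun ξ : Eu d₁ => ((1 + ‖ξ‖ ^ 2 / 1) ^ (d₁ + 1))⁻¹).trans ?_
  rw [integral_countable h1]
  simp [(hasSum_tau hη).tsum_eq]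

lemma integrable_weight_mul {B : Eu d₂ → ℝ} (hB : Integrable B) :
    Integrable (fun z : D.Param => B z.1 * D.weight z) D.pvol := by
  have hm : AEStronglyMeasurable (fun z : D.Param => B z.1 * D.weight z) D.pvol :=
    (hB.aestronglyMeasurable.comp_fst).mul D.measurable_weight.aestronglyMeasurable
  rw [integrable_prod_iff hm]
  constructor
  · refine Eventually.of_forall fun η => ?_
    by_cases hη : η ∈ D.Ω
    · exact (integrable_weight_slice hη).1.const_mul (B η)
    · simp [weight, indicator_of_notMem hη]
  · refine (hB.norm.mul_const (∫ ξ : Eu d₁, ((1 + ‖ξ‖ ^ 2 / 1) ^ (d₁ + 1))⁻¹)).mono'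
      hm.norm.integral_prod_right' (.of_forall fun η => ?_)
    have hJ : 0 ≤ ∫ ξ : Eu d₁, ((1 + ‖ξ‖ ^ 2 / 1) ^ (d₁ + 1))⁻¹ :=
      integral_nonneg fun ξ => by positivity
    have e : ∀ y, ‖B η * D.weight (η, y)‖ = ‖B η‖ * D.weight (η, y) := fun y => by
      rw [norm_mul, norm_of_nonneg (D.weight_nonneg _)]
    simp only [e]
    rw [integral_const_mul, norm_mul, norm_norm]
    refine mul_le_mul_of_nonneg_left ?_ (norm_nonneg _)
    rw [norm_of_nonneg (integral_nonneg fun y => D.weight_nonneg _)]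
    by_cases hη : η ∈ D.Ω
    · exact (integrable_weight_slice hη).2.le
    · simpa [weight, indicator_of_notMem hη] using hJ

/-- The kernels, up to normalization. -/
def kernel (H : 𝕊 → ℂ) (g : 𝔾) : ℂ := ∫ z, H (D.loc z) * D.elem z g ∂D.pvol

section Kernel

variable {H : 𝕊 → ℂ} {B : Eu d₂ → ℝ} (hB : Integrable B)
  (hHB : ∀ t η, 0 ≤ t → ‖H (t, η)‖ * (1 + t) ^ D.deg ≤ B η)
include hB hHB

omit hB in
lemma exists_norm_mul_elem_le : ∃ C, 0 ≤ C ∧ ∀ z g,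
    ‖H (D.loc z) * D.elem z g‖ ≤ C * (B z.1 * D.weight z) := by
  obtain ⟨C, hC, h⟩ := D.exists_norm_elem_le
  refine ⟨C, hC, fun z g => ?_⟩
  rw [norm_mul]
  calc _ ≤ ‖H (D.loc z)‖ * (C * (1 + (D.loc z).1) ^ D.deg * D.weight z) := by gcongr; exact h z g
    _ = C * (‖H ((D.loc z).1, z.1)‖ * (1 + (D.loc z).1) ^ D.deg * D.weight z) := by
        simp only [loc]; ring
    _ ≤ _ := by
        refine mul_le_mul_of_nonneg_left ?_ hC
        exact mul_le_mul_of_nonneg_right (hHB _ _ (D.loc_nonneg z)) (D.weight_nonneg z)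

lemma integrable_mul_elem (halt : Alt β) (hHm : Measurable H) (g : 𝔾) :
    Integrable (fun z => H (D.loc z) * D.elem z g) D.pvol := by
  obtain ⟨C, hC, h⟩ := D.exists_norm_mul_elem_le hHB
  refine ((D.integrable_weight_mul hB).const_mul C).mono' ?_ (.of_forall fun z => h z g)
  exact ((hHm.comp (D.measurable_loc halt)).mul
    ((D.measurable_elem halt).comp (by fun_prop : Measurable fun z => (z, g)))).aestronglyMeasurable

lemma continuous_kernel (halt : Alt β) (hHm : Measurable H) : Continuous (D.kernel H) := by
  obtain ⟨C, hC, h⟩ := D.exists_norm_mul_elem_le hHB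
  refine continuous_of_dominated (fun g =>
    (D.integrable_mul_elem hB hHB halt hHm g).aestronglyMeasurable)
    (fun g => Eventually.of_forall fun z => h z g) ((D.integrable_weight_mul hB).const_mul C)
    (.of_forall fun z => continuous_const.mul ?_)
  unfold elem
  by_cases hz : z.1 ∈ D.Ω
  · simp only [indicator_of_mem hz]
    have h1 : Continuous fun g : 𝔾 => D.coeff g.1 z.1 z.2.2 z.2.1 :=
      continuousOn_univ.mp ((D.continuousOn_coeff halt z.2.1).comp
        (f := fun g : 𝔾 => (z.1, g.1, z.2.2)) (by fun_prop) fun p _ => ⟨hz, trivial⟩)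
    exact h1.mul (by fun_prop)
  · simp only [indicator_of_notMem hz]
    exact continuous_const

lemma integrable_kernel_prod (halt : Alt β) (hHm : Measurable H) {Φ : 𝔾 → ℂ} (hΦ : Integrable Φ) :
    Integrable (fun p : D.Param × 𝔾 => H (D.loc p.1) * D.elem p.1 p.2 * Φ p.2)
      (D.pvol.prod (volume.prod volume)) := by
  obtain ⟨C, hC, h⟩ := D.exists_norm_mul_elem_le hHB
  refine (((D.integrable_weight_mul hB).const_mul C).mul_prod hΦ.norm).mono' ?_
    (.of_forall fun p => ?_)
  · refine AEStronglyMeasurable.mul ?_ hΦ.aestronglyMeasurable.comp_snd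
    exact ((hHm.comp ((D.measurable_loc halt).comp measurable_fst)).mul
      (D.measurable_elem halt)).aestronglyMeasurable
  · rw [norm_mul]
    exact mul_le_mul_of_nonneg_right (h _ _) (norm_nonneg _)

lemma integral_kernel_mul (halt : Alt β) (hHm : Measurable H) {Φ : 𝔾 → ℂ} (hΦ : Integrable Φ) :
    ∫ g, D.kernel H g * Φ g = ∫ z, H (D.loc z) * (∫ g, D.elem z g * Φ g) ∂D.pvol := by
  have h := integral_integral_swap (f := fun z g => H (D.loc z) * D.elem z g * Φ g)
    (D.integrable_kernel_prod hB hHB halt hHm hΦ)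
  simp only [mul_assoc, integral_const_mul] at h
  refine Eq.trans ?_ h.symm
  refine integral_ext fun g => ?_
  simp only [kernel, ← integral_mul_const, mul_assoc]

lemma kernel_eq_integral (halt : Alt β) (hHc : Continuous H)
    (hH : ∀ η, ∀ M : ℕ, ∃ C, ∀ t, 0 ≤ t → ‖H (t, η)‖ ≤ C * ((1 + t) ^ M)⁻¹) (x : Eu d₁)
    (u : Eu d₂) :
    IntegrableOn (fun η => ∫ ξ, D.V H ξ η * 𝐞(ξ,x) * 𝐞(η,u)) D.Ω ∧
    D.kernel H (x, u) = ∫ η in D.Ω, ∫ ξ, D.V H ξ η * 𝐞(ξ,x) * 𝐞(η,u) := by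
  have hI := D.integrable_mul_elem hB hHB halt hHc.measurable (x, u)
  have hae : ∀ᵐ η : Eu d₂, ∫ y, H (D.loc (η, y)) * D.elem (η, y) (x, u) ∂(Measure.count.prod volume)
      = D.Ω.indicator (fun η => ∫ ξ, D.V H ξ η * 𝐞(ξ,x) * 𝐞(η,u)) η := by
    filter_upwards [hI.prod_right_ae] with η hη'
    by_cases hη : η ∈ D.Ω
    · rw [indicator_of_mem hη, integral_count_prod hη', integral_mul_const,
        ← (hasSum_integral_coeff hη halt hHc (hH η) x).tsum_eq, ← tsum_mul_right]
      refine tsum_congr fun n => ?_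
      rw [← integral_mul_const]
      refine integral_ext fun ξ => ?_
      simp only [loc, elem, indicator_of_mem hη, mul_assoc]
    · simp [elem, indicator_of_notMem hη]
  constructor
  · rw [← integrable_indicator_iff D.measurableSet_Ω]
    exact hI.integral_prod_left.congr hae
  · rw [kernel, integral_prod _ hI, integral_congr_ae hae, integral_indicator D.measurableSet_Ω]

end Kernel

end SpectralData

namespace SpectralData

/-! ### The heat kernels of the twisted sublaplacians -/

variable {d₁ d₂ : ℕ} {β : 𝔅} (D : SpectralData β)

/-- The rates `1 / t` and `bⱼ coth (t bⱼ)`. -/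
def rate (η : Eu d₂) (t : ℝ) : Option (Fin D.d) → ℝ
  | none => t⁻¹
  | some j => D.b j η * (cosh (t * D.b j η) / sinh (t * D.b j η))

/-- The normalizing factors of the heat kernels. -/
def nrm (η : Eu d₂) (t : ℝ) : Option (Fin D.d) → ℝ
  | none => (√(4 * π * t) ^ D.r₀)⁻¹
  | some j => (D.b j η / (4 * π * sinh (t * D.b j η))) ^ D.r j

/-- The heat kernels of the twisted sublaplacians. -/
def heat (η : Eu d₂) (t : ℝ) (x : Eu d₁) : ℝ :=
  ∏ i, D.nrm η t i * exp (-(D.rate η t i * ‖D.Pr η i x‖ ^ 2 / 4))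

variable {D} {η : Eu d₂} (hη : η ∈ D.Ω)

lemma le_sinh {s : ℝ} (hs : 0 ≤ s) : s ≤ sinh s := Real.self_le_sinh_iff.mpr hs

lemma sinh_le_mul_cosh {s : ℝ} (hs : 0 ≤ s) : sinh s ≤ s * cosh s := by
  have hd : ∀ x, HasDerivAt (fun x => x * cosh x - sinh x)
      (1 * cosh x + x * sinh x - cosh x) x := fun x =>
    ((hasDerivAt_id x).mul (Real.hasDerivAt_cosh x)).sub (Real.hasDerivAt_sinh x)
  have hm : MonotoneOn (fun x => x * cosh x - sinh x) (Set.Ici 0) := by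
    refine monotoneOn_of_deriv_nonneg (convex_Ici 0)
      (fun x _ => (hd x).continuousAt.continuousWithinAt)
      (fun x _ => (hd x).differentiableAt.differentiableWithinAt) fun x hx => ?_
    rw [interior_Ici, Set.mem_Ioi] at hx
    rw [(hd x).deriv]
    have := mul_nonneg hx.le (Real.sinh_nonneg_iff.mpr hx.le)
    linarith
  have := hm (Set.mem_Ici.mpr le_rfl) hs hs
  simp at this
  linarith

section
include hη

lemma inv_le_rate {t : ℝ} (ht : 0 < t) (i : Option (Fin D.d)) : t⁻¹ ≤ D.rate η t i := by
  rcases i with _ | j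
  · exact le_rfl
  · have hb := D.b_pos j η hη
    have hs : 0 < sinh (t * D.b j η) := Real.sinh_pos_iff.mpr (by positivity)
    have h := sinh_le_mul_cosh (s := t * D.b j η) (by positivity)
    simp only [rate]
    rw [← mul_div_assoc, le_div_iff₀ hs, inv_mul_le_iff₀ ht]
    linarith

lemma nrm_pos {t : ℝ} (ht : 0 < t) (i : Option (Fin D.d)) : 0 < D.nrm η t i := by
  rcases i with _ | j
  · simp only [nrm]; positivity
  · have hb := D.b_pos j η hη
    have hs : 0 < sinh (t * D.b j η) := Real.sinh_pos_iff.mpr (by positivity)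
    simp only [nrm]; positivity

lemma nrm_le {t : ℝ} (ht : 0 < t) (i : Option (Fin D.d)) :
    D.nrm η t i ≤ (√(4 * π * t) ^ D.mult i)⁻¹ := by
  rcases i with _ | j
  · exact le_rfl
  · have hb := D.b_pos j η hη
    have hs : 0 < sinh (t * D.b j η) := Real.sinh_pos_iff.mpr (by positivity)
    have h := le_sinh (s := t * D.b j η) (by positivity)
    simp only [nrm, mult]
    rw [pow_mul, sq_sqrt (by positivity), ← inv_pow]
    refine pow_le_pow_left₀ (by positivity) ?_ _
    rw [inv_eq_one_div, div_le_div_iff₀ (by positivity) (by positivity)]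
    nlinarith [Real.pi_pos]

lemma sum_mult' : ∑ i, D.mult i = d₁ := by
  have h := sum_mult hη
  rw [mul_sum] at h
  rw [Fintype.sum_option]
  exact h

lemma heat_pos {t : ℝ} (ht : 0 < t) (x : Eu d₁) : 0 < D.heat η t x :=
  prod_pos fun i _ => mul_pos (nrm_pos hη ht i) (exp_pos _)

lemma heat_le (halt : Alt β) {t : ℝ} (ht : 0 < t) (x : Eu d₁) :
    D.heat η t x ≤ (√(4 * π * t) ^ d₁)⁻¹ * exp (-(‖x‖ ^ 2 / (4 * t))) := by
  have h : D.heat η t x ≤ ∏ i, (√(4 * π * t) ^ D.mult i)⁻¹ *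
      exp (-(‖D.Pr η i x‖ ^ 2 / (4 * t))) := by
    refine prod_le_prod (fun i _ => (mul_pos (nrm_pos hη ht i) (exp_pos _)).le) fun i _ => ?_
    refine mul_le_mul (nrm_le hη ht i) (Real.exp_le_exp.mpr (neg_le_neg ?_)) (exp_pos _).le
      (by positivity)
    have := mul_le_mul_of_nonneg_right (inv_le_rate hη ht i) (sq_nonneg ‖D.Pr η i x‖)
    have e : ‖D.Pr η i x‖ ^ 2 / (4 * t) = t⁻¹ * ‖D.Pr η i x‖ ^ 2 / 4 := by field_simp
    rw [e]
    linarith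
  refine h.trans_eq ?_
  rw [prod_mul_distrib, ← exp_sum, sum_neg_distrib, ← sum_div,
    ← norm_sq_eq_sum_starProjection (orthogonalFamily_W hη halt) (isInternal_W hη halt),
    prod_inv_distrib, prod_pow_eq_pow_sum, sum_mult' hη]

lemma hasDerivAt_rate {t : ℝ} (ht : 0 < t) (i : Option (Fin D.d)) :
    HasDerivAt (fun t => D.rate η t i) (D.ev η i ^ 2 - D.rate η t i ^ 2) t := by
  rcases i with _ | j
  · simp only [rate, ev]
    refine (hasDerivAt_inv ht.ne').congr_deriv ?_
    rw [inv_pow]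
    ring
  · have hb := D.b_pos j η hη
    have hs : sinh (t * D.b j η) ≠ 0 := (Real.sinh_pos_iff.mpr (by positivity)).ne'
    have h0 : HasDerivAt (fun t => t * D.b j η) (D.b j η) t := by
      simpa using (hasDerivAt_id t).mul_const (D.b j η)
    have h := ((h0.cosh).div h0.sinh hs).const_mul (D.b j η)
    simp only [rate, ev]
    refine h.congr_deriv ?_
    field_simp

lemma hasDerivAt_nrm {t : ℝ} (ht : 0 < t) (i : Option (Fin D.d)) :
    HasDerivAt (fun t => D.nrm η t i) (-(D.mult i * D.rate η t i / 2) * D.nrm η t i) t := by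
  rcases i with _ | j
  · simp only [nrm, mult, rate]
    have h0 : HasDerivAt (fun t => 4 * π * t) (4 * π) t := by
      simpa using (hasDerivAt_id t).const_mul (4 * π)
    have hp : 0 < 4 * π * t := by positivity
    have h := ((h0.sqrt hp.ne').pow D.r₀).inv (by
      rw [Pi.pow_apply]; positivity)
    refine h.congr_deriv ?_
    have hs : √(4 * π * t) ≠ 0 := by positivity
    have e : (4 * π) / (2 * √(4 * π * t)) = √(4 * π * t) / (2 * t) := by grind
    simp only [Pi.pow_apply]
    rw [e]
    rcases Nat.eq_zero_or_pos D.r₀ with h0 | h0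
    · simp [h0]
    · obtain ⟨m, hm⟩ := Nat.exists_eq_succ_of_ne_zero h0.ne'
      rw [hm]
      simp only [Nat.succ_eq_add_one, Nat.add_sub_cancel]
      field_simp
      ring
  · have hb := D.b_pos j η hη
    have hs : sinh (t * D.b j η) ≠ 0 := (Real.sinh_pos_iff.mpr (by positivity)).ne'
    have h0 : HasDerivAt (fun t => t * D.b j η) (D.b j η) t := by
      simpa using (hasDerivAt_id t).mul_const (D.b j η)
    have h := ((((h0.sinh).const_mul (4 * π)).inv (by positivity)).const_mul (D.b j η)).pow (D.r j)
    simp only [nrm, mult, rate]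
    simp only [Pi.pow_def, Pi.inv_apply, ← div_eq_mul_inv] at h
    refine h.congr_deriv ?_
    obtain ⟨m, hm⟩ := Nat.exists_eq_succ_of_ne_zero (D.r_pos j).ne'
    rw [hm]
    simp only [Nat.succ_eq_add_one, Nat.add_sub_cancel]
    push_cast
    rw [pow_succ (D.b j η / _)]
    field_simp

end

/-- The logarithmic derivative of the heat kernel in `t`. -/
def logDer (η : Eu d₂) (t : ℝ) (x : Eu d₁) (D : SpectralData β) : ℝ :=
  ∑ i, (-(D.mult i * D.rate η t i / 2) - (D.ev η i ^ 2 - D.rate η t i ^ 2) * ‖D.Pr η i x‖ ^ 2 / 4)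

include hη in
lemma hasDerivAt_heat {t : ℝ} (ht : 0 < t) (x : Eu d₁) :
    HasDerivAt (fun t => D.heat η t x) (D.logDer η t x * D.heat η t x) t := by
  have h1 : ∀ i, HasDerivAt (fun t => D.nrm η t i * exp (-(D.rate η t i * ‖D.Pr η i x‖ ^ 2 / 4)))
      ((-(D.mult i * D.rate η t i / 2) - (D.ev η i ^ 2 - D.rate η t i ^ 2) * ‖D.Pr η i x‖ ^ 2 / 4) *
        (D.nrm η t i * exp (-(D.rate η t i * ‖D.Pr η i x‖ ^ 2 / 4)))) t := by
    intro i
    refine ((hasDerivAt_nrm hη ht i).mul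
      ((((hasDerivAt_rate hη ht i).mul_const _).div_const 4).fun_neg.exp)).congr_deriv ?_
    ring
  have h := HasDerivAt.fun_finsetProd (u := univ) fun i _ => h1 i
  refine h.congr_deriv ?_
  rw [logDer, sum_mul]
  refine sum_congr rfl fun i _ => ?_
  rw [heat, ← mul_prod_erase _ _ (mem_univ i), smul_eq_mul]
  ring

/-- The operator `∑ᵢ mᵢ Pᵢ` with the rates `mᵢ`. -/
def rateOp (η : Eu d₂) (t : ℝ) (D : SpectralData β) : Eu d₁ →L[ℝ] Eu d₁ :=
  ∑ i, D.rate η t i • D.Pr η i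

lemma rateOp_apply (t : ℝ) (x : Eu d₁) : D.rateOp η t x = ∑ i, D.rate η t i • D.Pr η i x := by
  simp [rateOp]

lemma inner_rateOp_self (t : ℝ) (x : Eu d₁) :
    inner ℝ (D.rateOp η t x) x = ∑ i, D.rate η t i * ‖D.Pr η i x‖ ^ 2 := by
  rw [rateOp_apply, sum_inner]
  refine sum_congr rfl fun i _ => ?_
  rw [real_inner_smul_left, inner_starProjection_self]

lemma inner_rateOp_comm (t : ℝ) (x y : Eu d₁) :
    inner ℝ (D.rateOp η t x) y = inner ℝ (D.rateOp η t y) x := by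
  rw [rateOp_apply, rateOp_apply, sum_inner, sum_inner]
  refine sum_congr rfl fun i _ => ?_
  rw [real_inner_smul_left, real_inner_smul_left, Submodule.inner_starProjection_left_eq_right,
    real_inner_comm]

include hη in
lemma norm_rateOp_sq (halt : Alt β) (t : ℝ) (x : Eu d₁) :
    ‖D.rateOp η t x‖ ^ 2 = ∑ i, D.rate η t i ^ 2 * ‖D.Pr η i x‖ ^ 2 := by
  have h := (orthogonalFamily_W hη halt).norm_sum
    (fun i => D.rate η t i • (D.W η i).orthogonalProjectionOnto x) univ
  rw [rateOp_apply]
  refine Eq.trans ?_ (h.trans ?_)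
  · rfl
  · refine sum_congr rfl fun i _ => ?_
    rw [norm_smul, mul_pow, norm_eq_abs, sq_abs]
    rfl

lemma inner_rateOp_J (halt : Alt β) (t : ℝ) (x : Eu d₁) :
    inner ℝ (D.rateOp η t x) (J β η x) = 0 := by
  rw [rateOp_apply, sum_inner]
  refine sum_eq_zero fun i _ => ?_
  rw [real_inner_smul_left, real_inner_comm, inner_J_Pr halt, mul_zero]

include hη in
lemma trace_rateOp (halt : Alt β) (t : ℝ) :
    ∑ j, D.rateOp η t (single j 1) j = ∑ i, D.mult i * D.rate η t i := by
  have h1 : ∀ i, ∑ j, (D.Pr η i (single j 1)) j = (D.mult i : ℝ) := by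
    intro i
    have hp : LinearMap.IsProj (D.W η i) (D.Pr η i : Eu d₁ →ₗ[ℝ] Eu d₁) :=
      ⟨fun x => starProjection_apply_mem _ x,
        fun x hx => Submodule.starProjection_eq_self_iff.mpr hx⟩
    have h2 := hp.trace
    rw [finrank_W hη halt, LinearMap.trace_eq_sum_inner _ (EuclideanSpace.basisFun (Fin d₁) ℝ)] at h2
    rw [← h2]
    refine sum_congr rfl fun j _ => ?_
    simp [EuclideanSpace.inner_single_left]
  simp only [rateOp_apply, ← h1, sum_mul]
  rw [sum_comm]
  refine sum_congr rfl fun j _ => ?_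
  simp [mul_comm]

/-- The heat kernels as functions on the group. -/
def heatWave (η : Eu d₂) (t : ℝ) (D : SpectralData β) (g : 𝔾) : ℂ := D.heat η t g.1 * 𝐞(η,g.2)

lemma heatWave_eq (t : ℝ) (g : 𝔾) : D.heatWave η t g = ((∏ i, D.nrm η t i : ℝ) : ℂ) *
      cexp (((-(inner ℝ (D.rateOp η t g.1) g.1) / 4 : ℝ) : ℂ) + I * (inner ℝ η g.2 : ℝ)) := by
  rw [heatWave, heat, prod_mul_distrib, ← exp_sum, sum_neg_distrib,
    ← sum_div, ← inner_rateOp_self, Complex.exp_add, neg_div]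
  push_cast
  ring

lemma contDiff_heatWave (t : ℝ) : ContDiff ℝ ∞ (D.heatWave η t) := by
  have e : D.heatWave η t = fun g => ((∏ i, D.nrm η t i : ℝ) : ℂ) *
      cexp (((-(inner ℝ (D.rateOp η t g.1) g.1) / 4 : ℝ) : ℂ) +
        I * (inner ℝ η g.2 : ℝ)) := funext fun g => heatWave_eq t g
  rw [e]
  have h1 : ContDiff ℝ ∞ fun g : 𝔾 =>
      -(inner ℝ (D.rateOp η t g.1) g.1) / 4 := by
    refine (ContDiff.neg (ContDiff.inner ℝ ?_ contDiff_fst)).div_const 4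
    exact (D.rateOp η t).contDiff.comp contDiff_fst
  have h2 : ContDiff ℝ ∞ fun g : 𝔾 => inner ℝ η g.2 := ContDiff.inner ℝ contDiff_const contDiff_snd
  have h3 : ContDiff ℝ ∞ (fun s : ℝ => (s : ℂ)) := Complex.ofRealCLM.contDiff
  exact contDiff_const.mul (((h3.comp h1).add (contDiff_const.mul (h3.comp h2))).cexp)

/-- The logarithmic derivatives `Xⱼ ψ / ψ` of the functions `ψ = heatWave`. -/
def logField (η : Eu d₂) (t : ℝ) (D : SpectralData β) (j : Fin d₁) (x : Eu d₁) : ℂ :=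
  ((-(D.rateOp η t x j) / 2 : ℝ) : ℂ) + I * ((J β η x j / 2 : ℝ) : ℂ)

lemma hasDerivAt_logField (t : ℝ) (j : Fin d₁) (x v : Eu d₁) (s : ℝ) :
    HasDerivAt (fun s : ℝ => D.logField η t j (x + s • v)) (D.logField η t j v) s := by
  have h1 : ∀ s : ℝ, D.logField η t j (x + s • v) =
      D.logField η t j x + s * D.logField η t j v := by
    intro s
    simp only [logField, map_add, map_smul, PiLp.add_apply, PiLp.smul_apply, smul_eq_mul]
    push_cast
    ring
  simp only [h1]
  simpa using (((hasDerivAt_id s).ofReal_comp).mul_const (D.logField η t j v)).const_add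
    (D.logField η t j x)

lemma hasDerivAt_heatWave (t : ℝ) (j : Fin d₁) (g : 𝔾) :
    HasDerivAt (fun s : ℝ => D.heatWave η t (mul β g (s • (single j 1, 0))))
      (D.logField η t j g.1 * D.heatWave η t g) 0 := by
  set e : Eu d₁ := single j 1 with he
  have h1 : ∀ s : ℝ, mul β g (s • (e, 0)) = (g.1 + s • e, g.2 + (s / 2) • β g.1 e) := by
    intro s
    simp only [mul, Prod.smul_mk, smul_zero, add_zero, map_smul, smul_smul]
    congr 3
    ring
  have h2 : ∀ s : ℝ, D.heatWave η t (mul β g (s • (e, 0))) = ((∏ i, D.nrm η t i : ℝ) : ℂ) * cexp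
        (((-(inner ℝ (D.rateOp η t g.1) g.1 + s * (2 * inner ℝ (D.rateOp η t g.1) e) +
          s ^ 2 * inner ℝ (D.rateOp η t e) e) / 4 : ℝ) : ℂ) +
        I * ((inner ℝ η g.2 + s * (inner ℝ (J β η g.1) e / 2) : ℝ) : ℂ)) := by
    intro s
    rw [h1, heatWave_eq]
    congr 4
    · congr 2
      simp only [map_add, map_smul, inner_add_left, inner_add_right, real_inner_smul_left,
        real_inner_smul_right]
      rw [inner_rateOp_comm t e g.1]
      ring
    · rw [inner_add_right, real_inner_smul_right, inner_J]
      congr 1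
      ring
  simp only [h2]
  have h3 : HasDerivAt (fun s : ℝ => -(inner ℝ (D.rateOp η t g.1) g.1 +
      s * (2 * inner ℝ (D.rateOp η t g.1) e) + s ^ 2 * inner ℝ (D.rateOp η t e) e) / 4)
      (-(inner ℝ (D.rateOp η t g.1) e) / 2) 0 := by
    refine (((((hasDerivAt_id (0 : ℝ)).mul_const (2 * inner ℝ (D.rateOp η t g.1) e)).const_add
      (inner ℝ (D.rateOp η t g.1) g.1)).add (((hasDerivAt_id (0 : ℝ)).pow 2).mul_const
      (inner ℝ (D.rateOp η t e) e))).neg.div_const 4).congr_deriv ?_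
    simp
    ring
  have h4 : HasDerivAt (fun s : ℝ => inner ℝ η g.2 + s * (inner ℝ (J β η g.1) e / 2))
      (inner ℝ (J β η g.1) e / 2) 0 := by
    simpa using ((hasDerivAt_id (0 : ℝ)).mul_const (inner ℝ (J β η g.1) e / 2)).const_add
      (inner ℝ η g.2)
  refine (((h3.ofReal_comp.add (h4.ofReal_comp.const_mul I)).cexp).const_mul
    ((∏ i, D.nrm η t i : ℝ) : ℂ)).congr_deriv ?_
  have e1 : inner ℝ (D.rateOp η t g.1) e = D.rateOp η t g.1 j := by
    simp [he, EuclideanSpace.inner_single_right]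
  have e2 : inner ℝ (J β η g.1) e = J β η g.1 j := by
    simp [he, EuclideanSpace.inner_single_right]
  rw [heatWave_eq, logField, e1, e2]
  simp
  ring

lemma hfield_heatWave (t : ℝ) (j : Fin d₁) : hfield β j (D.heatWave η t) =
    fun g => D.logField η t j g.1 * D.heatWave η t g :=
  funext fun g => (hasDerivAt_heatWave t j g).deriv

lemma hfield_hfield_heatWave (t : ℝ) (j : Fin d₁) (g : 𝔾) :
    hfield β j (hfield β j (D.heatWave η t)) g =
      (D.logField η t j (single j 1) + D.logField η t j g.1 ^ 2) * D.heatWave η t g := by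
  rw [hfield_heatWave]
  have h1 : HasDerivAt (fun s : ℝ => D.logField η t j (mul β g (s • (single j 1, 0))).1)
      (D.logField η t j (single j 1)) 0 := by
    simpa [mul] using hasDerivAt_logField (D := D) (η := η) t j g.1 (single j 1) 0
  have h2 := h1.mul (hasDerivAt_heatWave (D := D) (η := η) t j g)
  refine h2.deriv.trans ?_
  simp [mul]
  ring

include hη in
lemma sum_logField (halt : Alt β) (t : ℝ) (x : Eu d₁) :
    ∑ j, (D.logField η t j (single j 1) + D.logField η t j x ^ 2) = (D.logDer η t x : ℂ) := by
  have hJe : ∀ j, J β η (single j 1) j = 0 := by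
    intro j
    have := inner_J β η (single j 1) (single j 1)
    rw [halt, inner_zero_right] at this
    simpa [EuclideanSpace.inner_single_right] using this
  have h1 : ∀ j, D.logField η t j (single j 1) + D.logField η t j x ^ 2 =
      ((-(D.rateOp η t (single j 1) j) / 2 + D.rateOp η t x j ^ 2 / 4 -
        J β η x j ^ 2 / 4 : ℝ) : ℂ) -
      I * ((D.rateOp η t x j * J β η x j / 2 : ℝ) : ℂ) := by
    intro j
    simp only [logField, hJe]
    push_cast
    linear_combination ((J β η x j : ℂ) ^ 2 / 4) * I_sq
  have h2 : ∑ j, D.rateOp η t x j * J β η x j = 0 := by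
    have := inner_rateOp_J (D := D) (η := η) halt t x
    rw [PiLp.inner_apply] at this
    simpa [mul_comm] using this
  have h3 : ∀ v : Eu d₁, ∑ j, v j ^ 2 = ‖v‖ ^ 2 := fun v => (EuclideanSpace.real_norm_sq_eq v).symm
  simp only [h1]
  rw [sum_sub_distrib, ← mul_sum, ← Complex.ofReal_sum, ← Complex.ofReal_sum,
    ← sum_div, h2, zero_div, ofReal_zero, mul_zero, sub_zero]
  congr 1
  rw [sum_sub_distrib, sum_add_distrib, ← sum_div, ← sum_div,
    ← sum_div, sum_neg_distrib, h3, h3, trace_rateOp hη halt, norm_rateOp_sq hη halt,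
    norm_J_sq hη halt, logDer, ← sum_neg_distrib, sum_div, sum_div,
    sum_div, ← sum_add_distrib, ← sum_sub_distrib]
  refine sum_congr rfl fun i _ => ?_
  ring

include hη in
lemma integral_heatWave_mul_sublaplacian (halt : Alt β) (t : ℝ) {Φ : 𝔾 → ℂ} (hΦ : IsTest Φ) :
    ∫ g, D.heatWave η t g * 𝓛 β Φ g = -∫ g, D.logDer η t g.1 * D.heatWave η t g * Φ g := by
  have hW := contDiff_heatWave (D := D) (η := η) t
  rw [integral_mul_sublaplacian β halt hΦ hW]
  have h1 : ∀ j, ContDiff ℝ ∞ (hfield β j (D.heatWave η t)) := fun j =>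
    contDiff_leftInvariantField β hW _
  have h2 : ∀ j, ∫ g, hfield β j (D.heatWave η t) g * hfield β j Φ g =
      -∫ g, hfield β j (hfield β j (D.heatWave η t)) g * Φ g := fun j => by
    rw [integral_field_mul β halt (h1 j) hΦ.1 (Or.inr hΦ.2), neg_neg]
  have h3 : ∀ j, Integrable fun g => hfield β j (hfield β j (D.heatWave η t)) g * Φ g := fun j =>
    ((contDiff_leftInvariantField β (h1 j) _).continuous.mul
      hΦ.1.continuous).integrable_of_hasCompactSupport hΦ.2.mul_left
  simp only [h2]
  rw [sum_neg_distrib, ← integral_finsetSum _ fun j _ => h3 j]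
  congr 1
  refine integral_ext fun g => ?_
  simp only [hfield_hfield_heatWave]
  rw [← sum_mul, ← sum_mul, sum_logField hη halt]

end SpectralData

/-! ### Null sets -/

lemma volume_setOf_eval_eq_zero {n : ℕ} {q : MvPolynomial (Fin n) ℝ} {a : Eu n}
    (ha : MvPolynomial.eval (fun k => a k) q ≠ 0) :
    volume {x : Eu n | MvPolynomial.eval (fun k => x k) q = 0} = 0 := by
  set Z := {x : Eu n | MvPolynomial.eval (fun k => x k) q = 0} with hZ
  have hZm : MeasurableSet Z := (isClosed_eq ((MvPolynomial.continuous_eval q).comp (by fun_prop))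
    continuous_const).measurableSet
  let S : Set (Eu n × ℝ) := {p | a + p.2 • p.1 ∈ Z}
  have hS : MeasurableSet S := hZm.preimage (by fun_prop)
  have h1 : (volume.prod volume) S = 0 := by
    rw [Measure.measure_prod_null hS]
    refine Eventually.of_forall fun y => ?_
    let p : Polynomial ℝ := MvPolynomial.aeval
      (fun k => Polynomial.C (a k) + Polynomial.X * Polynomial.C (y k)) q
    have hp : ∀ t : ℝ, p.eval t = MvPolynomial.eval (fun k => (a + t • y) k) q := by
      intro t
      have h := MvPolynomial.map_aeval (fun k => Polynomial.C (a k) + Polynomial.X *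
        Polynomial.C (y k)) (Polynomial.evalRingHom t) q
      simp only [Polynomial.coe_evalRingHom] at h
      rw [h, MvPolynomial.eval, MvPolynomial.coe_eval₂Hom]
      congr 1
      · ext; simp
      · funext k; simp [mul_comm t]
    have hp0 : p ≠ 0 := by
      intro h
      have := hp 0
      rw [h] at this
      simp only [zero_smul, add_zero, Polynomial.eval_zero] at this
      exact ha this.symm
    refine Set.Finite.measure_zero ((Multiset.toFinset p.roots).finite_toSet.subset ?_) _
    intro t ht
    have h2 : p.eval t = 0 := (hp t).trans ht
    simp [hp0, h2]
  have h2 : (volume.prod volume) (Prod.swap ⁻¹' S) = 0 := by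
    rw [← Measure.prod_swap, Measure.map_apply measurable_swap (hS.preimage measurable_swap)]
    exact h1
  have h3 := (Measure.measure_prod_null (hS.preimage measurable_swap)).mp h2
  obtain ⟨t, ht, ht0⟩ := (h3.and (volume.ae_ne (0 : ℝ))).exists
  have h4 : (Prod.mk t ⁻¹' (Prod.swap ⁻¹' S)) = (fun y => t • y) ⁻¹' ((fun z => a + z) ⁻¹' Z) := rfl
  beta_reduce at ht
  rw [h4, Measure.addHaar_preimage_smul _ ht0, measure_preimage_add, Pi.zero_apply] at ht
  refine (mul_eq_zero.mp ht).resolve_left (ENNReal.ofReal_pos.mpr ?_).ne'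
  positivity

lemma IsZariskiOpen.ae_mem {n : ℕ} {Ω : Set (Eu n)} (h : IsZariskiOpen Ω) (hne : Ω.Nonempty) :
    ∀ᵐ η : Eu n, η ∈ Ω := by
  obtain ⟨S, rfl⟩ := h
  obtain ⟨a, q, hq, ha⟩ := hne
  refine measure_mono_null (fun η hη => ?_) (volume_setOf_eval_eq_zero ha)
  by_contra h0
  exact hη ⟨q, hq, h0⟩

/-! ### Decay in the central variables -/

section Central

variable {d₁ d₂ : ℕ} (β : 𝔅)

/-- The operator `1 - ∑ₖ Uₖ²`. -/
def cenOp (Φ : 𝔾 → ℂ) (g : 𝔾) : ℂ := Φ g - ∑ k, 𝒳 β (0, single k 1) (𝒳 β (0, single k 1) Φ) g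

lemma IsTest.cenOp {Φ : 𝔾 → ℂ} (hΦ : IsTest Φ) : IsTest (cenOp β Φ) := by
  have h := hΦ.add (IsTest.sum univ fun k : Fin d₂ =>
    (hΦ.field β (0, single k 1)).field β (0, single k 1)).neg
  refine (congrArg IsTest ?_).mp h
  funext g
  simp only [TwoStep.cenOp]
  ring

variable (halt : Alt β) {h : 𝔾 → ℂ} (hh : LocallyIntegrable h) {η : Eu d₂}
  (hη : ∀ g a, h (g + (0, a)) = 𝐞(η,a) * h g)
  {Φ : 𝔾 → ℂ} (hΦ : IsTest Φ)
include halt hh hη hΦ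

lemma integral_mul_field_central (a : Eu d₂) :
    ∫ g, h g * 𝒳 β (0, a) Φ g = -(I * (inner ℝ η a : ℝ)) * ∫ g, h g * Φ g := by
  have h1 := hasDerivAt_integral_mul β halt hh hΦ (0, a) 0
  have h2 : ∀ t : ℝ, ∫ g, h g * Φ (mul β g (t • (0, a))) =
      cexp (-(I * (inner ℝ η a : ℝ)) * t) * ∫ g, h g * Φ g := by
    intro t
    have e : ∀ g, h g * Φ (mul β g (t • (0, a))) =
        (fun g => h (g + (0, -(t • a))) * Φ g) (g + (0, t • a)) := by
      intro g
      rw [Prod.smul_mk, smul_zero, mul_central]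
      simp only [add_assoc, Prod.mk_add_mk, add_zero, add_neg_cancel]
      rw [← Prod.zero_eq_mk, add_zero]
    simp only [e]
    rw [integral_add_right_eq_self (μ := volume) (fun g => h (g + (0, -(t • a))) * Φ g)]
    simp only [hη, mul_assoc, integral_const_mul]
    congr 2
    rw [inner_neg_right, real_inner_smul_right]
    push_cast
    ring
  simp only [h2, zero_smul, mul_zero'] at h1
  have h3 : HasDerivAt (fun t : ℝ => cexp (-(I * (inner ℝ η a : ℝ)) * t) *
      ∫ g, h g * Φ g) (-(I * (inner ℝ η a : ℝ)) * ∫ g, h g * Φ g) 0 := by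
    have h4 : HasDerivAt (fun t : ℝ => -(I * (inner ℝ η a : ℝ)) * (t : ℂ))
        (-(I * (inner ℝ η a : ℝ))) 0 := by
      simpa using ((hasDerivAt_id (0 : ℝ)).ofReal_comp).const_mul (-(I * (inner ℝ η a : ℝ)))
    simpa using (h4.cexp).mul_const (∫ g, h g * Φ g)
  exact h1.unique h3

lemma integral_mul_cenOp : ∫ g, h g * cenOp β Φ g = ((1 + ‖η‖ ^ 2 : ℝ) : ℂ) * ∫ g, h g * Φ g := by
  have h1 : ∀ k : Fin d₂, ∫ g, h g * 𝒳 β (0, single k 1) (𝒳 β (0, single k 1) Φ) g =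
      -((η k ^ 2 : ℝ) : ℂ) * ∫ g, h g * Φ g := by
    intro k
    rw [integral_mul_field_central β halt hh hη (hΦ.field β _),
      integral_mul_field_central β halt hh hη hΦ]
    have : inner ℝ η (single k (1 : ℝ)) = η k := by
      simp [EuclideanSpace.inner_single_right]
    rw [this]
    push_cast
    linear_combination ((η k : ℂ) ^ 2 * ∫ g, h g * Φ g) * I_sq
  have hi : ∀ k ∈ univ, Integrable fun g => h g * 𝒳 β (0, single (k : Fin d₂) 1)
      (𝒳 β (0, single k 1) Φ) g := fun k _ =>
    integrable_mul_test hh ((hΦ.field β _).field β _).1.continuous ((hΦ.field β _).field β _).2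
  have hi' := integrable_finsetSum _ hi
  have e : ∀ g, h g * cenOp β Φ g = h g * Φ g - ∑ k : Fin d₂, h g * 𝒳 β (0, single k 1)
      (𝒳 β (0, single k 1) Φ) g := fun g => by
    rw [cenOp, mul_sub, mul_sum]
  simp only [e]
  rw [integral_sub (integrable_mul_test hh hΦ.1.continuous hΦ.2) hi', integral_finsetSum _ hi]
  simp only [h1]
  rw [← sum_mul, EuclideanSpace.real_norm_sq_eq]
  push_cast
  rw [sum_neg_distrib]
  ring

lemma integral_mul_cenOp_iterate (N : ℕ) : IsTest ((cenOp β)^[N] Φ) ∧ ∫ g, h g * (cenOp β)^[N] Φ g =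
      (((1 + ‖η‖ ^ 2) ^ N : ℝ) : ℂ) * ∫ g, h g * Φ g := by
  induction N with
  | zero => exact ⟨hΦ, by simp⟩
  | succ N ih =>
    rw [Function.iterate_succ_apply']
    refine ⟨ih.1.cenOp β, ?_⟩
    rw [integral_mul_cenOp β halt hh hη ih.1, ih.2]
    push_cast
    ring

end Central

/-! ### The heat kernels as functionals on test functions -/

lemma IsTest.exists_integral_fiber_le {d₁ d₂ : ℕ} {Φ : 𝔾 → ℂ} (hΦ : IsTest Φ) :
    ∃ C, 0 ≤ C ∧ ∀ x, ∫ u, ‖Φ (x, u)‖ ≤ C := by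
  obtain ⟨C, hC⟩ := hΦ.2.exists_bound_of_continuous hΦ.1.continuous
  have hK : IsCompact (Prod.snd '' tsupport Φ) := hΦ.2.isCompact.image continuous_snd
  have hC0 : 0 ≤ C := (norm_nonneg _).trans (hC 0)
  have hi : Integrable ((Prod.snd '' tsupport Φ).indicator fun _ : Eu d₂ => C) :=
    (integrable_indicator_iff hK.measurableSet).mpr (integrableOn_const hK.measure_lt_top.ne)
  have hb : ∀ x u, ‖Φ (x, u)‖ ≤ (Prod.snd '' tsupport Φ).indicator (fun _ : Eu d₂ => C) u := by
    intro x u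
    by_cases h : (x, u) ∈ tsupport Φ
    · have hu : u ∈ Prod.snd '' tsupport Φ := ⟨(x, u), h, rfl⟩
      rw [indicator_of_mem hu]
      exact hC _
    · rw [image_eq_zero_of_notMem_tsupport h, norm_zero]
      exact indicator_nonneg (fun _ _ => hC0) _
  refine ⟨∫ u, (Prod.snd '' tsupport Φ).indicator (fun _ : Eu d₂ => C) u,
    integral_nonneg fun u => indicator_nonneg (fun _ _ => hC0) u, fun x => ?_⟩
  exact integral_mono_of_nonneg (.of_forall fun u => norm_nonneg _) hi (.of_forall (hb x))

namespace SpectralData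

variable {d₁ d₂ : ℕ} {β : 𝔅} {D : SpectralData β} {η : Eu d₂}

/-- Integration against the heat kernels. -/
def heatInt (η : Eu d₂) (t : ℝ) (D : SpectralData β) (Φ : 𝔾 → ℂ) : ℂ := ∫ g, D.heatWave η t g * Φ g

lemma integrable_heatWave_mul (t : ℝ) {Φ : 𝔾 → ℂ} (hΦ : IsTest Φ) :
    Integrable fun g => D.heatWave η t g * Φ g :=
  ((contDiff_heatWave t).continuous.mul hΦ.1.continuous).integrable_of_hasCompactSupport
    hΦ.2.mul_left

lemma continuous_heat (t : ℝ) : Continuous (D.heat η t) := by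
  unfold heat
  fun_prop

variable (hη : η ∈ D.Ω) (halt : Alt β)
include hη halt

omit hη halt in
lemma integral_gaussian_normalized {t : ℝ} (ht : 0 < t) :
    Integrable (fun x : Eu d₁ => (√(4 * π * t) ^ d₁)⁻¹ * exp (-(‖x‖ ^ 2 / (4 * t)))) ∧
    ∫ x : Eu d₁, (√(4 * π * t) ^ d₁)⁻¹ * exp (-(‖x‖ ^ 2 / (4 * t))) = 1 := by
  have hb : 0 < (4 * t)⁻¹ := by positivity
  have e : ∀ x : Eu d₁, exp (-(‖x‖ ^ 2 / (4 * t))) = exp (-(4 * t)⁻¹ * ‖x‖ ^ 2) := by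
    intro x
    congr 1
    ring
  have h := GaussianFourier.integral_rexp_neg_mul_sq_norm (V := Eu d₁) hb
  have e2 : (π / (4 * t)⁻¹) ^ ((finrank ℝ (Eu d₁) : ℝ) / 2) = √(4 * π * t) ^ d₁ := by
    rw [finrank_euclideanSpace_fin, Real.sqrt_eq_rpow, ← rpow_natCast, ← Real.rpow_mul
      (by positivity)]
    congr 1
    · field_simp
    · ring
  rw [e2] at h
  have hpos : 0 < √(4 * π * t) ^ d₁ := by positivity
  simp only [e]
  constructor
  · refine Integrable.const_mul ?_ _
    by_contra hni
    rw [integral_undef hni] at h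
    exact hpos.ne h
  · rw [integral_const_mul, h, inv_mul_cancel₀ hpos.ne']

lemma integrable_heat {t : ℝ} (ht : 0 < t) : Integrable (D.heat η t) ∧ ∫ x, D.heat η t x ≤ 1 := by
  obtain ⟨h1, h2⟩ := integral_gaussian_normalized ht
  have h3 : Integrable (D.heat η t) := h1.mono' (continuous_heat t).aestronglyMeasurable
    (.of_forall fun x => by
      rw [norm_of_nonneg (heat_pos hη ht x).le]
      exact heat_le hη halt ht x)
  exact ⟨h3, (integral_mono h3 h1 fun x => heat_le hη halt ht x).trans_eq h2⟩

lemma norm_heatInt_le {t : ℝ} (ht : 0 < t) {Φ : 𝔾 → ℂ} (hΦ : IsTest Φ) {C : ℝ}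
    (hC : ∀ x, ∫ u, ‖Φ (x, u)‖ ≤ C) : ‖D.heatInt η t Φ‖ ≤ C := by
  have hi := integrable_heatWave_mul (D := D) (η := η) t hΦ
  have hn : ∀ g, ‖D.heatWave η t g * Φ g‖ = D.heat η t g.1 * ‖Φ g‖ := by
    intro g
    rw [norm_mul, heatWave, norm_mul, mul_comm I, norm_exp_ofReal_mul_I, mul_one,
      norm_real, norm_of_nonneg (heat_pos hη ht _).le]
  have hC0 : 0 ≤ C := (integral_nonneg fun u => norm_nonneg _).trans (hC 0)
  obtain ⟨h1, h2⟩ := integrable_heat hη halt ht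
  have hi' : Integrable (fun g : 𝔾 => D.heat η t g.1 * ‖Φ g‖)
      (volume.prod volume) := hi.norm.congr (.of_forall fun g => hn g)
  calc ‖D.heatInt η t Φ‖ ≤ ∫ g, ‖D.heatWave η t g * Φ g‖ := norm_integral_le_integral_norm _
    _ = ∫ g : 𝔾, D.heat η t g.1 * ‖Φ g‖ ∂(volume.prod volume) := by
        simp only [hn]
        rfl
    _ = ∫ x, D.heat η t x * ∫ u, ‖Φ (x, u)‖ := by
        rw [integral_prod _ hi']
        simp only [integral_const_mul]
    _ ≤ ∫ x, D.heat η t x * C := by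
        refine integral_mono_of_nonneg (.of_forall fun x => mul_nonneg
          (heat_pos hη ht x).le (integral_nonneg fun u => norm_nonneg _)) (h1.mul_const C)
          (.of_forall fun x => ?_)
        exact mul_le_mul_of_nonneg_left (hC x) (heat_pos hη ht x).le
    _ = (∫ x, D.heat η t x) * C := integral_mul_const _ _
    _ ≤ C := mul_le_of_le_one_left hC0 h2

omit hη in
lemma exists_norm_heatInt_le {Φ : 𝔾 → ℂ} (hΦ : IsTest Φ) :
    ∃ B : Eu d₂ → ℝ, Integrable B ∧ ∀ η ∈ D.Ω, ∀ t, 0 < t → ‖D.heatInt η t Φ‖ ≤ B η := by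
  have hT : IsTest ((cenOp β)^[d₂ + 1] Φ) :=
    (integral_mul_cenOp_iterate β halt (h := fun _ => 1) (locallyIntegrable_const 1) (η := 0)
      (by simp) hΦ (d₂ + 1)).1
  obtain ⟨C, hC0, hC⟩ := hT.exists_integral_fiber_le
  refine ⟨fun η => C * ((1 + ‖η‖ ^ 2 / 1) ^ (d₂ + 1))⁻¹,
    (integrable_inv_one_add_norm_sq_div_pow one_pos (by
      rw [finrank_euclideanSpace_fin]; omega)).const_mul C, fun η hη t ht => ?_⟩
  have h1 := (integral_mul_cenOp_iterate β halt (contDiff_heatWave (D := D) (η := η)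
    t).continuous.locallyIntegrable (η := η) (fun g a => by
      simp only [heatWave, Prod.fst_add, Prod.snd_add, add_zero, inner_add_right]
      push_cast
      rw [mul_add, Complex.exp_add]
      ring) hΦ (d₂ + 1)).2
  have h2 := norm_heatInt_le hη halt ht hT hC
  rw [heatInt, h1, norm_mul, norm_real, norm_of_nonneg (by positivity)] at h2
  beta_reduce
  rw [div_one, ← div_eq_mul_inv, le_div_iff₀ (by positivity), mul_comm]
  exact h2

omit halt in
lemma continuousOn_logDer_mul_heatWave : ContinuousOn (fun p : ℝ × 𝔾 => (D.logDer η p.1 p.2.1 : ℂ) *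
      D.heatWave η p.1 p.2) (Set.Ioi 0 ×ˢ Set.univ) := by
  have hr : ∀ i, ContinuousOn (fun p : ℝ × 𝔾 => D.rate η p.1 i) (Set.Ioi 0 ×ˢ Set.univ) := fun i =>
    ContinuousOn.comp (fun t ht => (hasDerivAt_rate hη ht i).continuousAt.continuousWithinAt)
      continuousOn_fst fun p hp => hp.1
  have hn : ∀ i, ContinuousOn (fun p : ℝ × 𝔾 => D.nrm η p.1 i) (Set.Ioi 0 ×ˢ Set.univ) := fun i =>
    ContinuousOn.comp (fun t ht => (hasDerivAt_nrm hη ht i).continuousAt.continuousWithinAt)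
      continuousOn_fst fun p hp => hp.1
  have hp : ∀ i, ContinuousOn (fun p : ℝ × 𝔾 => ‖D.Pr η i p.2.1‖ ^ 2)
      (Set.Ioi 0 ×ˢ Set.univ) := fun i => by fun_prop
  refine ContinuousOn.mul (Complex.continuous_ofReal.comp_continuousOn ?_)
    (ContinuousOn.mul (Complex.continuous_ofReal.comp_continuousOn ?_) (by fun_prop))
  · exact continuousOn_finsetSum _ fun i _ => ((continuousOn_const.mul (hr i)).div_const 2).neg.sub
      (((continuousOn_const.sub ((hr i).pow 2)).mul (hp i)).div_const 4)
  · exact continuousOn_finsetProd _ fun i _ => (hn i).mul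
      (Real.continuous_exp.comp_continuousOn (((hr i).mul (hp i)).div_const 4).neg)

lemma hasDerivAt_heatInt {t : ℝ} (ht : 0 < t) {Φ : 𝔾 → ℂ} (hΦ : IsTest Φ) :
    HasDerivAt (fun t => D.heatInt η t Φ) (-D.heatInt η t (𝓛 β Φ)) t := by
  have hK : IsCompact (Set.Icc (t / 2) (2 * t) ×ˢ tsupport Φ) := isCompact_Icc.prod hΦ.2.isCompact
  obtain ⟨C, hC⟩ := hK.exists_bound_of_continuousOn
    ((continuousOn_logDer_mul_heatWave hη).mono (Set.prod_mono
      (fun s hs => lt_of_lt_of_le (by positivity) hs.1) (Set.subset_univ _)))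
  have hc : ∀ s, 0 < s → Continuous fun g : 𝔾 => (D.logDer η s g.1 : ℂ) *
      D.heatWave η s g := fun s hs => continuousOn_univ.mp
    ((continuousOn_logDer_mul_heatWave hη).comp (f := fun g => (s, g)) (by fun_prop)
      fun g _ => ⟨hs, trivial⟩)
  have hw : ∀ s, Continuous (D.heatWave η s) := fun s => (contDiff_heatWave s).continuous
  have h := hasDerivAt_integral_of_dominated_loc_of_deriv_le (𝕜 := ℝ) (μ := volume)
    (F := fun s g => D.heatWave η s g * Φ g) (x₀ := t)
    (F' := fun s g => D.logDer η s g.1 * D.heatWave η s g * Φ g)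
    (bound := fun g => C * ‖Φ g‖) (s := Set.Icc (t / 2) (2 * t))
    (Icc_mem_nhds (by linarith) (by linarith))
    (.of_forall fun s => ((hw s).mul hΦ.1.continuous).aestronglyMeasurable)
    (integrable_heatWave_mul t hΦ)
    ((hc t ht).mul hΦ.1.continuous).aestronglyMeasurable
    (.of_forall fun g s hs => ?_)
    ((hΦ.1.continuous.integrable_of_hasCompactSupport hΦ.2).norm.const_mul C)
    (.of_forall fun g s hs => ?_)
  · refine h.2.congr_deriv ?_
    rw [heatInt, integral_heatWave_mul_sublaplacian hη halt t hΦ, neg_neg]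
  · by_cases hg : g ∈ tsupport Φ
    · rw [norm_mul]
      exact mul_le_mul_of_nonneg_right (hC (s, g) ⟨hs, hg⟩) (norm_nonneg _)
    · simp [image_eq_zero_of_notMem_tsupport hg]
  · have hs0 : 0 < s := lt_of_lt_of_le (by positivity) hs.1
    refine ((((hasDerivAt_heat hη hs0 g.1).ofReal_comp).mul_const _).mul_const (Φ g)).congr_deriv ?_
    rw [heatWave]
    push_cast
    ring

lemma hasSum_integral_exp_coeff {t : ℝ} (ht : 0 < t) (x : Eu d₁) :
    HasSum (fun n => ∫ ξ, (exp (-(t * (D.lam η n + ‖D.P₀ η ξ‖ ^ 2))) : ℂ) * D.coeff x η ξ n)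
      (((2 * π) ^ d₁ / 2 ^ (∑ j, D.r j) * D.heat η t x : ℝ) : ℂ) := by
  have hinner : ∀ v : D.W η none, inner ℝ (v : Eu d₁) x =
      inner ℝ v ((D.W η none).orthogonalProjectionOnto x) := by simp
  set w : Fin D.d → ℝ := fun j => D.b j η * ‖D.P j η x‖ ^ 2 / 4 with hw
  set A0 : ℝ := (π / t) ^ ((D.r₀ : ℝ) / 2) * exp (-(‖D.Pr η none x‖ ^ 2 / (4 * t)))
    with hA0
  let f : Fin D.d → ℕ → ℂ := fun j n => (((π * D.b j η) ^ D.r j *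
    exp (-(t * (D.r j * D.b j η))) * ((-exp (-(2 * t * D.b j η))) ^ n *
      laguerreFun n (D.r j - 1) (w j)) : ℝ) : ℂ)
  have hterm : ∀ n, ∫ ξ, (exp (-(t * (D.lam η n + ‖D.P₀ η ξ‖ ^ 2))) : ℂ) *
      D.coeff x η ξ n = (A0 : ℂ) * ∏ j, f j (n j) := by
    intro n
    rw [integral_mul_coeff hη halt (fun v => (exp (-(t * (D.lam η n + ‖v‖ ^ 2))) : ℂ))]
    have e1 : ∀ v : D.W η none, (exp (-(t * (D.lam η n + ‖(v : Eu d₁)‖ ^ 2))) : ℂ) *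
        𝐞((v : Eu d₁),x) =
        (exp (-(t * D.lam η n)) : ℂ) * ((exp (-(t * ‖v‖ ^ 2)) : ℂ) *
          𝐞(v,((D.W η none).orthogonalProjectionOnto x))) := by
      intro v
      rw [hinner, ← mul_assoc, ← ofReal_mul, ← Real.exp_add]
      congr 3
      rw [Submodule.coe_norm]
      ring_nf
    have e2 : ‖(D.W η none).orthogonalProjectionOnto x‖ = ‖D.Pr η none x‖ := rfl
    have e3 : (finrank ℝ (D.W η none) : ℝ) = D.r₀ := by rw [finrank_W hη halt]; rfl
    simp only [e1]
    rw [integral_const_mul, integral_gaussian_mul_cexp ht, e2, e3, ← hA0]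
    have e4 : (exp (-(t * D.lam η n)) : ℂ) = ∏ j, ((exp (-(t * (D.r j * D.b j η))) *
        exp (-(2 * t * D.b j η)) ^ n j : ℝ) : ℂ) := by
      rw [← Complex.ofReal_prod]
      congr 1
      simp only [← Real.exp_nat_mul, ← Real.exp_add, ← exp_sum]
      congr 1
      rw [lam, mul_sum, ← sum_neg_distrib]
      refine sum_congr rfl fun j _ => ?_
      ring
    rw [e4, mul_comm _ (A0 : ℂ), mul_assoc, ← prod_mul_distrib]
    congr 1
    refine prod_congr rfl fun j _ => ?_
    simp only [f, hw]
    rw [← ofReal_mul]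
    congr 1
    rw [neg_pow (exp _)]
    ring
  have hfj : ∀ j, HasSum (fun n => ((-exp (-(2 * t * D.b j η))) ^ n *
      laguerreFun n (D.r j - 1) (w j)))
      (((1 + -exp (-(2 * t * D.b j η))) ^ D.r j)⁻¹ * exp (-(w j *
        ((1 - -exp (-(2 * t * D.b j η))) / (1 + -exp (-(2 * t * D.b j η))))))) := by
    intro j
    have hb := D.b_pos j η hη
    have hs : |-exp (-(2 * t * D.b j η))| < 1 := by
      rw [abs_neg, abs_of_pos (exp_pos _), Real.exp_lt_one_iff]
      have : 0 < 2 * t * D.b j η := by positivity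
      linarith
    have h := hasSum_laguerreFun hs (D.r j - 1) (w j)
    rwa [Nat.sub_add_cancel (D.r_pos j)] at h
  have hs := summable_norm_prod_pi f fun j => by
    simp only [f, norm_real]
    exact ((hfj j).summable.mul_left _).norm
  have h1 := hs.1.of_norm.hasSum.mul_left (A0 : ℂ)
  rw [hs.2] at h1
  simp only [hterm]
  refine (congrArg (HasSum _) ?_).mp h1
  have h2 : ∀ j, ∑' n, f j n = (((2 * π) ^ (2 * D.r j) / 2 ^ D.r j *
      (D.nrm η t (some j) * exp (-(D.rate η t (some j) * ‖D.Pr η (some j) x‖ ^ 2 / 4))) : ℝ) :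
        ℂ) := by
    intro j
    have hb := D.b_pos j η hη
    simp only [f]
    rw [← Complex.ofReal_tsum, ((hfj j).mul_left _).tsum_eq]
    congr 1
    set y := t * D.b j η with hy
    have hy0 : 0 < y := by positivity
    have hsh : 0 < sinh y := Real.sinh_pos_iff.mpr hy0
    have q1 : 1 + -exp (-(2 * t * D.b j η)) = 2 * exp (-y) * sinh y := by
      have : exp (-(2 * t * D.b j η)) = exp (-y) * exp (-y) := by
        rw [← Real.exp_add]; congr 1; rw [hy]; ring
      have h3 : exp (-y) * exp y = 1 := by rw [← Real.exp_add]; simp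
      rw [this, Real.sinh_eq]
      linear_combination -h3
    have q2 : 1 - -exp (-(2 * t * D.b j η)) = 2 * exp (-y) * cosh y := by
      have : exp (-(2 * t * D.b j η)) = exp (-y) * exp (-y) := by
        rw [← Real.exp_add]; congr 1; rw [hy]; ring
      have h3 : exp (-y) * exp y = 1 := by rw [← Real.exp_add]; simp
      rw [this, Real.cosh_eq]
      linear_combination -h3
    have q3 : exp (-(t * (D.r j * D.b j η))) = exp (-y) ^ D.r j := by
      rw [← Real.exp_nat_mul]; congr 1; rw [hy]; ring
    rw [q1, q2, q3]
    have hE := exp_pos (-y)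
    have q4 : w j * (2 * exp (-y) * cosh y / (2 * exp (-y) * sinh y)) =
        D.rate η t (some j) * ‖D.Pr η (some j) x‖ ^ 2 / 4 := by
      simp only [rate, hw, P_eq, ← hy]
      field_simp
    rw [q4, ← mul_assoc, ← mul_assoc]
    congr 1
    simp only [nrm, ← hy]
    rw [pow_mul, ← div_pow, ← mul_pow, ← mul_pow, ← inv_pow, ← mul_pow]
    congr 1
    field_simp
    ring
  simp only [h2]
  rw [← Complex.ofReal_prod, ← ofReal_mul]
  congr 1
  rw [heat, Fintype.prod_option, prod_mul_distrib, prod_div_distrib,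
    prod_pow_eq_pow_sum, prod_pow_eq_pow_sum]
  have e5 : A0 = (2 * π) ^ D.r₀ * (D.nrm η t none *
      exp (-(D.rate η t none * ‖D.Pr η none x‖ ^ 2 / 4))) := by
    rw [hA0, ← mul_assoc]
    congr 1
    · simp only [nrm]
      rw [← inv_pow, ← mul_pow, ← rpow_natCast]
      have h3 : (π / t) = (2 * π * (√(4 * π * t))⁻¹) ^ (2 : ℝ) := by
        rw [Real.rpow_two, mul_pow, inv_pow, sq_sqrt (by positivity)]
        field_simp
        ring
      rw [h3, ← Real.rpow_mul (by positivity)]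
      congr 1
      ring
    · congr 2
      simp only [rate]
      field_simp
  have e6 : (2 * π) ^ d₁ = (2 * π) ^ D.r₀ * (2 * π) ^ (∑ j, 2 * D.r j) := by
    rw [← pow_add, ← mul_sum, sum_mult hη]
  rw [e5, e6]
  ring

end SpectralData

/-! ### Fourier transform in the central variables -/

section Fiber

variable {d₁ d₂ : ℕ}

/-- The Fourier transform in the central variables. -/
def fib (η : Eu d₂) (Φ : 𝔾 → ℂ) (x : Eu d₁) : ℂ := ∫ u, 𝐞(η,u) * Φ (x, u)

variable {Φ : 𝔾 → ℂ}

lemma continuous_fib (hΦ : IsTest Φ) : Continuous fun p : ℙ => fib p.1 Φ p.2 := by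
  have hc := hΦ.1.continuous
  refine continuousOn_univ.mp (continuousOn_integral_of_compact_support
    (f := fun (p : ℙ) u => 𝐞(p.1,u) * Φ (p.2, u))
    (hΦ.2.isCompact.image continuous_snd) (Continuous.continuousOn (by fun_prop)) ?_)
  intro p u _ hu
  rw [image_eq_zero_of_notMem_tsupport (fun h => hu ⟨_, h, rfl⟩), mul_zero]

lemma hasCompactSupport_fib (hΦ : IsTest Φ) (η : Eu d₂) : HasCompactSupport (fib η Φ) := by
  refine HasCompactSupport.intro (hΦ.2.isCompact.image continuous_fst) fun x hx => ?_
  refine integral_eq_zero_of_ae (.of_forall fun u => ?_)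
  change _ * Φ (x, u) = 0
  rw [image_eq_zero_of_notMem_tsupport (fun h => hx ⟨_, h, rfl⟩), mul_zero]

lemma conj_fib (η : Eu d₂) (x : Eu d₁) : conj (fib η Φ x) = ∫ u, 𝐞((-η),u) * conj (Φ (x, u)) := by
  rw [fib, ← integral_conj]
  refine integral_ext fun u => ?_
  simp [← Complex.exp_conj]

lemma integral_fib (hΦ : IsTest Φ) (x : Eu d₁) : Integrable (fun η => fib η Φ x) ∧
    ∫ η, fib η Φ x = ((2 * π) ^ d₂ : ℝ) * Φ (x, 0) := by
  have hemb : Topology.IsClosedEmbedding fun u : Eu d₂ => (x, u) :=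
    .of_continuous_injective_isClosedMap (by fun_prop) (fun u v h => congrArg Prod.snd h) fun s hs => by
      rw [show (fun u : Eu d₂ => (x, u)) '' s = {x} ×ˢ s by
        ext p; simp [Prod.ext_iff, eq_comm, and_comm]]
      exact isClosed_singleton.prod hs
  let F : 𝓢(Eu d₂, ℂ) := (hΦ.2.comp_isClosedEmbedding hemb).toSchwartzMap
    (hΦ.1.comp (contDiff_const.prodMk contDiff_id))
  have e : ∀ η, fib η Φ x = (FourierTransform.fourierInv F : 𝓢(Eu d₂, ℂ)) ((2 * π)⁻¹ • η) := by
    intro η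
    rw [SchwartzMap.fourierInv_coe, Real.fourierInv_eq']
    refine integral_ext fun u => ?_
    rw [inner_smul_right, smul_eq_mul, ← mul_assoc, mul_inv_cancel₀ (by positivity), one_mul,
      mul_comm I, real_inner_comm]
    rfl
  have hp : (2 * π)⁻¹ ≠ 0 := by positivity
  simp only [e]
  refine ⟨(FourierTransform.fourierInv F : 𝓢(Eu d₂, ℂ)).integrable.comp_smul hp, ?_⟩
  rw [Measure.integral_comp_smul, finrank_euclideanSpace_fin]
  have h0 := congrArg (fun G : 𝓢(Eu d₂, ℂ) => G 0) 
    (FourierTransform.fourier_fourierInv_eq (F := 𝓢(Eu d₂, ℂ)) (E := 𝓢(Eu d₂, ℂ)) F)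
  simp only [SchwartzMap.fourier_coe, Real.fourier_eq', inner_zero_right, mul_zero,
    ofReal_zero, zero_mul, Complex.exp_zero, one_smul] at h0
  rw [h0, inv_pow, inv_inv, abs_of_nonneg (by positivity), real_smul]
  rfl

end Fiber

/-! ### Correlation functions -/

section Corr

variable {d₁ d₂ : ℕ} (β : 𝔅)

/-- The matrix coefficient `⟨R_k φ, f⟩` of the right regular representation. -/
def corr (φ f : 𝔾 → ℂ) (k : 𝔾) : ℂ := ∫ h, f h * conj (φ (mul β h k))

variable {φ f : 𝔾 → ℂ}

lemma corr_zero (hφ : IsTest φ) (hf : IsTest f) : corr β φ f 0 = inner ℂ (toL2 φ) (toL2 f) := by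
  rw [inner_toL2_toL2 hφ.memLp hf.memLp]
  refine integral_ext fun h => ?_
  rw [mul_zero', mul_comm]

lemma corr_comp_add (a : Eu d₂) (k : 𝔾) :
    corr β (fun g => φ (g + (0, a))) f k = corr β φ f (k + (0, a)) := by
  simp only [corr, ← mul_central β, mul_assoc']

lemma integrable_corr (hφ : IsTest φ) (hf : IsTest f) (k : 𝔾) :
    Integrable fun h => f h * conj (φ (mul β h k)) := by
  have h1 : Continuous fun h => mul β h k := Continuous.mul β continuous_id continuous_const
  exact (hf.1.continuous.mul (Complex.continuous_conj.comp
    (hφ.1.continuous.comp h1))).integrable_of_hasCompactSupport hf.2.mul_right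

lemma corr_add_left {φ' : 𝔾 → ℂ} (hφ : IsTest φ) (hφ' : IsTest φ') (hf : IsTest f) :
    corr β (fun g => φ g + φ' g) f = fun k => corr β φ f k + corr β φ' f k := by
  funext k
  rw [corr, corr, corr, ← integral_add (integrable_corr β hφ hf k) (integrable_corr β hφ' hf k)]
  simp only [map_add, mul_add]

lemma corr_const_mul_left (c : ℂ) :
    corr β (fun g => c * φ g) f = fun k => conj c * corr β φ f k := by
  funext k
  rw [corr, corr, ← integral_const_mul]
  simp only [map_mul, mul_left_comm]

variable (halt : Alt β)
include halt

lemma IsTest.corr (hφ : IsTest φ) (hf : IsTest f) : IsTest (corr β φ f) := by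
  have hφ' : IsTest fun g => conj (φ (-g)) :=
    IsTest.conj ⟨hφ.1.comp contDiff_neg, hφ.2.comp_homeomorph (Homeomorph.neg _)⟩
  have e : TwoStep.corr β φ f = fun k => leftReg β (fun g => conj (φ (-g))) f (-k) := by
    funext k
    refine integral_ext fun h => ?_
    beta_reduce
    rw [neg_mul_rev β halt, neg_neg, neg_neg]
  refine ⟨?_, ?_⟩
  · rw [e]
    exact (contDiff_leftReg β halt hφ' (hf.1.continuous.locallyIntegrable)).comp contDiff_neg
  · refine HasCompactSupport.intro
      (K := (fun p : 𝔾 × 𝔾 => mul β (-p.1) p.2) '' (tsupport f ×ˢ tsupport φ))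
      ((hf.2.isCompact.prod hφ.2.isCompact).image
        (Continuous.mul β continuous_fst.neg continuous_snd)) fun k hk => ?_
    refine integral_eq_zero_of_ae (.of_forall fun h => ?_)
    change f h * _ = 0
    by_contra h0
    obtain ⟨h1, h2⟩ := mul_ne_zero_iff.mp h0
    refine hk ⟨(h, mul β h k), ⟨subset_tsupport _ h1, subset_tsupport _ fun h3 => ?_⟩,
      neg_mul_cancel_left β halt h k⟩
    exact h2 (by rw [h3, map_zero])

lemma field_corr (hφ : IsTest φ) (hf : IsTest f) (v : 𝔾) :
    𝒳 β v (corr β φ f) = corr β (𝒳 β v φ) f := by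
  funext k
  have h1 := hasDerivAt_integral_mul β halt (h := fun g => f (mul β g (-k)))
    (hf.comp_mul_right β halt (-k)).1.continuous.locallyIntegrable hφ.conj v 0
  have h2 : ∀ t : ℝ, ∫ g, f (mul β g (-k)) * conj (φ (mul β g (t • v))) =
      corr β φ f (mul β k (t • v)) := by
    intro t
    rw [← integral_mul_right β halt _ k]
    refine integral_ext fun h => ?_
    rw [mul_neg_cancel_right β halt, mul_assoc']
  simp only [h2] at h1
  rw [leftInvariantField, h1.deriv, ← integral_mul_right β halt _ k]
  refine integral_ext fun h => ?_
  rw [mul_neg_cancel_right β halt, zero_smul, mul_zero', field_conj]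

lemma sublaplacian_corr (hφ : IsTest φ) (hf : IsTest f) : 𝓛 β (corr β φ f) = corr β (𝓛 β φ) f := by
  funext k
  have h : ∀ j : Fin d₁, IsTest (𝒳 β (single j 1, 0)
      (𝒳 β (single j 1, 0) φ)) := fun j => (hφ.field β _).field β _
  simp only [sublaplacian, field_corr β halt hφ hf, field_corr β halt (hφ.field β _) hf]
  simp only [corr]
  rw [← integral_finsetSum _ fun j _ => integrable_corr β (h j) hf k, ← integral_neg]
  simp only [map_neg, map_sum, mul_neg, mul_sum, sublaplacian]

lemma fib_corr_zero (hφ : IsTest φ) (hf : IsTest f) (η : Eu d₂) :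
    fib η (corr β φ f) 0 = ∫ y, fib (-η) f y * conj (fib (-η) φ y) := by
  have hφc := hφ.1.continuous
  have hfc := hf.1.continuous
  have hG : Integrable (fun p : Eu d₂ × 𝔾 =>
      𝐞(η,p.1) * (f p.2 * conj (φ (p.2 + (0, p.1))))) (volume.prod volume) := by
    refine Continuous.integrable_of_hasCompactSupport (by fun_prop) (HasCompactSupport.intro
      (K := (fun q : 𝔾 × 𝔾 => ((q.1 - q.2).2, q.2)) '' (tsupport φ ×ˢ tsupport f))
      ((hφ.2.isCompact.prod hf.2.isCompact).image (by fun_prop)) fun p hp => ?_)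
    by_contra h0
    obtain ⟨h1, h2⟩ := mul_ne_zero_iff.mp (mul_ne_zero_iff.mp h0).2
    refine hp ⟨(p.2 + (0, p.1), p.2), ⟨subset_tsupport _ fun h3 => h2 (by rw [h3, map_zero]),
      subset_tsupport _ h1⟩, ?_⟩
    simp
  have hH : Integrable (fun h : 𝔾 => 𝐞((-η),h.2) *
      f h * conj (fib (-η) φ h.1)) (volume.prod volume) := by
    have h1 : Continuous fun h : 𝔾 => fib (-η) φ h.1 :=
      (continuous_fib hφ).comp (f := fun h : 𝔾 => (-η, h.1)) (by fun_prop)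
    exact Continuous.integrable_of_hasCompactSupport (by fun_prop) (hf.2.mul_left.mul_right)
  calc fib η (corr β φ f) 0 = ∫ u, ∫ h, 𝐞(η,u) *
        (f h * conj (φ (h + (0, u)))) := by
        simp only [fib, corr, mul_central β, ← integral_const_mul]
    _ = ∫ h : 𝔾, ∫ u, 𝐞(η,u) * (f h * conj (φ (h + (0, u)))) := integral_integral_swap hG
    _ = ∫ h : 𝔾, 𝐞((-η),h.2) * f h * conj (fib (-η) φ h.1) := by
        refine integral_ext fun h => ?_
        rw [conj_fib, ← integral_const_mul, neg_neg, ← integral_add_left_eq_self _ (-h.2)]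
        refine integral_ext fun u => ?_
        have e1 : h + (0, -h.2 + u) = (h.1, u) := by ext1 <;> simp
        rw [e1, inner_add_right, inner_neg_left, inner_neg_right]
        push_cast
        rw [mul_add, Complex.exp_add]
        ring
    _ = ∫ h : 𝔾, 𝐞((-η),h.2) * f h * conj (fib (-η) φ h.1) ∂(volume.prod volume) := rfl
    _ = _ := by
        rw [integral_prod _ hH]
        refine integral_ext fun y => ?_
        exact integral_mul_const (conj (fib (-η) φ y)) fun u => 𝐞((-η),u) * f (y, u)

omit halt in
lemma integrable_norm_sq_fib (hf : IsTest f) (η : Eu d₂) : Integrable fun y => ‖fib η f y‖ ^ 2 := by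
  have h1 : Continuous fun y => fib η f y :=
    (continuous_fib hf).comp (f := fun y => (η, y)) (by fun_prop)
  exact (by fun_prop : Continuous fun y => ‖fib η f y‖ ^ 2).integrable_of_hasCompactSupport
    ((hasCompactSupport_fib hf η).comp_left (g := fun z : ℂ => ‖z‖ ^ 2) (by simp))

lemma fib_corr_self (hf : IsTest f) (η : Eu d₂) :
    fib η (corr β f f) 0 = ((∫ y, ‖fib (-η) f y‖ ^ 2 : ℝ) : ℂ) := by
  rw [fib_corr_zero β halt hf hf, ← integral_complex_ofReal]
  refine integral_ext fun y => ?_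
  rw [Complex.mul_conj, normSq_eq_norm_sq]

lemma integral_norm_sq_fib (hf : IsTest f) : Integrable (fun η : Eu d₂ => ∫ y, ‖fib (-η) f y‖ ^ 2) ∧
      ∫ η : Eu d₂, ∫ y, ‖fib (-η) f y‖ ^ 2 = (2 * π) ^ d₂ * ‖toL2 f‖ ^ 2 := by
  obtain ⟨h1, h2⟩ := integral_fib (hf.corr β halt hf) 0
  simp only [fib_corr_self β halt hf] at h1 h2
  refine ⟨h1.re, ?_⟩
  rw [integral_complex_ofReal, ← Prod.zero_eq_mk, corr_zero β hf hf, inner_self_eq_norm_sq_to_K] at h2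
  apply ofReal_injective
  rw [h2]
  push_cast
  rfl

lemma norm_fib_corr_le (hφ : IsTest φ) (hf : IsTest f) (η : Eu d₂) (x : Eu d₁) :
    ‖fib η (corr β φ f) x‖ ≤ ((∫ y, ‖fib (-η) φ y‖ ^ 2) + ∫ y, ‖fib (-η) f y‖ ^ 2) / 2 := by
  have hψ := hφ.comp_mul_right β halt (x, 0)
  have e1 : ∀ u, corr β φ f (x, u) = corr β (fun g => φ (mul β g (x, 0))) f (0, u) := by
    intro u
    have : ((x, u) : 𝔾) = mul β (0, u) (x, 0) := by simp [mul]
    simp only [corr, this, mul_assoc']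
  have e2 : ∀ u, corr β (fun g => φ (mul β g (x, 0))) (fun g => φ (mul β g (x, 0))) (0, u) =
      corr β φ φ (0, u) := by
    intro u
    rw [corr, corr, ← integral_mul_right β halt (fun h => φ h * conj (φ (mul β h (0, u)))) (x, 0)]
    refine integral_ext fun g => ?_
    rw [mul_assoc', mul_assoc']
    have : mul β (0, u) (x, 0) = mul β (x, 0) ((0, u) : 𝔾) := by simp [mul]
    rw [this]
  have e3 : (∫ y, ‖fib (-η) (fun g => φ (mul β g (x, 0))) y‖ ^ 2) = ∫ y, ‖fib (-η) φ y‖ ^ 2 := by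
    have h := fib_corr_self β halt hψ η
    simp only [fib, e2] at h
    have h' := fib_corr_self β halt hφ η
    simp only [fib] at h'
    exact_mod_cast h.symm.trans h'
  have e4 : fib η (corr β φ f) x = fib η (corr β (fun g => φ (mul β g (x, 0))) f) 0 := by
    simp only [fib, e1]
  rw [e4, fib_corr_zero β halt hψ hf, ← e3, ← integral_add (integrable_norm_sq_fib hψ _)
    (integrable_norm_sq_fib hf _), ← integral_div]
  refine norm_integral_le_of_norm_le (((integrable_norm_sq_fib hψ _).add
    (integrable_norm_sq_fib hf _)).div_const 2) (.of_forall fun y => ?_)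
  rw [norm_mul, RCLike.norm_conj]
  nlinarith [sq_nonneg (‖fib (-η) (fun g => φ (mul β g (x, 0))) y‖ - ‖fib (-η) f y‖)]

end Corr

namespace SpectralData

variable {d₁ d₂ : ℕ} {β : 𝔅} {D : SpectralData β}

/-! ### The heat semigroup at time zero -/

lemma heatInt_eq_fib (η : Eu d₂) (t : ℝ) {Φ : 𝔾 → ℂ} (hΦ : IsTest Φ) :
    D.heatInt η t Φ = ∫ x, (D.heat η t x : ℂ) * fib η Φ x := by
  have hi : Integrable (fun g => D.heatWave η t g * Φ g) (volume.prod volume) :=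
    integrable_heatWave_mul t hΦ
  refine (integral_prod _ hi).trans (integral_ext fun x => ?_)
  rw [fib, ← integral_const_mul]
  simp only [heatWave, mul_assoc]

lemma tendsto_sinh_div : Tendsto (fun s => sinh s / s) (𝓝[≠] 0) (𝓝 1) := by
  have h := (Real.hasDerivAt_sinh 0).tendsto_slope
  simpa [slope_fun_def_field] using h

variable {η : Eu d₂} (hη : η ∈ D.Ω)
include hη

lemma tendsto_rate (i : Option (Fin D.d)) : Tendsto (fun t => t * D.rate η t i) (𝓝[>] 0) (𝓝 1) := by
  rcases i with _ | j
  · refine tendsto_const_nhds.congr' ?_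
    filter_upwards [self_mem_nhdsWithin] with t ht
    exact (mul_inv_cancel₀ (ne_of_gt ht)).symm
  · have hb := D.b_pos j η hη
    have h1 : Tendsto (fun t : ℝ => t * D.b j η) (𝓝[>] 0) (𝓝[≠] 0) := by
      refine tendsto_nhdsWithin_iff.mpr ⟨?_, ?_⟩
      · exact ((continuous_id.mul continuous_const).tendsto' _ _ (by simp)).mono_left
          nhdsWithin_le_nhds
      · filter_upwards [self_mem_nhdsWithin] with t ht
        exact (mul_pos ht hb).ne'
    have h2 : Tendsto (fun t : ℝ => cosh (t * D.b j η)) (𝓝[>] 0) (𝓝 1) :=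
      ((by fun_prop : Continuous fun t : ℝ => cosh (t * D.b j η)).tendsto' _ _
        (by simp)).mono_left nhdsWithin_le_nhds
    have h3 := h2.div (tendsto_sinh_div.comp h1) one_ne_zero
    rw [div_one] at h3
    refine h3.congr' ?_
    filter_upwards [self_mem_nhdsWithin] with t ht
    have ht' : t ≠ 0 := ne_of_gt ht
    simp only [comp_apply, rate, Pi.div_apply]
    field_simp

lemma tendsto_nrm (i : Option (Fin D.d)) :
    Tendsto (fun t => √t ^ D.mult i * D.nrm η t i) (𝓝[>] 0) (𝓝 (√(4 * π) ^ D.mult i)⁻¹) := by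
  rcases i with _ | j
  · refine tendsto_const_nhds.congr' ?_
    filter_upwards [self_mem_nhdsWithin] with t ht
    have ht' : √t ≠ 0 := (Real.sqrt_pos.mpr ht).ne'
    simp only [nrm, mult]
    rw [Real.sqrt_mul (by positivity) t, mul_pow]
    field_simp
  · have hb := D.b_pos j η hη
    have h1 : Tendsto (fun t : ℝ => t * D.b j η) (𝓝[>] 0) (𝓝[≠] 0) := by
      refine tendsto_nhdsWithin_iff.mpr ⟨?_, ?_⟩
      · exact ((continuous_id.mul continuous_const).tendsto' _ _ (by simp)).mono_left
          nhdsWithin_le_nhds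
      · filter_upwards [self_mem_nhdsWithin] with t ht
        exact (mul_pos ht hb).ne'
    have h3 := (((tendsto_sinh_div.comp h1).inv₀ one_ne_zero).mul_const (4 * π)⁻¹).pow (D.r j)
    have e : (1⁻¹ * (4 * π)⁻¹) ^ D.r j = (√(4 * π) ^ D.mult (some j))⁻¹ := by
      simp only [mult]
      rw [pow_mul, sq_sqrt (by positivity), inv_one, one_mul, inv_pow]
    rw [e] at h3
    refine h3.congr' ?_
    filter_upwards [self_mem_nhdsWithin] with t ht
    have ht' : 0 < t := ht
    have hs : 0 < sinh (t * D.b j η) := Real.sinh_pos_iff.mpr (by positivity)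
    simp only [comp_apply, nrm, mult]
    rw [pow_mul, sq_sqrt ht'.le, ← mul_pow]
    congr 1
    field_simp

variable (halt : Alt β)
include halt

lemma tendsto_heat (y : Eu d₁) : Tendsto (fun t => √t ^ d₁ * D.heat η t (√t • y)) (𝓝[>] 0)
      (𝓝 ((√(4 * π * 1) ^ d₁)⁻¹ * exp (-(‖y‖ ^ 2 / (4 * 1))))) := by
  have h := tendsto_finsetProd (s := univ) (f := fun (i : Option (Fin D.d)) t =>
    (√t ^ D.mult i * D.nrm η t i) * exp (-(t * D.rate η t i * ‖D.Pr η i y‖ ^ 2 / 4))) fun i _ =>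
    (tendsto_nrm hη i).mul (((Real.continuous_exp.tendsto _).comp
      ((((tendsto_rate hη i).mul_const (‖D.Pr η i y‖ ^ 2)).div_const 4).neg)))
  have e : ∏ i, (√(4 * π) ^ D.mult i)⁻¹ * exp (-(1 * ‖D.Pr η i y‖ ^ 2 / 4)) =
      (√(4 * π * 1) ^ d₁)⁻¹ * exp (-(‖y‖ ^ 2 / (4 * 1))) := by
    rw [prod_mul_distrib, ← exp_sum, prod_inv_distrib, prod_pow_eq_pow_sum,
      sum_mult' hη, norm_sq_eq_sum_starProjection (orthogonalFamily_W hη halt) (isInternal_W hη halt) y]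
    simp only [one_mul, mul_one, sum_neg_distrib, sum_div]
  rw [e] at h
  refine h.congr' ?_
  filter_upwards [self_mem_nhdsWithin] with t ht
  have ht' : 0 < t := ht
  have e2 : √t ^ d₁ = ∏ i, √t ^ D.mult i := by
    rw [prod_pow_eq_pow_sum, sum_mult' hη]
  rw [e2, heat, ← prod_mul_distrib]
  refine prod_congr rfl fun i _ => ?_
  rw [map_smul, norm_smul, mul_pow, norm_of_nonneg (Real.sqrt_nonneg _), sq_sqrt ht'.le, mul_assoc]
  ring_nf

lemma tendsto_heatInt {Φ : 𝔾 → ℂ} (hΦ : IsTest Φ) :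
    Tendsto (fun t => D.heatInt η t Φ) (𝓝[>] 0) (𝓝 (fib η Φ 0)) := by
  have hF : Continuous (fib η Φ) := (continuous_fib hΦ).comp (f := fun x => (η, x)) (by fun_prop)
  obtain ⟨C, hC⟩ := (hasCompactSupport_fib hΦ η).exists_bound_of_continuous hF
  obtain ⟨g1, g2⟩ := integral_gaussian_normalized (d₁ := d₁) one_pos
  have e : ∀ t, 0 < t → D.heatInt η t Φ =
      ∫ y, ((√t ^ d₁ * D.heat η t (√t • y) : ℝ) : ℂ) * fib η Φ (√t • y) := by
    intro t ht
    have hs : 0 < √t := Real.sqrt_pos.mpr ht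
    have h := Measure.integral_comp_smul (volume : Measure (Eu d₁))
      (fun x => (D.heat η t x : ℂ) * fib η Φ x) (√t)
    rw [finrank_euclideanSpace_fin, abs_of_nonneg (by positivity), ← heatInt_eq_fib η t hΦ,
      eq_inv_smul_iff₀ (pow_pos hs _).ne'] at h
    rw [← h, ← integral_smul]
    refine integral_ext fun y => ?_
    simp only [real_smul]
    push_cast
    ring
  have hlim : Tendsto (fun t => ∫ y, ((√t ^ d₁ * D.heat η t (√t • y) : ℝ) : ℂ) *
      fib η Φ (√t • y)) (𝓝[>] 0) (𝓝 (∫ y : Eu d₁, (((√(4 * π * 1) ^ d₁)⁻¹ *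
        exp (-(‖y‖ ^ 2 / (4 * 1))) : ℝ) : ℂ) * fib η Φ 0)) := by
    refine tendsto_integral_filter_of_dominated_convergence _ ?_ ?_ (g1.mul_const C) ?_
    · refine Eventually.of_forall fun t => Continuous.aestronglyMeasurable ?_
      have := continuous_heat (D := D) (η := η) t
      fun_prop
    · filter_upwards [self_mem_nhdsWithin] with t ht
      have ht' : 0 < t := ht
      refine Eventually.of_forall fun y => ?_
      rw [norm_mul, norm_real, norm_of_nonneg (mul_nonneg (by positivity) (heat_pos hη ht' _).le)]
      refine mul_le_mul ?_ (hC _) (norm_nonneg _) (by positivity)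
      refine (mul_le_mul_of_nonneg_left (heat_le hη halt ht' (√t • y)) (by positivity)).trans_eq ?_
      have hs : √t ≠ 0 := (Real.sqrt_pos.mpr ht').ne'
      rw [norm_smul, mul_pow, norm_of_nonneg (Real.sqrt_nonneg _), sq_sqrt ht'.le,
        Real.sqrt_mul (by positivity) t, mul_pow, mul_one, mul_one]
      field_simp
    · refine Eventually.of_forall fun y => ?_
      refine Tendsto.mul ((Complex.continuous_ofReal.tendsto _).comp (tendsto_heat hη halt y)) ?_
      refine Tendsto.mono_left (Continuous.tendsto' ?_ _ _ (by simp)) nhdsWithin_le_nhds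
      fun_prop
  rw [integral_mul_const, integral_complex_ofReal, g2, Complex.ofReal_one, one_mul] at hlim
  refine hlim.congr' ?_
  filter_upwards [self_mem_nhdsWithin] with t ht
  exact (e t ht).symm

lemma norm_heatInt_corr_le {φ f : 𝔾 → ℂ} (hφ : IsTest φ) (hf : IsTest f) {t : ℝ}
    (ht : 0 < t) : ‖D.heatInt η t (corr β φ f)‖ ≤
      ((∫ y, ‖fib (-η) φ y‖ ^ 2) + ∫ y, ‖fib (-η) f y‖ ^ 2) / 2 := by
  obtain ⟨h1, h2⟩ := integrable_heat hη halt ht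
  have h0 : 0 ≤ ((∫ y, ‖fib (-η) φ y‖ ^ 2) + ∫ y, ‖fib (-η) f y‖ ^ 2) / 2 := by positivity
  rw [heatInt_eq_fib η t (hφ.corr β halt hf)]
  refine (norm_integral_le_of_norm_le (h1.mul_const _) (.of_forall fun x => ?_)).trans
    ((integral_mul_const _ _).trans_le (mul_le_of_le_one_left h0 h2))
  rw [norm_mul, norm_real, norm_of_nonneg (heat_pos hη ht x).le]
  exact mul_le_mul_of_nonneg_left (norm_fib_corr_le β halt hφ hf η x) (heat_pos hη ht x).le

omit hη in
lemma continuousOn_heatWave {t : ℝ} (ht : 0 < t) :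
    ContinuousOn (fun p : Eu d₂ × 𝔾 => D.heatWave p.1 t p.2) (D.Ω ×ˢ Set.univ) := by
  have hb : ∀ j, ContinuousOn (fun p : Eu d₂ × 𝔾 => D.b j p.1) (D.Ω ×ˢ Set.univ) :=
    fun j => (D.b_cont j).comp continuousOn_fst fun p hp => hp.1
  have hs : ∀ j, ∀ p ∈ D.Ω ×ˢ (Set.univ : Set 𝔾), sinh (t * D.b j p.1) ≠ 0 :=
    fun j p hp => (Real.sinh_pos_iff.mpr (mul_pos ht (D.b_pos j p.1 hp.1))).ne'
  have hr : ∀ i, ContinuousOn (fun p : Eu d₂ × 𝔾 => D.rate p.1 t i) (D.Ω ×ˢ Set.univ) := by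
    rintro (_ | j)
    · exact continuousOn_const
    · exact (hb j).mul (((Real.continuous_cosh.comp_continuousOn (continuousOn_const.mul (hb j)))).div
        (Real.continuous_sinh.comp_continuousOn (continuousOn_const.mul (hb j))) (hs j))
  have hn : ∀ i, ContinuousOn (fun p : Eu d₂ × 𝔾 => D.nrm p.1 t i) (D.Ω ×ˢ Set.univ) := by
    rintro (_ | j)
    · exact continuousOn_const
    · exact ((hb j).div (continuousOn_const.mul (Real.continuous_sinh.comp_continuousOn
        (continuousOn_const.mul (hb j)))) fun p hp => mul_ne_zero (by positivity) (hs j p hp)).pow _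
  have hP : ∀ i, ContinuousOn (fun p : Eu d₂ × 𝔾 => D.Pr p.1 i p.2.1) (D.Ω ×ˢ Set.univ) := fun i =>
    (D.continuousOn_Pr halt i).comp (f := fun p : Eu d₂ × 𝔾 => (p.1, p.2.1))
      (Continuous.continuousOn (by fun_prop)) fun p hp => ⟨hp.1, trivial⟩
  have hh : ContinuousOn (fun p : Eu d₂ × 𝔾 => D.heat p.1 t p.2.1) (D.Ω ×ˢ Set.univ) :=
    continuousOn_finsetProd _ fun i _ => (hn i).mul (Real.continuous_exp.comp_continuousOn
      (((hr i).mul ((hP i).norm.pow 2)).div_const 4).neg)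
  exact (Complex.continuous_ofReal.comp_continuousOn hh).mul (Continuous.continuousOn (by fun_prop))

omit hη in
lemma continuousOn_heatInt {t : ℝ} (ht : 0 < t) {Φ : 𝔾 → ℂ} (hΦ : IsTest Φ) :
    ContinuousOn (fun η => D.heatInt η t Φ) D.Ω :=
  continuousOn_integral_of_compact_support
    (f := fun η (g : 𝔾) => D.heatWave η t g * Φ g) hΦ.2.isCompact
    ((continuousOn_heatWave halt ht).mul (hΦ.1.continuous.comp continuous_snd).continuousOn)
    fun η g _ hg => by rw [image_eq_zero_of_notMem_tsupport hg, mul_zero]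

/-! ### The heat semigroup on the group -/

omit hη halt in
/-- The pairing of a test function with the heat kernel of the group, up to a constant. -/
def heatSum (t : ℝ) (D : SpectralData β) (Φ : 𝔾 → ℂ) : ℂ := ∫ η in D.Ω, D.heatInt η t Φ

omit hη

lemma aestronglyMeasurable_heatInt {t : ℝ} (ht : 0 < t) {Φ : 𝔾 → ℂ} (hΦ : IsTest Φ) :
    AEStronglyMeasurable (fun η => D.heatInt η t Φ) (volume.restrict D.Ω) :=
  (continuousOn_heatInt halt ht hΦ).aestronglyMeasurable D.measurableSet_Ω

lemma integrableOn_heatInt {t : ℝ} (ht : 0 < t) {Φ : 𝔾 → ℂ} (hΦ : IsTest Φ) :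
    IntegrableOn (fun η => D.heatInt η t Φ) D.Ω := by
  obtain ⟨B, hB, hb⟩ := exists_norm_heatInt_le (D := D) halt hΦ
  exact hB.integrableOn.mono' (aestronglyMeasurable_heatInt halt ht hΦ)
    (ae_restrict_of_forall_mem D.measurableSet_Ω (fun η hη => hb η hη t ht))

lemma hasDerivAt_heatSum {t : ℝ} (ht : 0 < t) {Φ : 𝔾 → ℂ} (hΦ : IsTest Φ) :
    HasDerivAt (fun t => D.heatSum t Φ) (-D.heatSum t (𝓛 β Φ)) t := by
  have hL := hΦ.sublaplacian β
  obtain ⟨B, hB, hb⟩ := exists_norm_heatInt_le (D := D) halt hL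
  have h := hasDerivAt_integral_of_dominated_loc_of_deriv_le (μ := volume.restrict D.Ω)
    (F := fun t η => D.heatInt η t Φ) (F' := fun t η => -D.heatInt η t (𝓛 β Φ))
    (bound := B) (x₀ := t) (Ioi_mem_nhds ht)
    (by filter_upwards [Ioi_mem_nhds ht] with s hs using aestronglyMeasurable_heatInt halt hs hΦ)
    (integrableOn_heatInt halt ht hΦ) (aestronglyMeasurable_heatInt halt ht hL).neg
    (ae_restrict_of_forall_mem D.measurableSet_Ω (fun η hη s hs => by
      rw [norm_neg]; exact hb η hη s hs)) hB.integrableOn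
    (ae_restrict_of_forall_mem D.measurableSet_Ω (fun η hη s hs =>
      hasDerivAt_heatInt hη halt hs hΦ))
  exact h.2.congr_deriv (integral_neg _)

lemma tendsto_heatSum {Φ : 𝔾 → ℂ} (hΦ : IsTest Φ) :
    Tendsto (fun t => D.heatSum t Φ) (𝓝[>] 0) (𝓝 (((2 * π) ^ d₂ : ℝ) * Φ 0)) := by
  obtain ⟨B, hB, hb⟩ := exists_norm_heatInt_le (D := D) halt hΦ
  have h : Tendsto (fun t => D.heatSum t Φ) (𝓝[>] 0) (𝓝 (∫ η in D.Ω, fib η Φ 0)) := by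
    refine tendsto_integral_filter_of_dominated_convergence B ?_ ?_ hB.integrableOn ?_
    · filter_upwards [self_mem_nhdsWithin] with t ht using aestronglyMeasurable_heatInt halt ht hΦ
    · filter_upwards [self_mem_nhdsWithin] with t ht
      exact ae_restrict_of_forall_mem D.measurableSet_Ω (fun η hη => hb η hη t ht)
    · exact ae_restrict_of_forall_mem D.measurableSet_Ω (fun η hη =>
        tendsto_heatInt hη halt hΦ)
  rw [Measure.restrict_eq_self_of_ae_mem (D.zariskiOpen.ae_mem D.nonempty), (integral_fib hΦ 0).2] at h
  exact h

lemma norm_heatSum_corr_le {φ f : 𝔾 → ℂ} (hφ : IsTest φ) (hf : IsTest f) {t : ℝ}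
    (ht : 0 < t) : ‖D.heatSum t (corr β φ f)‖ ≤
      (2 * π) ^ d₂ * (‖toL2 φ‖ ^ 2 + ‖toL2 f‖ ^ 2) / 2 := by
  obtain ⟨h1, h2⟩ := integral_norm_sq_fib β halt hφ
  obtain ⟨h3, h4⟩ := integral_norm_sq_fib β halt hf
  rw [mul_add, ← h2, ← h4, ← integral_add h1 h3, ← integral_div]
  refine (norm_integral_le_of_norm_le ((h1.add h3).div_const 2).integrableOn
    (ae_restrict_of_forall_mem D.measurableSet_Ω (fun η hη =>
      norm_heatInt_corr_le hη halt hφ hf ht))).trans ?_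
  exact setIntegral_le_integral ((h1.add h3).div_const 2) (.of_forall fun η => by
    simp only [Pi.zero_apply, Pi.add_apply]; positivity)

end SpectralData

/-! ### Evolution equations for self-adjoint operators -/

lemma tendsto_sum_of_hasDerivAt {Y : ℕ → ℝ → ℂ} {c : ℂ} {M N : ℝ}
    (hc : ∀ k, ContinuousOn (Y k) (Set.Ici 0))
    (hd : ∀ k t, 0 < t → HasDerivAt (Y k) (c * Y (k + 1) t) t)
    (hb : ∀ k t, 0 ≤ t → ‖Y k t‖ ≤ M * N ^ k) {t : ℝ} (ht : 0 ≤ t) :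
    Tendsto (fun n => ∑ j ∈ range n, (c * t) ^ j / (j.factorial : ℂ) * Y j 0) atTop
      (𝓝 (Y 0 t)) := by
  have hd0 : ∀ k t, 0 ≤ t → HasDerivWithinAt (Y k) (c * Y (k + 1) t) (Set.Ici t) t := by
    intro k t ht
    rcases ht.eq_or_lt with rfl | ht
    · refine hasDerivWithinAt_Ici_of_tendsto_deriv (s := Set.Ioi 0)
        (fun s hs => (hd k s hs).differentiableAt.differentiableWithinAt)
        ((hc k 0 Set.self_mem_Ici).mono Set.Ioi_subset_Ici_self) self_mem_nhdsWithin ?_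
      have h1 : Tendsto (fun s => c * Y (k + 1) s) (𝓝[>] 0) (𝓝 (c * Y (k + 1) 0)) :=
        (((hc (k + 1) 0 Set.self_mem_Ici).mono Set.Ioi_subset_Ici_self).tendsto).const_mul c
      refine h1.congr' ?_
      filter_upwards [self_mem_nhdsWithin] with s hs
      exact (hd k s hs).deriv.symm
    · exact (hd k t ht).hasDerivWithinAt
  have key : ∀ n m t, 0 ≤ t →
      ‖Y m t - ∑ j ∈ range n, (c * t) ^ j / (j.factorial : ℂ) * Y (m + j) 0‖ ≤
        M * N ^ m * ((N * ‖c‖ * t) ^ n / n.factorial) := by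
    intro n
    induction n with
    | zero => intro m t ht; simpa using hb m t ht
    | succ n ih =>
      intro m t ht
      have hS : ∀ s : ℝ, HasDerivAt (fun s : ℝ => ∑ j ∈ range (n + 1),
          (c * s) ^ j / (j.factorial : ℂ) * Y (m + j) 0)
          (∑ j ∈ range n, c * ((c * s) ^ j / (j.factorial : ℂ) * Y (m + 1 + j) 0)) s := by
        intro s
        simp only [sum_range_succ', pow_zero]
        refine (HasDerivAt.fun_sum fun j _ => ?_).add_const _
        have h1 : HasDerivAt (fun s : ℝ => c * (s : ℂ)) c s := by
          simpa using (Complex.ofRealCLM.hasDerivAt (x := s)).const_mul c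
        refine (((h1.fun_pow (j + 1)).div_const ((j + 1).factorial : ℂ)).mul_const _).congr_deriv ?_
        have h2 : ((j : ℂ) + 1) ≠ 0 := by exact_mod_cast Nat.succ_ne_zero j
        rw [Nat.factorial_succ, show m + (j + 1) = m + 1 + j by ring]
        push_cast
        have h3 : (j.factorial : ℂ) ≠ 0 := by exact_mod_cast j.factorial_ne_zero
        field_simp
      have hB : ∀ s : ℝ, HasDerivAt (fun s : ℝ => M * N ^ m * ((N * ‖c‖ * s) ^ (n + 1) / (n + 1).factorial))
          (‖c‖ * (M * N ^ (m + 1) * ((N * ‖c‖ * s) ^ n / n.factorial))) s := by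
        intro s
        have h1 : HasDerivAt (fun s : ℝ => N * ‖c‖ * s) (N * ‖c‖) s := by
          simpa using (hasDerivAt_id s).const_mul (N * ‖c‖)
        refine (((h1.fun_pow (n + 1)).div_const ((n + 1).factorial : ℝ)).const_mul _).congr_deriv ?_
        have h2 : ((n : ℝ) + 1) ≠ 0 := by positivity
        have h3 : (n.factorial : ℝ) ≠ 0 := by positivity
        rw [Nat.factorial_succ, Nat.add_sub_cancel, pow_succ N m]
        push_cast
        field_simp
      refine image_norm_le_of_norm_deriv_right_le_deriv_boundary' (a := 0) (b := t)
        (f := fun s => Y m s - ∑ j ∈ range (n + 1), (c * s) ^ j / (j.factorial : ℂ) * Y (m + j) 0)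
        (f' := fun s => c * Y (m + 1) s -
          ∑ j ∈ range n, c * ((c * s) ^ j / (j.factorial : ℂ) * Y (m + 1 + j) 0))
        (B' := fun s => ‖c‖ * (M * N ^ (m + 1) * ((N * ‖c‖ * s) ^ n / n.factorial)))
        (((hc m).mono Set.Icc_subset_Ici_self).sub fun s _ =>
          (hS s).continuousAt.continuousWithinAt)
        (fun s hs => (hd0 m s hs.1).sub (hS s).hasDerivWithinAt) ?_
        (fun s _ => (hB s).continuousAt.continuousWithinAt)
        (fun s _ => (hB s).hasDerivWithinAt) (fun s hs => ?_) ⟨ht, le_rfl⟩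
      · simp [sum_range_succ']
      · rw [← mul_sum, ← mul_sub, norm_mul]
        exact mul_le_mul_of_nonneg_left (ih (m + 1) s hs.1) (norm_nonneg _)
  have hz : Tendsto (fun n : ℕ => M * N ^ 0 * ((N * ‖c‖ * t) ^ n / n.factorial)) atTop (𝓝 0) := by
    simpa only [mul_zero] using (FloorSemiring.tendsto_pow_div_factorial_atTop (N * ‖c‖ * t)).const_mul (M * N ^ 0)
  rw [tendsto_iff_norm_sub_tendsto_zero]
  refine squeeze_zero (fun n => norm_nonneg _) (fun n => ?_) hz
  rw [norm_sub_rev]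
  simpa using key n 0 t ht

section Evolution

variable {Ω : Type*} [mΩ : MeasurableSpace Ω] {𝓗 : Type*} [NormedAddCommGroup 𝓗]
  [InnerProductSpace ℂ 𝓗] [CompleteSpace 𝓗] (P : ProjMeasure Ω 𝓗)

open ProjMeasure

/-- The function `F(ψ)` cut off to `{|ψ| ≤ N}`. -/
def cut (ψ : Ω → ℝ) (N : ℝ) (F : ℝ → ℂ) : Ω → ℂ := {p | |ψ p| ≤ N}.indicator fun p => F (ψ p)

variable {ψ : Ω → ℝ} (hψ : Measurable ψ)

omit mΩ in
lemma norm_cut_le {N : ℝ} {F : ℝ → ℂ} {C : ℝ} (hC : 0 ≤ C) (h : ∀ s, |s| ≤ N → ‖F s‖ ≤ C) (p : Ω) :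
    ‖cut ψ N F p‖ ≤ C := by
  by_cases hp : |ψ p| ≤ N
  · simpa [cut, indicator, hp] using h _ hp
  · simpa [cut, indicator, hp] using hC

omit mΩ in
lemma cut_mul_cut {M N : ℝ} (h : N ≤ M) (F G : ℝ → ℂ) :
    (fun p => cut ψ M F p * cut ψ N G p) = cut ψ N fun s => F s * G s := by
  funext p
  by_cases hN : |ψ p| ≤ N
  · simp [cut, indicator, hN, hN.trans h]
  · simp [cut, indicator, hN]

omit mΩ in
lemma conj_cut (N : ℝ) (F : ℝ → ℂ) :
    (fun p => conj (cut ψ N F p)) = cut ψ N fun s => conj (F s) := by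
  funext p
  by_cases hN : |ψ p| ≤ N <;> simp [cut, indicator, hN]

omit mΩ in
lemma tendsto_cut (F : ℝ → ℂ) (p : Ω) : Tendsto (fun N : ℕ => cut ψ N F p) atTop (𝓝 (F (ψ p))) := by
  refine tendsto_const_nhds.congr' ?_
  obtain ⟨N₀, hN₀⟩ := exists_nat_ge |ψ p|
  filter_upwards [eventually_ge_atTop N₀] with N hN
  have : |ψ p| ≤ N := hN₀.trans (by exact_mod_cast hN)
  simp [cut, indicator, this]

include hψ

lemma isBdd_cut (N : ℝ) {F : ℝ → ℂ} (hF : Continuous F) : IsBdd (cut ψ N F) := by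
  refine ⟨(hF.measurable.comp hψ).indicator (measurableSet_le hψ.abs measurable_const), ?_⟩
  obtain ⟨C, hC⟩ := (isCompact_Icc (a := -N) (b := N)).exists_bound_of_continuousOn hF.continuousOn
  exact ⟨max C 0, norm_cut_le (le_max_right _ _) fun s hs => (hC s (abs_le.mp hs)).trans (le_max_left _ _)⟩

lemma fc_cut_fc_cut {M N : ℝ} (h : N ≤ M) {F G : ℝ → ℂ} (hF : Continuous F) (hG : Continuous G)
    (v : 𝓗) : P.fc (cut ψ M F) (P.fc (cut ψ N G) v) = P.fc (cut ψ N fun s => F s * G s) v := by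
  rw [← mul_apply_eq_comp, ← P.fc_mul (isBdd_cut hψ M hF) (isBdd_cut hψ N hG), cut_mul_cut h]

lemma tendsto_fc_cut {F : ℝ → ℂ} (hF : Continuous F) {C : ℝ} (hC0 : 0 ≤ C) (hC : ∀ s, ‖F s‖ ≤ C)
    (v : 𝓗) : Tendsto (fun N : ℕ => P.fc (cut ψ N F) v) atTop (𝓝 (P.fc (fun p => F (ψ p)) v)) :=
  P.tendsto_fc (fun N => (isBdd_cut hψ N hF).1) (hF.measurable.comp hψ)
    (fun N => norm_cut_le hC0 fun s _ => hC s) (fun p => hC _) (tendsto_cut F) v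

lemma tendsto_fc_cut_one (v : 𝓗) :
    Tendsto (fun N : ℕ => P.fc (cut ψ N fun _ => 1) v) atTop (𝓝 v) := by
  have h := tendsto_fc_cut P hψ (F := fun _ => 1) continuous_const zero_le_one (by simp) v
  have e : P.fc (fun _ : Ω => (1 : ℂ)) = 1 := by
    rw [← P.proj_univ, ← P.fc_indicator MeasurableSet.univ, Set.indicator_univ]
  rw [e] at h
  exact h

lemma mem_graph_cut {Γ : Submodule ℂ (𝓗 × 𝓗)} (hΓ : P.IsIntegralGraph ψ Γ) (N : ℕ) (v : 𝓗) :
    (P.fc (cut ψ N fun _ => 1) v, P.fc (cut ψ N fun s => s) v) ∈ Γ := by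
  have c1 : Continuous fun _ : ℝ => (1 : ℂ) := continuous_const
  have c2 : Continuous fun s : ℝ => (s : ℂ) := continuous_ofReal
  have hdom : ∀ (N : ℕ) v, ∃ w, (P.fc (cut ψ N fun _ => 1) v, w) ∈ Γ := by
    intro N v
    refine (hΓ.1 _).mpr ((P.integrable_measure_fc (isBdd_cut hψ N c1) (fun p => ψ p ^ 2) _).mpr ?_)
    refine Integrable.of_bound (C := (N : ℝ) ^ 2) ?_ (.of_forall fun p => ?_)
    · have := (isBdd_cut hψ N c1).1
      fun_prop
    · by_cases hp : |ψ p| ≤ N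
      · simpa [cut, indicator, hp, sq_abs] using pow_le_pow_left₀ (abs_nonneg _) hp 2
      · simp [cut, indicator, hp]
  obtain ⟨w, hw⟩ := hdom N v
  suffices h : w = P.fc (cut ψ N fun s => s) v from h ▸ hw
  have hq : ∀ (M : ℕ) x y, (x, y) ∈ Γ → P.fc (cut ψ M fun _ => 1) x = x →
      inner ℂ x (y - P.fc (cut ψ M fun s => s) x) = 0 := by
    intro M x y hxy hx
    have e : ∫ p, ψ p ∂(P.measure x) = ∫ p, ‖cut ψ M (fun _ => 1) p‖ ^ 2 * ψ p ∂(P.measure x) := by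
      rw [← P.integral_measure_fc (isBdd_cut hψ M c1) ψ x, hx]
    rw [inner_sub_right, hΓ.2 x y hxy, P.inner_fc_self (isBdd_cut hψ M c2), e,
      ← integral_complex_ofReal, sub_eq_zero]
    refine integral_ext fun p => ?_
    by_cases hp : |ψ p| ≤ M
    · simp [cut, indicator, hp]
    · simp [cut, indicator, hp]
  have hpol : ∀ (M : ℕ), N ≤ M → ∀ z, inner ℂ (P.fc (cut ψ M fun _ => 1) z)
      (w - P.fc (cut ψ N fun s => s) v) = 0 := by
    intro M hM z
    have hNM : (N : ℝ) ≤ M := by exact_mod_cast hM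
    obtain ⟨y, hy⟩ := hdom M z
    set x := P.fc (cut ψ M fun _ => 1) z
    set a := P.fc (cut ψ N fun _ => 1) v
    set B := P.fc (cut ψ M fun s => (s : ℂ))
    have hx : P.fc (cut ψ M fun _ => 1) x = x := by
      have := fc_cut_fc_cut P hψ (le_refl (M : ℝ)) c1 c1 z
      simpa only [mul_one] using this
    have ha : P.fc (cut ψ M fun _ => 1) a = a := by
      have := fc_cut_fc_cut P hψ hNM c1 c1 v
      simpa only [mul_one] using this
    have hB : B a = P.fc (cut ψ N fun s => s) v := by
      have := fc_cut_fc_cut P hψ hNM c2 c1 v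
      simpa only [mul_one] using this
    have h1 := hq M _ _ (Γ.add_mem hy hw) (by simp [hx, ha])
    have h2 := hq M _ _ (Γ.add_mem hy (Γ.smul_mem I hw)) (by simp [hx, ha])
    have h3 := hq M _ _ hy hx
    have h4 := hq M _ _ hw ha
    change inner ℂ (x + a) (y + w - B (x + a)) = 0 at h1
    change inner ℂ (x + I • a) (y + I • w - B (x + I • a)) = 0 at h2
    change inner ℂ x (y - B x) = 0 at h3
    change inner ℂ a (w - B a) = 0 at h4
    rw [← hB]
    simp only [map_add, map_smul, inner_sub_right, inner_add_left, inner_add_right, inner_smul_left,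
      inner_smul_right, conj_I] at h1 h2 h3 h4 ⊢
    linear_combination (1 / 2 : ℂ) * h1 - (I / 2) * h2 + ((I - 1) / 2) * h3 +
      ((I - 1) / 2) * h4 + ((inner ℂ x w - inner ℂ x (B a) - (inner ℂ a y - inner ℂ a (B x))) / 2 -
        I * (inner ℂ a w - inner ℂ a (B a)) / 2) * I_sq
  refine sub_eq_zero.mp ((inner_self_eq_zero (𝕜 := ℂ)).mp ?_)
  refine tendsto_nhds_unique ((tendsto_fc_cut_one P hψ _).inner tendsto_const_nhds)
    (tendsto_const_nhds.congr' ?_)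
  filter_upwards [eventually_ge_atTop N] with M hM
  exact (hpol M hM _).symm

end Evolution

section Evolution

variable {Ω : Type*} [mΩ : MeasurableSpace Ω] {𝓗 : Type*} [NormedAddCommGroup 𝓗]
  [InnerProductSpace ℂ 𝓗] [CompleteSpace 𝓗] (P : ProjMeasure Ω 𝓗)

open ProjMeasure

variable {ψ : Ω → ℝ} (hψ : Measurable ψ)
include hψ

lemma fc_cut_evolution {Γ : Submodule ℂ (𝓗 × 𝓗)}
    (hΓ : P.IsIntegralGraph ψ (closure (Γ : Set (𝓗 × 𝓗)))) {u : ℝ → 𝓗} {M : ℝ} {c : ℂ}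
    (hM : ∀ t, 0 ≤ t → ‖u t‖ ≤ M)
    (hc : ∀ p ∈ Γ, ContinuousOn (fun t => inner ℂ p.1 (u t)) (Set.Ici 0))
    (hd : ∀ p ∈ Γ, ∀ t, 0 < t → HasDerivAt (fun t => inner ℂ p.1 (u t)) (c * inner ℂ p.2 (u t)) t)
    (N : ℕ) {t : ℝ} (ht : 0 ≤ t) :
    P.fc (cut ψ N fun _ => 1) (u t) = P.fc (cut ψ N fun s => cexp (c * t * s)) (u 0) := by
  have hM0 : 0 ≤ M := (norm_nonneg _).trans (hM 0 le_rfl)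
  have hunif : ∀ {a : ℕ → 𝓗} {b : 𝓗}, Tendsto a atTop (𝓝 b) →
      TendstoUniformlyOn (fun n t => inner ℂ (a n) (u t)) (fun t => inner ℂ b (u t)) atTop
        (Set.Ici 0) := by
    intro a b hab
    rw [Metric.tendstoUniformlyOn_iff]
    intro ε hε
    have h1 : Tendsto (fun n => ‖b - a n‖ * M) atTop (𝓝 0) := by
      simpa using ((tendsto_const_nhds (x := b)).sub hab).norm.mul_const M
    filter_upwards [h1.eventually_lt_const hε] with n hn s hs
    rw [dist_eq_norm, ← inner_sub_left]
    exact (norm_inner_le_norm _ _).trans_lt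
      ((mul_le_mul_of_nonneg_left (hM s hs) (norm_nonneg _)).trans_lt hn)
  have hcl : ∀ p ∈ closure (Γ : Set (𝓗 × 𝓗)),
      ContinuousOn (fun t => inner ℂ p.1 (u t)) (Set.Ici 0) ∧
      ∀ t, 0 < t → HasDerivAt (fun t => inner ℂ p.1 (u t)) (c * inner ℂ p.2 (u t)) t := by
    intro p hp
    obtain ⟨q, hq, hqp⟩ := mem_closure_iff_seq_limit.mp hp
    have h1 : Tendsto (fun n => (q n).1) atTop (𝓝 p.1) := (continuous_fst.tendsto p).comp hqp
    have h2 : Tendsto (fun n => (conj c) • (q n).2) atTop (𝓝 ((conj c) • p.2)) :=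
      ((continuous_snd.tendsto p).comp hqp).const_smul _
    refine ⟨(hunif h1).continuousOn (Filter.Eventually.of_forall fun n => hc _ (hq n)).frequently,
      fun t ht => ?_⟩
    have h3 := hasDerivAt_of_tendstoUniformlyOn (l := atTop) isOpen_Ioi
      ((hunif h2).mono Set.Ioi_subset_Ici_self)
      (.of_forall fun n s hs => by
        have := hd _ (hq n) s hs
        simpa only [inner_smul_left, conj_conj] using this)
      (fun s hs => (hunif h1).tendsto_at (Set.Ioi_subset_Ici_self hs)) (Set.mem_Ioi.mpr ht)
    simpa only [inner_smul_left, conj_conj] using h3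
  have cp : ∀ k : ℕ, Continuous fun s : ℝ => (s : ℂ) ^ k := fun k => by fun_prop
  have cs : Continuous fun s : ℝ => (s : ℂ) := by fun_prop
  have c1 : Continuous fun _ : ℝ => (1 : ℂ) := continuous_const
  refine ext_inner_left ℂ fun v => ?_
  have hmem : ∀ k : ℕ, (P.fc (cut ψ N fun s => (s : ℂ) ^ k) v,
      P.fc (cut ψ N fun s => (s : ℂ) ^ (k + 1)) v) ∈ closure (Γ : Set (𝓗 × 𝓗)) := by
    intro k
    rw [← Submodule.topologicalClosure_coe] at hΓ ⊢
    have h := mem_graph_cut P hψ hΓ N (P.fc (cut ψ N fun s => (s : ℂ) ^ k) v)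
    rw [fc_cut_fc_cut P hψ le_rfl c1 (cp k), fc_cut_fc_cut P hψ le_rfl cs (cp k)] at h
    simpa only [one_mul, ← pow_succ', SetLike.mem_coe] using h
  have hT := tendsto_sum_of_hasDerivAt (M := ‖v‖ * M) (N := N)
    (Y := fun k t => inner ℂ (P.fc (cut ψ N fun s => (s : ℂ) ^ k) v) (u t)) (c := c)
    (fun k => (hcl _ (hmem k)).1) (fun k => (hcl _ (hmem k)).2) (fun k s hs => by
      refine (norm_inner_le_norm _ _).trans ?_
      have h1 := P.norm_fc_le (isBdd_cut hψ N (cp k)) (C := (N : ℝ) ^ k) (by positivity)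
        (norm_cut_le (by positivity) fun s hs => by
          rw [norm_pow, norm_real, norm_eq_abs]
          exact pow_le_pow_left₀ (abs_nonneg _) hs k) v
      calc _ ≤ ((N : ℝ) ^ k * ‖v‖) * M := mul_le_mul h1 (hM s hs) (norm_nonneg _) (by positivity)
        _ = _ := by ring) ht
  have hadj : ∀ k w, inner ℂ (P.fc (cut ψ N fun s => (s : ℂ) ^ k) v) w =
      inner ℂ v (P.fc (cut ψ N fun s => (s : ℂ) ^ k) w) := by
    intro k w
    rw [P.inner_fc_left (isBdd_cut hψ N (cp k)), conj_cut]
    simp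
  simp only [hadj] at hT
  simp only [pow_zero] at hT
  have cP : ∀ n : ℕ, Continuous fun s : ℝ =>
      ∑ j ∈ range n, (c * t * s) ^ j / (j.factorial : ℂ) := fun n => by fun_prop
  have hsum : ∀ n, ∑ j ∈ range n, (c * t) ^ j / (j.factorial : ℂ) *
      inner ℂ v (P.fc (cut ψ N fun s => (s : ℂ) ^ j) (u 0)) =
      inner ℂ v (P.fc (cut ψ N fun s => ∑ j ∈ range n, (c * t * s) ^ j / (j.factorial : ℂ)) (u 0)) := by
    intro n
    induction n with
    | zero =>
      have h0 : (cut ψ N fun _ => (0 : ℂ)) = fun _ => 0 * (0 : ℂ) := by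
        funext p; simp [cut]
      simp only [range_zero, sum_empty]
      rw [h0, P.fc_const_mul (isBdd_const 0)]
      simp
    | succ n ih =>
      have e : (cut ψ N fun s => ∑ j ∈ range (n + 1), (c * t * s) ^ j / (j.factorial : ℂ)) =
          fun p => cut ψ N (fun s => ∑ j ∈ range n, (c * t * s) ^ j / (j.factorial : ℂ)) p +
            (c * t) ^ n / (n.factorial : ℂ) * cut ψ N (fun s => (s : ℂ) ^ n) p := by
        funext p
        by_cases hp : |ψ p| ≤ N
        · simp only [cut, indicator, Set.mem_ofPred_eq, hp, if_true, sum_range_succ]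
          ring
        · simp [cut, indicator, hp]
      rw [sum_range_succ, ih, e, P.fc_add (isBdd_cut hψ N (cP n))
        ((isBdd_cut hψ N (cp n)).const_mul _), P.fc_const_mul (isBdd_cut hψ N (cp n)),
        _root_.add_apply, _root_.smul_apply, inner_add_right, inner_smul_right]
  simp only [hsum] at hT
  refine tendsto_nhds_unique hT ((tendsto_const_nhds (x := v)).inner ?_)
  have hle : ∀ n : ℕ, ∀ s : ℝ, |s| ≤ N →
      ‖∑ j ∈ range n, (c * t * s) ^ j / (j.factorial : ℂ)‖ ≤ exp (‖c‖ * t * N) := by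
    intro n s hs
    have h1 : ‖c * t * s‖ ≤ ‖c‖ * t * N := by
      rw [norm_mul, norm_mul, norm_real, norm_real, norm_of_nonneg ht]
      exact mul_le_mul_of_nonneg_left hs (by positivity)
    refine (norm_sum_le _ _).trans (le_trans (sum_le_sum fun j _ => ?_)
      (Real.sum_le_exp_of_nonneg (x := ‖c‖ * t * N) (by positivity) n))
    rw [norm_div, norm_pow, Complex.norm_natCast]
    exact div_le_div_of_nonneg_right (pow_le_pow_left₀ (norm_nonneg _) h1 j) (by positivity)
  have hlim : ∀ s : ℝ, Tendsto (fun n => ∑ j ∈ range n, (c * t * s) ^ j / (j.factorial : ℂ))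
      atTop (𝓝 (cexp (c * t * s))) := fun s => by
    rw [Complex.exp_eq_exp_ℂ]
    exact (NormedSpace.expSeries_div_hasSum_exp (c * t * s)).tendsto_sum_nat
  refine P.tendsto_fc (fun n => (isBdd_cut hψ N (cP n)).1) (isBdd_cut hψ N (by fun_prop)).1
    (fun n => norm_cut_le (exp_pos _).le (hle n))
    (norm_cut_le (exp_pos _).le fun s hs => le_of_tendsto (hlim s).norm
      (.of_forall fun n => hle n s hs)) (fun p => ?_) _
  by_cases hp : |ψ p| ≤ N
  · simpa [cut, indicator, hp] using hlim (ψ p)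
  · simp [cut, indicator, hp]

end Evolution

section Riesz

variable {d₁ d₂ : ℕ}

lemma exists_inner_toL2_eq {b : (𝔾 → ℂ) → ℂ}
    (hadd : ∀ φ ψ, IsTest φ → IsTest ψ → b (fun g => φ g + ψ g) = b φ + b ψ)
    (hsmul : ∀ (c : ℂ) φ, IsTest φ → b (fun g => c * φ g) = conj c * b φ) {M : ℝ}
    (hM : 0 ≤ M) (hb : ∀ φ, IsTest φ → ‖b φ‖ ≤ M * ‖toL2 φ‖) :
    ∃ u : L2G d₁ d₂, ‖u‖ ≤ M ∧ ∀ φ, IsTest φ → inner ℂ (toL2 φ) u = b φ := by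
  let E : Submodule ℂ (𝔾 → ℂ) :=
    { carrier := {f | IsTest f}
      zero_mem' := ⟨contDiff_const, HasCompactSupport.zero⟩
      add_mem' := fun hf hg => IsTest.add hf hg
      smul_mem' := fun c f hf => IsTest.const_mul hf c }
  let e : E →ₗ[ℂ] L2G d₁ d₂ :=
    { toFun := fun f => toL2 f.1
      map_add' := fun f g => toL2_add f.2.memLp g.2.memLp
      map_smul' := fun c f => toL2_smul f.2.memLp c }
  let ℓ : E →ₗ[ℂ] ℂ :=
    { toFun := fun f => conj (b f.1)
      map_add' := fun f g => (congrArg _ (hadd f.1 g.1 f.2 g.2)).trans (map_add _ _ _)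
      map_smul' := fun c f => (congrArg _ (hsmul c f.1 f.2)).trans (by simp) }
  have hdense : DenseRange e := by
    refine dense_toL2.mono ?_
    rintro w ⟨f, hf, rfl⟩
    exact ⟨⟨f, hf⟩, rfl⟩
  have hn : ∀ x, ‖ℓ x‖ ≤ M * ‖e x‖ := fun x => (RCLike.norm_conj _).trans_le (hb x.1 x.2)
  refine ⟨(InnerProductSpace.toDual ℂ _).symm (ℓ.extendOfNorm e), ?_, fun φ hφ => ?_⟩
  · rw [LinearIsometryEquiv.norm_map]
    exact LinearMap.opNorm_extendOfNorm_le hdense hM hn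
  · rw [← inner_conj_symm, InnerProductSpace.toDual_symm_apply]
    have h := LinearMap.extendOfNorm_eq hdense ⟨M, hn⟩ ⟨φ, hφ⟩
    change ℓ.extendOfNorm e (toL2 φ) = conj (b φ) at h
    rw [h, conj_conj]

end Riesz

/-! ### The spectral measures of test functions -/

section Joint

variable {d₁ d₂ : ℕ} {β : 𝔅} (halt : Alt β)
  {P : ProjMeasure 𝕊 (L2G d₁ d₂)} (hP : IsJointResolution β P)

open ProjMeasure SpectralData

set_option hygiene false in
/-- The normalization of the Fourier inversion formula on the center. -/
notation "𝔠" => (((2 * π) ^ d₂ : ℝ) : ℂ)⁻¹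

set_option hygiene false in
/-- The spectral measure of a test function. -/
notation "μ_f" => P.measure (toL2 f)

lemma isBdd_cexp (a : Eu d₂) : IsBdd fun p : 𝕊 => 𝐞(p.2,a) := ⟨by fun_prop, 1, fun p => by
    beta_reduce; rw [mul_comm, norm_exp_ofReal_mul_I]⟩

lemma translation_zero : translation (cen (d₁ := d₁) (0 : Eu d₂)) = 1 := by
  ext1 v
  refine Lp.ext ((coeFn_translation _ _).trans (.of_forall fun g => ?_))
  exact congrArg v (add_zero g)

include halt hP

lemma translation_single_eq_fc (k : Fin d₂) (r : ℝ) : translation (cen (r • single k (1 : ℝ))) =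
      P.fc fun p => 𝐞(p.2,(r • single k (1 : ℝ))) := by
  ext1 v
  set e : Eu d₂ := single k 1 with he
  have hψ : Measurable fun p : 𝕊 => p.2 k := by fun_prop
  have hΓ := hP.2 k
  rw [(isSymmOp_centralDerivative β halt k).closureGraph_eq] at hΓ
  have hd : ∀ p ∈ (isSymmOp_centralDerivative β halt k).graph, ∀ t : ℝ,
      HasDerivAt (fun t : ℝ => inner ℂ p.1 (translation (cen (t • r • e)) v))
        (I * r * inner ℂ p.2 (translation (cen (t • r • e)) v)) t := by
    rintro _ ⟨f, hf, rfl⟩ t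
    have hX := hf.field β (cen e)
    have e1 : toL2 (centralDerivative β k f) = -I • toL2 (𝒳 β (cen e) f) := by
      rw [← toL2_smul hX.memLp]; rfl
    have h1 := hasDerivAt_inner_translation β halt v hf e (-(t * r))
    have h2 := (HasDerivAt.scomp (h := fun t : ℝ => -(t * r)) t h1
      ((hasDerivAt_id t).mul_const r).neg).star
    refine (h2.congr_of_eventuallyEq (.of_forall fun s => ?_)).congr_deriv ?_
    · simp only [comp_apply]
      rw [← starRingEnd_apply, inner_conj_symm, inner_translation, smul_smul]
      congr 3
      simp [cen]
    · dsimp only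
      rw [← starRingEnd_apply, e1, inner_smul_left, real_smul, map_mul, inner_conj_symm,
        inner_translation, smul_smul]
      have : -cen (d₁ := d₁) (-(t * r) • e) = cen ((t * r) • e) := by simp [cen]
      rw [this]
      simp
      ring_nf
      simp
  have key : ∀ N : ℕ, P.fc (cut (fun p : 𝕊 => p.2 k) N fun _ => 1) (translation (cen (r • e)) v) =
      P.fc (cut (fun p : 𝕊 => p.2 k) N fun s => cexp (I * r * (1 : ℝ) * s)) v := by
    intro N
    have h := fc_cut_evolution P hψ hΓ (u := fun t : ℝ => translation (cen (t • r • e)) v) (M := ‖v‖)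
      (c := I * r) (fun t _ => (norm_translation _ _).le)
      (fun p hp t _ => (hd p hp t).continuousAt.continuousWithinAt) (fun p hp t _ => hd p hp t)
      N zero_le_one
    simp only [one_smul, zero_smul] at h
    rw [h, translation_zero]
    rfl
  have h1 := tendsto_fc_cut_one P hψ (translation (cen (r • e)) v)
  simp only [key] at h1
  have h2 := tendsto_nhds_unique h1 (tendsto_fc_cut P hψ (by fun_prop) zero_le_one (fun s => by
    rw [show I * r * (1 : ℝ) * s = ((r * s : ℝ) : ℂ) * I by push_cast; ring,
      norm_exp_ofReal_mul_I]) v)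
  rw [h2]
  congr 2
  funext p
  congr 1
  rw [inner_smul_right, he, EuclideanSpace.inner_single_right]
  simp
  ring

lemma translation_eq_fc (a : Eu d₂) : translation (cen a) = P.fc fun p => 𝐞(p.2,a) := by
  have hadd : ∀ a b : Eu d₂, (translation (cen a) = P.fc fun p => 𝐞(p.2,a)) → (translation (cen b) =
      P.fc fun p => 𝐞(p.2,b)) → translation (cen (a + b)) =
      P.fc fun p => 𝐞(p.2,(a + b)) := by
    intro a b ha hb
    have e : (fun p : 𝕊 => 𝐞(p.2,(a + b))) = fun p => 𝐞(p.2,a) * 𝐞(p.2,b) := by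
      funext p
      rw [← Complex.exp_add, inner_add_right]
      push_cast
      ring_nf
    rw [e, P.fc_mul (isBdd_cexp a) (isBdd_cexp b), ← ha, ← hb]
    ext1 v
    refine Lp.ext ((coeFn_translation _ _).trans ?_)
    refine EventuallyEq.trans ?_ (coeFn_translation _ _).symm
    filter_upwards [(measurePreserving_add_right volume (cen (d₁ := d₁) a)).quasiMeasurePreserving.ae_eq_comp
      (coeFn_translation (cen b) v)] with g hg
    rw [comp_apply, comp_apply] at hg
    refine Eq.trans (congrArg v ?_) hg.symm
    simp [cen, add_assoc]
  have ha : a = ∑ k, a k • single k (1 : ℝ) := by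
    simpa using ((EuclideanSpace.basisFun (Fin d₂) ℝ).sum_repr a).symm
  rw [ha]
  refine sum_induction _ (fun a => translation (cen a) = P.fc fun p => 𝐞(p.2,a)) hadd ?_ fun k _ =>
    translation_single_eq_fc halt hP k (a k)
  rcases Nat.eq_zero_or_pos d₂ with h0 | h0
  · have e : P.fc (fun _ : 𝕊 => (1 : ℂ)) = 1 := by
      rw [← P.proj_univ, ← P.fc_indicator MeasurableSet.univ, Set.indicator_univ]
    simp only [inner_zero_right, ofReal_zero, mul_zero, Complex.exp_zero, e]
    exact translation_zero
  · simpa using translation_single_eq_fc halt hP ⟨0, h0⟩ 0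

variable (D : SpectralData β) {f : 𝔾 → ℂ} (hf : IsTest f)
include hf

omit hP in
/-- The heat semigroup applied to a test function. -/
lemma exists_heat_vector : ∃ (u : ℝ → L2G d₁ d₂) (M : ℝ), u 0 = toL2 f ∧
    (∀ t, 0 ≤ t → ‖u t‖ ≤ M) ∧ ∀ t, 0 < t → ∀ φ, IsTest φ →
      inner ℂ (toL2 φ) (u t) = 𝔠 * D.heatSum t (corr β φ f) := by
  set M := (1 + ‖toL2 f‖ ^ 2) / 2 with hM
  have hex : ∀ t, 0 < t → ∃ u : L2G d₁ d₂, ‖u‖ ≤ M ∧ ∀ φ, IsTest φ →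
      inner ℂ (toL2 φ) u = 𝔠 * D.heatSum t (corr β φ f) := by
    intro t ht
    have hsm : ∀ (c : ℂ) φ, IsTest φ → 𝔠 * D.heatSum t (corr β (fun g => c * φ g) f) = conj c *
          (𝔠 * D.heatSum t (corr β φ f)) := by
      intro c φ hφ
      rw [corr_const_mul_left, mul_left_comm, heatSum, heatSum, ← integral_const_mul (conj c)]
      congr 1
      refine integral_ext fun η => ?_
      simp only [heatInt, ← integral_const_mul, mul_left_comm]
    have hbd : ∀ φ, IsTest φ → ‖𝔠 * D.heatSum t (corr β φ f)‖ ≤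
        (‖toL2 φ‖ ^ 2 + ‖toL2 f‖ ^ 2) / 2 := by
      intro φ hφ
      rw [norm_mul, norm_inv, norm_real, norm_of_nonneg (by positivity),
        inv_mul_le_iff₀ (by positivity), ← mul_div_assoc]
      exact norm_heatSum_corr_le halt hφ hf ht
    refine exists_inner_toL2_eq (b := fun φ => 𝔠 *
      D.heatSum t (corr β φ f)) (fun φ ψ hφ hψ => ?_) hsm (by positivity) fun φ hφ => ?_
    · rw [corr_add_left β hφ hψ hf, ← mul_add, heatSum, heatSum, heatSum, ← integral_add
          (integrableOn_heatInt halt ht (hφ.corr β halt hf))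
          (integrableOn_heatInt halt ht (hψ.corr β halt hf))]
      congr 1
      refine integral_ext fun η => ?_
      simp only [heatInt]
      rw [← integral_add (integrable_heatWave_mul t (hφ.corr β halt hf))
        (integrable_heatWave_mul t (hψ.corr β halt hf))]
      simp only [mul_add]
    · have h1 : ∀ s : ℝ, 0 < s → s * ‖𝔠 * D.heatSum t (corr β φ f)‖ ≤
          (s ^ 2 * ‖toL2 φ‖ ^ 2 + ‖toL2 f‖ ^ 2) / 2 := by
        intro s hs
        have h2 := hbd _ (hφ.const_mul s)
        rw [hsm _ _ hφ, norm_mul (conj (s : ℂ)), toL2_smul hφ.memLp, norm_smul, RCLike.norm_conj,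
          norm_real, norm_of_nonneg hs.le, mul_pow s ‖toL2 φ‖] at h2
        exact h2
      rcases (norm_nonneg (toL2 φ)).eq_or_lt with h0 | h0
      · rw [← h0, mul_zero]
        by_contra hcon
        rw [not_le] at hcon
        have h2 := h1 ((‖toL2 f‖ ^ 2 + 1) / ‖𝔠 * D.heatSum t (corr β φ f)‖) (by positivity)
        rw [div_mul_cancel₀ _ hcon.ne', ← h0] at h2
        nlinarith [sq_nonneg ‖toL2 f‖]
      · have h2 := h1 ‖toL2 φ‖⁻¹ (by positivity)
        rw [inv_mul_le_iff₀ h0, ← mul_pow, inv_mul_cancel₀ h0.ne', one_pow] at h2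
        rw [hM, mul_comm _ ‖toL2 φ‖]
        exact h2
  choose! u hu1 hu2 using hex
  refine ⟨fun t => if 0 < t then u t else toL2 f, M, by simp, fun t ht => ?_, fun t ht φ hφ => ?_⟩
  · beta_reduce
    split_ifs with h
    · exact hu1 t h
    · nlinarith [sq_nonneg (‖toL2 f‖ - 1)]
  · beta_reduce
    rw [if_pos ht]
    exact hu2 t ht φ hφ

lemma heat_spectral : (∀ᵐ p ∂μ_f, 0 ≤ p.1) ∧ ∀ t : ℝ, 0 < t → ∀ a : Eu d₂,
    ∫ p, cexp (-(t * p.1)) * 𝐞(p.2,a) ∂μ_f = 𝔠 * ∫ η in D.Ω, 𝐞(η,a) *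
        D.heatInt η t (corr β f f) := by
  obtain ⟨u, M, hu0, huM, hu⟩ := exists_heat_vector halt D hf
  have hψ : Measurable fun p : 𝕊 => p.1 := measurable_fst
  have hΓ := hP.1
  rw [(isSymmOp_sublaplacian β halt).closureGraph_eq] at hΓ
  have hd : ∀ φ, IsTest φ → ∀ t, 0 < t → HasDerivAt (fun t => inner ℂ (toL2 φ) (u t))
      (-1 * inner ℂ (toL2 (𝓛 β φ)) (u t)) t := by
    intro φ hφ t ht
    rw [hu t ht _ (hφ.sublaplacian β), ← sublaplacian_corr β halt hφ hf, ← mul_assoc, mul_comm (-1 : ℂ),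
      mul_assoc, neg_one_mul]
    refine ((hasDerivAt_heatSum halt ht (hφ.corr β halt hf)).const_mul _).congr_of_eventuallyEq ?_
    filter_upwards [Ioi_mem_nhds ht] with s hs using hu s hs φ hφ
  have hE : ∀ N : ℕ, ∀ t : ℝ, 0 ≤ t → P.fc (cut (fun p : 𝕊 => p.1) N fun _ => 1) (u t) =
      P.fc (cut (fun p : 𝕊 => p.1) N fun s => cexp (-1 * t * s)) (toL2 f) := by
    intro N t ht
    rw [← hu0]
    refine fc_cut_evolution P hψ hΓ huM ?_ ?_ N ht
    · rintro _ ⟨φ, hφ, rfl⟩ t ht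
      rcases (Set.mem_Ici.mp ht).eq_or_lt with rfl | ht
      · refine continuousWithinAt_Ioi_iff_Ici.mp ?_
        have h1 := (tendsto_heatSum (D := D) halt (hφ.corr β halt hf)).const_mul 𝔠
        rw [← mul_assoc, inv_mul_cancel₀ (by exact_mod_cast (by positivity : (2 * π) ^ d₂ ≠ 0)),
          one_mul, corr_zero β hφ hf, ← hu0] at h1
        refine Tendsto.congr' ?_ h1
        filter_upwards [self_mem_nhdsWithin] with s hs using (hu s hs φ hφ).symm
      · exact (hd φ hφ t ht).continuousAt.continuousWithinAt
    · rintro _ ⟨φ, hφ, rfl⟩ t ht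
      exact hd φ hφ t ht
  have hce : ∀ t : ℝ, Continuous fun s : ℝ => cexp (-1 * t * s) := fun t => by fun_prop
  have hM0 : 0 ≤ M := (norm_nonneg _).trans (huM 0 le_rfl)
  have hpos : ∀ᵐ p ∂μ_f, 0 ≤ p.1 := by
    let S : ℕ → Set 𝕊 := fun k => {p | |p.1| ≤ k ∧ p.1 ≤ -((k : ℝ) + 1)⁻¹}
    have hSm : ∀ k, MeasurableSet (S k) := fun k =>
      (measurableSet_le measurable_fst.abs measurable_const).inter
        (measurableSet_le measurable_fst measurable_const)
    have hS : ∀ k, μ_f (S k) = 0 := by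
      intro k
      by_contra h0
      have hm : 0 < (μ_f).real (S k) := ENNReal.toReal_pos h0 (measure_ne_top _ _)
      have hbound : ∀ t : ℝ, 0 < t → t * ((k : ℝ) + 1)⁻¹ * (μ_f).real (S k) ≤ M ^ 2 := by
        intro t ht
        have hb := isBdd_cut (ψ := fun p : 𝕊 => p.1) hψ k (hce t)
        have h1 : ‖P.fc (cut (fun p : 𝕊 => p.1) k fun s => cexp (-1 * t * s)) (toL2 f)‖ ≤ M := by
          rw [← hE k t ht.le]
          refine (P.norm_fc_le (isBdd_cut hψ _ continuous_const) zero_le_one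
            (norm_cut_le zero_le_one (by simp)) _).trans ?_
          rw [one_mul]
          exact huM t ht.le
        have h2 := pow_le_pow_left₀ (norm_nonneg _) h1 2
        rw [P.norm_fc_sq hb] at h2
        refine le_trans ?_ h2
        have h3 : t * ((k : ℝ) + 1)⁻¹ * (μ_f).real (S k) =
            ∫ p, (S k).indicator (fun _ => t * ((k : ℝ) + 1)⁻¹) p ∂μ_f := by
          rw [integral_indicator (hSm k), setIntegral_const, smul_eq_mul, mul_comm]
        rw [h3]
        refine integral_mono_of_nonneg (.of_forall fun p => indicator_nonneg
          (fun _ _ => by positivity) p) ?_ (.of_forall fun p => ?_)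
        · obtain ⟨C, hC⟩ := hb.2
          refine Integrable.of_bound ((hb.1.norm.pow_const 2).aestronglyMeasurable) (C ^ 2)
            (.of_forall fun p => ?_)
          rw [norm_pow, norm_norm]
          exact pow_le_pow_left₀ (norm_nonneg _) (hC p) 2
        · by_cases hp : p ∈ S k
          swap
          · rw [indicator_of_notMem hp]
            exact sq_nonneg _
          rw [indicator_of_mem hp]
          have e1 : ‖cut (fun p : 𝕊 => p.1) k (fun s => cexp (-1 * t * s)) p‖ =
              exp (-(t * p.1)) := by
            simp [cut, indicator, hp.1, Complex.norm_exp]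
          have h4 : t * ((k : ℝ) + 1)⁻¹ ≤ -(t * p.1) := by
            have := mul_le_mul_of_nonneg_left hp.2 ht.le
            linarith
          have h5 := Real.add_one_le_exp (-(t * p.1))
          have h6 : 0 < t * ((k : ℝ) + 1)⁻¹ := by positivity
          simp only [e1]
          nlinarith
      have h7 := hbound ((M ^ 2 + 1) / (((k : ℝ) + 1)⁻¹ * (μ_f).real (S k))) (by positivity)
      rw [mul_assoc, div_mul_cancel₀ _ (by positivity)] at h7
      linarith
    have hU : {p : 𝕊 | ¬ 0 ≤ p.1} ⊆ ⋃ k, S k := by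
      intro p hp
      have hp' : p.1 < 0 := not_le.mp hp
      obtain ⟨k₁, h1⟩ := exists_nat_ge |p.1|
      obtain ⟨k₂, h2⟩ := exists_nat_one_div_lt (neg_pos.mpr hp')
      refine Set.mem_iUnion.mpr ⟨max k₁ k₂, h1.trans (by exact_mod_cast le_max_left _ _), ?_⟩
      have h3 : ((max k₁ k₂ : ℕ) + 1 : ℝ)⁻¹ ≤ 1 / ((k₂ : ℝ) + 1) := by
        rw [one_div]
        exact inv_anti₀ (by positivity) (by exact_mod_cast Nat.succ_le_succ (le_max_right _ _))
      linarith
    exact measure_mono_null hU (measure_iUnion_null hS)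
  refine ⟨hpos, fun t ht a => ?_⟩
  have hτ : toL2 (fun g => f (g + cen (-a))) = P.fc (fun p => 𝐞(p.2,(-a))) (toL2 f) := by
    rw [← translation_toL2 _ hf, translation_eq_fc halt hP]
  have h1 : Tendsto (fun N : ℕ => inner ℂ (toL2 fun g => f (g + cen (-a)))
      (P.fc (cut (fun p : 𝕊 => p.1) N fun _ => 1) (u t))) atTop
      (𝓝 (inner ℂ (toL2 fun g => f (g + cen (-a))) (u t))) :=
    tendsto_const_nhds.inner (tendsto_fc_cut_one P hψ (u t))
  simp only [hE _ t ht.le] at h1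
  rw [hu t ht _ (hf.comp_add _)] at h1
  simp only [hτ, P.inner_fc_fc (isBdd_cexp (-a)) (isBdd_cut hψ _ (hce t))] at h1
  have h2 : Tendsto (fun N : ℕ => ∫ p, conj (𝐞(p.2,(-a))) *
      cut (fun p : 𝕊 => p.1) N (fun s => cexp (-1 * t * s)) p ∂μ_f) atTop
      (𝓝 (∫ p, conj (𝐞(p.2,(-a))) * cexp (-1 * t * p.1) ∂μ_f)) := by
    refine tendsto_integral_of_dominated_convergence (fun _ => 1)
      (fun N => ((isBdd_cexp (-a)).conj.mul (isBdd_cut hψ N (hce t))).1.aestronglyMeasurable)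
      (integrable_const 1) (fun N => ?_) (.of_forall fun p =>
        (tendsto_cut (ψ := fun p : 𝕊 => p.1) _ p).const_mul _)
    filter_upwards [hpos] with p hp
    rw [norm_mul, RCLike.norm_conj, mul_comm I, norm_exp_ofReal_mul_I, one_mul]
    by_cases hN : |p.1| ≤ N
    · simpa [cut, indicator, hN, Complex.norm_exp] using mul_nonneg ht.le hp
    · simp [cut, indicator, hN]
  have h3 := tendsto_nhds_unique h2 h1
  refine Eq.trans (integral_ext fun p => ?_) (h3.trans ?_)
  · rw [← Complex.exp_conj, mul_comm]
    simp [inner_neg_right]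
  · congr 1
    refine integral_ext fun η => ?_
    have e : corr β (fun g => f (g + cen (-a))) f = fun k => corr β f f (k + (0, -a)) :=
      funext fun k => corr_comp_add β (-a) k
    simp only [heatInt, e]
    rw [← integral_add_right_eq_self _ ((0, a) : 𝔾), ← integral_const_mul]
    refine integral_ext fun k => ?_
    have e2 : k + (0, a) + (0, -a) = k := by ext1 <;> simp
    simp only [e2, heatWave, Prod.fst_add, Prod.snd_add, add_zero, inner_add_right]
    push_cast
    rw [mul_add, Complex.exp_add]
    ring

end Joint

/-! ### Measures determined by exponentials -/

section Uniqueness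

open scoped NNReal BoundedContinuousFunction

variable {n : ℕ}

/-- The functions `(s, η) ↦ e^{-k s} e^{i ⟨η, a⟩}`. -/
def expFun (k : ℕ) (a : Eu n) : (ℝ≥0 × Eu n) →ᵇ ℂ := BoundedContinuousFunction.ofNormedAddCommGroup
    (fun p => cexp (-(k * (p.1 : ℝ))) * 𝐞(p.2,a))
    (by fun_prop) 1 fun p => by
      rw [norm_mul, mul_comm I, norm_exp_ofReal_mul_I, mul_one, Complex.norm_exp]
      simp only [Complex.neg_re, Complex.mul_re, Complex.natCast_re, Complex.ofReal_re,
        Complex.natCast_im, zero_mul, sub_zero, Real.exp_le_one_iff, neg_nonpos]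
      positivity

lemma expFun_apply (k : ℕ) (a : Eu n) (p : ℝ≥0 × Eu n) : expFun k a p =
    cexp (-(k * (p.1 : ℝ))) * 𝐞(p.2,a) := rfl

lemma conj_expFun (k : ℕ) (a : Eu n) (p : ℝ≥0 × Eu n) : conj (expFun k a p) = expFun k (-a) p := by
  simp [expFun_apply, ← Complex.exp_conj]

/-- The linear span of the exponentials, a star subalgebra. -/
def expAlg (n : ℕ) : StarSubalgebra ℂ ((ℝ≥0 × Eu n) →ᵇ ℂ) where
  carrier := Submodule.span ℂ (Set.range fun i : ℕ × Eu n => expFun i.1 i.2)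
  mul_mem' := fun hf hg => by
    have h := Submodule.mul_mem_mul hf hg
    rw [Submodule.span_mul_span] at h
    refine Submodule.span_mono ?_ h
    rintro _ ⟨_, ⟨i, rfl⟩, _, ⟨j, rfl⟩, rfl⟩
    refine ⟨(i.1 + j.1, i.2 + j.2), ?_⟩
    ext p
    simp only [BoundedContinuousFunction.mul_apply, expFun_apply, ← Complex.exp_add, inner_add_right]
    push_cast
    ring_nf
  add_mem' := fun hf hg => Submodule.add_mem _ hf hg
  algebraMap_mem' := fun c => by
    rw [Algebra.algebraMap_eq_smul_one]
    refine Submodule.smul_mem _ c (Submodule.subset_span ⟨(0, 0), ?_⟩)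
    ext p
    simp [expFun_apply]
  star_mem' := by
    intro f hf
    refine Submodule.span_induction (p := fun f _ => star f ∈
      Submodule.span ℂ (Set.range fun i : ℕ × Eu n => expFun i.1 i.2)) ?_ ?_ ?_ ?_ hf
    · rintro _ ⟨i, rfl⟩
      refine Submodule.subset_span ⟨(i.1, -i.2), ?_⟩
      ext p
      exact (conj_expFun i.1 i.2 p).symm
    · rw [star_zero]; exact Submodule.zero_mem _
    · intro x y _ _ h1 h2; rw [star_add]; exact Submodule.add_mem _ h1 h2
    · intro c x _ h; rw [star_smul]; exact Submodule.smul_mem _ _ h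

lemma separatesPoints_expAlg :
    ((expAlg n).map (BoundedContinuousFunction.toContinuousMapStarₐ ℂ)).SeparatesPoints := by
  intro p q hpq
  have hmem : ∀ i : ℕ × Eu n, ∃ f ∈ (fun f : C(ℝ≥0 × Eu n, ℂ) => (f : ℝ≥0 × Eu n → ℂ)) ''
      ((expAlg n).map (BoundedContinuousFunction.toContinuousMapStarₐ ℂ) : Set C(ℝ≥0 × Eu n, ℂ)),
      ∀ p, f p = expFun i.1 i.2 p := fun i =>
    ⟨_, ⟨_, ⟨expFun i.1 i.2, Submodule.subset_span ⟨i, rfl⟩, rfl⟩, rfl⟩, fun _ => rfl⟩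
  by_cases h : p.2 = q.2
  · obtain ⟨f, hf, hf'⟩ := hmem (1, 0)
    refine ⟨f, hf, fun h1 => hpq (Prod.ext (NNReal.coe_injective ?_) h)⟩
    rw [hf', hf', expFun_apply, expFun_apply] at h1
    simp only [inner_zero_right, ofReal_zero, mul_zero, Complex.exp_zero, mul_one,
      Nat.cast_one, one_mul, ← Complex.ofReal_neg, ← Complex.ofReal_exp] at h1
    exact neg_injective (Real.exp_injective (ofReal_injective h1))
  · have h0 : ‖p.2 - q.2‖ ≠ 0 := norm_ne_zero_iff.mpr (sub_ne_zero.mpr h)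
    obtain ⟨f, hf, hf'⟩ := hmem (0, (π / ‖p.2 - q.2‖ ^ 2) • (p.2 - q.2))
    refine ⟨f, hf, fun h1 => ?_⟩
    rw [hf', hf', expFun_apply, expFun_apply] at h1
    have h2 : inner ℝ p.2 ((π / ‖p.2 - q.2‖ ^ 2) • (p.2 - q.2)) =
        inner ℝ q.2 ((π / ‖p.2 - q.2‖ ^ 2) • (p.2 - q.2)) + π := by
      rw [← sub_eq_iff_eq_add', ← inner_sub_left, inner_smul_right, real_inner_self_eq_norm_sq]
      field_simp
    rw [h2] at h1
    push_cast at h1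
    rw [mul_add I, Complex.exp_add, mul_comm I (π : ℂ), Complex.exp_pi_mul_I] at h1
    simp only [Nat.cast_zero, zero_mul, neg_zero, Complex.exp_zero, one_mul, mul_neg, mul_one] at h1
    exact Complex.exp_ne_zero _ (neg_eq_self.mp h1)

variable {Z : Type*} [MeasurableSpace Z] {m : Measure Z} {T : Z → ℝ≥0 × Eu n} (hT : Measurable T)
include hT

lemma integral_eq_of_expFun_real {q : Z → ℝ} (hq : Integrable q m) {μ : Measure (ℝ≥0 × Eu n)}
    [IsFiniteMeasure μ] (h : ∀ k a, ∫ p, expFun k a p ∂μ = ∫ z, expFun k a (T z) * q z ∂m)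
    {F : ℝ≥0 × Eu n → ℂ} (hF : Measurable F) (hFi : Integrable (fun z => F (T z) * q z) m) :
    ∫ p, F p ∂μ = ∫ z, F (T z) * q z ∂m := by
  have hlt : ∀ r : Z → ℝ, ∀ᵐ z ∂m, ENNReal.ofReal (r z) < ⊤ := fun r =>
    Eventually.of_forall fun _ => ENNReal.ofReal_lt_top
  have hfin : ∀ {r : Z → ℝ}, Integrable r m →
      IsFiniteMeasure ((m.withDensity fun z => ENNReal.ofReal (r z)).map T) := by
    intro r hr
    have := isFiniteMeasure_withDensity_ofReal hr.2
    infer_instance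
  have hint : ∀ {r : Z → ℝ}, Integrable r m → ∀ {G : ℝ≥0 × Eu n → ℂ}, Measurable G →
      ∫ p, G p ∂((m.withDensity fun z => ENNReal.ofReal (r z)).map T) =
        ∫ z, G (T z) * (max (r z) 0 : ℝ) ∂m := by
    intro r hr G hG
    rw [integral_map hT.aemeasurable hG.aestronglyMeasurable,
      integral_withDensity_eq_integral_toReal_smul₀ hr.aemeasurable.ennreal_ofReal (hlt r)]
    refine integral_ext fun z => ?_
    simp only [ENNReal.toReal_ofReal', real_smul, mul_comm]
  have hinti : ∀ {r : Z → ℝ}, Integrable r m → ∀ {G : ℝ≥0 × Eu n → ℂ}, Measurable G →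
      Integrable (fun z => G (T z) * r z) m →
      Integrable (fun z => G (T z) * (max (r z) 0 : ℝ)) m ∧
      Integrable G ((m.withDensity fun z => ENNReal.ofReal (r z)).map T) := by
    intro r hr G hG hi
    have h1 : Integrable (fun z => G (T z) * (max (r z) 0 : ℝ)) m := by
      have hr' := hr.aestronglyMeasurable.aemeasurable
      refine hi.mono ((hG.comp hT).aemeasurable.mul
        (Complex.measurable_ofReal.comp_aemeasurable (hr'.max aemeasurable_const))).aestronglyMeasurable
        (.of_forall fun z => ?_)
      rw [norm_mul, norm_mul, norm_real, norm_real, norm_eq_abs, norm_eq_abs]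
      refine mul_le_mul_of_nonneg_left ?_ (norm_nonneg _)
      rw [abs_of_nonneg (le_max_right _ _)]
      exact max_le (le_abs_self _) (abs_nonneg _)
    refine ⟨h1, ?_⟩
    rw [integrable_map_measure hG.aestronglyMeasurable hT.aemeasurable,
      integrable_withDensity_iff_integrable_smul₀' hr.aemeasurable.ennreal_ofReal (hlt r)]
    refine h1.congr (.of_forall fun z => ?_)
    simp only [ENNReal.toReal_ofReal', real_smul, comp_apply, mul_comm]
  have hsplit : ∀ z (c : ℂ), c * (max (q z) 0 : ℝ) - c * (max (-q z) 0 : ℝ) = c * q z := by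
    intro z c
    rw [← mul_sub, ← Complex.ofReal_sub, max_zero_sub_max_neg_zero_eq_self]
  have := hfin hq
  have := hfin hq.neg
  have hB : ∀ f : (ℝ≥0 × Eu n) →ᵇ ℂ, Integrable (fun z => f (T z) * q z) m := fun f =>
    hq.ofReal.bdd_mul (c := ‖f‖) (f.continuous.measurable.comp hT).aestronglyMeasurable
      (.of_forall fun z => f.norm_coe_le_norm _)
  have hBn : ∀ {G : ℝ≥0 × Eu n → ℂ}, Integrable (fun z => G (T z) * q z) m →
      Integrable (fun z => G (T z) * ((-q) z : ℝ)) m := fun hG =>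
    hG.neg.congr (.of_forall fun z => by simp)
  have key : (m.withDensity fun z => ENNReal.ofReal (q z)).map T =
      μ + (m.withDensity fun z => ENNReal.ofReal ((-q) z)).map T := by
    refine ext_of_forall_mem_subalgebra_integral_eq_of_pseudoEMetric_complete_countable
      (𝕜 := ℂ) separatesPoints_expAlg fun g hg => ?_
    have hgen : ∫ p, g p ∂μ = ∫ z, g (T z) * q z ∂m := by
      refine Submodule.span_induction (p := fun (g : (ℝ≥0 × Eu n) →ᵇ ℂ) _ =>
        ∫ p, g p ∂μ = ∫ z, g (T z) * q z ∂m)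
        ?_ ?_ ?_ ?_ hg
      · rintro _ ⟨i, rfl⟩; exact h i.1 i.2
      · simp
      · intro f g _ _ h1 h2
        simp only [BoundedContinuousFunction.add_apply, add_mul]
        rw [integral_add (f.integrable μ) (g.integrable μ), integral_add (hB f) (hB g), h1, h2]
      · intro c f _ h1
        simp only [BoundedContinuousFunction.smul_apply, smul_eq_mul, mul_assoc, integral_const_mul, h1]
    rw [integral_add_measure (g.integrable μ) (g.integrable _), hgen, hint hq g.continuous.measurable,
      hint hq.neg g.continuous.measurable, ← sub_eq_iff_eq_add, ← integral_sub
        (hinti hq g.continuous.measurable (hB g)).1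
        (hinti hq.neg g.continuous.measurable (hBn (hB g))).1]
    exact integral_congr_ae (.of_forall fun z => hsplit z _)
  have h1 := (hinti hq hF hFi).2
  have h2 := (hinti hq.neg hF (hBn hFi)).2
  have h3 : Integrable F μ := by
    rw [key] at h1
    exact h1.left_of_add_measure
  have h4 := congrArg (fun ν => ∫ p, F p ∂ν) key
  beta_reduce at h4
  rw [integral_add_measure h3 h2, hint hq hF, hint hq.neg hF, ← sub_eq_iff_eq_add, ← integral_sub
    (hinti hq hF hFi).1 (hinti hq.neg hF (hBn hFi)).1] at h4
  rw [← h4]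
  exact integral_congr_ae (.of_forall fun z => hsplit z _)

lemma integral_eq_of_expFun {ρ : Z → ℂ} (hρ : Integrable ρ m) {μ : Measure (ℝ≥0 × Eu n)}
    [IsFiniteMeasure μ] (h : ∀ k a, ∫ p, expFun k a p ∂μ = ∫ z, expFun k a (T z) * ρ z ∂m)
    {F : ℝ≥0 × Eu n → ℂ} (hF : Measurable F) (hFi : Integrable (fun z => F (T z) * ρ z) m) :
    ∫ p, F p ∂μ = ∫ z, F (T z) * ρ z ∂m := by
  have hB : ∀ k a, Integrable (fun z => expFun k a (T z) * ρ z) m := fun k a =>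
    hρ.bdd_mul (c := ‖expFun k a‖) ((expFun k a).continuous.measurable.comp hT).aestronglyMeasurable
      (.of_forall fun z => (expFun k a).norm_coe_le_norm _)
  have hc : ∀ k a, ∫ p, expFun k a p ∂μ = ∫ z, expFun k a (T z) * conj (ρ z) ∂m := by
    intro k a
    have h1 := congrArg (conj) (h k (-a))
    rw [← integral_conj, ← integral_conj] at h1
    simpa only [map_mul, conj_expFun, neg_neg] using h1
  have hBc : ∀ k a, Integrable (fun z => expFun k a (T z) * conj (ρ z)) m := fun k a =>
    ((hB k (-a)).norm.mono' ((expFun k a).continuous.measurable.comp hT |>.aestronglyMeasurable.mul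
      (Complex.continuous_conj.comp_aestronglyMeasurable hρ.aestronglyMeasurable))
      (.of_forall fun z => by
        rw [norm_mul, norm_mul, RCLike.norm_conj, ← conj_expFun, RCLike.norm_conj]))
  have hre : ∀ c z, c * ((ρ z).re : ℂ) = (1 / 2) * (c * ρ z + c * conj (ρ z)) := by
    intro c z
    rw [Complex.re_eq_add_conj]; ring
  have him : ∀ c z, c * ((ρ z).im : ℂ) = (1 / (2 * I)) * (c * ρ z - c * conj (ρ z)) := by
    intro c z
    rw [Complex.im_eq_sub_conj]; ring
  have hFm : AEStronglyMeasurable (fun z => F (T z)) m := (hF.comp hT).aestronglyMeasurable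
  have i1 : Integrable (fun z => F (T z) * ((ρ z).re : ℂ)) m :=
    hFi.mono (hFm.mul hρ.re.ofReal.aestronglyMeasurable) (.of_forall fun z => by
      rw [norm_mul, norm_mul, norm_real]
      exact mul_le_mul_of_nonneg_left (Complex.abs_re_le_norm _) (norm_nonneg _))
  have i2 : Integrable (fun z => F (T z) * ((ρ z).im : ℂ)) m :=
    hFi.mono (hFm.mul hρ.im.ofReal.aestronglyMeasurable) (.of_forall fun z => by
      rw [norm_mul, norm_mul, norm_real]
      exact mul_le_mul_of_nonneg_left (Complex.abs_im_le_norm _) (norm_nonneg _))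
  have h1 := integral_eq_of_expFun_real hT hρ.re (μ := μ) (fun k a => by
    refine Eq.trans ?_ (integral_congr_ae (.of_forall fun z => (hre _ z).symm))
    rw [integral_const_mul, integral_add (hB k a) (hBc k a), ← h, ← hc]
    ring) hF i1
  have h2 := integral_eq_of_expFun_real hT hρ.im (μ := 0) (fun k a => by
    refine Eq.trans ?_ (integral_congr_ae (.of_forall fun z => (him _ z).symm))
    rw [integral_const_mul, integral_sub (hB k a) (hBc k a), ← h, ← hc]
    simp) hF i2
  rw [integral_zero_measure] at h2
  rw [h1, ← add_zero (∫ z, F (T z) * _ ∂m), ← mul_zero I, h2, ← integral_const_mul]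
  refine Eq.trans (integral_add i1 (i2.const_mul I)).symm ?_
  refine integral_ext fun z => ?_
  conv_rhs => rw [← Complex.re_add_im (ρ z)]
  change F (T z) * (ρ z).re + I * (F (T z) * (ρ z).im) = _
  ring

end Uniqueness

/-! ### Identification of the spectral measures -/

namespace SpectralData

variable {d₁ d₂ : ℕ} {β : 𝔅} (D : SpectralData β)

lemma exists_exp_mul_pow_le {t : ℝ} (ht : 0 < t) (M : ℕ) :
    ∃ C, 0 ≤ C ∧ ∀ s, 0 ≤ s → exp (-(t * s)) * (1 + s) ^ M ≤ C := by
  refine ⟨M.factorial * exp 1 * (1 + t⁻¹) ^ M, by positivity, fun s hs => ?_⟩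
  have h1 := exp_neg_le_inv_pow M (q := t * s) (by positivity)
  have h2 : 1 + s ≤ (1 + t⁻¹) * (1 + t * s) := by
    have e : (1 + t⁻¹) * (1 + t * s) = 1 + t * s + t⁻¹ + s := by field_simp; ring
    have : 0 ≤ t * s := by positivity
    have : 0 < t⁻¹ := by positivity
    linarith
  calc _ ≤ M.factorial * exp 1 * ((1 + t * s) ^ M)⁻¹ * ((1 + t⁻¹) * (1 + t * s)) ^ M := by gcongr
    _ = _ := by
        rw [mul_pow]
        field_simp

/-- The functions `(λ, η) ↦ e^{-t λ} e^{i ⟨η, a⟩}`, damped in `η`. -/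
def expH (t : ℝ) (a : Eu d₂) (p : 𝕊) : ℂ := cexp (-(t * p.1)) * 𝐞(p.2,a) *
    (((1 + ‖p.2‖ ^ 2 / 1) ^ (d₂ + 1))⁻¹ : ℝ)

lemma norm_expH (t : ℝ) (a : Eu d₂) (p : 𝕊) :
    ‖expH t a p‖ = exp (-(t * p.1)) * ((1 + ‖p.2‖ ^ 2 / 1) ^ (d₂ + 1))⁻¹ := by
  rw [expH, norm_mul, norm_mul, mul_comm I, norm_exp_ofReal_mul_I, norm_real,
    norm_of_nonneg (by positivity), Complex.norm_exp, mul_one]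
  simp

lemma integrable_damping (C : ℝ) :
    Integrable fun η : Eu d₂ => C * ((1 + ‖η‖ ^ 2 / 1) ^ (d₂ + 1))⁻¹ :=
  (integrable_inv_one_add_norm_sq_div_pow one_pos (by rw [finrank_euclideanSpace_fin]; omega)).const_mul C

lemma exists_norm_expH_le {t : ℝ} (ht : 0 < t) (M : ℕ) (a : Eu d₂) : ∃ C, 0 ≤ C ∧
    ∀ s η, 0 ≤ s → ‖expH t a (s, η)‖ * (1 + s) ^ M ≤ C * ((1 + ‖η‖ ^ 2 / 1) ^ (d₂ + 1))⁻¹ := by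
  obtain ⟨C, hC0, hC⟩ := exists_exp_mul_pow_le ht M
  refine ⟨C, hC0, fun s η hs => ?_⟩
  rw [norm_expH, mul_right_comm]
  exact mul_le_mul_of_nonneg_right (hC s hs) (by positivity)

/-- The integral of a function against an elementary function. -/
def rho (Φ : 𝔾 → ℂ) (z : D.Param) : ℂ := ∫ g, D.elem z g * Φ g

variable (halt : Alt β)
include halt

lemma kernel_expH {t : ℝ} (ht : 0 < t) (a : Eu d₂) (g : 𝔾) :
    D.kernel (expH t a) g = ((2 * π) ^ d₁ / 2 ^ (∑ j, D.r j) : ℝ) * ∫ η in D.Ω, 𝐞(η,a) *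
        (((1 + ‖η‖ ^ 2 / 1) ^ (d₂ + 1))⁻¹ : ℝ) * D.heatWave η t g := by
  obtain ⟨C, hC0, hC⟩ := exists_norm_expH_le ht D.deg a
  have hcont : Continuous (expH t a) := by
    unfold expH
    refine _root_.Continuous.mul (by fun_prop) (Complex.continuous_ofReal.comp ?_)
    exact Continuous.inv₀ (by fun_prop) fun p => by positivity
  have hH : ∀ η, ∀ M : ℕ, ∃ C, ∀ s, 0 ≤ s → ‖expH t a (s, η)‖ ≤ C * ((1 + s) ^ M)⁻¹ := by
    intro η M
    obtain ⟨C, hC0, hC⟩ := exists_norm_expH_le ht M a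
    refine ⟨C * ((1 + ‖η‖ ^ 2 / 1) ^ (d₂ + 1))⁻¹, fun s hs => ?_⟩
    rw [← div_eq_mul_inv, le_div_iff₀ (by positivity)]
    exact hC s η hs
  rw [(D.kernel_eq_integral (integrable_damping C) hC halt hcont hH g.1 g.2).2, ← integral_const_mul]
  refine setIntegral_congr_fun D.measurableSet_Ω fun η hη => ?_
  have h1 := hasSum_integral_coeff hη halt hcont (hH η) g.1
  have h2 := (hasSum_integral_exp_coeff hη halt ht g.1).mul_left
    (𝐞(η,a) * (((1 + ‖η‖ ^ 2 / 1) ^ (d₂ + 1))⁻¹ : ℝ))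
  have h3 := h1.unique (h2.congr_fun fun n => by
    rw [← integral_const_mul]
    refine integral_ext fun ξ => ?_
    simp only [expH]
    push_cast
    ring)
  simp only [integral_mul_const, heatWave]
  rw [h3]
  push_cast
  ring

lemma locallyIntegrable_elem (z : D.Param) : LocallyIntegrable (D.elem z) := by
  obtain ⟨C, _, h⟩ := D.exists_norm_elem_le
  refine (locallyIntegrable_const (C * (1 + (D.loc z).1) ^ D.deg * D.weight z)).mono
    ((D.measurable_elem halt).comp (by fun_prop : Measurable fun g => (z, g))).aestronglyMeasurable
    (.of_forall fun g => ?_)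
  exact (h z g).trans (le_abs_self _)

lemma rho_cenOp {Φ : 𝔾 → ℂ} (hΦ : IsTest Φ) (N : ℕ) (z : D.Param) :
    IsTest ((cenOp β)^[N] Φ) ∧ D.rho ((cenOp β)^[N] Φ) z = (((1 + ‖z.1‖ ^ 2) ^ N : ℝ) : ℂ) * D.rho Φ z := by
  refine integral_mul_cenOp_iterate β halt (D.locallyIntegrable_elem halt z) (η := z.1)
    (fun g a => ?_) hΦ N
  by_cases hz : z.1 ∈ D.Ω
  · simp only [elem, indicator_of_mem hz, Prod.fst_add, Prod.snd_add, add_zero, inner_add_right]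
    push_cast
    rw [mul_add, Complex.exp_add]
    ring
  · simp [elem, indicator_of_notMem hz]

lemma integral_exp_rho {Φ : 𝔾 → ℂ} (hΦ : IsTest Φ) {t : ℝ} (ht : 0 < t) (a : Eu d₂) :
    Integrable (fun z => cexp (-(t * (D.loc z).1)) * 𝐞(z.1,a) * D.rho Φ z) D.pvol ∧
    ∫ z, cexp (-(t * (D.loc z).1)) * 𝐞(z.1,a) *
      D.rho Φ z ∂D.pvol = ((2 * π) ^ d₁ / 2 ^ (∑ j, D.r j) : ℝ) *
        ∫ η in D.Ω, 𝐞(η,a) * D.heatInt η t Φ := by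
  set Ψ := (cenOp β)^[d₂ + 1] Φ with hΨ
  have hΨt : IsTest Ψ := (D.rho_cenOp halt hΦ (d₂ + 1) 0).1
  obtain ⟨C, hC0, hC⟩ := exists_norm_expH_le ht D.deg a
  have hm : Measurable (expH t a) := by unfold expH; fun_prop
  have e1 : ∀ z : D.Param, cexp (-(t * (D.loc z).1)) *
      𝐞(z.1,a) * D.rho Φ z = expH t a (D.loc z) * D.rho Ψ z := by
    intro z
    have h0 : ((1 + ‖z.1‖ ^ 2 / 1) ^ (d₂ + 1) : ℂ) ≠ 0 := by
      exact_mod_cast (by positivity : (1 + ‖z.1‖ ^ 2 / 1) ^ (d₂ + 1) ≠ 0)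
    rw [hΨ, (D.rho_cenOp halt hΦ (d₂ + 1) z).2, expH]
    simp only [loc, div_one] at h0 ⊢
    push_cast
    field_simp
  have e2 : ∀ η ∈ D.Ω, D.heatInt η t Φ = (((1 + ‖η‖ ^ 2 / 1) ^ (d₂ + 1))⁻¹ : ℝ) * D.heatInt η t Ψ := by
    intro η hη
    have h0 : ((1 + ‖η‖ ^ 2) ^ (d₂ + 1) : ℂ) ≠ 0 := by
      exact_mod_cast (by positivity : (1 + ‖η‖ ^ 2) ^ (d₂ + 1) ≠ 0)
    have h1 := (integral_mul_cenOp_iterate β halt (contDiff_heatWave (D := D) (η := η)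
      t).continuous.locallyIntegrable (η := η) (fun g a => by
        simp only [heatWave, Prod.fst_add, Prod.snd_add, add_zero, inner_add_right]
        push_cast
        rw [mul_add, Complex.exp_add]
        ring) hΦ (d₂ + 1)).2
    rw [heatInt, heatInt, h1, div_one]
    push_cast
    field_simp
  simp only [e1]
  constructor
  · refine (D.integrable_kernel_prod (integrable_damping C) hC halt hm
      hΨt.integrable).integral_prod_left.congr (.of_forall fun z => ?_)
    simp only [mul_assoc, integral_const_mul]
    rfl
  · have hK := D.integral_kernel_mul (integrable_damping C) hC halt hm hΨt.integrable
    rw [show ∫ z, expH t a (D.loc z) * D.rho Ψ z ∂D.pvol = _ from hK.symm]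
    have e3 : ∫ η in D.Ω, 𝐞(η,a) * D.heatInt η t Φ = ∫ η in D.Ω, ∫ g, 𝐞(η,a) *
          (((1 + ‖η‖ ^ 2 / 1) ^ (d₂ + 1))⁻¹ : ℝ) * D.heatWave η t g * Ψ g :=
      setIntegral_congr_fun D.measurableSet_Ω fun η hη => by
        beta_reduce
        rw [e2 η hη, heatInt, ← mul_assoc, ← integral_const_mul]
        simp only [mul_assoc]
    have hprod : (volume.restrict D.Ω).prod (volume : Measure 𝔾) =
        (volume.prod volume).restrict (D.Ω ×ˢ Set.univ) := by
      rw [← Measure.prod_restrict, Measure.restrict_univ]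
    have hi : Integrable (fun p : Eu d₂ × 𝔾 => 𝐞(p.1,a) *
        (((1 + ‖p.1‖ ^ 2 / 1) ^ (d₂ + 1))⁻¹ : ℝ) * D.heatWave p.1 t p.2 * Ψ p.2)
        ((volume.restrict D.Ω).prod volume) := by
      refine (((integrable_damping (d₂ := d₂) (√(4 * π * t) ^ d₁)⁻¹).integrableOn
        (s := D.Ω)).mul_prod hΨt.integrable.norm).mono' ?_ ?_
      · have h1 := hΨt.1.continuous
        refine AEStronglyMeasurable.mul (AEStronglyMeasurable.mul (by fun_prop) ?_) (by fun_prop)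
        rw [hprod]
        exact (continuousOn_heatWave halt ht).aestronglyMeasurable
          (D.measurableSet_Ω.prod MeasurableSet.univ)
      · rw [hprod, ae_restrict_iff' (D.measurableSet_Ω.prod MeasurableSet.univ)]
        refine Eventually.of_forall fun p hp => ?_
        rw [norm_mul, norm_mul, norm_mul, heatWave, norm_mul, mul_comm I, mul_comm I,
          norm_exp_ofReal_mul_I, norm_exp_ofReal_mul_I, norm_real,
          norm_real, norm_of_nonneg (by positivity),
          norm_of_nonneg (heat_pos hp.1 ht _).le, one_mul, mul_one,
          mul_comm (√(4 * π * t) ^ d₁)⁻¹]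
        refine mul_le_mul_of_nonneg_right (mul_le_mul_of_nonneg_left ?_ (by positivity)) (norm_nonneg _)
        refine (heat_le hp.1 halt ht _).trans (mul_le_of_le_one_right (by positivity) ?_)
        rw [Real.exp_le_one_iff, neg_nonpos]
        positivity
    rw [e3, integral_integral_swap hi, ← integral_const_mul]
    refine integral_ext fun g => ?_
    rw [D.kernel_expH halt ht, integral_mul_const, mul_assoc]

variable {P : ProjMeasure 𝕊 (L2G d₁ d₂)} (hP : IsJointResolution β P)
  {H : 𝕊 → ℂ} {B : Eu d₂ → ℝ} (hB : Integrable B)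
  (hHB : ∀ t η, 0 ≤ t → ‖H (t, η)‖ * (1 + t) ^ D.deg ≤ B η) (hHm : Measurable H)
include hP hB hHB hHm

open scoped NNReal in
lemma integral_measure_toL2 {f : 𝔾 → ℂ} (hf : IsTest f) :
    ∫ p, H p ∂(P.measure (toL2 f)) = (2 ^ (∑ j, D.r j) / (2 * π) ^ (d₁ + d₂) : ℝ) *
      ∫ g, D.kernel H g * corr β f f g := by
  obtain ⟨hpos, hsp⟩ := heat_spectral halt hP D hf
  have hΦ := hf.corr β halt hf
  set μ := P.measure (toL2 f)
  set κ : ℂ := ((2 ^ (∑ j, D.r j) / (2 * π) ^ (d₁ + d₂) : ℝ) : ℂ) with hκ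
  let S : 𝕊 → ℝ≥0 × Eu d₂ := fun p => (p.1.toNNReal, p.2)
  let w : 𝕊 → ℝ≥0 := fun p => ⟨exp (-(p.1.toNNReal : ℝ)), (exp_pos _).le⟩
  have hS : Measurable S := by fun_prop
  have hw : Measurable w := by fun_prop
  have hT : Measurable fun z : D.Param => S (D.loc z) := hS.comp (D.measurable_loc halt)
  have hwd : IsFiniteMeasure (μ.withDensity fun p => (w p : ENNReal)) := by
    refine isFiniteMeasure_withDensity (ne_of_lt (lt_of_le_of_lt (lintegral_mono
      (g := fun _ => (1 : ENNReal)) fun p => ?_) (by simp)))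
    exact ENNReal.coe_le_one_iff.mpr (Subtype.coe_le_coe.mp
      (Real.exp_le_one_iff.mpr (neg_nonpos.mpr (NNReal.coe_nonneg _))))
  have hint : ∀ {F : ℝ≥0 × Eu d₂ → ℂ}, Measurable F →
      ∫ p, F p ∂((μ.withDensity fun p => (w p : ENNReal)).map S) =
        ∫ p, cexp (-(p.1.toNNReal : ℝ)) * F (S p) ∂μ := by
    intro F hF
    rw [integral_map hS.aemeasurable hF.aestronglyMeasurable, integral_withDensity_eq_integral_smul hw]
    refine integral_ext fun p => ?_
    rw [← Complex.ofReal_neg, ← Complex.ofReal_exp]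
    exact real_smul
  have hloc : ∀ z : D.Param, (((D.loc z).1.toNNReal : ℝ≥0) : ℝ) = (D.loc z).1 := fun z =>
    Real.coe_toNNReal _ (D.loc_nonneg z)
  have hi1 := (D.integral_exp_rho halt hΦ one_pos 0).1
  have hρ : Integrable (fun z : D.Param => κ * (cexp (-(D.loc z).1) * D.rho (corr β f f) z))
      D.pvol := by
    refine (hi1.const_mul κ).congr (.of_forall fun z => ?_)
    simp
  have hHρ : Integrable (fun z => H (D.loc z) * D.rho (corr β f f) z) D.pvol := by
    refine (D.integrable_kernel_prod hB hHB halt hHm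
      hΦ.integrable).integral_prod_left.congr (.of_forall fun z => ?_)
    simp only [mul_assoc, integral_const_mul]
    rfl
  have hF : Measurable fun p : ℝ≥0 × Eu d₂ => H ((p.1 : ℝ), p.2) * cexp ((p.1 : ℝ)) :=
    (hHm.comp (by fun_prop)).mul (by fun_prop)
  have eF : ∀ z : D.Param, H (((S (D.loc z)).1 : ℝ), (S (D.loc z)).2) *
      cexp (((S (D.loc z)).1 : ℝ)) * (κ * (cexp (-(D.loc z).1) * D.rho (corr β f f) z)) =
      κ * (H (D.loc z) * D.rho (corr β f f) z) := by
    intro z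
    simp only [S, hloc]
    have : cexp ((D.loc z).1 : ℂ) * cexp (-((D.loc z).1 : ℂ)) = 1 := by
      rw [← Complex.exp_add, add_neg_cancel, Complex.exp_zero]
    linear_combination (H (D.loc z) * κ * D.rho (corr β f f) z) * this
  have hmain := integral_eq_of_expFun hT hρ (μ := (μ.withDensity fun p => (w p : ENNReal)).map S)
    (fun k a => ?_) hF ((hHρ.const_mul κ).congr (.of_forall fun z => (eF z).symm))
  · rw [hint hF] at hmain
    simp only [eF, integral_const_mul] at hmain
    rw [D.integral_kernel_mul hB hHB halt hHm hΦ.integrable]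
    refine Eq.trans (integral_congr_ae ?_) hmain
    filter_upwards [hpos] with p hp
    have h1 : (p.1.toNNReal : ℝ) = p.1 := Real.coe_toNNReal _ hp
    have : cexp (p.1 : ℂ) * cexp (-(p.1 : ℂ)) = 1 := by
      rw [← Complex.exp_add, add_neg_cancel, Complex.exp_zero]
    simp only [S, h1]
    linear_combination (-(H p)) * this
  · have hk : (0 : ℝ) < k + 1 := by positivity
    rw [hint (expFun k a).continuous.measurable]
    have h1 := hsp (k + 1) hk a
    have h2 := (D.integral_exp_rho halt hΦ hk a).2
    have h3 : ∫ p, cexp (-(p.1.toNNReal : ℝ)) * expFun k a (S p) ∂μ =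
        ∫ p, cexp (-((k + 1 : ℝ) * p.1)) * 𝐞(p.2,a) ∂μ := by
      refine integral_congr_ae ?_
      filter_upwards [hpos] with p hp
      have h1 : (p.1.toNNReal : ℝ) = p.1 := Real.coe_toNNReal _ hp
      simp only [expFun_apply, S, h1]
      rw [← mul_assoc, ← Complex.exp_add]
      push_cast
      ring_nf
    have h4 : ∀ z : D.Param, expFun k a (S (D.loc z)) * (κ * (cexp (-(D.loc z).1) *
        D.rho (corr β f f) z)) = κ * (cexp (-((k + 1 : ℝ) * (D.loc z).1)) *
          𝐞(z.1,a) * D.rho (corr β f f) z) := by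
      intro z
      simp only [expFun_apply, S, hloc]
      have : cexp (-((k + 1 : ℝ) * ((D.loc z).1 : ℂ))) =
          cexp (-(k * ((D.loc z).1 : ℂ))) * cexp (-((D.loc z).1 : ℂ)) := by
        rw [← Complex.exp_add]
        push_cast
        ring_nf
      rw [this]
      simp only [loc]
      ring
    simp only [h4, integral_const_mul, h2]
    rw [h3, h1, hκ, ← mul_assoc, pow_add]
    congr 1
    have hp1 : (π : ℂ) ≠ 0 := by exact_mod_cast Real.pi_ne_zero
    push_cast
    field_simp

end SpectralData

/-! ### The convolution kernel -/

section Convolution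

variable {d₁ d₂ : ℕ} (β : 𝔅) {φ f K : 𝔾 → ℂ}

lemma continuous_conv (hf : IsTest f) (hK : Continuous K) : Continuous (conv β f K) := by
  have hc := hf.1.continuous
  have h1 : Continuous fun p : 𝔾 × 𝔾 => mul β (-p.2) p.1 :=
    Continuous.mul β (by fun_prop) (by fun_prop)
  refine continuousOn_univ.mp (continuousOn_integral_of_compact_support
    (f := fun g h => f h * K (mul β (-h) g)) hf.2.isCompact (Continuous.continuousOn
      ((hc.comp continuous_snd).mul (hK.comp h1))) fun g h _ hh => ?_)
  rw [image_eq_zero_of_notMem_tsupport hh, zero_mul]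

lemma corr_add_right {f' : 𝔾 → ℂ} (hφ : IsTest φ) (hf : IsTest f) (hf' : IsTest f') :
    corr β φ (fun g => f g + f' g) = fun k => corr β φ f k + corr β φ f' k := by
  funext k
  rw [corr, corr, corr, ← integral_add (integrable_corr β hφ hf k) (integrable_corr β hφ hf' k)]
  simp only [add_mul]

lemma corr_const_mul_right (c : ℂ) : corr β φ (fun g => c * f g) = fun k => c * corr β φ f k := by
  funext k
  rw [corr, corr, ← integral_const_mul]
  simp only [mul_assoc]

variable (halt : Alt β)
include halt

lemma integral_mul_corr (hφ : IsTest φ) (hf : IsTest f) (hK : Continuous K) :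
    ∫ k, K k * corr β φ f k = ∫ g, conj (φ g) * conv β f K g := by
  have hfc := hf.1.continuous
  have hφc := hφ.1.continuous
  have h1 : Continuous fun p : 𝔾 × 𝔾 => mul β p.2 p.1 :=
    Continuous.mul β (by fun_prop) (by fun_prop)
  have h2 : Continuous fun p : 𝔾 × 𝔾 => mul β (-p.1) p.2 :=
    Continuous.mul β (by fun_prop) (by fun_prop)
  have i1 : Integrable (fun p : 𝔾 × 𝔾 =>
      K p.1 * (f p.2 * conj (φ (mul β p.2 p.1)))) (volume.prod volume) := by
    refine Continuous.integrable_of_hasCompactSupport ((hK.comp continuous_fst).mul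
      ((hfc.comp continuous_snd).mul (Complex.continuous_conj.comp (hφc.comp h1)))) ?_
    refine HasCompactSupport.intro ((hf.2.isCompact.prod hφ.2.isCompact).image
      (h2.prodMk continuous_fst)) fun p hp => ?_
    by_contra h
    refine hp ⟨(p.2, mul β p.2 p.1), ⟨subset_tsupport _ fun h0 => h ?_,
      subset_tsupport _ fun h0 => h ?_⟩, ?_⟩
    · rw [h0, zero_mul, MulZeroClass.mul_zero]
    · rw [h0, map_zero, MulZeroClass.mul_zero, MulZeroClass.mul_zero]
    · simp only [neg_mul_cancel_left β halt]
  have i2 : Integrable (fun p : 𝔾 × 𝔾 =>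
      conj (φ p.2) * (f p.1 * K (mul β (-p.1) p.2))) (volume.prod volume) := by
    refine Continuous.integrable_of_hasCompactSupport ((Complex.continuous_conj.comp
      (hφc.comp continuous_snd)).mul ((hfc.comp continuous_fst).mul (hK.comp h2))) ?_
    refine HasCompactSupport.intro (hf.2.isCompact.prod hφ.2.isCompact) fun p hp => ?_
    by_contra h
    refine hp ⟨subset_tsupport _ fun h0 => h ?_, subset_tsupport _ fun h0 => h ?_⟩
    · rw [h0, zero_mul, MulZeroClass.mul_zero]
    · rw [h0, map_zero, zero_mul]
  calc ∫ k, K k * corr β φ f k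
      = ∫ k, ∫ h, K k * (f h * conj (φ (mul β h k))) := by
        simp only [corr, integral_const_mul]
    _ = ∫ h, ∫ k, K k * (f h * conj (φ (mul β h k))) := integral_integral_swap i1
    _ = ∫ h, ∫ g, conj (φ g) * (f h * K (mul β (-h) g)) := by
        congr 1
        funext h
        rw [← integral_mul_left β halt (fun g => conj (φ g) * (f h * K (mul β (-h) g))) h]
        congr 1
        funext k
        rw [neg_mul_cancel_left β halt]
        ring
    _ = ∫ g, ∫ h, conj (φ g) * (f h * K (mul β (-h) g)) := integral_integral_swap i2
    _ = _ := by simp only [conv, integral_const_mul]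

lemma inner_eq_integral_mul_corr (hK : Continuous K) {T : L2G d₁ d₂ →L[ℂ] L2G d₁ d₂}
    (hT : ∀ f, IsTest f → inner ℂ (toL2 f) (T (toL2 f)) = ∫ k, K k * corr β f f k)
    (hφ : IsTest φ) (hf : IsTest f) :
    inner ℂ (toL2 φ) (T (toL2 f)) = ∫ k, K k * corr β φ f k := by
  have hi : ∀ {φ f}, IsTest φ → IsTest f → Integrable fun k => K k * corr β φ f k := fun hφ hf =>
    (hK.mul (hφ.corr β halt hf).1.continuous).integrable_of_hasCompactSupport
      (hφ.corr β halt hf).2.mul_left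
  have key : ∀ f, IsTest f → inner ℂ (toL2 φ) (T (toL2 f)) + inner ℂ (toL2 f) (T (toL2 φ)) =
      (∫ k, K k * corr β φ f k) + ∫ k, K k * corr β f φ k := by
    intro f hf
    have h := hT _ (hφ.add hf)
    rw [toL2_add hφ.memLp hf.memLp, corr_add_left β hφ hf (hφ.add hf), corr_add_right β hφ hφ hf,
      corr_add_right β hf hφ hf] at h
    simp only [map_add, inner_add_left, inner_add_right, hT _ hφ, hT _ hf, mul_add] at h
    rw [integral_add, integral_add, integral_add] at h
    · linear_combination h
    · exact hi hf hφ
    · exact hi hf hf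
    · exact hi hφ hφ
    · exact hi hφ hf
    · exact (hi hφ hφ).add (hi hφ hf)
    · exact (hi hf hφ).add (hi hf hf)
  have h1 := key f hf
  have h2 := key _ (hf.const_mul I)
  rw [toL2_smul hf.memLp, corr_const_mul_right, corr_const_mul_left] at h2
  simp only [map_smul, inner_smul_left, inner_smul_right, conj_I, mul_left_comm (K _),
    integral_const_mul] at h2
  linear_combination h1 / 2 + (-I / 2) * h2 - (inner ℂ (toL2 f) (T (toL2 φ)) / 2 -
    inner ℂ (toL2 φ) (T (toL2 f)) / 2 + (∫ k, K k * corr β φ f k) / 2 -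
    (∫ k, K k * corr β f φ k) / 2) * I_sq

lemma isConvolutionKernel_of_inner (hK : Continuous K) {T : L2G d₁ d₂ →L[ℂ] L2G d₁ d₂}
    (hT : ∀ f, IsTest f → inner ℂ (toL2 f) (T (toL2 f)) = ∫ k, K k * corr β f f k) :
    IsConvolutionKernel β T K := by
  refine ⟨hK.locallyIntegrable, fun f w hf hw => ?_⟩
  rw [eq_toL2 hf.memLp hw]
  refine ae_eq_of_integral_contDiff_smul_eq ((Lp.memLp _).locallyIntegrable (by norm_num))
    (continuous_conv β hf hK).locallyIntegrable fun ψ hψ hψc => ?_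
  have hφ : IsTest fun g => (ψ g : ℂ) :=
    ⟨Complex.ofRealCLM.contDiff.comp hψ, hψc.comp_left ofReal_zero⟩
  have h := inner_eq_integral_mul_corr β halt hK hT hφ hf
  rw [integral_mul_corr β halt hφ hf hK, ← inner_conj_symm, inner_toL2 _ hφ.memLp,
    ← integral_conj] at h
  simp only [map_mul, conj_conj, conj_ofReal] at h
  simp only [real_smul, mul_comm (ψ _ : ℂ) (T _ _), h]

end Convolution

/-! ### Existence of spectral data -/

section Factorization

open Polynomial

lemma exists_monic_irreducible_factorization {R : Type*} [CommRing R] [IsDomain R] (Q : R[X])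
    (hQ : Q.Monic) : ∃ f : Multiset R[X], (∀ q ∈ f, q.Monic ∧ Irreducible q) ∧ f.prod = Q := by
  induction h : Q.natDegree using Nat.strong_induction_on generalizing Q with
  | _ n ih =>
    by_cases h1 : Q = 1
    · exact ⟨0, by simp, by simp [h1]⟩
    by_cases hi : Irreducible Q
    · exact ⟨{Q}, by simp [hQ, hi], by simp⟩
    rw [hQ.irreducible_iff_natDegree] at hi
    push Not at hi
    obtain ⟨p, q, hp, hq, rfl, hp0, hq0⟩ := hi h1
    rw [hp.natDegree_mul hq] at h
    obtain ⟨f, hf, rfl⟩ := ih _ (by omega) p hp rfl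
    obtain ⟨g, hg, rfl⟩ := ih _ (by omega) q hq rfl
    refine ⟨f + g, fun r hr => ?_, Multiset.prod_add _ _⟩
    exact (Multiset.mem_add.mp hr).elim (hf r) (hg r)

lemma exists_bezout_derivative {R : Type*} [CommRing R] [IsDomain R] [IsIntegrallyClosed R]
    [CharZero R] (S : Finset R[X]) (hS : ∀ q ∈ S, q.Monic ∧ Irreducible q) :
    ∃ (a b : R[X]) (δ : R), δ ≠ 0 ∧ a * ∏ q ∈ S, q + b * derivative (∏ q ∈ S, q) = C δ := by
  set K := FractionRing R
  have : CharZero K := charZero_of_injective_algebraMap (IsFractionRing.injective R K)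
  have hinj : Function.Injective (mapRingHom (algebraMap R K)) :=
    map_injective _ (IsFractionRing.injective R K)
  have hirr : ∀ q ∈ S, Irreducible (q.map (algebraMap R K)) := fun q hq =>
    ((hS q hq).1.irreducible_iff_irreducible_map_fraction_map).mp (hS q hq).2
  have hsep : (∏ q ∈ S, q.map (algebraMap R K)).Separable := by
    refine separable_prod' (fun p hp q hq hne => ?_) fun q hq => (hirr q hq).separable
    refine ((hirr p hp).coprime_iff_not_dvd).mpr fun h => hne (hinj ?_)
    exact eq_of_monic_of_associated ((hS p hp).1.map _) ((hS q hq).1.map _)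
      ((hirr p hp).associated_of_dvd (hirr q hq) h)
  rw [← Polynomial.map_prod, separable_def, derivative_map] at hsep
  obtain ⟨u, v, huv⟩ := hsep
  obtain ⟨c, hcm, hc⟩ := IsLocalization.integerNormalization_spec (nonZeroDivisors R) u
  obtain ⟨d, hdm, hd⟩ := IsLocalization.integerNormalization_spec (nonZeroDivisors R) v
  refine ⟨C d * IsLocalization.integerNormalization (nonZeroDivisors R) u,
    C c * IsLocalization.integerNormalization (nonZeroDivisors R) v, c * d,
    mul_ne_zero (nonZeroDivisors.ne_zero hcm) (nonZeroDivisors.ne_zero hdm), hinj ?_⟩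
  simp only [map_add, map_mul, coe_mapRingHom, hc, hd, map_C, Algebra.smul_def,
    Polynomial.algebraMap_apply]
  linear_combination (C (algebraMap R K c) * C (algebraMap R K d)) * huv

lemma exists_monotone_roots {q : ℝ[X]} (hq : q.Monic) (hs : q.Splits) {k : ℕ}
    (hk : q.natDegree = k) : ∃ x : Fin k → ℝ, Monotone x ∧ q = ∏ i, (X - C (x i)) := by
  have hl : (q.roots.sort (· ≤ ·)).length = k := by
    rw [Multiset.length_sort, ← hs.natDegree_eq_card_roots, hk]
  subst hl
  refine ⟨(q.roots.sort (· ≤ ·)).get, (q.roots.pairwise_sort (· ≤ ·)).sortedLE.monotone_get, ?_⟩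
  conv_lhs => rw [hs.eq_prod_roots_of_monic hq, ← Multiset.sort_eq q.roots (· ≤ ·)]
  rw [Multiset.map_coe, Multiset.prod_coe, ← List.prod_ofFn]
  congr 1
  conv_lhs => rw [← List.ofFn_get (q.roots.sort (· ≤ ·)), List.map_ofFn]
  rfl

lemma eq_of_prod_X_sub_C_eq {k : ℕ} {x y : Fin k → ℝ} (hx : Monotone x) (hy : Monotone y)
    (h : ∏ i, (X - C (x i)) = ∏ i, (X - C (y i))) : x = y := by
  have e : ∀ x : Fin k → ℝ, (∏ i, (X - C (x i))).roots = (List.ofFn x : Multiset ℝ) := fun x => by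
    rw [← List.prod_ofFn]
    conv_rhs => rw [← roots_multiset_prod_X_sub_C (List.ofFn x : Multiset ℝ), Multiset.map_coe,
        Multiset.prod_coe, List.map_ofFn]
    rfl
  have h1 := congrArg roots h
  rw [e, e, Multiset.coe_eq_coe] at h1
  exact List.ofFn_injective (h1.eq_of_sortedLE hx.sortedLE_ofFn hy.sortedLE_ofFn)

lemma continuousOn_roots {Y : Type*} [TopologicalSpace Y] {Ω : Set Y} {k : ℕ} {q : Y → ℝ[X]}
    {x : Y → Fin k → ℝ} (hx : ∀ η ∈ Ω, Monotone (x η)) (hx0 : ∀ η ∈ Ω, ∀ i, 0 ≤ x η i)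
    (hq : ∀ η ∈ Ω, q η = ∏ i, (X - C (x η i)))
    (hc : ∀ n, ContinuousOn (fun η => (q η).coeff n) Ω) : ContinuousOn x Ω := by
  intro η₀ hη₀
  have hdeg : ∀ η ∈ Ω, (q η).natDegree = k := fun η hη => by
    rw [hq η hη, natDegree_prod_of_monic _ _ fun i _ => monic_X_sub_C _]
    simp
  have hsum : ∀ η ∈ Ω, ∑ i, x η i ≤ |(q η).coeff (k - 1)| := by
    intro η hη
    rcases Nat.eq_zero_or_pos k with rfl | hk
    · simp
    have := prod_X_sub_C_nextCoeff (s := univ) (x η)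
    rw [← hq η hη, nextCoeff, if_neg (by rw [hdeg η hη]; omega), hdeg η hη] at this
    rw [this, abs_neg]
    exact le_abs_self _
  have hcw := hc (k - 1) η₀ hη₀
  set M := |(q η₀).coeff (k - 1)| + 1
  have hK : IsCompact (Metric.closedBall (0 : Fin k → ℝ) M ∩ {y | Monotone y}) := by
    refine (isCompact_closedBall _ _).inter_right ?_
    simp only [Monotone, Set.ofPred_forall]
    exact isClosed_iInter fun i => isClosed_iInter fun j => isClosed_iInter fun _ =>
      isClosed_le (continuous_apply i) (continuous_apply j)
  refine hK.tendsto_nhds_of_unique_mapClusterPt ?_ fun y hy hcl => ?_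
  · filter_upwards [self_mem_nhdsWithin, hcw.abs.eventually (gt_mem_nhds (lt_add_one _))] with η hη h
    refine ⟨mem_closedBall_zero_iff.mpr ((pi_norm_le_iff_of_nonneg (by positivity)).mpr
      fun i => ?_), hx η hη⟩
    rw [norm_of_nonneg (hx0 η hη i)]
    exact (single_le_sum (fun i _ => hx0 η hη i) (mem_univ i)).trans ((hsum η hη).trans h.le)
  · refine eq_of_prod_X_sub_C_eq hy.2 (hx η₀ hη₀) (funext fun s => ?_)
    have h1 : MapClusterPt (∏ i, (s - y i)) (𝓝[Ω] η₀) fun η => ∏ i, (s - x η i) :=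
      hcl.continuousAt_comp (f := fun y : Fin k → ℝ => ∏ i, (s - y i))
        (continuous_finsetProd _ fun i _ => by fun_prop).continuousAt
    have h2 : Tendsto (fun η => ∏ i, (s - x η i)) (𝓝[Ω] η₀) (𝓝 (∏ i, (s - x η₀ i))) := by
      have h3 : ∀ η ∈ Ω, ∏ i, (s - x η i) = ∑ n ∈ range (k + 1), (q η).coeff n * s ^ n := by
        intro η hη
        rw [← eval_eq_sum_range' (by rw [hdeg η hη]; omega), hq η hη, eval_prod]
        simp
      rw [h3 η₀ hη₀]
      refine Tendsto.congr' (f₁ := fun η => ∑ n ∈ range (k + 1), (q η).coeff n * s ^ n) ?_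
        (tendsto_finsetSum _ fun n _ => (hc n η₀ hη₀).mul_const _)
      filter_upwards [self_mem_nhdsWithin] with η hη using (h3 η hη).symm
    simp only [eval_prod, eval_sub, eval_X, eval_C]
    exact eq_of_nhds_neBot (h1.neBot.mono (inf_le_inf_left _ h2))

end Factorization

section Existence

open Polynomial

variable {d₁ d₂ : ℕ} (β : 𝔅)

/-- The characteristic polynomial of `-J_η²`, with coefficients polynomial in `η`. -/
def genericCharpoly : Polynomial (MvPolynomial (Fin d₂) ℝ) :=
  let M : Matrix (Fin d₁) (Fin d₁) (MvPolynomial (Fin d₂) ℝ) := Matrix.of fun i j => ∑ k,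
    MvPolynomial.C (β (single j 1) (single i 1) k) * MvPolynomial.X k
  (-(M * M)).charpoly

lemma map_genericCharpoly (η : Eu d₂) :
    (genericCharpoly β).map (MvPolynomial.eval fun k => η k) = (negJSq β η).charpoly := by
  let b := (EuclideanSpace.basisFun (Fin d₁) ℝ).toBasis
  rw [← LinearMap.charpoly_toMatrix _ b, genericCharpoly, ← Matrix.charpoly_map, negJSq, map_neg,
    LinearMap.toMatrix_mul, Matrix.map_neg _ (by simp), Matrix.map_mul]
  congr
  all_goals
    ext i j
    rw [LinearMap.toMatrix_apply, Matrix.map_apply]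
    have h := inner_J β η (single j 1) (single i 1)
    rw [EuclideanSpace.inner_single_right, PiLp.inner_apply] at h
    simpa [b, mul_comm] using h.symm

variable (halt : Alt β)
include halt

lemma nonneg_of_isRoot_charpoly {η : Eu d₂} {a : ℝ} (h : (negJSq β η).charpoly.IsRoot a) : 0 ≤ a := by
  obtain ⟨v, hv⟩ := ((Module.End.hasEigenvalue_iff_isRoot_charpoly _ _).mpr h).exists_hasEigenvector
  have h1 := inner_negJSq halt η v v
  rw [hv.apply_eq_smul, inner_smul_left, real_inner_self_eq_norm_sq, real_inner_self_eq_norm_sq] at h1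
  have h2 : 0 < ‖v‖ ^ 2 := by have := norm_pos_iff.mpr hv.2; positivity
  exact nonneg_of_mul_nonneg_left (h1.symm ▸ sq_nonneg _ : 0 ≤ a * ‖v‖ ^ 2) h2

lemma even_rootMultiplicity_charpoly (η : Eu d₂) {a : ℝ} (ha : 0 < a) :
    Even ((negJSq β η).charpoly.rootMultiplicity a) := by
  rw [← finrank_eigenspace halt]
  set W := Module.End.eigenspace (negJSq β η) a
  have hW : ∀ v ∈ W, J β η v ∈ W := by
    intro v hv
    rw [Module.End.mem_eigenspace_iff] at hv ⊢
    rw [← map_smul, ← hv]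
    simp [negJSq]
  have h1 : (J β η).restrict hW * (J β η).restrict hW = (-a) • 1 := by
    ext1 v
    apply Subtype.ext
    have := Module.End.mem_eigenspace_iff.mp v.2
    simp only [negJSq, LinearMap.neg_apply, Module.End.mul_apply] at this
    simp [LinearMap.restrict_apply, ← this]
  have h2 := congrArg LinearMap.det h1
  rw [map_mul, LinearMap.det_smul, map_one, mul_one] at h2
  by_contra h
  have h3 := (Nat.not_even_iff_odd.mp h).pow_neg (neg_neg_of_pos ha)
  nlinarith [mul_self_nonneg (LinearMap.det ((J β η).restrict hW))]

lemma nonempty_spectralData : Nonempty (SpectralData β) := by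
  classical
  obtain ⟨f, hf, hfQ⟩ := exists_monic_irreducible_factorization (genericCharpoly β)
    (Matrix.charpoly_monic _)
  set T := f.toFinset.erase X
  have hT : ∀ q ∈ T, q.Monic ∧ Irreducible q := fun q hq =>
    hf q (Multiset.mem_toFinset.mp (mem_of_mem_erase hq))
  have hXT : X ∉ T := notMem_erase _ _
  obtain ⟨p₁, p₂, δ, hδ, hbez⟩ := exists_bezout_derivative (insert X T) fun q hq => by
    rcases mem_insert.mp hq with rfl | h
    exacts [⟨Polynomial.monic_X, Polynomial.irreducible_X⟩, hT q h]
  let ev (η : Eu d₂) : MvPolynomial (Fin d₂) ℝ →+* ℝ := MvPolynomial.eval fun k => η k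
  set Ω : Set (Eu d₂) := {η | ev η δ ≠ 0} with hΩ
  have hfac : ∀ η, (negJSq β η).charpoly = X ^ f.count X *
      ∏ q : T, (q.1.map (ev η)) ^ f.count q.1 := by
    intro η
    rw [← map_genericCharpoly, ← hfQ, prod_multiset_count_of_subset f (insert X T)
      (fun q hq => ?_), prod_insert hXT, Polynomial.map_mul, Polynomial.map_prod,
      ← prod_coe_sort T]
    · simp [ev]
    · by_cases h : q = X
      · simp [h]
      · simp [T, h, Multiset.mem_toFinset.mp hq]
  have hcount : ∀ q : T, 0 < f.count q.1 := fun q =>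
    Multiset.count_pos.mpr (Multiset.mem_toFinset.mp (mem_of_mem_erase q.2))
  have hdvd : ∀ η (q : T), q.1.map (ev η) ∣ (negJSq β η).charpoly := by
    intro η q
    rw [hfac]
    exact ((dvd_pow_self _ (hcount q).ne').trans
      (dvd_prod_of_mem (fun q : T => (q.1.map (ev η)) ^ f.count q.1) (mem_univ q))).mul_left _
  have hex : ∀ η (q : T), ∃ x : Fin q.1.natDegree → ℝ, Monotone x ∧
      q.1.map (ev η) = ∏ i, (X - C (x i)) := fun η q =>
    exists_monotone_roots ((hT q q.2).1.map _)
      ((isSymmetric_negJSq halt η).splits_charpoly.of_dvd (LinearMap.charpoly_monic _).ne_zero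
        (hdvd η q)) ((hT q q.2).1.natDegree_map _)
  choose x hmono hx using hex
  have hroot : ∀ η q i, (negJSq β η).charpoly.IsRoot (x η q i) := by
    intro η q i
    refine Polynomial.IsRoot.dvd (p := q.1.map (ev η)) ?_ (hdvd η q)
    rw [hx, Polynomial.IsRoot.def, Polynomial.eval_prod]
    exact prod_eq_zero (mem_univ i) (by simp)
  have hx0 : ∀ η q i, 0 ≤ x η q i := fun η q i =>
    nonneg_of_isRoot_charpoly β halt (hroot η q i)
  let y (η : Eu d₂) : Option (Σ q : T, Fin q.1.natDegree) → ℝ := fun i => i.elim 0 fun s => x η s.1 s.2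
  have hyinj : ∀ η ∈ Ω, Function.Injective (y η) := by
    intro η hη
    have h := congrArg (Polynomial.map (ev η)) hbez
    have e : (∏ q ∈ insert X T, q).map (ev η) = ∏ k, (X - C (y η k)) := by
      rw [prod_insert hXT, Polynomial.map_mul, Polynomial.map_prod, Polynomial.map_X,
        Fintype.prod_option, Fintype.prod_sigma, ← prod_coe_sort T]
      simp [y, hx]
    rw [Polynomial.map_add, Polynomial.map_mul, Polynomial.map_mul, ← Polynomial.derivative_map, e,
      Polynomial.map_C] at h
    refine Polynomial.separable_prod_X_sub_C_iff.mp ⟨C (ev η δ)⁻¹ * p₁.map (ev η),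
      C (ev η δ)⁻¹ * p₂.map (ev η), ?_⟩
    rw [mul_assoc, mul_assoc, ← mul_add, h, ← Polynomial.C_mul, inv_mul_cancel₀ hη, Polynomial.C_1]
  have hprod : ∀ η, (negJSq β η).charpoly = X ^ f.count X * ∏ s : Σ q : T, Fin q.1.natDegree,
        (X - C (x η s.1 s.2)) ^ f.count s.1.1 := by
    intro η
    rw [hfac, Fintype.prod_sigma]
    simp only [hx, prod_pow]
  have hpos : ∀ η ∈ Ω, ∀ q i, 0 < x η q i := fun η hη q i => (hx0 η q i).lt_of_ne fun h =>
    absurd (hyinj η hη (a₁ := none) (a₂ := some ⟨q, i⟩) h) (by simp)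
  have hinj : ∀ η ∈ Ω, ∀ s s' : Σ q : T, Fin q.1.natDegree, s ≠ s' →
      x η s.1 s.2 ≠ x η s'.1 s'.2 := fun η hη s s' hs h =>
    hs (Option.some_injective _ (hyinj η hη (a₁ := some s) (a₂ := some s') h))
  have hne : Ω.Nonempty := by
    by_contra h
    refine hδ (MvPolynomial.funext fun v => ?_)
    by_contra h0
    exact h ⟨WithLp.toLp 2 v, by simpa [hΩ, ev] using h0⟩
  have heven : ∀ s : Σ q : T, Fin q.1.natDegree, Even (f.count s.1.1) := by
    intro s
    obtain ⟨η, hη⟩ := hne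
    have h := even_rootMultiplicity_charpoly β halt η (hpos η hη s.1 s.2)
    have h1 := rootMultiplicity_prod_pow (hyinj η hη)
      (fun k => k.elim (f.count X) fun s => f.count s.1.1) (some s)
    rw [Fintype.prod_option] at h1
    rw [hprod] at h
    simp only [y, Option.elim, Polynomial.C_0, sub_zero] at h1
    rwa [h1] at h
  have hcont : ∀ q, ContinuousOn (fun η => x η q) Ω := by
    refine fun q => continuousOn_roots (q := fun η => q.1.map (ev η)) (fun η _ => hmono η q)
      (fun η _ => hx0 η q) (fun η _ => hx η q) fun n => Continuous.continuousOn ?_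
    simp only [Polynomial.coeff_map, ev]
    exact (MvPolynomial.continuous_eval _).comp (by fun_prop)
  let e := Fintype.equivFin (Σ q : T, Fin q.1.natDegree)
  exact ⟨{
    Ω := Ω
    zariskiOpen := ⟨{δ}, by simp [hΩ, ev]⟩
    nonempty := hne
    d := _
    r₀ := f.count X
    r := fun j => f.count (e.symm j).1.1 / 2
    r_pos := fun j => by
      have h1 := hcount (e.symm j).1
      have h2 := (heven (e.symm j)).two_dvd
      omega
    b := fun j η => √(x η (e.symm j).1 (e.symm j).2)
    b_cont := fun j => ((continuous_apply _).comp_continuousOn (hcont (e.symm j).1)).sqrt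
    b_pos := fun j η hη => Real.sqrt_pos.mpr (hpos η hη _ _)
    b_ne := fun j j' hj η hη h => hinj η hη _ _ (fun h => hj (e.symm.injective h))
      ((Real.sqrt_inj (hx0 _ _ _) (hx0 _ _ _)).mp h)
    charpoly_eq := fun η hη => by
      rw [hprod, ← e.symm.prod_comp]
      congr 1
      refine prod_congr rfl fun j _ => ?_
      rw [sq_sqrt (hx0 _ _ _), Nat.mul_div_cancel' (heven (e.symm j)).two_dvd] }⟩

end Existence

/-! ### The main theorem -/

lemma exists_norm_schwartz_le {n : ℕ} (H : 𝓢(ℝ × Eu n, ℂ)) (M : ℕ) : ∃ C, ∀ t η, 0 ≤ t →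
    ‖H (t, η)‖ * (1 + t) ^ M ≤ C * ((1 + ‖η‖ ^ 2 / 1) ^ (n + 1))⁻¹ := by
  obtain ⟨C, h⟩ : ∃ C, ∀ p, (1 + ‖p‖) ^ (M + 2 * (n + 1)) * ‖iteratedFDeriv ℝ 0 H p‖ ≤ C :=
    ⟨_, SchwartzMap.one_add_le_sup_seminorm_apply (𝕜 := ℝ) (m := (M + 2 * (n + 1), 0)) le_rfl le_rfl H⟩
  refine ⟨C, fun t η ht => ?_⟩
  rw [← div_eq_mul_inv, le_div_iff₀ (by positivity)]
  refine le_trans ?_ (h (t, η))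
  have h1 : t ≤ ‖(t, η)‖ := (le_abs_self t).trans (norm_fst_le (t, η))
  have h2 : ‖η‖ ≤ ‖(t, η)‖ := norm_snd_le (t, η)
  have h3 : 1 + ‖η‖ ^ 2 / 1 ≤ (1 + ‖(t, η)‖) ^ 2 := by nlinarith [norm_nonneg η]
  rw [norm_iteratedFDeriv_zero, mul_assoc, mul_comm, pow_add _ M, pow_mul]
  gcongr

lemma bracket_self {𝔤 : Type*} [LieRing 𝔤] [LieAlgebra ℝ 𝔤] (S : Stratification 𝔤) {d₁ d₂ : ℕ}
    (X : Module.Basis (Fin d₁) ℝ S.layer₁) (U : Module.Basis (Fin d₂) ℝ S.layer₂) (x : Eu d₁) :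
    bracket S X U x x = 0 := by
  simp [bracket]

lemma Stratification.finrank_eq {𝔤 : Type*} [LieRing 𝔤] [LieAlgebra ℝ 𝔤] (S : Stratification 𝔤)
    {d₁ d₂ : ℕ} (X : Module.Basis (Fin d₁) ℝ S.layer₁) (U : Module.Basis (Fin d₂) ℝ S.layer₂) :
    finrank ℝ 𝔤 = d₁ + d₂ := by
  have := Module.Finite.of_basis X
  have := Module.Finite.of_basis U
  rw [← (Submodule.prodEquivOfIsCompl _ _ S.isCompl).finrank_eq, Module.finrank_prod,
    Module.finrank_eq_card_basis X, Module.finrank_eq_card_basis U, Fintype.card_fin, Fintype.card_fin]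

end TwoStep

end

theorem mainTheorem6 {𝔤 : Type*} [LieRing 𝔤] [LieAlgebra ℝ 𝔤] (S : TwoStep.Stratification 𝔤)
    {d₁ d₂ : ℕ} (X : Module.Basis (Fin d₁) ℝ S.layer₁) (U : Module.Basis (Fin d₂) ℝ S.layer₂) :
    -- the data entering the formula can be chosen as prescribed
    Nonempty (TwoStep.SpectralData (TwoStep.bracket S X U)) ∧
    ∀ H : 𝓢(ℝ × TwoStep.Eu d₂, ℂ),
      -- the operator `H(L, U)` exists as a bounded operator on `L²(G)`
      (∃ T, TwoStep.IsJointFunction (TwoStep.bracket S X U) H T) ∧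
      ∀ D : TwoStep.SpectralData (TwoStep.bracket S X U),
        -- the sum and the integrals in the kernel formula converge absolutely
        (∀ η ∈ D.Ω, ∀ ξ, Summable (D.term H ξ η)) ∧
        (∀ η ∈ D.Ω, Integrable (fun ξ => D.V H ξ η)) ∧
        (∀ x u, IntegrableOn (fun η => ∫ ξ, D.V H ξ η *
          Complex.exp (Complex.I * (inner ℝ ξ x : ℝ)) *
          Complex.exp (Complex.I * (inner ℝ η u : ℝ))) D.Ω) ∧
        -- the kernel of `H(L, U)` is the continuous function given by the formula
        ∀ T, TwoStep.IsJointFunction (TwoStep.bracket S X U) H T →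
          ∃ K : TwoStep.Eu d₁ × TwoStep.Eu d₂ → ℂ, Continuous K ∧
            TwoStep.IsConvolutionKernel (TwoStep.bracket S X U) T K ∧
            ∀ x u, K (x, u) = (2 : ℂ) ^ (∑ j, D.r j) / (2 * (Real.pi : ℂ)) ^ (Module.finrank ℝ 𝔤) *
              ∫ η in D.Ω, ∫ ξ, D.V H ξ η * Complex.exp (Complex.I * (inner ℝ ξ x : ℝ)) *
                Complex.exp (Complex.I * (inner ℝ η u : ℝ)) := by
  have halt := TwoStep.bracket_self S X U
  refine ⟨TwoStep.nonempty_spectralData _ halt, fun H => ⟨?_, fun D => ?_⟩⟩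
  · obtain ⟨P, hP⟩ := TwoStep.exists_jointResolution _ halt
    have hH : TwoStep.ProjMeasure.IsBdd H :=
      ⟨H.continuous.measurable, SchwartzMap.seminorm ℝ 0 0 H, fun p => SchwartzMap.norm_le_seminorm ℝ H p⟩
    exact ⟨P.fc H, P, hP, fun v => ⟨hH.integrable P v, P.inner_fc_self hH v⟩⟩
  have hH : ∀ η, ∀ M : ℕ, ∃ C, ∀ t, 0 ≤ t → ‖H (t, η)‖ ≤ C * ((1 + t) ^ M)⁻¹ := by
    intro η M
    obtain ⟨C, hC⟩ := TwoStep.exists_norm_schwartz_le H M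
    refine ⟨C * ((1 + ‖η‖ ^ 2 / 1) ^ (d₂ + 1))⁻¹, fun t ht => ?_⟩
    rw [← div_eq_mul_inv _ ((1 + t) ^ M), le_div_iff₀ (by positivity)]
    exact hC t η ht
  obtain ⟨C, hHB⟩ := TwoStep.exists_norm_schwartz_le H D.deg
  have hB := TwoStep.SpectralData.integrable_damping (d₂ := d₂) C
  have hHc := H.continuous
  have hK := D.kernel_eq_integral hB hHB halt hHc hH
  have hcont := D.continuous_kernel hB hHB halt hHc.measurable
  refine ⟨fun η hη => TwoStep.SpectralData.summable_term hη halt (hH η),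
    fun η hη => TwoStep.SpectralData.integrable_V hη halt hHc (hH η), fun x u => (hK x u).1, ?_⟩
  rintro T ⟨P, hP, hT⟩
  set κ : ℂ := ((2 ^ (∑ j, D.r j) / (2 * Real.pi) ^ (d₁ + d₂) : ℝ) : ℂ) with hκ
  refine ⟨fun g => κ * D.kernel H g, continuous_const.mul hcont,
    TwoStep.isConvolutionKernel_of_inner _ halt (continuous_const.mul hcont) fun f hf => ?_,
    fun x u => ?_⟩
  · rw [(hT _).2, D.integral_measure_toL2 halt hP hB hHB hHc.measurable hf, ← integral_const_mul]
    exact integral_congr_ae (Eventually.of_forall fun g => (mul_assoc _ _ _).symm)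
  · beta_reduce
    rw [(hK x u).2, S.finrank_eq X U, hκ]
    push_cast
    rfl
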